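/- **Setting.** Units of length, time and mass and a time origin are fixed. *Spacetime.* Let $E$ be a smooth 4-manifold (Hausdorff, second countable) with - a smooth surjective submersion $t:E\to\mathbb R$; put $VE=\ker dt\subset TE$; - a smooth Riemannian metric $g$ and an orientation on the vector bundle $VE$, with volume form $\mathrm{vol}$; the cross product is given by $g(u\times u',w)=\mathrm{vol}(u,u',w)$, and $\varphi^\sharp$ denotes the vector field with $g(\varphi^\sharp,\cdot)=\varphi$; - a smooth torsion-free linear connection $K$ of $TE$, with covariant derivative $\nabla$, such that $\nabla dt=0$, $\nabla g=0$, and whose curvature $R$ satisfies $g(R(a,b)c,d)=g(R(c,d)a,b)$ for all $a,b,c,d\in VE$ at one point. Throughout $R(X,Y)=[\nabla_X,\nabla_Y]-\nabla_{[X,Y]}$. Let $m,\hbar>0$ be the mass and Planck's constant, let $\check R$ be the curvature of the restriction of $K$ to $VE$, and let $\rho$ be the 2-form of $E$ with values in $V^*E$ such that $\check R(X,Y)u=\rho(X,Y)^\sharp\times u$, that is $$\rho(X,Y)(w)=-\tfrac12\sum_j \mathrm{vol}(\check R(X,Y)e_j,e_j,w)$$ for any orthonormal basis $(e_j)$ of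 the fibre of $VE$. *Phase space.* $J_1E=\{v\in TE: dt(v)=1\}$ is the first jet bundle of $t$, and an observer (over an open set) is a smooth section $o$ of $J_1E\to E$. The connection $K$ splits the tangent vectors of $J_1E$ at $v$ into a projection $X\in TE$ and a vertical component $a\in VE$. In this splitting the cosymplectic 2-form is $$\Omega((X,a),(X',a'))=\tfrac m\hbar\big[g(a,X'-dt(X')v)-g(a',X-dt(X)v)\big],$$ and the second order connection $\gamma$ is the vector field whose value at $v$ is the horizontal lift of $v$. The Poisson bracket is $\{f,f'\}=df'(H_f)$, where $H_f$ is tangent to the fibres of $J_1E\to\mathbb R$ and $i_{H_f}\Omega=df$ on these fibres. *Special phase functions.* A spin special phase function over an open $V\subset E$ is a function on the part over $V$ of the phase space $J_1E\times_E(\mathbb L^*\otimes VE)$ (which is $J_1E\times_E VE$ in the chosen units) of the form $(v,w)\mapsto f(v)+\varphi(w)$. Here $\varphi$ is a smooth section of $V^*E$ over $V$, and locally, with respect to some observer $o$, $$f(v)=\tfrac12\tfrac m\hbar f^0\,g(v-o,v-o)+\tfrac m\hbar\, g(\vec f,v-o)+\breve f$$ with a smooth section $\vec f$ of $VE$ and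 smooth functions $f^0,\breve f$ of $E$. The vector field $X[f]=f^0o-\vec f$ does not depend on $o$, and $f[o]=f\circ o$. The special bracket is $$[[f+\varphi,f'+\varphi']]=\{f,f'\}+f^0\,\gamma.f'-f'^0\,\gamma.f-\rho(X[f],X[f'])+\nabla_{X[f]}\varphi'-\nabla_{X[f']}\varphi+\varphi'\times\varphi .$$ *Quantum bundles.* Let $Q,U',U$ be Hermitian complex vector bundles over $E$ of ranks $1,2,2$, with a smooth isometric isomorphism $Q\otimes U'\cong U$ ($U$ is the Pauli bundle). Let - $Ch$ be a Hermitian universal connection of $J_1E\times_EQ\to J_1E$, i.e. a smooth system of Hermitian linear connections $Ch[o]$ of $Q$ parametrised pointwise by the observers, with curvature $-i\Omega$ ($\Omega$ being the above alternating bilinear form); thus each $Ch[o]$ has curvature $-i\,o^*\Omega$; - $\Sigma$ (the Pauli map) be a smooth isometric isomorphism of $VE$ with the bundle of traceless anti-Hermitian endomorphisms of $U$ with the metric $(A,B)\mapsto-2\,\mathrm{Tr}(AB)$, preserving orientations: $[\Sigma e_1,\Sigma e_2]=\Sigma e_3$ for every positively oriented orthonormal basis $(e_1,e_2,e_3)$;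 - $C$ (the spin connection) be a smooth Hermitian linear connection of $U'$ for which $\Sigma$ is parallel (with respect to $K$ on $VE$ and the connection induced by $C$ on traceless endomorphisms of $U'$, equivalently of $U$) and which induces a flat connection on $\wedge^2U'$. A Hermitian vector field over $V$ is a smooth vector field $Y$ on the total space of $U|_V$ that projects on a vector field $X$ of $V$, is complex linear on the fibres (its fibre component in linear charts is $\mathbb C$-linear), and satisfies $X.h(\psi,\psi')=h(Y.\psi,\psi')+h(\psi,Y.\psi')$ for all local sections $\psi,\psi'$ of $U$; here $h$ is the Hermitian metric of $U$, and $Y.\psi$ is the section whose associated vertical field is the Lie bracket of $Y$ with the vertical field associated with $\psi$. For an observer $o$, $\nu[o]Y$ denotes the vertical part of $Y$ with respect to the connection $Ch[o]\otimes C$ of $U=Q\otimes U'$, viewed fibrewise as a map $U\to U$. **Theorem.** The spin special phase functions over open subsets of $E$, with the special bracket, and the Hermitian vector fields on $U$ over open subsets of $E$, with the Lie bracket, are sheaves of real Lie algebras. Moreover, for every open $V\subset E$: 1. For each spin special phase function $f+\varphi$ over $V$ and each observer $o$ on $V$, let $Y[f+\varphi]$ be the vector field on $U|_V$ obtained from the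 pair $\big(X[f],\ i\,f[o]\,1+\Sigma(\varphi^\sharp)\big)$ through the connection $Ch[o]\otimes C$, i.e. the horizontal lift of $X[f]$ plus the vertical field given by the endomorphism $i f[o]1+\Sigma(\varphi^\sharp)$. Then $Y[f+\varphi]$ is a Hermitian vector field and does not depend on $o$. 2. Conversely, for each Hermitian vector field $Y$ over $V$ with projection $X$ there is a unique spin special phase function $f+\varphi$ over $V$ with $\big(X[f],\,i f[o]1+\Sigma(\varphi^\sharp)\big)=\big(X,\,\nu[o]Y\big)$ for the observers $o$ on $V$, and it does not depend on $o$. 3. The two maps are mutually inverse, $\mathbb R$-linear, compatible with restrictions to smaller open sets, and satisfy $Y\big[[[f+\varphi,f'+\varphi']]\big]=\big[Y[f+\varphi],Y[f'+\varphi']\big]$. They therefore give an observer-independent isomorphism of sheaves of Lie algebras between the spin special phase functions and the Hermitian vector fields on $U$. -/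

import Mathlib

open Bundle Set
open scoped Manifold ContDiff Topology

noncomputable section

namespace GalileiSpin

/-- The model space of a four-dimensional manifold. -/
abbrev R4 : Type := EuclideanSpace ℝ (Fin 4)

/-- The model fibre of a complex vector bundle of rank two. -/
abbrev C2 : Type := EuclideanSpace ℂ (Fin 2)

/-- The tangent spaces `T_x M` of a four-dimensional manifold. -/
local notation "Tan" => TangentSpace 𝓘(ℝ, R4)

/-! ### Vector bundles over a four-manifold: sections, lifts, curvature -/

section Bundles

variable {M : Type*} [TopologicalSpace M] [ChartedSpace R4 M]

variable (F : Type*) [NormedAddCommGroup F] [NormedSpace ℝ F]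
  {V : M → Type*} [TopologicalSpace (TotalSpace F V)]
  [∀ x, AddCommGroup (V x)] [∀ x, Module ℝ (V x)] [∀ x, TopologicalSpace (V x)]
  [FiberBundle F V]

/-- The section `s` of `V` is smooth on the set `W`. -/
def SmoothOn (W : Set M) (s : ∀ x, V x) : Prop :=
  ContMDiffOn 𝓘(ℝ, R4) (𝓘(ℝ, R4).prod 𝓘(ℝ, F)) ∞ (fun x ↦ TotalSpace.mk' F x (s x)) W

/-- The section `s` of `V` is differentiable at `x`. -/
def DiffAt (s : ∀ x, V x) (x : M) : Prop :=
  MDifferentiableAt 𝓘(ℝ, R4) (𝓘(ℝ, R4).prod 𝓘(ℝ, F)) (fun y ↦ TotalSpace.mk' F y (s y)) x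

variable {F}

/-- The tangent space of the total space of `V` at `u`. -/
abbrev TotTan (u : TotalSpace F V) : Type _ :=
  TangentSpace (𝓘(ℝ, R4).prod 𝓘(ℝ, F)) u

/-- The canonical identification of `V_x` with the vertical tangent space at `u ∈ V_x`:
the velocity at `0` of the curve `s ↦ u + s w`. -/
def vlift (u : TotalSpace F V) (w : V u.proj) : TotTan u :=
  mfderiv 𝓘(ℝ, ℝ) (𝓘(ℝ, R4).prod 𝓘(ℝ, F))
    (fun s : ℝ ↦ TotalSpace.mk' F u.proj (u.snd + s • w)) 0 (1 : ℝ)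

open Classical in
/-- The inverse of `vlift` (a vertical tangent vector at `u`, seen in the fibre through `u`). -/
def vproj (u : TotalSpace F V) (ξ : TotTan u) : V u.proj :=
  if h : ∃ w : V u.proj, vlift u w = ξ then h.choose else 0

/-- The horizontal lift at `u` of the tangent vector `X` with respect to a linear connection given
by its covariant derivative `cov` (`cov s x X` is `∇_X s` at `x`): if `s` is a section with
`s x = u`, it is `Ts (X)` minus the vertical vector `∇_X s`. -/
def hlift (cov : (∀ x, V x) → ∀ x : M, Tan x → V x) (u : TotalSpace F V) (X : Tan u.proj) :
    TotTan u :=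
  let ξ : TotTan u := mfderiv 𝓘(ℝ, R4) (𝓘(ℝ, R4).prod 𝓘(ℝ, F))
    (fun y ↦ TotalSpace.mk' F y (FiberBundle.extend F u.snd y)) u.proj X
  ξ - vlift u (cov (FiberBundle.extend F u.snd) u.proj X)

variable (F) [IsManifold 𝓘(ℝ, R4) ∞ M] in
/-- The curvature `R(X, Y) s = ∇_X ∇_Y s - ∇_Y ∇_X s - ∇_[X, Y] s` at `x`, computed with local
extensions of `X`, `Y` and `s`. -/
def curv (cov : (∀ x, V x) → ∀ x : M, Tan x → V x) (x : M) (X Y : Tan x) (s : V x) : V x :=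
  let X' : ∀ y : M, Tan y := FiberBundle.extend R4 X
  let Y' : ∀ y : M, Tan y := FiberBundle.extend R4 Y
  let s' : ∀ y : M, V y := FiberBundle.extend F s
  cov (fun y ↦ cov s' y (Y' y)) x X - cov (fun y ↦ cov s' y (X' y)) x Y
    - cov s' x (VectorField.mlieBracket 𝓘(ℝ, R4) X' Y' x)

end Bundles

section ComplexBundles

variable {M : Type*} [TopologicalSpace M] [ChartedSpace R4 M]
  (F : Type*) [NormedAddCommGroup F] [NormedSpace ℂ F]
  (V : M → Type*) [TopologicalSpace (TotalSpace F V)]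
  [∀ x, NormedAddCommGroup (V x)] [∀ x, InnerProductSpace ℂ (V x)]
  [FiberBundle F V]

/-- The Hermitian metrics of the fibres depend smoothly on the base point. -/
def SmoothHermitian : Prop :=
  ∀ (W : Set M) (s s' : ∀ x, V x), IsOpen W → SmoothOn F W s → SmoothOn F W s' →
    ContMDiffOn 𝓘(ℝ, R4) 𝓘(ℝ, ℂ) ∞ (fun x ↦ inner ℂ (s x) (s' x)) W

variable {V}

/-- A covariant derivative is complex linear and Hermitian, `∇ h = 0`. -/
structure IsHermitianConn (cov : (∀ x, V x) → ∀ x : M, Tan x → V x) : Prop where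
  smul_I : ∀ (s : ∀ x, V x) (x : M) (X : Tan x), DiffAt F s x →
    cov (fun y ↦ Complex.I • s y) x X = Complex.I • cov s x X
  metric : ∀ (s s' : ∀ x, V x) (x : M) (X : Tan x), DiffAt F s x → DiffAt F s' x →
    mvfderiv 𝓘(ℝ, R4) (fun y ↦ inner ℂ (s y) (s' y)) x X
      = inner ℂ (cov s x X) (s' x) + inner ℂ (s x) (cov s' x X)

end ComplexBundles

/-! ### Galileian spacetime -/

section Spacetime

variable {M : Type*} [TopologicalSpace M] [ChartedSpace R4 M] [IsManifold 𝓘(ℝ, R4) ∞ M]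

/-- The time form `dt` at `x`. -/
def dtime (t : M → ℝ) (x : M) : Tan x →L[ℝ] ℝ := mvfderiv 𝓘(ℝ, R4) t x

/-- The vertical (spacelike) tangent space `V_x = ker dt_x`. -/
abbrev Ver (t : M → ℝ) (x : M) : Submodule ℝ (Tan x) := LinearMap.ker (dtime t x).toLinearMap

open Classical in
/-- A tangent vector known to be spacelike, seen in the vertical space. -/
def toVer (t : M → ℝ) (x : M) (w : Tan x) : Ver t x := if h : w ∈ Ver t x then ⟨w, h⟩ else 0

/-- The section `Y` of the vertical bundle is smooth on `W`. -/
def VerSmoothOn (t : M → ℝ) (W : Set M) (Y : ∀ x, Ver t x) : Prop :=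
  SmoothOn R4 W (fun x ↦ (Y x : Tan x))

end Spacetime

/-- A curved Galileian spacetime with a particle of mass `mass`, after the choice of units (of
length, time and mass) and of a time origin, so that the time line is `ℝ`. -/
structure Spacetime (M : Type*) [TopologicalSpace M] [ChartedSpace R4 M]
    [IsManifold 𝓘(ℝ, R4) ∞ M] where
  /-- the time function, a surjective submersion -/
  t : M → ℝ
  t_smooth : ContMDiff 𝓘(ℝ, R4) 𝓘(ℝ, ℝ) ∞ t
  t_surjective : Function.Surjective t
  t_submersion : ∀ x, dtime t x ≠ 0
  /-- the spacelike Riemannian metric -/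
  g : ∀ x, Ver t x →ₗ[ℝ] Ver t x →ₗ[ℝ] ℝ
  g_symm : ∀ x u w, g x u w = g x w u
  g_pos : ∀ x u, u ≠ 0 → 0 < g x u u
  g_smooth : ∀ (W : Set M) (Y Z : ∀ x, Ver t x), IsOpen W → VerSmoothOn t W Y →
    VerSmoothOn t W Z → ContMDiffOn 𝓘(ℝ, R4) 𝓘(ℝ, ℝ) ∞ (fun x ↦ g x (Y x) (Z x)) W
  /-- the volume form of the metric and of the given orientation of space -/
  vol : ∀ x, Ver t x [⋀^Fin 3]→ₗ[ℝ] ℝ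
  vol_sq : ∀ x (u : Fin 3 → Ver t x), vol x u ^ 2 = (Matrix.of fun i j ↦ g x (u i) (u j)).det
  vol_smooth : ∀ (W : Set M) (Y : Fin 3 → ∀ x, Ver t x), IsOpen W →
    (∀ i, VerSmoothOn t W (Y i)) →
    ContMDiffOn 𝓘(ℝ, R4) 𝓘(ℝ, ℝ) ∞ (fun x ↦ vol x (fun i ↦ Y i x)) W
  /-- the (joined) spacetime connection -/
  K : CovariantDerivative 𝓘(ℝ, R4) R4 (TangentSpace 𝓘(ℝ, R4) : M → Type)
  K_smooth : K.ContMDiffCovariantDerivative ∞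
  K_torsion : K.torsion = 0
  K_time : ∀ (Y : ∀ x : M, Tan x) (x : M) (X : Tan x), DiffAt R4 Y x →
    mvfderiv 𝓘(ℝ, R4) (fun y ↦ dtime t y (Y y)) x X = dtime t x (K Y x X)
  K_metric : ∀ (Y Z : ∀ x, Ver t x) (x : M) (X : Tan x),
    DiffAt R4 (fun y ↦ (Y y : Tan y)) x → DiffAt R4 (fun y ↦ (Z y : Tan y)) x →
    mvfderiv 𝓘(ℝ, R4) (fun y ↦ g y (Y y) (Z y)) x X
      = g x (toVer t x (K (fun y ↦ (Y y : Tan y)) x X)) (Z x)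
        + g x (Y x) (toVer t x (K (fun y ↦ (Z y : Tan y)) x X))
  K_pair : ∀ (x : M) (a b c d : Ver t x),
    g x (toVer t x (curv R4 (fun s y X ↦ K s y X) x a b c)) d
      = g x (toVer t x (curv R4 (fun s y X ↦ K s y X) x c d a)) b
  /-- the mass of the particle -/
  mass : ℝ
  mass_pos : 0 < mass
  /-- Planck's constant -/
  hbar : ℝ
  hbar_pos : 0 < hbar

namespace Spacetime

variable {M : Type*} [TopologicalSpace M] [ChartedSpace R4 M] [IsManifold 𝓘(ℝ, R4) ∞ M]
  (S : Spacetime M)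

/-- The time form. -/
abbrev dt (x : M) : Tan x →L[ℝ] ℝ := dtime S.t x

/-- The vertical bundle `VE`. -/
abbrev VE (x : M) : Submodule ℝ (Tan x) := Ver S.t x

/-- The fibre over `x` of the phase space `J₁E`, the first jet bundle of the time function: a jet
of a section is identified with its velocity, a tangent vector `v` with `dt v = 1`. -/
def J1 (x : M) : Type := {v : Tan x // S.dt x v = 1}

variable {S} in
/-- The difference of two velocities at the same event, a spacelike vector. -/
def J1.sub {x : M} (v v' : S.J1 x) : S.VE x :=
  ⟨v.1 - v'.1, by
    have h := v.2
    have h' := v'.2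
    simp only [LinearMap.mem_ker, ContinuousLinearMap.coe_coe, map_sub, h, h', sub_self]⟩

/-- The velocity with the direction of a tangent vector that is not spacelike. -/
def J1.ofTan {x : M} (w : Tan x) (h : S.dt x w ≠ 0) : S.J1 x :=
  ⟨(S.dt x w)⁻¹ • w, by rw [map_smul, smul_eq_mul, inv_mul_cancel₀ h]⟩

/-- `o` is an observer on `W`: a section of `J₁E` that is smooth on `W`. -/
def IsObserverOn (W : Set M) (o : ∀ x, S.J1 x) : Prop := SmoothOn R4 W (fun x ↦ (o x).1)

/-- The unscaled coefficient `m / ħ` of the rescaled metric. -/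
def coef : ℝ := S.mass / S.hbar

/-! #### Spacelike algebra -/

open Classical in
/-- Index raising `VE* → VE` by the spacelike metric. -/
def sharp (x : M) (α : Module.Dual ℝ (S.VE x)) : S.VE x :=
  if h : ∃ u : S.VE x, ∀ w, S.g x u w = α w then h.choose else 0

/-- The covector `w ↦ vol (u, u', w)`. -/
def crossForm (x : M) (u u' : S.VE x) : Module.Dual ℝ (S.VE x) where
  toFun w := S.vol x ![u, u', w]
  map_add' w w' := by
    have h := (S.vol x).map_update_add ![u, u', 0] 2 w w'
    have e : ∀ z, Function.update ![u, u', 0] 2 z = ![u, u', z] := by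
      intro z; ext1 i; fin_cases i <;> rfl
    simpa only [e] using h
  map_smul' c w := by
    have h := (S.vol x).map_update_smul ![u, u', 0] 2 c w
    have e : ∀ z, Function.update ![u, u', 0] 2 z = ![u, u', z] := by
      intro z; ext1 i; fin_cases i <;> rfl
    simpa only [e, RingHom.id_apply] using h

/-- The cross product of spacelike vectors, `g (u × u', w) = vol (u, u', w)`. -/
def cross (x : M) (u u' : S.VE x) : S.VE x := S.sharp x (S.crossForm x u u')

/-- The covariant derivative of spacelike fields, `Ǩ`, the restriction of `K`. -/
def covVer (Y : ∀ x, S.VE x) (x : M) (X : Tan x) : S.VE x :=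
  toVer S.t x (S.K (fun y ↦ (Y y : Tan y)) x X)

/-- The curvature `Ř (X, Y)` of `Ǩ`, an endomorphism of `VE`. -/
def curvVer (x : M) (X Y : Tan x) (u : S.VE x) : S.VE x :=
  toVer S.t x (curv R4 (fun s y Z ↦ S.K s y Z) x X Y (u : Tan x))

instance (x : M) : FiniteDimensional ℝ (S.VE x) :=
  haveI : FiniteDimensional ℝ (Tan x) := inferInstanceAs (FiniteDimensional ℝ R4)
  inferInstance

/-- The two-form `ρ` with values in the dual of the vertical bundle: minus one half of the
contraction of `Ř (X, Y)` (with its second index raised) with the volume form, that is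
`ρ (X, Y) w = - 1/2 ∑ⱼ vol (Ř (X, Y) eⱼ, eⱼ, w) = - 1/2 Tr (u ↦ w × Ř (X, Y) u)` for orthonormal
`eⱼ`. Equivalently, `Ř (X, Y) u = ρ (X, Y)^♯ × u`. The trace is computed in a basis. -/
def rho (x : M) (X Y : Tan x) (w : S.VE x) : ℝ :=
  -(1 / 2) * ∑ j, (Module.finBasis ℝ (S.VE x)).repr
    (S.cross x w (S.curvVer x X Y (Module.finBasis ℝ (S.VE x) j))) j

/-! #### Calculus on the phase space -/

open Classical in
/-- A function on `J₁E ⊆ TE`, extended to all of `TE` so as to be constant on the lines through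
the origin of each tangent space (and by `0` on spacelike vectors). -/
def extJ1 (f : ∀ x, S.J1 x → ℝ) (w : TangentBundle 𝓘(ℝ, R4) M) : ℝ :=
  if h : S.dt w.proj w.snd ≠ 0 then f w.proj (J1.ofTan S w.snd h) else 0

/-- The derivative of `f : J₁E → ℝ` at `v` along the `K`-horizontal lift of `X`, which is tangent
to `J₁E` because `∇ dt = 0`. -/
def dHor (f : ∀ x, S.J1 x → ℝ) (x : M) (v : S.J1 x) (X : Tan x) : ℝ :=
  mvfderiv (𝓘(ℝ, R4).prod 𝓘(ℝ, R4)) (S.extJ1 f) (TotalSpace.mk' R4 x v.1)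
    (hlift (F := R4) (V := (TangentSpace 𝓘(ℝ, R4) : M → Type)) (fun s y Z ↦ S.K s y Z)
      (TotalSpace.mk' R4 x v.1) X)

/-- The derivative of `f : J₁E → ℝ` at `v` along the vertical vector `w`. -/
def dVer (f : ∀ x, S.J1 x → ℝ) (x : M) (v : S.J1 x) (w : S.VE x) : ℝ :=
  mvfderiv (𝓘(ℝ, R4).prod 𝓘(ℝ, R4)) (S.extJ1 f) (TotalSpace.mk' R4 x v.1)
    (vlift (F := R4) (V := (TangentSpace 𝓘(ℝ, R4) : M → Type))
      (TotalSpace.mk' R4 x v.1) (w : Tan x))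

open Classical in
/-- The spacelike part of the horizontal differential, as a spacelike vector. -/
def gradHor (f : ∀ x, S.J1 x → ℝ) (x : M) (v : S.J1 x) : S.VE x :=
  if h : ∃ u : S.VE x, ∀ w : S.VE x, S.g x u w = S.dHor f x v w then h.choose else 0

open Classical in
/-- The vertical differential, as a spacelike vector. -/
def gradVer (f : ∀ x, S.J1 x → ℝ) (x : M) (v : S.J1 x) : S.VE x :=
  if h : ∃ u : S.VE x, ∀ w : S.VE x, S.g x u w = S.dVer f x v w then h.choose else 0

/-- The spacelike part `X - dt (X) v` of `X`, relatively to the velocity `v`. -/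
def spacePart (x : M) (v : S.J1 x) (X : Tan x) : S.VE x :=
  ⟨X - S.dt x X • v.1, by
    have h := v.2
    simp only [LinearMap.mem_ker, ContinuousLinearMap.coe_coe, map_sub, map_smul, h, smul_eq_mul,
      mul_one, sub_self]⟩

/-- The cosymplectic two-form `Ω = (m/ħ) gᵢⱼ (dx₀ⁱ - (K_λⁱ_h x₀ʰ + K_λⁱ_0) dx^λ) ∧ (dxʲ - x₀ʲ dx⁰)`
at `v ∈ J₁E`, as an alternating bilinear form. A tangent vector of `J₁E` at `v` is given by its
projection `X` on `E` and its `K`-vertical component `a`. -/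
def Omega (x : M) (v : S.J1 x) (X : Tan x) (a : S.VE x) (X' : Tan x) (a' : S.VE x) : ℝ :=
  S.coef * (S.g x a (S.spacePart x v X') - S.g x a' (S.spacePart x v X))

/-- The pull-back `o^* Ω` by an observer; the `K`-vertical component of `To (X)` is `∇_X o`. -/
def pullOmega (o : ∀ x, S.J1 x) (x : M) (X X' : Tan x) : ℝ :=
  S.Omega x (o x) X (toVer S.t x (S.K (fun y ↦ (o y).1) x X))
    X' (toVer S.t x (S.K (fun y ↦ (o y).1) x X'))

/-- The Poisson bracket of functions on `J₁E`: `{f, f'} = df' (H_f)`, where `H_f` is the vector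
field tangent to the fibres of `J₁E → T` with `i_{H_f} Ω = df` on these fibres. In terms of the
`K`-splitting `H_f` has projection `- (ħ/m) gradVer f` and vertical component
`(ħ/m) gradHor f`. -/
def poisson (f f' : ∀ x, S.J1 x → ℝ) (x : M) (v : S.J1 x) : ℝ :=
  S.coef⁻¹ * (S.g x (S.gradHor f x v) (S.gradVer f' x v)
    - S.g x (S.gradVer f x v) (S.gradHor f' x v))

/-- The action of the second order connection `γ` on functions of `J₁E`: at `v` it is the
`K`-horizontal lift of `v` itself. -/
def gammaDeriv (f : ∀ x, S.J1 x → ℝ) (x : M) (v : S.J1 x) : ℝ := S.dHor f x v v.1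

/-! #### Special phase functions -/

/-- The function `½ (m/ħ) a g (v - v₀, v - v₀) + (m/ħ) g (b, v - v₀) + c` of `v ∈ J₁E_x`. -/
def quad (x : M) (v₀ : S.J1 x) (a : ℝ) (b : S.VE x) (c : ℝ) (v : S.J1 x) : ℝ :=
  a * (S.coef / 2) * S.g x (v.sub v₀) (v.sub v₀) + S.coef * S.g x b (v.sub v₀) + c

/-- `f` is a special phase function (for a scalar particle) over the open set `W`: locally, with
respect to an observer `o` (in adapted coordinates `x₀ⁱ` is `v - o`),
`f = ½ (m/ħ) f⁰ gᵢⱼ x₀ⁱ x₀ʲ + (m/ħ) fⁱ gᵢⱼ x₀ʲ + f̆` with smooth `f⁰`, `fⁱ`, `f̆`. -/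
def IsSpecialOn (W : Set M) (f : ∀ x, S.J1 x → ℝ) : Prop :=
  ∀ x₀ ∈ W, ∃ W' : Set M, IsOpen W' ∧ x₀ ∈ W' ∧ W' ⊆ W ∧
    ∃ (o : ∀ x, S.J1 x) (a : M → ℝ) (b : ∀ x, S.VE x) (c : M → ℝ),
      S.IsObserverOn W' o ∧ ContMDiffOn 𝓘(ℝ, R4) 𝓘(ℝ, ℝ) ∞ a W' ∧ VerSmoothOn S.t W' b ∧
      ContMDiffOn 𝓘(ℝ, R4) 𝓘(ℝ, ℝ) ∞ c W' ∧
      ∀ x ∈ W', ∀ v, f x v = S.quad x (o x) (a x) (b x) (c x) v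

open Classical in
/-- The tangent vector `X[f] = f⁰ o - f⃗` at `x` determined by a special phase function
(`f⁰ ∂₀ - fⁱ ∂ᵢ` in coordinates adapted to `o`). -/
def vec (f : ∀ x, S.J1 x → ℝ) (x : M) : Tan x :=
  if h : ∃ X : Tan x, ∃ (v₀ : S.J1 x) (a : ℝ) (b : S.VE x) (c : ℝ),
    (∀ v, f x v = S.quad x v₀ a b c v) ∧ X = a • v₀.1 - (b : Tan x) then h.choose else 0

/-- The bracket `{f, f'} + (f⁰ γ).f' - (f'⁰ γ).f` of special phase functions of a scalar
particle. -/
def scalarBracket (f f' : ∀ x, S.J1 x → ℝ) (x : M) (v : S.J1 x) : ℝ :=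
  S.poisson f f' x v + S.dt x (S.vec f x) * S.gammaDeriv f' x v
    - S.dt x (S.vec f' x) * S.gammaDeriv f x v

/-- Functions on the part over `V` of the phase space `J₁E ×_E (L* ⊗ VE)` of a particle with
spin. -/
abbrev PhaseFun (V : TopologicalSpace.Opens M) : Type _ := ∀ x : V, S.J1 (x : M) → S.VE (x : M) → ℝ

/-- The section `φ` of the dual of the vertical bundle is smooth on `W`. -/
def CovecSmoothOn (W : Set M) (φ : ∀ x, Module.Dual ℝ (S.VE x)) : Prop :=
  ∀ (W' : Set M) (Y : ∀ x, S.VE x), IsOpen W' → W' ⊆ W → VerSmoothOn S.t W' Y →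
    ContMDiffOn 𝓘(ℝ, R4) 𝓘(ℝ, ℝ) ∞ (fun x ↦ φ x (Y x)) W'

/-- The special phase functions `f + φ` of a particle with spin, over the open set `V`. -/
def special (V : TopologicalSpace.Opens M) : Set (S.PhaseFun V) :=
  {G | ∃ (f : ∀ x, S.J1 x → ℝ) (φ : ∀ x, Module.Dual ℝ (S.VE x)),
    S.IsSpecialOn (V : Set M) f ∧ S.CovecSmoothOn (V : Set M) φ ∧
    ∀ (x : V) v w, G x v w = f x v + φ x w}

variable {S} {V : TopologicalSpace.Opens M}

open Classical in
/-- The part `f` of `f + φ` (and `0` outside of `V`). -/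
def scalarPart (G : S.PhaseFun V) (x : M) (v : S.J1 x) : ℝ :=
  if h : x ∈ V then G ⟨x, h⟩ v 0 else 0

open Classical in
/-- The part `φ` of `f + φ` (and `0` outside of `V`). -/
def spinPart (G : S.PhaseFun V) (x : M) : Module.Dual ℝ (S.VE x) :=
  if h : ∃ (hx : x ∈ V) (φ : Module.Dual ℝ (S.VE x)), ∀ v w, G ⟨x, hx⟩ v w = G ⟨x, hx⟩ v 0 + φ w
  then h.choose_spec.choose else 0

/-- The vector field `X[f]` of `f + φ`. -/
def vecField (G : S.PhaseFun V) (x : M) : Tan x := S.vec (scalarPart G) x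

/-- The spacelike vector field `φ^♯`. -/
def spinVec (G : S.PhaseFun V) (x : M) : S.VE x := S.sharp x (spinPart G x)

/-- The bracket of `f + φ` and `f' + φ'`, namely
`[f, f'] - ρ (X[f], X[f']) + ∇_{X[f]} φ' - ∇_{X[f']} φ + φ' × φ`. Covectors are differentiated and
multiplied through the metric, which is parallel: `∇_X φ' = g (∇_X φ'^♯, ·)`. -/
def bracket (G G' : S.PhaseFun V) : S.PhaseFun V := fun x v w ↦
  S.scalarBracket (scalarPart G) (scalarPart G') x v
  - S.rho x (vecField G x) (vecField G' x) w
  + S.g x (S.covVer (spinVec G') x (vecField G x) - S.covVer (spinVec G) x (vecField G' x)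
      + S.cross x (spinVec G' x) (spinVec G x)) w

/-- Restriction to a smaller open set. -/
def resFun {W V : TopologicalSpace.Opens M} (h : W ≤ V) (G : S.PhaseFun V) : S.PhaseFun W :=
  fun x ↦ G ⟨x, h x.2⟩

end Spacetime

/-! ### Linear projectable vector fields on a Hermitian bundle -/

section HermitianFields

variable {M : Type*} [TopologicalSpace M] [ChartedSpace R4 M] [IsManifold 𝓘(ℝ, R4) ∞ M]
  {U : M → Type*} [TopologicalSpace (TotalSpace C2 U)]
  [∀ x, NormedAddCommGroup (U x)] [∀ x, InnerProductSpace ℂ (U x)] [FiberBundle C2 U]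
  [VectorBundle ℝ C2 U] [ContMDiffVectorBundle ∞ C2 U 𝓘(ℝ, R4)]

/-- The part over `V` of the total space of `U`. -/
def overSet (U : M → Type*) (V : TopologicalSpace.Opens M) : Set (TotalSpace C2 U) :=
  {u | u.proj ∈ V}

/-- Vector fields on the part over `V` of the total space of `U`. -/
abbrev FieldOver (U : M → Type*) [TopologicalSpace (TotalSpace C2 U)]
    [∀ x, NormedAddCommGroup (U x)] [∀ x, InnerProductSpace ℂ (U x)] [FiberBundle C2 U]
    (V : TopologicalSpace.Opens M) : Type _ := ∀ u : overSet U V, TotTan (F := C2) (V := U) u.1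

variable {V : TopologicalSpace.Opens M}

open Classical in
/-- Extension by `0` of a vector field over `V`. -/
def extField (Y : FieldOver U V) (u : TotalSpace C2 U) : TotTan u :=
  if h : u ∈ overSet U V then Y ⟨u, h⟩ else 0

/-- The Lie bracket of vector fields on the part of `U` over `V`. -/
def lieField (Y Y' : FieldOver U V) : FieldOver U V := fun u ↦
  VectorField.mlieBracket (𝓘(ℝ, R4).prod 𝓘(ℝ, C2)) (extField Y) (extField Y') u.1

/-- The Lie derivative `Y.ψ` of a section: `[Y, ψ̃]` is the vertical field determined by the
section `Y.ψ`, where `ψ̃` is the one determined by `ψ`. (It is read at the zero vector of each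
fibre.) -/
def lieSection (Y : FieldOver U V) (ψ : ∀ x, U x) (x : M) : U x :=
  vproj (TotalSpace.mk' C2 x (0 : U x))
    (VectorField.mlieBracket (𝓘(ℝ, R4).prod 𝓘(ℝ, C2)) (extField Y)
      (fun u ↦ vlift u (ψ u.proj)) (TotalSpace.mk' C2 x (0 : U x)))

/-- `Y` is a Hermitian linear projectable vector field on the part of `U` over `V`, projectable
over `X`. -/
structure IsHermitianOver (Y : FieldOver U V) (X : ∀ x : M, Tan x) : Prop where
  smooth : ContMDiffOn (𝓘(ℝ, R4).prod 𝓘(ℝ, C2)) (𝓘(ℝ, R4).prod 𝓘(ℝ, C2)).tangent ∞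
    (fun u ↦ (⟨u, extField Y u⟩ : TangentBundle (𝓘(ℝ, R4).prod 𝓘(ℝ, C2)) (TotalSpace C2 U)))
    (overSet U V)
  smooth_base : SmoothOn R4 (V : Set M) X
  projectable : ∀ u : overSet U V,
    mfderiv (𝓘(ℝ, R4).prod 𝓘(ℝ, C2)) 𝓘(ℝ, R4) (TotalSpace.proj : TotalSpace C2 U → M) u.1 (Y u)
      = X u.1.proj
  /-- in every linear chart `e` the fibre component of `Y` is complex linear on each fibre,
  `Y = X^λ ∂_λ + (Y^A_B z^B) ∂_A` -/
  linear : ∀ e ∈ FiberBundle.trivializationAtlas C2 U, ∀ (x : M) (hx : x ∈ V), x ∈ e.baseSet →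
    ∃ A : C2 →ₗ[ℂ] C2, ∀ u : U x,
      mvfderiv (𝓘(ℝ, R4).prod 𝓘(ℝ, C2)) (fun p : TotalSpace C2 U ↦ (e p).2)
        (TotalSpace.mk' C2 x u) (Y ⟨TotalSpace.mk' C2 x u, hx⟩)
        = A (e (TotalSpace.mk' C2 x u)).2
  hermitian : ∀ (W : Set M) (φ ψ : ∀ x, U x), IsOpen W → W ⊆ V → SmoothOn C2 W φ →
    SmoothOn C2 W ψ → ∀ x ∈ W,
      mvfderiv 𝓘(ℝ, R4) (fun y ↦ inner ℂ (φ y) (ψ y)) x (X x)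
        = inner ℂ (lieSection Y φ x) (ψ x) + inner ℂ (φ x) (lieSection Y ψ x)

/-- The Hermitian linear projectable vector fields on the part of `U` over `V`. -/
def hermFields (U : M → Type*) [TopologicalSpace (TotalSpace C2 U)]
    [∀ x, NormedAddCommGroup (U x)] [∀ x, InnerProductSpace ℂ (U x)] [FiberBundle C2 U]
    [VectorBundle ℝ C2 U] [ContMDiffVectorBundle ∞ C2 U 𝓘(ℝ, R4)]
    (V : TopologicalSpace.Opens M) : Set (FieldOver U V) :=
  {Y | ∃ X : ∀ x : M, Tan x, IsHermitianOver Y X}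

/-- The projection on the base of a projectable vector field. -/
def projField (Y : FieldOver U V) (x : V) : Tan (x : M) :=
  mfderiv (𝓘(ℝ, R4).prod 𝓘(ℝ, C2)) 𝓘(ℝ, R4) (TotalSpace.proj : TotalSpace C2 U → M)
    (TotalSpace.mk' C2 (x : M) (0 : U x)) (Y ⟨TotalSpace.mk' C2 (x : M) (0 : U x), x.2⟩)

/-- Restriction to a smaller open set. -/
def resField {W V : TopologicalSpace.Opens M} (h : W ≤ V) (Y : FieldOver U V) : FieldOver U W :=
  fun u ↦ Y ⟨u.1, h u.2⟩

end HermitianFields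

/-! ### The quantum setting for a particle with spin -/

section Quantum

variable {M : Type*} [TopologicalSpace M] [ChartedSpace R4 M] [IsManifold 𝓘(ℝ, R4) ∞ M]
  (S : Spacetime M)

open Classical in
/-- A quantum connection: a Hermitian universal connection of `J₁E ×_E Q → J₁E`, with curvature
`R = - i Ω` (in the convention `R (X, Y) = [∇_X, ∇_Y] - ∇_[X, Y]`). Universality means that at
each `v ∈ J₁E` covariant differentiation is only along vectors of `E`, so that the connection is a
family, parametrized by `v`, of covariant derivatives of sections of `Q`; an observer `o` yields
the connection `Ch[o] : s ↦ (x ↦ Ch s x (o x))` of `Q`. All the remaining components of the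
curvature condition are expressed by its pull-backs by the local observers. -/
structure QuantumConnection (Q : M → Type*) [TopologicalSpace (TotalSpace ℂ Q)]
    [∀ x, NormedAddCommGroup (Q x)] [∀ x, InnerProductSpace ℂ (Q x)] [FiberBundle ℂ Q] where
  Ch : (∀ x, Q x) → ∀ x : M, S.J1 x → (Tan x →L[ℝ] Q x)
  isCov : ∀ o : ∀ x, S.J1 x,
    IsCovariantDerivativeOn ℂ (I := 𝓘(ℝ, R4)) (V := Q) (fun s x ↦ Ch s x (o x))
  /-- `(v, X) ↦ Ch_X s (v)` is smooth on `J₁E` (extended to vectors that are not spacelike) -/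
  smooth : ∀ (s : ∀ x, Q x) (X : ∀ x : M, Tan x), SmoothOn ℂ univ s → SmoothOn R4 univ X →
    ContMDiffOn (𝓘(ℝ, R4).prod 𝓘(ℝ, R4)) (𝓘(ℝ, R4).prod 𝓘(ℝ, ℂ)) ∞
      (fun w : TangentBundle 𝓘(ℝ, R4) M ↦ TotalSpace.mk' ℂ (E := Q) w.proj
        (if h : S.dt w.proj w.snd ≠ 0
          then Ch s w.proj (Spacetime.J1.ofTan S w.snd h) (X w.proj) else 0))
      {w | S.dt w.proj w.snd ≠ 0}
  hermitian : ∀ o : ∀ x, S.J1 x, IsHermitianConn ℂ (fun s x X ↦ Ch s x (o x) X)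
  curvature : ∀ (W : Set M) (o : ∀ x, S.J1 x), IsOpen W → S.IsObserverOn W o → ∀ x ∈ W,
    ∀ (X Y : Tan x) (q : Q x),
      curv ℂ (fun s y Z ↦ Ch s y (o y) Z) x X Y q
        = (-Complex.I * (S.pullOmega o x X Y : ℂ)) • q

/-- The quantum data of a particle with spin: the Pauli bundle `U`, written as `U = Q ⊗ U'`, with a
quantum connection `Ch` of `Q`, a spin connection `C` of `U'`, and the Pauli map. -/
structure SpinQuantum (Q U' U : M → Type*)
    [TopologicalSpace (TotalSpace ℂ Q)] [∀ x, NormedAddCommGroup (Q x)]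
    [∀ x, InnerProductSpace ℂ (Q x)] [FiberBundle ℂ Q]
    [TopologicalSpace (TotalSpace C2 U')] [∀ x, NormedAddCommGroup (U' x)]
    [∀ x, InnerProductSpace ℂ (U' x)] [FiberBundle C2 U'] [VectorBundle ℝ C2 U']
    [TopologicalSpace (TotalSpace C2 U)] [∀ x, NormedAddCommGroup (U x)]
    [∀ x, InnerProductSpace ℂ (U x)] [FiberBundle C2 U]
    extends QuantumConnection S Q where
  metric_Q : SmoothHermitian ℂ Q
  metric_U' : SmoothHermitian C2 U'
  metric_U : SmoothHermitian C2 U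
  /-- the isometric identification of `Q ⊗ U'` with `U` -/
  tens : ∀ x, Q x →ₗ[ℂ] U' x →ₗ[ℂ] U x
  tens_inner : ∀ x (q q' : Q x) (s s' : U' x),
    inner ℂ (tens x q s) (tens x q' s') = inner ℂ q q' * inner ℂ s s'
  tens_smooth : ∀ (W : Set M) (q : ∀ x, Q x) (s : ∀ x, U' x), IsOpen W → SmoothOn ℂ W q →
    SmoothOn C2 W s → SmoothOn C2 W (fun x ↦ tens x (q x) (s x))
  /-- the Pauli map: an isometry of `VE` with the bundle of traceless anti-Hermitian
  endomorphisms of `U` with the metric `(A, B) ↦ - 2 Tr (A B)`, preserving orientations (positively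
  oriented orthonormal frames of the latter satisfy `[ξ₁, ξ₂] = ξ₃`) -/
  pauli : ∀ x, S.VE x →ₗ[ℝ] (U x →ₗ[ℂ] U x)
  pauli_smooth : ∀ (W : Set M) (Y : ∀ x, S.VE x) (ψ : ∀ x, U x), IsOpen W →
    VerSmoothOn S.t W Y → SmoothOn C2 W ψ → SmoothOn C2 W (fun x ↦ pauli x (Y x) (ψ x))
  pauli_antiherm : ∀ x (w : S.VE x) (u u' : U x),
    inner ℂ (pauli x w u) u' = -inner ℂ u (pauli x w u')
  pauli_trace : ∀ x (w : S.VE x), LinearMap.trace ℂ (U x) (pauli x w) = 0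
  pauli_isometry : ∀ x (w w' : S.VE x),
    -2 * LinearMap.trace ℂ (U x) (pauli x w ∘ₗ pauli x w') = (S.g x w w' : ℂ)
  pauli_oriented : ∀ x (e : Fin 3 → S.VE x),
    (∀ i j, S.g x (e i) (e j) = if i = j then 1 else 0) → S.vol x e = 1 →
    pauli x (e 0) ∘ₗ pauli x (e 1) - pauli x (e 1) ∘ₗ pauli x (e 0) = pauli x (e 2)
  /-- the spin connection -/
  C : CovariantDerivative 𝓘(ℝ, R4) C2 U'
  C_smooth : C.ContMDiffCovariantDerivative ∞
  C_hermitian : IsHermitianConn C2 (fun s x X ↦ C s x X)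
  /-- `∇ Σ = 0`: the connection induced by `C` on traceless anti-Hermitian endomorphisms (of `U'`,
  or equivalently of `U`) corresponds to `K` through the Pauli map -/
  C_pauli : ∀ (W : Set M) (Y : ∀ x, S.VE x) (s s' : ∀ x, U' x), IsOpen W →
    VerSmoothOn S.t W Y → SmoothOn C2 W s → SmoothOn C2 W s' →
    (∀ x ∈ W, ∀ q : Q x, tens x q (s' x) = pauli x (Y x) (tens x q (s x))) →
    ∀ x ∈ W, ∀ (X : Tan x) (q : Q x),
      tens x q (C s' x X) = pauli x (S.covVer Y x X) (tens x q (s x))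
        + pauli x (Y x) (tens x q (C s x X))
  /-- the connection induced by `C` on `⋀² U'` is flat -/
  C_flat : ∀ (x : M) (X Y : Tan x) (s₁ s₂ : U' x) (α : U' x [⋀^Fin 2]→ₗ[ℂ] ℂ),
    α ![curv C2 (fun s y Z ↦ C s y Z) x X Y s₁, s₂]
      + α ![s₁, curv C2 (fun s y Z ↦ C s y Z) x X Y s₂] = 0

namespace SpinQuantum

variable {S} {Q U' U : M → Type*}
    [TopologicalSpace (TotalSpace ℂ Q)] [∀ x, NormedAddCommGroup (Q x)]
    [∀ x, InnerProductSpace ℂ (Q x)] [FiberBundle ℂ Q]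
    [TopologicalSpace (TotalSpace C2 U')] [∀ x, NormedAddCommGroup (U' x)]
    [∀ x, InnerProductSpace ℂ (U' x)] [FiberBundle C2 U'] [VectorBundle ℝ C2 U']
    [TopologicalSpace (TotalSpace C2 U)] [∀ x, NormedAddCommGroup (U x)]
    [∀ x, InnerProductSpace ℂ (U x)] [FiberBundle C2 U]
    (P : SpinQuantum S Q U' U) {V : TopologicalSpace.Opens M}

/-- The covariant derivative of the connection `Ch[o] ⊗ C` of `U = Q ⊗ U'`. Near `x` a section `ψ`
is written as `q ⊗ s` with a non-vanishing local section `q` of `Q`, and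
`∇ (q ⊗ s) = Ch[o] q ⊗ s + q ⊗ C s`. -/
def tensorConn (o : ∀ x, S.J1 x) (ψ : ∀ x, U x) (x : M) (X : Tan x) : U x :=
  let q : ∀ y, Q y := FiberBundle.extend ℂ (Classical.epsilon fun q₀ : Q x ↦ q₀ ≠ 0)
  let s : ∀ y, U' y := fun y ↦ Function.invFun (fun s₀ ↦ P.tens y (q y) s₀) (ψ y)
  P.tens x (P.Ch q x (o x) X) (s x) + P.tens x (q x) (P.C s x X)

/-- The pair `(X[f], i f[o] 1 + Σ (φ^♯))` of a special phase function `f + φ`. -/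
def pairOfFun (o : ∀ x, S.J1 x) (G : S.PhaseFun V) :
    (∀ x : V, Tan (x : M)) × (∀ x : V, U x → U x) :=
  (fun x ↦ Spacetime.vecField G x,
    fun x u ↦ (Complex.I * (Spacetime.scalarPart G x (o x) : ℂ)) • u
      + P.pauli x (Spacetime.spinVec G x) u)

/-- The pair `(X, ν[o] Y)` of a linear projectable vector field `Y`: its projection `X` on the
base and its vertical part with respect to `Ch[o] ⊗ C`. -/
def pairOfField (o : ∀ x, S.J1 x) (Y : FieldOver U V) :
    (∀ x : V, Tan (x : M)) × (∀ x : V, U x → U x) :=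
  (projField Y, fun x u ↦ vproj (TotalSpace.mk' C2 (x : M) u)
    (Y ⟨TotalSpace.mk' C2 (x : M) u, x.2⟩
      - hlift (P.tensorConn o) (TotalSpace.mk' C2 (x : M) u) (projField Y x)))

/-- The vector field `X ⌟ (Ch[o] ⊗ C) + Y̌` on `U` obtained from a pair `(X, Y̌)`. -/
def fieldOfPair (o : ∀ x, S.J1 x)
    (p : (∀ x : V, Tan (x : M)) × (∀ x : V, U x → U x)) : FieldOver U V :=
  fun u ↦ hlift (P.tensorConn o) u.1 (p.1 ⟨u.1.proj, u.2⟩)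
    + vlift u.1 (p.2 ⟨u.1.proj, u.2⟩ u.1.snd)

end SpinQuantum

end Quantum

/-! ### Sheaves of Lie algebras -/

/-- The subset `L` of a real vector space is a vector subspace and is a Lie algebra with the
product `br`. -/
structure IsLieAlgebraOn {A : Type*} [AddCommGroup A] [Module ℝ A] (L : Set A) (br : A → A → A) :
    Prop where
  zero_mem : 0 ∈ L
  add_mem : ∀ a ∈ L, ∀ b ∈ L, a + b ∈ L
  smul_mem : ∀ (r : ℝ), ∀ a ∈ L, r • a ∈ L
  br_mem : ∀ a ∈ L, ∀ b ∈ L, br a b ∈ L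
  add_br : ∀ a ∈ L, ∀ b ∈ L, ∀ c ∈ L, br (a + b) c = br a c + br b c
  smul_br : ∀ (r : ℝ), ∀ a ∈ L, ∀ b ∈ L, br (r • a) b = r • br a b
  br_self : ∀ a ∈ L, br a a = 0
  jacobi : ∀ a ∈ L, ∀ b ∈ L, ∀ c ∈ L, br a (br b c) + br b (br c a) + br c (br a b) = 0

/-- `L` is a sheaf of Lie algebras, as a subsheaf of the sheaf `A` (a sheaf of functions, for which
gluing is automatic) with restriction maps `res` and with the product `br`. -/
structure IsLieSheaf {M : Type*} [TopologicalSpace M] {A : TopologicalSpace.Opens M → Type*}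
    [∀ V, AddCommGroup (A V)] [∀ V, Module ℝ (A V)]
    (res : ∀ {W V : TopologicalSpace.Opens M}, W ≤ V → A V → A W)
    (L : ∀ V, Set (A V)) (br : ∀ V, A V → A V → A V) : Prop where
  lie : ∀ V, IsLieAlgebraOn (L V) (br V)
  res_br : ∀ {W V : TopologicalSpace.Opens M} (h : W ≤ V), ∀ a ∈ L V, ∀ b ∈ L V,
    res h (br V a b) = br W (res h a) (res h b)
  mem_iff : ∀ (V : TopologicalSpace.Opens M) (a : A V),
    a ∈ L V ↔ ∀ x ∈ V, ∃ (W : TopologicalSpace.Opens M) (h : W ≤ V), x ∈ W ∧ res h a ∈ L W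

end GalileiSpin

end

open Bundle Set
open scoped Manifold ContDiff Topology

noncomputable section

set_option linter.unusedSectionVars false
set_option linter.style.haveILetI false

namespace GalileiSpin

local notation "Tan" => TangentSpace 𝓘(ℝ, R4)

/-! ### Calculus of vector valued functions on manifolds -/

section Calculus

variable {E : Type*} [NormedAddCommGroup E] [NormedSpace ℝ E]
  {H : Type*} [TopologicalSpace H] {I : ModelWithCorners ℝ E H}
  {N : Type*} [TopologicalSpace N] [ChartedSpace H N]
  {E' : Type*} [NormedAddCommGroup E'] [NormedSpace ℝ E']
  {H' : Type*} [TopologicalSpace H'] {I' : ModelWithCorners ℝ E' H'}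
  {N' : Type*} [TopologicalSpace N'] [ChartedSpace H' N']
  {A B C : Type*} [NormedAddCommGroup A] [NormedSpace ℝ A] [NormedAddCommGroup B]
  [NormedSpace ℝ B] [NormedAddCommGroup C] [NormedSpace ℝ C]

/-! Fix an observer `o` and let `∇` be the connection `Ch[o] ⊗ C`. A linear field `Y` on `U` over
`X` acts on sections by `Y.ψ = ∇_X ψ - N ψ`, where `N = ν[o]Y` is an endomorphism of each fibre.
Since `∇` is Hermitian, `Y` is Hermitian exactly when `N` is anti-Hermitian. In rank two this means
`N = i c 1 + Σ(w)` with a unique real `c` and a unique spacelike `w`: the Pauli map is injective,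
being isometric, and its three-dimensional image fills the traceless anti-Hermitian endomorphisms,
which have real dimension at most three. So for fixed `o` a Hermitian field is a triple `(X, c, w)`,
and a special phase function is the triple `(X[f], f[o], φ^♯)`.

Independence of the observer comes from the curvature of `Ch`. Two observers with the same velocity
at a point but different first jets pull the curvature condition back to two equations, whose
difference isolates the derivative of `Ch` in the velocity (`chVer_eq`). This derivative is affine
in the velocity. Its integral along a segment of velocities is a quadratic law (`Ch_sub`), and the
resulting change of the horizontal lift of `X[f]` is opposite to the change of `i f[o]` for a
special `f` (`QuadAt`, `fieldOfPair_eq`). Read backwards, the same law shows that the function built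
from `ν[o]Y` with one observer serves all of them (`exists_special`); its smoothness is read from
traces of `N` and of `Σ(w) Σ(w')`.

For the bracket, the Lie derivative of sections is a representation (`lieSec_bracket`), so the
endomorphism of `[Y, Y']` is `∇_X N' - ∇_X' N - [N, N'] - R(X, X')`. This is evaluated at each
velocity `v` with an observer through `v` that is parallel at the point. There `o^*Ω` vanishes, and
`R` reduces to the curvature of `C`. Flatness on `⋀² U'` makes it traceless, hence equal to some
`Σ(r)`, and because `Σ` is parallel `r` is the vector dual to `ρ` (`exists_curvature`). Along the
same observer the Poisson and `γ` terms add up to `X.f'[o] - X'.f[o]` (`scalarBracket_eq`). Together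
with `∇Σ = 0` and `[Σu, Σw] = Σ(u × w)` this is the special bracket (`bracket_eq`). Closure under
the special bracket and its Lie algebra axioms are then transported from the Hermitian fields
through the injective map `toField`.

On the total space all computations use the projection and the fibre component of tangent vectors
(`totTan_ext`). The fields that are affine on the fibres (`AffRep`) contain both the linear fields
and the vertical lifts of sections, and they are closed under brackets. -/

lemma mvfderiv_comp_vec {f : N → N'} {g : N' → A} (x : N)
    (hg : MDifferentiableAt I' 𝓘(ℝ, A) g (f x)) (hf : MDifferentiableAt I I' f x)
    (v : TangentSpace I x) :
    mvfderiv I (fun y ↦ g (f y)) x v = mvfderiv I' g (f x) (mfderiv I I' f x v) := by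
  have := mfderiv_comp x hg hf
  exact congrArg (fun L ↦ L v) this

lemma mvfderiv_congr {f g : N → A} {x : N} (h : f =ᶠ[𝓝 x] g) :
    mvfderiv I f x = mvfderiv I g x := by
  have h2 : mfderiv I 𝓘(ℝ, A) f x = mfderiv I 𝓘(ℝ, A) g x := h.mfderiv_eq
  exact h2

lemma mvfderiv_congr_apply {f g : N → A} {x : N} (h : f =ᶠ[𝓝 x] g) (v : TangentSpace I x) :
    mvfderiv I f x v = mvfderiv I g x v := by
  rw [mvfderiv_congr h]

lemma mvfderiv_eq_fderiv {f : A → B} {x : A} :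
    mvfderiv 𝓘(ℝ, A) f x = fderiv ℝ f x := by
  have : mfderiv 𝓘(ℝ, A) 𝓘(ℝ, B) f x = fderiv ℝ f x := mfderiv_eq_fderiv
  exact this

lemma mvfderiv_clm (L : A →L[ℝ] B) {f : N → A} {x : N}
    (hf : MDifferentiableAt I 𝓘(ℝ, A) f x) (v : TangentSpace I x) :
    mvfderiv I (fun y ↦ L (f y)) x v = L (mvfderiv I f x v) := by
  have := mvfderiv_comp_vec (I := I) (I' := 𝓘(ℝ, A)) (g := L) x
    L.differentiableAt.mdifferentiableAt hf v
  rw [this, mvfderiv_eq_fderiv, L.fderiv]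
  rfl

lemma mvfderiv_bilin (L : A →L[ℝ] B →L[ℝ] C) {f : N → A} {g : N → B} {x : N}
    (hf : MDifferentiableAt I 𝓘(ℝ, A) f x) (hg : MDifferentiableAt I 𝓘(ℝ, B) g x)
    (v : TangentSpace I x) :
    mvfderiv I (fun y ↦ L (f y) (g y)) x v
      = L (mvfderiv I f x v) (g x) + L (f x) (mvfderiv I g x v) := by
  have hb := L.isBoundedBilinearMap
  have h1 := (hb.differentiableAt (f x, g x)).mdifferentiableAt
  have h2 : MDifferentiableAt I 𝓘(ℝ, A × B) (fun y ↦ (f y, g y)) x := hf.prodMk_space hg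
  have h3 := mvfderiv_comp_vec x h1 h2 v
  have h4 : mvfderiv I (fun y ↦ (f y, g y)) x v = (mvfderiv I f x v, mvfderiv I g x v) :=
    Prod.ext (mvfderiv_clm (ContinuousLinearMap.fst ℝ A B) h2 v).symm
      (mvfderiv_clm (ContinuousLinearMap.snd ℝ A B) h2 v).symm
  refine h3.trans ?_
  rw [mvfderiv_eq_fderiv, hb.fderiv, add_comm]
  exact congrArg (hb.deriv (f x, g x)) h4

lemma contMDiffOn_bilin (L : A →L[ℝ] B →L[ℝ] C) {f : N → A} {g : N → B} {W : Set N}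
    (hf : ContMDiffOn I 𝓘(ℝ, A) ∞ f W) (hg : ContMDiffOn I 𝓘(ℝ, B) ∞ g W) :
    ContMDiffOn I 𝓘(ℝ, C) ∞ (fun y ↦ L (f y) (g y)) W :=
  (L.contMDiff.comp_contMDiffOn hf).clm_apply hg

lemma mdifferentiableAt_bilin (L : A →L[ℝ] B →L[ℝ] C) {f : N → A} {g : N → B} {x : N}
    (hf : MDifferentiableAt I 𝓘(ℝ, A) f x) (hg : MDifferentiableAt I 𝓘(ℝ, B) g x) :
    MDifferentiableAt I 𝓘(ℝ, C) (fun y ↦ L (f y) (g y)) x := by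
  have hb := L.isBoundedBilinearMap
  have h1 : MDifferentiableAt 𝓘(ℝ, A × B) 𝓘(ℝ, C) (fun p : A × B ↦ L p.1 p.2) (f x, g x) :=
    (hb.differentiableAt (f x, g x)).mdifferentiableAt
  exact MDifferentiableAt.comp x h1 (hf.prodMk_space hg)

end Calculus

/-! ### Vector fields, derivations and Lie brackets -/

section VectorFields

variable {E : Type*} [NormedAddCommGroup E] [NormedSpace ℝ E]
  {H : Type*} [TopologicalSpace H] {I : ModelWithCorners ℝ E H}
  {N : Type*} [TopologicalSpace N] [ChartedSpace H N] [IsManifold I ∞ N]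
  {A : Type*} [NormedAddCommGroup A] [NormedSpace ℝ A]

/-- A vector field is smooth on `W`. -/
def FieldSmoothOn (I : ModelWithCorners ℝ E H) {N : Type*} [TopologicalSpace N]
    [ChartedSpace H N] [IsManifold I ∞ N] (W : Set N) (X : ∀ x : N, TangentSpace I x) : Prop :=
  ContMDiffOn I I.tangent ∞ (fun x ↦ (⟨x, X x⟩ : TangentBundle I N)) W

/-- `X.f` is the fibre part of the tangent map of `f` composed with `X`, and the tangent bundle of a
vector space is a product. -/
lemma contMDiffOn_mvfderiv {W : Set N} (hW : IsOpen W) {f : N → A} {X : ∀ x : N, TangentSpace I x}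
    (hf : ContMDiffOn I 𝓘(ℝ, A) ∞ f W) (hX : FieldSmoothOn I W X) :
    ContMDiffOn I 𝓘(ℝ, A) ∞ (fun x ↦ mvfderiv I f x (X x)) W := by
  have h1 : ContMDiffOn I.tangent 𝓘(ℝ, A).tangent ∞ (tangentMapWithin I 𝓘(ℝ, A) f W)
      (π E (TangentSpace I) ⁻¹' W) :=
    hf.contMDiffOn_tangentMapWithin (by simp) hW.uniqueMDiffOn
  have h2 := h1.comp hX (fun x hx ↦ hx)
  have h3 : ContMDiff 𝓘(ℝ, A).tangent 𝓘(ℝ, A) ∞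
      (fun p : TangentBundle 𝓘(ℝ, A) A ↦ p.2) :=
    contMDiff_snd_tangentBundle_modelSpace A 𝓘(ℝ, A)
  have h4 := h3.comp_contMDiffOn h2
  refine h4.congr fun x hx ↦ ?_
  simp only [Function.comp, tangentMapWithin]
  rw [mfderivWithin_of_isOpen hW hx]
  rfl

lemma FieldSmoothOn.mdifferentiableAt {W : Set N} (hW : IsOpen W)
    {X : ∀ x : N, TangentSpace I x} (hX : FieldSmoothOn I W X) {x : N} (hx : x ∈ W) :
    MDifferentiableAt I I.tangent (fun x ↦ (⟨x, X x⟩ : TangentBundle I N)) x :=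
  (hX.contMDiffAt (hW.mem_nhds hx)).mdifferentiableAt (by simp)

lemma FieldSmoothOn.smul {W : Set N} {X : ∀ x : N, TangentSpace I x} {f : N → ℝ}
    (hf : ContMDiffOn I 𝓘(ℝ, ℝ) ∞ f W) (hX : FieldSmoothOn I W X) :
    FieldSmoothOn I W (f • X) :=
  ContMDiffOn.smul_section hf hX

variable [CompleteSpace E]

lemma FieldSmoothOn.mlieBracket {W : Set N} (hW : IsOpen W)
    {X Y : ∀ x : N, TangentSpace I x} (hX : FieldSmoothOn I W X) (hY : FieldSmoothOn I W Y) :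
    FieldSmoothOn I W (VectorField.mlieBracket I X Y) := by
  intro x hx
  have h1 : ContMDiffAt I I.tangent ∞ (fun x ↦ (⟨x, X x⟩ : TangentBundle I N)) x :=
    hX.contMDiffAt (hW.mem_nhds hx)
  have h2 : ContMDiffAt I I.tangent ∞ (fun x ↦ (⟨x, Y x⟩ : TangentBundle I N)) x :=
    hY.contMDiffAt (hW.mem_nhds hx)
  haveI : IsManifold I (((⊤ : ℕ∞) : ℕ∞ω) + 1) N := by simpa using ‹IsManifold I ∞ N›
  haveI : IsManifold I (minSmoothness ℝ 2) N := by
    simp only [minSmoothness_of_isRCLikeNormedField]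
    infer_instance
  exact (ContMDiffAt.mlieBracket_vectorField (m := ⊤) (n := ⊤) h1 h2
    (by simp [minSmoothness_of_isRCLikeNormedField])).contMDiffWithinAt

/-- The Jacobi identity for `X`, `Y`, `f Z`, minus `f` times the one for `X`, `Y`, `Z`, leaves `([X,
Y].f - X.Y.f + Y.X.f) Z = 0`. The auxiliary field `Z` is chosen nonzero at `x`. -/
lemma mvfderiv_mlieBracket_real {W : Set N} (hW : IsOpen W) {x : N} (hx : x ∈ W) {f : N → ℝ}
    {X Y : ∀ x : N, TangentSpace I x} (hf : ContMDiffOn I 𝓘(ℝ, ℝ) ∞ f W)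
    (hX : FieldSmoothOn I W X) (hY : FieldSmoothOn I W Y) :
    mvfderiv I f x (VectorField.mlieBracket I X Y x)
      = mvfderiv I (fun y ↦ mvfderiv I f y (Y y)) x (X x)
        - mvfderiv I (fun y ↦ mvfderiv I f y (X y)) x (Y x) := by
  -- In dimension zero no nonzero `Z` exists, but both sides vanish.
  rcases subsingleton_or_nontrivial E with hE | hE
  · have h0 : ∀ v : TangentSpace I x, v = 0 := fun v ↦ Subsingleton.elim (α := E) v 0
    rw [h0 (X x), h0 (Y x), h0 (VectorField.mlieBracket I X Y x)]
    simp
  obtain ⟨w, hw⟩ := exists_ne (0 : E)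
  let Z : ∀ y : N, TangentSpace I y := FiberBundle.extend E (show TangentSpace I x from w)
  have hZx : Z x = w := FiberBundle.extend_apply_self E _
  obtain ⟨W', hW', hxW', hZ'⟩ : ∃ W' ⊆ W, IsOpen W' ∧ x ∈ W' ∧ FieldSmoothOn I W' Z := by
    obtain ⟨s, hs, hZ⟩ := FiberBundle.exists_contMDiffOn_extend (k := ∞) I E
      (show TangentSpace I x from w)
    obtain ⟨t, ht, hto, hxt⟩ := mem_nhds_iff.1 (Filter.inter_mem hs (hW.mem_nhds hx))
    exact ⟨t, fun y hy ↦ (ht hy).2, hto, hxt, hZ.mono fun y hy ↦ (ht hy).1⟩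
  obtain ⟨hxW'', hZ⟩ := hZ'
  have hf := hf.mono hW'
  have hX : FieldSmoothOn I W' X := hX.mono hW'
  have hY : FieldSmoothOn I W' Y := hY.mono hW'
  have hXf := contMDiffOn_mvfderiv hxW' hf hX
  have hYf := contMDiffOn_mvfderiv hxW' hf hY
  have dA : ∀ {T : ∀ x : N, TangentSpace I x}, FieldSmoothOn I W' T → ∀ y ∈ W',
      MDifferentiableAt I I.tangent (fun x ↦ (⟨x, T x⟩ : TangentBundle I N)) y :=
    fun hT y hy ↦ hT.mdifferentiableAt hxW' hy
  have dF : ∀ {h : N → ℝ}, ContMDiffOn I 𝓘(ℝ, ℝ) ∞ h W' → ∀ y ∈ W',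
      MDifferentiableAt I 𝓘(ℝ, ℝ) h y :=
    fun hh y hy ↦ (hh.contMDiffAt (hxW'.mem_nhds hy)).mdifferentiableAt (by simp)
  have cA : ∀ {T : ∀ x : N, TangentSpace I x}, FieldSmoothOn I W' T →
      ContMDiffAt I I.tangent (minSmoothness ℝ 2)
        (fun x ↦ (⟨x, T x⟩ : TangentBundle I N)) x := fun hT ↦ by
    have h : ContMDiffAt I I.tangent ∞ (fun x ↦ (⟨x, _⟩ : TangentBundle I N)) x :=
      hT.contMDiffAt (hxW'.mem_nhds hxW'')
    refine h.of_le ?_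
    simp only [minSmoothness_of_isRCLikeNormedField]
    exact ENat.LEInfty.out
  haveI : IsManifold I (minSmoothness ℝ 3) N := by
    simp only [minSmoothness_of_isRCLikeNormedField]
    infer_instance
  have J1 := VectorField.leibniz_identity_mlieBracket_apply (I := I) (cA hX) (cA hY)
    (cA (hZ.smul hf))
  have J2 := VectorField.leibniz_identity_mlieBracket_apply (I := I) (cA hX) (cA hY) (cA hZ)
  -- Second order Leibniz rule for `[S, [T, f Z]]`. The two terms with a single derivative of `f`
  -- are exchanged when `S` and `T` are, and so cancel in the commutator.
  have e1 : ∀ {T : ∀ x : N, TangentSpace I x} {S : ∀ x : N, TangentSpace I x},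
      FieldSmoothOn I W' T → FieldSmoothOn I W' S →
      VectorField.mlieBracket I S (VectorField.mlieBracket I T (f • Z)) x
        = (mvfderiv I (fun y ↦ mvfderiv I f y (T y)) x (S x)) • Z x
          + (mvfderiv I f x (T x)) • VectorField.mlieBracket I S Z x
          + ((mvfderiv I f x (S x)) • VectorField.mlieBracket I T Z x
          + f x • VectorField.mlieBracket I S (VectorField.mlieBracket I T Z) x) := by
    intro T S hT hS
    have h1 : VectorField.mlieBracket I T (f • Z) =ᶠ[𝓝 x]
        (fun y ↦ mvfderiv I f y (T y)) • Z + f • VectorField.mlieBracket I T Z := by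
      filter_upwards [hxW'.mem_nhds hxW''] with y hy
      exact VectorField.mlieBracket_smul_right (dF hf y hy) (dA hZ y hy)
    rw [Filter.EventuallyEq.mlieBracket_vectorField_eq (Filter.EventuallyEq.refl _ S) h1]
    have hTf := contMDiffOn_mvfderiv hxW' hf hT
    have hTZ := hT.mlieBracket hxW' hZ
    rw [VectorField.mlieBracket_add_right (dA (hZ.smul hTf) x hxW'')
      (dA (hTZ.smul hf) x hxW''),
      VectorField.mlieBracket_smul_right (dF hTf x hxW'') (dA hZ x hxW''),
      VectorField.mlieBracket_smul_right (dF hf x hxW'') (dA hTZ x hxW'')]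
  rw [e1 hY hX, e1 hX hY, VectorField.mlieBracket_smul_right (dF hf x hxW'') (dA hZ x hxW''),
    J2] at J1
  have hz : (mvfderiv I f x (VectorField.mlieBracket I X Y x)
      - (mvfderiv I (fun y ↦ mvfderiv I f y (Y y)) x (X x)
        - mvfderiv I (fun y ↦ mvfderiv I f y (X y)) x (Y x))) • Z x = 0 := by
    rw [← sub_eq_zero] at J1
    rw [← neg_eq_zero, ← J1]
    module
  rcases smul_eq_zero.1 hz with h | h
  · exact sub_eq_zero.1 h
  · exact absurd (hZx.symm.trans h) hw

/-- Reduction to real functions: continuous linear functionals separate the points of `A` and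
commute with differentiation. -/
lemma mvfderiv_mlieBracket {W : Set N} (hW : IsOpen W) {x : N} (hx : x ∈ W) {f : N → A}
    {X Y : ∀ x : N, TangentSpace I x} (hf : ContMDiffOn I 𝓘(ℝ, A) ∞ f W)
    (hX : FieldSmoothOn I W X) (hY : FieldSmoothOn I W Y) :
    mvfderiv I f x (VectorField.mlieBracket I X Y x)
      = mvfderiv I (fun y ↦ mvfderiv I f y (Y y)) x (X x)
        - mvfderiv I (fun y ↦ mvfderiv I f y (X y)) x (Y x) := by
  refine (SeparatingDual.eq_iff_forall_dual_eq (R := ℝ) (V := A)).2 fun L ↦ ?_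
  have dF : ∀ {h : N → A}, ContMDiffOn I 𝓘(ℝ, A) ∞ h W → ∀ y ∈ W,
      MDifferentiableAt I 𝓘(ℝ, A) h y :=
    fun hh y hy ↦ (hh.contMDiffAt (hW.mem_nhds hy)).mdifferentiableAt (by simp)
  have hL : ContMDiffOn I 𝓘(ℝ, ℝ) ∞ (fun y ↦ L (f y)) W := (ContinuousLinearMap.contMDiff L).comp_contMDiffOn hf
  have key := mvfderiv_mlieBracket_real hW hx hL hX hY
  have hc : ∀ {T : ∀ x : N, TangentSpace I x}, FieldSmoothOn I W T → ∀ v : TangentSpace I x,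
      mvfderiv I (fun y ↦ mvfderiv I (fun y ↦ L (f y)) y (T y)) x v
        = L (mvfderiv I (fun y ↦ mvfderiv I f y (T y)) x v) := by
    intro T hT v
    have hT' : ContMDiffOn I 𝓘(ℝ, A) ∞ (fun y ↦ mvfderiv I f y (T y)) W :=
      contMDiffOn_mvfderiv hW hf hT
    rw [← mvfderiv_clm L (dF hT' x hx)]
    refine mvfderiv_congr_apply ?_ v
    filter_upwards [hW.mem_nhds hx] with y hy
    exact mvfderiv_clm L (dF hf y hy) _
  rw [map_sub, ← hc hX, ← hc hY, ← key, mvfderiv_clm L (dF hf x hx)]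

end VectorFields

/-! ### Smooth sections and their extensions -/

section Sections

variable {M : Type*} [TopologicalSpace M] [ChartedSpace R4 M] [IsManifold 𝓘(ℝ, R4) ∞ M]
  {F : Type*} [NormedAddCommGroup F] [NormedSpace ℝ F]
  {V : M → Type*} [TopologicalSpace (TotalSpace F V)]
  [∀ x, AddCommGroup (V x)] [∀ x, Module ℝ (V x)] [∀ x, TopologicalSpace (V x)]
  [FiberBundle F V] [VectorBundle ℝ F V] [ContMDiffVectorBundle ∞ F V 𝓘(ℝ, R4)]

lemma SmoothOn.mono {W W' : Set M} {s : ∀ x, V x} (hs : SmoothOn F W s) (h : W' ⊆ W) :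
    SmoothOn F W' s :=
  ContMDiffOn.mono hs h

lemma SmoothOn.diffAt {W : Set M} (hW : IsOpen W) {s : ∀ x, V x} (hs : SmoothOn F W s) {x : M}
    (hx : x ∈ W) : DiffAt F s x :=
  (ContMDiffOn.contMDiffAt hs (hW.mem_nhds hx)).mdifferentiableAt (by simp)

/-- In the preferred trivialization at `x` the extension of `v` has constant fibre coordinate. -/
lemma smoothOn_extend {x : M} (v : V x) :
    SmoothOn F (trivializationAt F V x).baseSet (FiberBundle.extend F v : ∀ y, V y) := by
  set t := trivializationAt F V x
  intro y hy
  rw [t.contMDiffWithinAt_section _ hy]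
  have : ContMDiffOn 𝓘(ℝ, R4) 𝓘(ℝ, F) ∞ (fun _ : M ↦ (t ⟨x, v⟩).2) t.baseSet := contMDiffOn_const
  exact (this.congr fun z hz ↦ by simp [FiberBundle.extend, t, hz]) y hy

lemma mem_baseSet_extend (x : M) : x ∈ (trivializationAt F V x).baseSet :=
  FiberBundle.mem_baseSet_trivializationAt' x

/-- A local section agrees near a given point with a global one. -/
lemma exists_global_section [T2Space M] {W : Set M} (hW : IsOpen W) {x : M} (hx : x ∈ W)
    {s : ∀ x, V x} (hs : SmoothOn F W s) :
    ∃ s' : ∀ x, V x, SmoothOn F univ s' ∧ ∃ W' ⊆ W, IsOpen W' ∧ x ∈ W' ∧ ∀ y ∈ W', s' y = s y := by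
  -- The global section is `b s`, with a bump function `b` supported in `W` and equal to one near
  -- `x`.
  obtain ⟨b, -, hb⟩ := (SmoothBumpFunction.nhds_basis_tsupport (I := 𝓘(ℝ, R4)) x).mem_iff.1
    (hW.mem_nhds hx)
  have h1 := ContMDiffOn.smul_section_of_tsupport (n := ∞) (b.contMDiff.contMDiffOn (s := W)) hW hb hs
  refine ⟨(b : M → ℝ) • s, h1.contMDiffOn, ?_⟩
  obtain ⟨t, ht, hto, hxt⟩ := mem_nhds_iff.1 (Filter.inter_mem b.eventuallyEq_one (hW.mem_nhds hx))
  refine ⟨t, fun y hy ↦ (ht hy).2, hto, hxt, fun y hy ↦ ?_⟩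
  have : b y = 1 := (ht hy).1
  simp [this]

end Sections

/-! ### Tangent vectors of a total space, vertical and horizontal lifts -/

section TotalSpaces

variable {M : Type*} [TopologicalSpace M] [ChartedSpace R4 M] [IsManifold 𝓘(ℝ, R4) ∞ M]
  {F : Type*} [NormedAddCommGroup F] [NormedSpace ℝ F]
  {V : M → Type*} [TopologicalSpace (TotalSpace F V)]
  [∀ x, AddCommGroup (V x)] [∀ x, Module ℝ (V x)] [∀ x, TopologicalSpace (V x)]
  [FiberBundle F V] [VectorBundle ℝ F V] [ContMDiffVectorBundle ∞ F V 𝓘(ℝ, R4)]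
  (e : Trivialization F (π F V)) [MemTrivializationAtlas e]

/-- The fibre coordinate of a vector in a trivialization. -/
abbrev fib (x : M) (w : V x) : F := (e (TotalSpace.mk' F x w)).2

/-- The projection of a tangent vector of the total space. -/
def dproj {u : TotalSpace F V} (ξ : TotTan u) : Tan u.proj :=
  mfderiv (𝓘(ℝ, R4).prod 𝓘(ℝ, F)) 𝓘(ℝ, R4) (TotalSpace.proj : TotalSpace F V → M) u ξ

/-- The fibre component of a tangent vector of the total space in a trivialization. -/
def dfib {u : TotalSpace F V} (ξ : TotTan u) : F :=
  mvfderiv (𝓘(ℝ, R4).prod 𝓘(ℝ, F)) (fun p : TotalSpace F V ↦ (e p).2) u ξ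

lemma dproj_add {u : TotalSpace F V} (ξ η : TotTan u) : dproj (ξ + η) = dproj ξ + dproj η :=
  map_add _ _ _

lemma dproj_sub {u : TotalSpace F V} (ξ η : TotTan u) : dproj (ξ - η) = dproj ξ - dproj η :=
  map_sub _ _ _

lemma dproj_smul {u : TotalSpace F V} (c : ℝ) (ξ : TotTan u) : dproj (c • ξ) = c • dproj ξ :=
  map_smul _ _ _

lemma dproj_zero {u : TotalSpace F V} : dproj (0 : TotTan u) = 0 :=
  map_zero _

lemma dfib_add {u : TotalSpace F V} (ξ η : TotTan u) : dfib e (ξ + η) = dfib e ξ + dfib e η :=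
  map_add _ _ _

lemma dfib_sub {u : TotalSpace F V} (ξ η : TotTan u) : dfib e (ξ - η) = dfib e ξ - dfib e η :=
  map_sub _ _ _

lemma dfib_smul {u : TotalSpace F V} (c : ℝ) (ξ : TotTan u) : dfib e (c • ξ) = c • dfib e ξ :=
  map_smul _ _ _

lemma dfib_zero {u : TotalSpace F V} : dfib e (0 : TotTan u) = 0 :=
  map_zero _

variable {e}

lemma fib_add {x : M} (hx : x ∈ e.baseSet) (v w : V x) :
    fib e x (v + w) = fib e x v + fib e x w := (e.linear ℝ hx).map_add v w

lemma fib_smul {x : M} (hx : x ∈ e.baseSet) (c : ℝ) (w : V x) :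
    fib e x (c • w) = c • fib e x w := (e.linear ℝ hx).map_smul c w

lemma fib_zero {x : M} (hx : x ∈ e.baseSet) : fib e x (0 : V x) = 0 := by
  simpa using fib_smul hx 0 (0 : V x)

lemma fib_neg {x : M} (hx : x ∈ e.baseSet) (w : V x) : fib e x (-w) = - fib e x w := by
  simpa using fib_smul hx (-1) w

lemma fib_sub {x : M} (hx : x ∈ e.baseSet) (v w : V x) :
    fib e x (v - w) = fib e x v - fib e x w := by
  rw [sub_eq_add_neg, fib_add hx, fib_neg hx, sub_eq_add_neg]

lemma fib_sum {ι : Type*} (t : Finset ι) {x : M} (hx : x ∈ e.baseSet) (v : ι → V x) :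
    fib e x (∑ i ∈ t, v i) = ∑ i ∈ t, fib e x (v i) :=
  map_sum (IsLinearMap.mk' _ (e.linear ℝ hx)) v t

lemma fib_symm {x : M} (hx : x ∈ e.baseSet) (z : F) : fib e x (e.symm x z) = z := by
  simp [fib, hx]

lemma fib_injective {x : M} (hx : x ∈ e.baseSet) : Function.Injective (fib e x) := by
  intro v w h
  exact (e.linearEquivAt ℝ x hx).injective h

lemma exists_fib_eq {x : M} (hx : x ∈ e.baseSet) (z : F) : ∃ w : V x, fib e x w = z :=
  ⟨e.symm x z, fib_symm hx z⟩

lemma contMDiffOn_fib_snd :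
    ContMDiffOn (𝓘(ℝ, R4).prod 𝓘(ℝ, F)) 𝓘(ℝ, F) ∞ (fun p : TotalSpace F V ↦ (e p).2) e.source :=
  contMDiff_snd.comp_contMDiffOn (e.contMDiffOn (n := ∞) (IB := 𝓘(ℝ, R4)))

lemma mdifferentiableAt_fib_snd {u : TotalSpace F V} (hu : u.proj ∈ e.baseSet) :
    MDifferentiableAt (𝓘(ℝ, R4).prod 𝓘(ℝ, F)) 𝓘(ℝ, F) (fun p : TotalSpace F V ↦ (e p).2) u :=
  (contMDiffOn_fib_snd.contMDiffAt (e.open_source.mem_nhds (e.mem_source.2 hu))).mdifferentiableAt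
    (by simp)

lemma mdifferentiableAt_proj (u : TotalSpace F V) :
    MDifferentiableAt (𝓘(ℝ, R4).prod 𝓘(ℝ, F)) 𝓘(ℝ, R4) (TotalSpace.proj : TotalSpace F V → M) u :=
  (contMDiffAt_proj (n := ∞) V).mdifferentiableAt (by simp)

/-- A tangent vector of the total space is determined by its projection and its component. -/
lemma totTan_ext {u : TotalSpace F V} (hu : u.proj ∈ e.baseSet) {ξ η : TotTan u}
    (h1 : dproj ξ = dproj η) (h2 : dfib e ξ = dfib e η) : ξ = η := by
  have hus : u ∈ e.source := e.mem_source.2 hu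
  have hd : e.toOpenPartialHomeomorph.MDifferentiable (𝓘(ℝ, R4).prod 𝓘(ℝ, F))
      (𝓘(ℝ, R4).prod 𝓘(ℝ, F)) :=
    ⟨(e.contMDiffOn (n := ∞)).mdifferentiableOn (by simp),
      (e.contMDiffOn_symm (n := ∞)).mdifferentiableOn (by simp)⟩
  -- A trivialization is a local diffeomorphism, so its differential is injective; the two
  -- components of this differential are `dproj` and `dfib e`.
  refine hd.mfderiv_injective hus ?_
  have hea : MDifferentiableAt (𝓘(ℝ, R4).prod 𝓘(ℝ, F)) (𝓘(ℝ, R4).prod 𝓘(ℝ, F)) e u :=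
    hd.mdifferentiableAt hus
  have c1 : ∀ ζ : TotTan u, (mfderiv (𝓘(ℝ, R4).prod 𝓘(ℝ, F)) (𝓘(ℝ, R4).prod 𝓘(ℝ, F)) e u ζ).1
      = dproj ζ := by
    intro ζ
    have h3 : (fun p ↦ (e p).1) =ᶠ[𝓝 u] (TotalSpace.proj : TotalSpace F V → M) := by
      filter_upwards [e.open_source.mem_nhds hus] with p hp using e.coe_fst hp
    have h4 := mfderiv_comp (I'' := 𝓘(ℝ, R4)) u (mdifferentiableAt_fst (I := 𝓘(ℝ, R4)) (I' := 𝓘(ℝ, F)) (x := e u)) hea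
    have h5 : mfderiv (𝓘(ℝ, R4).prod 𝓘(ℝ, F)) 𝓘(ℝ, R4) (Prod.fst ∘ e) u
      = mfderiv (𝓘(ℝ, R4).prod 𝓘(ℝ, F)) 𝓘(ℝ, R4) (TotalSpace.proj : TotalSpace F V → M) u :=
      Filter.EventuallyEq.mfderiv_eq h3
    rw [h5, mfderiv_fst] at h4
    exact (congrArg (fun T ↦ T ζ) h4).symm
  have c2 : ∀ ζ : TotTan u, (mfderiv (𝓘(ℝ, R4).prod 𝓘(ℝ, F)) (𝓘(ℝ, R4).prod 𝓘(ℝ, F)) e u ζ).2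
      = dfib e ζ := by
    intro ζ
    have h4 := mfderiv_comp (I'' := 𝓘(ℝ, F)) u (mdifferentiableAt_snd (I := 𝓘(ℝ, R4)) (I' := 𝓘(ℝ, F)) (x := e u)) hea
    rw [mfderiv_snd] at h4
    exact (congrArg (fun T ↦ T ζ) h4).symm
  refine Prod.ext ?_ ?_
  · exact (c1 ξ).trans ((h1.trans (c1 η).symm))
  · exact (c2 ξ).trans ((h2.trans (c2 η).symm))

variable (u : TotalSpace F V)

lemma mdifferentiableAt_vcurve (w : V u.proj) (t : ℝ) :
    MDifferentiableAt 𝓘(ℝ, ℝ) (𝓘(ℝ, R4).prod 𝓘(ℝ, F))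
      (fun s : ℝ ↦ TotalSpace.mk' F u.proj (u.snd + s • w)) t := by
  set e := trivializationAt F V u.proj
  have hx : u.proj ∈ e.baseSet := mem_baseSet_extend u.proj
  have : ContMDiffAt 𝓘(ℝ, ℝ) (𝓘(ℝ, R4).prod 𝓘(ℝ, F)) ∞
      (fun s : ℝ ↦ TotalSpace.mk' F u.proj (u.snd + s • w)) t := by
    rw [e.contMDiffAt_iff (e.mem_source.2 hx)]
    refine ⟨contMDiffAt_const, ?_⟩
    have h : (fun s : ℝ ↦ (e (TotalSpace.mk' F u.proj (u.snd + s • w))).2)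
        = fun s : ℝ ↦ fib e u.proj u.snd + s • fib e u.proj w := by
      funext s
      change fib e _ _ = _
      rw [fib_add hx, fib_smul hx]
    rw [h]
    exact (contDiff_const.add (contDiff_id.smul contDiff_const)).contDiffAt.contMDiffAt
  exact this.mdifferentiableAt (by simp)

variable {u}

lemma dproj_vlift (w : V u.proj) : dproj (vlift u w) = 0 := by
  have h0 : TotalSpace.mk' F u.proj (u.snd + (0 : ℝ) • w) = u := by
    simp
  have h := mfderiv_comp_apply_of_eq (I'' := 𝓘(ℝ, R4)) (0 : ℝ) (mdifferentiableAt_proj u)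
    (mdifferentiableAt_vcurve u w 0) h0 (1 : ℝ)
  have h1 : ((TotalSpace.proj : TotalSpace F V → M) ∘
    fun s : ℝ ↦ TotalSpace.mk' F u.proj (u.snd + s • w)) = fun _ ↦ u.proj := rfl
  rw [h1, mfderiv_const] at h
  exact h.symm

lemma dfib_vlift (hu : u.proj ∈ e.baseSet) (w : V u.proj) :
    dfib e (vlift u w) = fib e u.proj w := by
  have h0 : TotalSpace.mk' F u.proj (u.snd + (0 : ℝ) • w) = u := by
    simp
  have h := mfderiv_comp_apply_of_eq (I'' := 𝓘(ℝ, F)) (0 : ℝ) (mdifferentiableAt_fib_snd hu)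
    (mdifferentiableAt_vcurve u w 0) h0 (1 : ℝ)
  refine h.symm.trans ?_
  have h2 : ((fun p : TotalSpace F V ↦ (e p).2) ∘
      fun s : ℝ ↦ TotalSpace.mk' F u.proj (u.snd + s • w))
        = fun s : ℝ ↦ fib e u.proj u.snd + s • fib e u.proj w := by
    funext s
    change fib e _ _ = _
    rw [fib_add hu, fib_smul hu]
  rw [h2, mfderiv_eq_fderiv]
  have h3 : HasDerivAt (fun s : ℝ ↦ fib e u.proj u.snd + s • fib e u.proj w)
      ((1 : ℝ) • fib e u.proj w) 0 := ((hasDerivAt_id (0 : ℝ)).smul_const _).const_add _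
  have h4 := h3.hasFDerivAt.fderiv
  refine (congrArg (fun T ↦ T (1 : ℝ)) h4).trans ?_
  simp

lemma vlift_add (w w' : V u.proj) : vlift u (w + w') = vlift u w + vlift u w' := by
  have hx := mem_baseSet_extend (F := F) (V := V) u.proj
  refine totTan_ext hx ?_ ?_
  · rw [dproj_add, dproj_vlift, dproj_vlift, dproj_vlift, add_zero]
  · rw [dfib_add, dfib_vlift hx, dfib_vlift hx, dfib_vlift hx, fib_add hx]

lemma vlift_smul (c : ℝ) (w : V u.proj) : vlift u (c • w) = c • vlift u w := by
  have hx := mem_baseSet_extend (F := F) (V := V) u.proj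
  refine totTan_ext hx ?_ ?_
  · rw [dproj_smul, dproj_vlift, dproj_vlift, smul_zero]
  · rw [dfib_smul, dfib_vlift hx, dfib_vlift hx, fib_smul hx]

lemma vlift_injective : Function.Injective (vlift u : V u.proj → TotTan u) := by
  intro w w' h
  have hx := mem_baseSet_extend (F := F) (V := V) u.proj
  refine fib_injective hx ?_
  rw [← dfib_vlift hx, ← dfib_vlift hx, h]

lemma vproj_vlift (w : V u.proj) : vproj u (vlift u w) = w := by
  have h : ∃ w', vlift u w' = vlift u w := ⟨w, rfl⟩
  rw [vproj, dif_pos h]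
  exact vlift_injective h.choose_spec

lemma exists_vlift_eq {ξ : TotTan u} (h : dproj ξ = 0) : ∃ w, vlift u w = ξ := by
  have hx := mem_baseSet_extend (F := F) (V := V) u.proj
  obtain ⟨w, hw⟩ := exists_fib_eq (e := trivializationAt F V u.proj) hx
    (dfib (trivializationAt F V u.proj) ξ)
  refine ⟨w, totTan_ext hx ?_ ?_⟩
  · rw [dproj_vlift, h]
  · rw [dfib_vlift hx, hw]

lemma vlift_vproj {ξ : TotTan u} (h : dproj ξ = 0) : vlift u (vproj u ξ) = ξ := by
  have h' := exists_vlift_eq h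
  rw [vproj, dif_pos h']
  exact h'.choose_spec

lemma fib_vproj (hu : u.proj ∈ e.baseSet) {ξ : TotTan u} (h : dproj ξ = 0) :
    fib e u.proj (vproj u ξ) = dfib e ξ := by
  conv_rhs => rw [← vlift_vproj h]
  rw [dfib_vlift hu]

/-- The tangent map of a section. -/
abbrev tsec (s : ∀ x, V x) (x : M) (X : Tan x) : TotTan (TotalSpace.mk' F x (s x)) :=
  mfderiv 𝓘(ℝ, R4) (𝓘(ℝ, R4).prod 𝓘(ℝ, F)) (fun y ↦ TotalSpace.mk' F y (s y)) x X

lemma dproj_tsec {s : ∀ x, V x} {x : M} (hs : DiffAt F s x) (X : Tan x) :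
    dproj (tsec (F := F) s x X) = X := by
  have h := mfderiv_comp_apply (I'' := 𝓘(ℝ, R4)) x
    (mdifferentiableAt_proj (TotalSpace.mk' F x (s x))) hs X
  refine h.symm.trans ?_
  have h1 : ((TotalSpace.proj : TotalSpace F V → M) ∘ fun y ↦ TotalSpace.mk' F y (s y)) = id := rfl
  rw [h1, mfderiv_id]
  rfl

lemma dfib_tsec {s : ∀ x, V x} {x : M} (hx : x ∈ e.baseSet) (hs : DiffAt F s x) (X : Tan x) :
    dfib e (tsec (F := F) s x X) = mvfderiv 𝓘(ℝ, R4) (fun y ↦ fib e y (s y)) x X :=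
  (mvfderiv_comp_vec x (mdifferentiableAt_fib_snd (u := TotalSpace.mk' F x (s x)) hx) hs X).symm

lemma mdifferentiableAt_fib {s : ∀ x, V x} {x : M} (hx : x ∈ e.baseSet) (hs : DiffAt F s x) :
    MDifferentiableAt 𝓘(ℝ, R4) 𝓘(ℝ, F) (fun y ↦ fib e y (s y)) x :=
  MDifferentiableAt.comp (I' := 𝓘(ℝ, R4).prod 𝓘(ℝ, F)) (g := fun p : TotalSpace F V ↦ (e p).2) x
    (mdifferentiableAt_fib_snd (u := TotalSpace.mk' F x (s x)) hx) hs

lemma contMDiffOn_fib {s : ∀ x, V x} {W : Set M} (hs : SmoothOn F W s) :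
    ContMDiffOn 𝓘(ℝ, R4) 𝓘(ℝ, F) ∞ (fun y ↦ fib e y (s y)) (W ∩ e.baseSet) :=
  contMDiffOn_fib_snd.comp (hs.mono inter_subset_left) fun _ hx ↦ e.mem_source.2 hx.2

lemma smoothOn_of_fib {s : ∀ x, V x} {W : Set M} (hW : W ⊆ e.baseSet)
    (hs : ContMDiffOn 𝓘(ℝ, R4) 𝓘(ℝ, F) ∞ (fun y ↦ fib e y (s y)) W) : SmoothOn F W s := by
  intro x hx
  rw [e.contMDiffWithinAt_section _ (hW hx)]
  exact hs x hx

lemma diffAt_of_fib {s : ∀ x, V x} {x : M} (hx : x ∈ e.baseSet)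
    (hs : MDifferentiableAt 𝓘(ℝ, R4) 𝓘(ℝ, F) (fun y ↦ fib e y (s y)) x) : DiffAt F s x := by
  unfold DiffAt
  rw [e.mdifferentiableAt_section_iff 𝓘(ℝ, R4) s hx]
  exact hs

lemma smoothOn_of_forall {s : ∀ x, V x} {W : Set M}
    (h : ∀ x ∈ W, ∃ W' : Set M, IsOpen W' ∧ x ∈ W' ∧ SmoothOn F W' s) : SmoothOn F W s := by
  intro x hx
  obtain ⟨W', hW', hx', hs⟩ := h x hx
  exact (hs.contMDiffAt (hW'.mem_nhds hx')).contMDiffWithinAt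

/-- The differential of the fibre coordinate of a section. -/
abbrev dcoord (e : Trivialization F (π F V)) (s : ∀ x, V x) (x : M) (X : Tan x) : F :=
  mvfderiv 𝓘(ℝ, R4) (fun y ↦ fib e y (s y)) x X

lemma dcoord_add {s s' : ∀ x, V x} {x : M} (hx : x ∈ e.baseSet) (hs : DiffAt F s x)
    (hs' : DiffAt F s' x) (X : Tan x) : dcoord e (s + s') x X = dcoord e s x X + dcoord e s' x X := by
  have h : (fun y ↦ fib e y ((s + s') y)) =ᶠ[𝓝 x] (fun y ↦ fib e y (s y)) + fun y ↦ fib e y (s' y) := by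
    filter_upwards [e.open_baseSet.mem_nhds hx] with y hy using fib_add hy _ _
  rw [dcoord, mvfderiv_congr_apply h, mvfderiv_add (mdifferentiableAt_fib hx hs)
    (mdifferentiableAt_fib hx hs')]
  rfl

lemma dcoord_smul {s : ∀ x, V x} {f : M → ℝ} {x : M} (hx : x ∈ e.baseSet) (hs : DiffAt F s x)
    (hf : MDifferentiableAt 𝓘(ℝ, R4) 𝓘(ℝ, ℝ) f x) (X : Tan x) :
    dcoord e (f • s) x X
      = f x • dcoord e s x X + mvfderiv 𝓘(ℝ, R4) f x X • fib e x (s x) := by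
  have h : (fun y ↦ fib e y ((f • s) y)) =ᶠ[𝓝 x] f • fun y ↦ fib e y (s y) := by
    filter_upwards [e.open_baseSet.mem_nhds hx] with y hy using fib_smul hy _ _
  rw [dcoord, mvfderiv_congr_apply h, mvfderiv_smul hf (mdifferentiableAt_fib hx hs)]
  rfl

/-! ### Covariant derivatives at a point -/

variable (F) in
/-- A covariant derivative at the point `x`. -/
structure IsConnAt (cov : (∀ x, V x) → ∀ x : M, Tan x → V x) (x : M) : Prop where
  add : ∀ (s s' : ∀ x, V x) (X : Tan x), DiffAt F s x → DiffAt F s' x →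
    cov (s + s') x X = cov s x X + cov s' x X
  leibniz : ∀ (f : M → ℝ) (s : ∀ x, V x) (X : Tan x), MDifferentiableAt 𝓘(ℝ, R4) 𝓘(ℝ, ℝ) f x →
    DiffAt F s x → cov (f • s) x X = f x • cov s x X + mvfderiv 𝓘(ℝ, R4) f x X • s x

variable {cov : (∀ x, V x) → ∀ x : M, Tan x → V x} [FiniteDimensional ℝ F]

/-- The difference of a covariant derivative and the derivative of the coordinates is a tensor. -/
lemma IsConnAt.fib_sub_dcoord {x : M} (hc : IsConnAt F cov x) (hx : x ∈ e.baseSet)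
    {s s' : ∀ x, V x} (hs : DiffAt F s x) (hs' : DiffAt F s' x) (h : s x = s' x) (X : Tan x) :
    fib e x (cov s x X) - dcoord e s x X = fib e x (cov s' x X) - dcoord e s' x X := by
  -- Both derivatives obey the Leibniz rule with the same derivative term, which cancels in the
  -- difference; what remains is the Christoffel term.
  have ht : TensorialAt 𝓘(ℝ, R4) F (fun s : ∀ x, V x ↦ fib e x (cov s x X) - dcoord e s x X) x := by
    constructor
    · intro f σ hf hσ
      rw [hc.leibniz f σ X hf hσ, dcoord_smul hx hσ hf, fib_add hx, fib_smul hx, fib_smul hx]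
      module
    · intro σ σ' hσ hσ'
      rw [hc.add σ σ' X hσ hσ', dcoord_add hx hσ hσ', fib_add hx]
      module
  exact ht.pointwise hs hs' h

/-- Sections with the same germ have the same coordinate differential, and the other part of the
covariant derivative depends only on the value at `x`. -/
lemma IsConnAt.congr {x : M} (hc : IsConnAt F cov x) {s s' : ∀ x, V x} (hs : DiffAt F s x)
    (h : ∀ᶠ y in 𝓝 x, s' y = s y) (X : Tan x) : cov s' x X = cov s x X := by
  have hx := mem_baseSet_extend (F := F) (V := V) x
  have hs' : DiffAt F s' x := by
    refine MDifferentiableAt.congr_of_eventuallyEq hs ?_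
    filter_upwards [h] with y hy
    rw [hy]
  refine fib_injective hx ?_
  have h1 := hc.fib_sub_dcoord hx hs' hs h.self_of_nhds X
  have h2 : dcoord (trivializationAt F V x) s' x X = dcoord (trivializationAt F V x) s x X := by
    refine mvfderiv_congr_apply ?_ X
    filter_upwards [h] with y hy
    rw [hy]
  rw [h2] at h1
  exact sub_left_injective h1

variable (F) in
lemma diffAt_extend {x : M} (v : V x) : DiffAt F (FiberBundle.extend F v : ∀ y, V y) x :=
  FiberBundle.mdifferentiableAt_extend 𝓘(ℝ, R4) F v

lemma hlift_eq (X : Tan u.proj) : ∃ ξ : TotTan u, dproj ξ = X ∧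
    (∀ (e : Trivialization F (π F V)) [MemTrivializationAtlas e], u.proj ∈ e.baseSet →
      dfib e ξ = dcoord e (FiberBundle.extend F u.snd) u.proj X) ∧
    hlift cov u X = ξ - vlift u (cov (FiberBundle.extend F u.snd) u.proj X) := by
  -- Stated for an arbitrary section through `u`, so that `s u.proj = u.snd` can be substituted: the
  -- tangent map of a section is based at the value of the section rather than at `u`.
  have key : ∀ (u : TotalSpace F V) (s : ∀ x, V x) (X : Tan u.proj), DiffAt F s u.proj →
      s u.proj = u.snd → ∃ ξ : TotTan u, dproj ξ = X ∧
        (∀ (e : Trivialization F (π F V)) [MemTrivializationAtlas e], u.proj ∈ e.baseSet →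
          dfib e ξ = dcoord e s u.proj X) ∧
        ξ = mfderiv 𝓘(ℝ, R4) (𝓘(ℝ, R4).prod 𝓘(ℝ, F)) (fun y ↦ TotalSpace.mk' F y (s y)) u.proj X := by
    rintro ⟨x, w⟩ s X hs h
    dsimp only at h hs X
    subst h
    exact ⟨_, dproj_tsec hs X, fun e _ he ↦ dfib_tsec he hs X, rfl⟩
  obtain ⟨ξ, h1, h2, h3⟩ := key u _ X (diffAt_extend F u.snd) (FiberBundle.extend_apply_self F u.snd)
  refine ⟨ξ, h1, h2, ?_⟩
  rw [h3]
  rfl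

lemma dproj_hlift (X : Tan u.proj) : dproj (hlift cov u X) = X := by
  obtain ⟨ξ, h1, -, h3⟩ := hlift_eq (cov := cov) X
  rw [h3, dproj_sub, dproj_vlift, sub_zero, h1]

/-- The lift is defined with one particular extension of `u`, but any section through `u` gives the
same result, since the difference of the two derivatives is tensorial. -/
lemma dfib_hlift (hu : u.proj ∈ e.baseSet) (hc : IsConnAt F cov u.proj) {s : ∀ x, V x}
    (hs : DiffAt F s u.proj) (h : s u.proj = u.snd) (X : Tan u.proj) :
    dfib e (hlift cov u X) = dcoord e s u.proj X - fib e u.proj (cov s u.proj X) := by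
  obtain ⟨ξ, -, h2, h3⟩ := hlift_eq (cov := cov) X
  have h4 := hc.fib_sub_dcoord hu (diffAt_extend F u.snd) hs
    ((FiberBundle.extend_apply_self F u.snd).trans h.symm) X
  rw [h3, dfib_sub, dfib_vlift hu, h2 e hu, ← neg_sub (fib e u.proj _), h4, neg_sub]

end TotalSpaces

/-! ### Smooth connections and tensoriality of the curvature -/

section SmoothConnections

variable {M : Type*} [TopologicalSpace M] [ChartedSpace R4 M] [IsManifold 𝓘(ℝ, R4) ∞ M]
  {F : Type*} [NormedAddCommGroup F] [NormedSpace ℝ F] [FiniteDimensional ℝ F]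
  {V : M → Type*} [TopologicalSpace (TotalSpace F V)]
  [∀ x, AddCommGroup (V x)] [∀ x, Module ℝ (V x)] [∀ x, TopologicalSpace (V x)]
  [FiberBundle F V] [VectorBundle ℝ F V] [ContMDiffVectorBundle ∞ F V 𝓘(ℝ, R4)]

lemma SmoothOn.add {W : Set M} {s s' : ∀ x, V x} (hs : SmoothOn F W s) (hs' : SmoothOn F W s') :
    SmoothOn F W (s + s') := ContMDiffOn.add_section hs hs'

lemma SmoothOn.sub {W : Set M} {s s' : ∀ x, V x} (hs : SmoothOn F W s) (hs' : SmoothOn F W s') :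
    SmoothOn F W (s - s') := ContMDiffOn.sub_section hs hs'

lemma SmoothOn.smul {W : Set M} {f : M → ℝ} {s : ∀ x, V x}
    (hf : ContMDiffOn 𝓘(ℝ, R4) 𝓘(ℝ, ℝ) ∞ f W) (hs : SmoothOn F W s) : SmoothOn F W (f • s) :=
  ContMDiffOn.smul_section hf hs

lemma SmoothOn.zero {W : Set M} : SmoothOn F W (0 : ∀ x, V x) :=
  contMDiffOn_zeroSection ℝ V

lemma SmoothOn.sum {W : Set M} {ι : Type*} {t : Finset ι} {s : ι → ∀ x, V x}
    (hs : ∀ i ∈ t, SmoothOn F W (s i)) : SmoothOn F W (∑ i ∈ t, s i) := by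
  classical
  induction t using Finset.induction_on with
  | empty => simpa using SmoothOn.zero
  | insert a t ha ih =>
    rw [Finset.sum_insert ha]
    exact (hs a (by simp)).add (ih fun i hi ↦ hs i (by simp [hi]))

lemma SmoothOn.congr {W : Set M} {s s' : ∀ x, V x} (hs : SmoothOn F W s)
    (h : ∀ x ∈ W, s' x = s x) : SmoothOn F W s' :=
  ContMDiffOn.congr hs fun x hx ↦ by rw [h x hx]

variable (F) in
/-- An operation on smooth sections that is additive and linear over smooth functions depends only
on the value of the section at the point. -/
lemma tensorial_pointwise {A : Type*} [AddCommGroup A] [Module ℝ A] {W : Set M} (hW : IsOpen W)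
    {x : M} (hx : x ∈ W) (Φ : (∀ x, V x) → A)
    (hadd : ∀ W' ⊆ W, IsOpen W' → x ∈ W' → ∀ s s', SmoothOn F W' s → SmoothOn F W' s' →
      Φ (s + s') = Φ s + Φ s')
    (hsmul : ∀ W' ⊆ W, IsOpen W' → x ∈ W' → ∀ (f : M → ℝ) s,
      ContMDiffOn 𝓘(ℝ, R4) 𝓘(ℝ, ℝ) ∞ f W' → SmoothOn F W' s → Φ (f • s) = f x • Φ s)
    {s s' : ∀ x, V x} (hs : SmoothOn F W s) (hs' : SmoothOn F W s') (h : s x = s' x) :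
    Φ s = Φ s' := by
  classical
  set t := trivializationAt F V x
  let b := Module.finBasis ℝ F
  have hxt : x ∈ t.baseSet := mem_baseSet_extend x
  let W' := W ∩ t.baseSet
  have hW' : IsOpen W' := hW.inter t.open_baseSet
  have hxW' : x ∈ W' := ⟨hx, hxt⟩
  -- The indicator is smooth on `W'`, where it is constant. Multiplication by it makes the expansion
  -- in the local frame an identity of sections over all of `M`, so no locality of `Φ` has to be
  -- assumed.
  let χ : M → ℝ := W'.indicator 1
  have hχ : ∀ y ∈ W', χ y = 1 := fun y hy ↦ by simp [χ, hy]
  have hχs : ContMDiffOn 𝓘(ℝ, R4) 𝓘(ℝ, ℝ) ∞ χ W' :=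
    (contMDiffOn_const (c := (1 : ℝ))).congr hχ
  have hε : ∀ i, SmoothOn F W' (t.localFrame b i) := fun i ↦
    (t.contMDiffOn_localFrame_baseSet (I := 𝓘(ℝ, R4)) ∞ b i).mono inter_subset_right
  have hsum : ∀ (u : Finset (Fin (Module.finrank ℝ F))) (c : Fin (Module.finrank ℝ F) → M → ℝ),
      (∀ i, ContMDiffOn 𝓘(ℝ, R4) 𝓘(ℝ, ℝ) ∞ (c i) W') →
      Φ (∑ i ∈ u, c i • (χ • t.localFrame b i)) = ∑ i ∈ u, c i x • Φ (χ • t.localFrame b i) := by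
    intro u c hc
    induction u using Finset.induction_on with
    | empty =>
      have := hsmul W' inter_subset_left hW' hxW' 0 0 contMDiffOn_const SmoothOn.zero
      simpa using this
    | insert a u ha ih =>
      rw [Finset.sum_insert ha, Finset.sum_insert ha,
        hadd W' inter_subset_left hW' hxW' _ _ ((hε a).smul hχs |>.smul (hc a))
          (SmoothOn.sum fun i _ ↦ ((hε i).smul hχs).smul (hc i)), ih,
        hsmul W' inter_subset_left hW' hxW' _ _ (hc a) ((hε a).smul hχs)]
  have main : ∀ {s : ∀ x, V x}, SmoothOn F W s →
      Φ s = ∑ i, t.localFrameCoeff 𝓘(ℝ, R4) b i x (s x) • Φ (χ • t.localFrame b i) := by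
    intro s hs
    have h1 : Φ (χ • s) = Φ s := by
      rw [hsmul W' inter_subset_left hW' hxW' _ _ hχs (hs.mono inter_subset_left), hχ x hxW',
        one_smul]
    rw [← h1]
    have h2 : χ • s = ∑ i, (fun y ↦ t.localFrameCoeff 𝓘(ℝ, R4) b i y (s y)) • (χ • t.localFrame b i) := by
      funext y
      by_cases hy : y ∈ W'
      · have h3 := t.eq_sum_localFrameCoeff_smul (I := 𝓘(ℝ, R4)) (b := b) (s := s) hy.2
        simp only [Finset.sum_apply, Pi.smul_apply', hχ y hy, one_smul]
        exact h3
      · have h4 : χ y = 0 := by simp [χ, hy]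
        simp [Finset.sum_apply, Pi.smul_apply', h4]
    rw [h2]
    exact hsum Finset.univ _ fun i ↦ contMDiffOn_localFrameCoeff b hW' inter_subset_right
      (hs.mono inter_subset_left) i
  rw [main hs, main hs', h]

variable (F) in
/-- A covariant derivative with smooth coefficients over `W₀`. -/
structure IsSmoothConnOn (W₀ : Set M) (cov : (∀ x, V x) → ∀ x : M, Tan x → V x) : Prop where
  conn : ∀ x ∈ W₀, IsConnAt F cov x
  map_add : ∀ s x X Y, cov s x (X + Y) = cov s x X + cov s x Y
  map_smul : ∀ s x (c : ℝ) X, cov s x (c • X) = c • cov s x X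
  smooth : ∀ W ⊆ W₀, IsOpen W → ∀ (s : ∀ x, V x) (X : ∀ x, Tan x), SmoothOn F W s →
    SmoothOn R4 W X → SmoothOn F W (fun y ↦ cov s y (X y))

/-- The curvature operator of a covariant derivative. -/
def curvOp (cov : (∀ x, V x) → ∀ x : M, Tan x → V x) (X Y : ∀ x : M, Tan x) (s : ∀ x, V x)
    (x : M) : V x :=
  cov (fun y ↦ cov s y (Y y)) x (X x) - cov (fun y ↦ cov s y (X y)) x (Y x)
    - cov s x (VectorField.mlieBracket 𝓘(ℝ, R4) X Y x)

variable {cov : (∀ x, V x) → ∀ x : M, Tan x → V x} {W₀ W : Set M} {x : M}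
  {X Y : ∀ x : M, Tan x} {s : ∀ x, V x}

lemma IsSmoothConnOn.mono (hc : IsSmoothConnOn F W₀ cov) (h : W ⊆ W₀) : IsSmoothConnOn F W cov where
  conn x hx := hc.conn x (h hx)
  map_add := hc.map_add
  map_smul := hc.map_smul
  smooth W' hW' := hc.smooth W' (hW'.trans h)

lemma contMDiffOn_dfun (hW : IsOpen W) {A : Type*} [NormedAddCommGroup A] [NormedSpace ℝ A]
    {f : M → A} (hf : ContMDiffOn 𝓘(ℝ, R4) 𝓘(ℝ, A) ∞ f W)
    (hX : SmoothOn R4 W X) : ContMDiffOn 𝓘(ℝ, R4) 𝓘(ℝ, A) ∞ (fun x ↦ mvfderiv 𝓘(ℝ, R4) f x (X x)) W :=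
  contMDiffOn_mvfderiv hW hf hX

lemma smoothOn_mlieBracket (hW : IsOpen W) (hX : SmoothOn R4 W X) (hY : SmoothOn R4 W Y) :
    SmoothOn R4 W (VectorField.mlieBracket 𝓘(ℝ, R4) X Y) :=
  FieldSmoothOn.mlieBracket hW hX hY

lemma mdiffAt_of_smoothOn {A : Type*} [NormedAddCommGroup A] [NormedSpace ℝ A] {f : M → A}
    (hW : IsOpen W) (hf : ContMDiffOn 𝓘(ℝ, R4) 𝓘(ℝ, A) ∞ f W) (hx : x ∈ W) :
    MDifferentiableAt 𝓘(ℝ, R4) 𝓘(ℝ, A) f x :=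
  (hf.contMDiffAt (hW.mem_nhds hx)).mdifferentiableAt (by simp)

lemma IsSmoothConnOn.map_neg (hc : IsSmoothConnOn F W cov) (s : ∀ x, V x) (x : M) (X : Tan x) :
    cov s x (-X) = - cov s x X := by
  rw [← neg_one_smul ℝ, hc.map_smul, neg_one_smul]

lemma curvOp_swap (hc : IsSmoothConnOn F W cov) : curvOp cov Y X s x = - curvOp cov X Y s x := by
  rw [curvOp, curvOp, VectorField.mlieBracket_swap_apply, hc.map_neg]
  abel

lemma curvOp_add_left (hc : IsSmoothConnOn F W cov) (hW : IsOpen W) (hx : x ∈ W)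
    {X' : ∀ x : M, Tan x} (hX : SmoothOn R4 W X) (hX' : SmoothOn R4 W X')
    (hs : SmoothOn F W s) :
    curvOp cov (X + X') Y s x = curvOp cov X Y s x + curvOp cov X' Y s x := by
  have h1 : cov (fun y ↦ cov s y ((X + X') y)) x (Y x)
      = cov (fun y ↦ cov s y (X y)) x (Y x) + cov (fun y ↦ cov s y (X' y)) x (Y x) := by
    have hd := hc.smooth W subset_rfl hW s X hs hX
    have hd' := hc.smooth W subset_rfl hW s X' hs hX'
    rw [← (hc.conn x hx).add _ _ _ (hd.diffAt hW hx) (hd'.diffAt hW hx)]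
    congr 1
    funext y
    exact hc.map_add s y _ _
  have h2 := VectorField.mlieBracket_add_left (I := 𝓘(ℝ, R4)) (W := Y) (x := x)
    (hX.diffAt hW hx) (hX'.diffAt hW hx)
  rw [curvOp, curvOp, curvOp, h1, h2, hc.map_add, Pi.add_apply, hc.map_add]
  abel

lemma curvOp_smul_left (hc : IsSmoothConnOn F W cov) (hW : IsOpen W) (hx : x ∈ W)
    {f : M → ℝ} (hf : ContMDiffOn 𝓘(ℝ, R4) 𝓘(ℝ, ℝ) ∞ f W) (hX : SmoothOn R4 W X)
    (hs : SmoothOn F W s) :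
    curvOp cov (f • X) Y s x = f x • curvOp cov X Y s x := by
  have hfx := mdiffAt_of_smoothOn hW hf hx
  have h1 : cov (fun y ↦ cov s y ((f • X) y)) x (Y x)
      = f x • cov (fun y ↦ cov s y (X y)) x (Y x)
        + mvfderiv 𝓘(ℝ, R4) f x (Y x) • cov s x (X x) := by
    have hd := hc.smooth W subset_rfl hW s X hs hX
    rw [← (hc.conn x hx).leibniz _ _ _ hfx (hd.diffAt hW hx)]
    congr 1
    funext y
    exact hc.map_smul s y _ _
  have h2 := VectorField.mlieBracket_smul_left (I := 𝓘(ℝ, R4)) (W := Y) (x := x) hfx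
    (hX.diffAt hW hx)
  rw [curvOp, curvOp, h1, h2, Pi.smul_apply', hc.map_add, hc.map_smul, hc.map_smul, hc.map_smul]
  module

lemma curvOp_add_section (hc : IsSmoothConnOn F W cov) (hW : IsOpen W) (hx : x ∈ W)
    {s' : ∀ x, V x} (hX : SmoothOn R4 W X) (hY : SmoothOn R4 W Y)
    (hs : SmoothOn F W s) (hs' : SmoothOn F W s') :
    curvOp cov X Y (s + s') x = curvOp cov X Y s x + curvOp cov X Y s' x := by
  have h1 : ∀ {X : ∀ x : M, Tan x} (v : Tan x), SmoothOn R4 W X →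
      cov (fun y ↦ cov (s + s') y (X y)) x v
      = cov (fun y ↦ cov s y (X y)) x v + cov (fun y ↦ cov s' y (X y)) x v := by
    intro X v hX
    have hd := hc.smooth W subset_rfl hW s X hs hX
    have hd' := hc.smooth W subset_rfl hW s' X hs' hX
    rw [← (hc.conn x hx).add _ _ _ (hd.diffAt hW hx) (hd'.diffAt hW hx)]
    refine (hc.conn x hx).congr ((hd.add hd').diffAt hW hx) ?_ v
    filter_upwards [hW.mem_nhds hx] with y hy
    exact (hc.conn y hy).add _ _ _ (hs.diffAt hW hy) (hs'.diffAt hW hy)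
  rw [curvOp, curvOp, curvOp, h1 _ hX, h1 _ hY,
    (hc.conn x hx).add _ _ _ (hs.diffAt hW hx) (hs'.diffAt hW hx)]
  abel

/-- The terms with one derivative of `f` are symmetric in `X` and `Y`. The second derivatives
combine to `X.Y.f - Y.X.f - [X, Y].f`, which is zero. -/
lemma curvOp_smul_section (hc : IsSmoothConnOn F W cov) (hW : IsOpen W) (hx : x ∈ W)
    {f : M → ℝ} (hf : ContMDiffOn 𝓘(ℝ, R4) 𝓘(ℝ, ℝ) ∞ f W) (hX : SmoothOn R4 W X)
    (hY : SmoothOn R4 W Y) (hs : SmoothOn F W s) :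
    curvOp cov X Y (f • s) x = f x • curvOp cov X Y s x := by
  have hfx := mdiffAt_of_smoothOn hW hf hx
  have h1 : ∀ {X : ∀ x : M, Tan x} (v : Tan x), SmoothOn R4 W X →
      cov (fun y ↦ cov (f • s) y (X y)) x v
      = (f x • cov (fun y ↦ cov s y (X y)) x v + mvfderiv 𝓘(ℝ, R4) f x v • cov s x (X x))
       + (mvfderiv 𝓘(ℝ, R4) f x (X x) • cov s x v
        + mvfderiv 𝓘(ℝ, R4) (fun y ↦ mvfderiv 𝓘(ℝ, R4) f y (X y)) x v • s x) := by
    intro X v hX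
    have hd := hc.smooth W subset_rfl hW s X hs hX
    have hXf := contMDiffOn_dfun hW hf hX
    have hXfx := mdiffAt_of_smoothOn hW hXf hx
    rw [← (hc.conn x hx).leibniz _ _ _ hfx (hd.diffAt hW hx),
      ← (hc.conn x hx).leibniz (fun y ↦ mvfderiv 𝓘(ℝ, R4) f y (X y)) _ _ hXfx (hs.diffAt hW hx),
      ← (hc.conn x hx).add _ _ _ ((hd.smul hf).diffAt hW hx) ((hs.smul hXf).diffAt hW hx)]
    refine (hc.conn x hx).congr (((hd.smul hf).add (hs.smul hXf)).diffAt hW hx) ?_ v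
    filter_upwards [hW.mem_nhds hx] with y hy
    exact (hc.conn y hy).leibniz _ _ _ (mdiffAt_of_smoothOn hW hf hy) (hs.diffAt hW hy)
  have h2 : mvfderiv 𝓘(ℝ, R4) f x (VectorField.mlieBracket 𝓘(ℝ, R4) X Y x) = _ :=
    mvfderiv_mlieBracket hW hx hf hX hY
  rw [curvOp, curvOp, h1 _ hX, h1 _ hY, (hc.conn x hx).leibniz _ _ _ hfx (hs.diffAt hW hx), h2]
  module

/-- The curvature can be computed with arbitrary smooth extensions. -/
lemma curv_eq_curvOp (hc : IsSmoothConnOn F W cov) (hW : IsOpen W) (hx : x ∈ W)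
    (hX : SmoothOn R4 W X) (hY : SmoothOn R4 W Y) (hs : SmoothOn F W s) :
    curv F cov x (X x) (Y x) (s x) = curvOp cov X Y s x := by
  let X' : ∀ y : M, Tan y := FiberBundle.extend R4 (X x)
  let Y' : ∀ y : M, Tan y := FiberBundle.extend R4 (Y x)
  let s' : ∀ y : M, V y := FiberBundle.extend F (s x)
  have h0 : curv F cov x (X x) (Y x) (s x) = curvOp cov X' Y' s' x := by
    simp only [curv, curvOp, X', Y', FiberBundle.extend_apply_self]
    rfl
  let W' : Set M := W ∩ (trivializationAt R4 (TangentSpace 𝓘(ℝ, R4)) x).baseSet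
    ∩ (trivializationAt F V x).baseSet
  have hWW : W' ⊆ W := fun y hy ↦ hy.1.1
  have hW' : IsOpen W' := (hW.inter (Trivialization.open_baseSet _)).inter
    (Trivialization.open_baseSet _)
  have hxW' : x ∈ W' := ⟨⟨hx, mem_baseSet_extend x⟩, mem_baseSet_extend x⟩
  have hX' : SmoothOn R4 W' X' := (smoothOn_extend (X x)).mono fun y hy ↦ hy.1.2
  have hY' : SmoothOn R4 W' Y' := (smoothOn_extend (Y x)).mono fun y hy ↦ hy.1.2
  have hs' : SmoothOn F W' s' := (smoothOn_extend (s x)).mono fun y hy ↦ hy.2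
  have hX := hX.mono hWW
  have hY := hY.mono hWW
  have hs := hs.mono hWW
  have hc := hc.mono hWW
  -- Tensoriality in the first field; antisymmetry of `curvOp` carries it over to the second.
  have eX : ∀ {X X' Y : ∀ x : M, Tan x} {s : ∀ x, V x}, SmoothOn R4 W' X → SmoothOn R4 W' X' →
      SmoothOn F W' s → X x = X' x → curvOp cov X Y s x = curvOp cov X' Y s x := by
    intro X X' Y s hX hX' hs h
    refine tensorial_pointwise R4 hW' hxW' (fun X ↦ curvOp cov X Y s x) ?_ ?_ hX hX' h
    · intro W₁ h₁ ho hx₁ T T' hT hT'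
      exact curvOp_add_left (hc.mono h₁) ho hx₁ hT hT' (hs.mono h₁)
    · intro W₁ h₁ ho hx₁ f T hf hT
      exact curvOp_smul_left (hc.mono h₁) ho hx₁ hf hT (hs.mono h₁)
  rw [h0, eX hX' hX hs' (FiberBundle.extend_apply_self R4 _), ← neg_eq_iff_eq_neg.2 (curvOp_swap hc),
    eX hY' hY hs' (FiberBundle.extend_apply_self R4 _), ← curvOp_swap hc]
  refine tensorial_pointwise F hW' hxW' (fun s ↦ curvOp cov X Y s x) ?_ ?_ hs' hs
    (FiberBundle.extend_apply_self F _)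
  · intro W₁ h₁ ho hx₁ T T' hT hT'
    exact curvOp_add_section (hc.mono h₁) ho hx₁ (hX.mono h₁) (hY.mono h₁) hT hT'
  · intro W₁ h₁ ho hx₁ f T hf hT
    exact curvOp_smul_section (hc.mono h₁) ho hx₁ hf (hX.mono h₁) (hY.mono h₁) hT

end SmoothConnections

/-! ### Vector fields on a total space -/

section TotalFields

variable {M : Type*} [TopologicalSpace M] [ChartedSpace R4 M] [IsManifold 𝓘(ℝ, R4) ∞ M]
  {F : Type*} [NormedAddCommGroup F] [NormedSpace ℝ F]
  {V : M → Type*} [TopologicalSpace (TotalSpace F V)]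
  [∀ x, AddCommGroup (V x)] [∀ x, Module ℝ (V x)] [∀ x, TopologicalSpace (V x)]
  [FiberBundle F V] [VectorBundle ℝ F V] [ContMDiffVectorBundle ∞ F V 𝓘(ℝ, R4)]
  {e : Trivialization F (π F V)} [MemTrivializationAtlas e]

/-- A vector field on the total space is smooth if its projection and its fibre component are. -/
lemma fieldSmoothOn_of_components {O : Set (TotalSpace F V)}
    (hOe : O ⊆ e.source) {Y : ∀ u : TotalSpace F V, TotTan u}
    (h1 : ContMDiffOn (𝓘(ℝ, R4).prod 𝓘(ℝ, F)) 𝓘(ℝ, R4).tangent ∞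
      (fun u ↦ (⟨u.proj, dproj (Y u)⟩ : TangentBundle 𝓘(ℝ, R4) M)) O)
    (h2 : ContMDiffOn (𝓘(ℝ, R4).prod 𝓘(ℝ, F)) 𝓘(ℝ, F) ∞ (fun u ↦ dfib e (Y u)) O) :
    FieldSmoothOn (𝓘(ℝ, R4).prod 𝓘(ℝ, F)) O Y := by
  have hO2 : ContMDiffOn (𝓘(ℝ, R4).prod 𝓘(ℝ, F)) 𝓘(ℝ, F).tangent ∞
      (fun u ↦ (⟨(e u).2, (dfib e (Y u) : F)⟩ : TangentBundle 𝓘(ℝ, F) F)) O := by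
    have h3 : ContMDiffOn (𝓘(ℝ, R4).prod 𝓘(ℝ, F)) (𝓘(ℝ, F).prod 𝓘(ℝ, F)) ∞
      (fun u ↦ ((e u).2, (dfib e (Y u) : F))) O := (contMDiffOn_fib_snd.mono hOe).prodMk h2
    have h4 : ContMDiff (𝓘(ℝ, F).prod 𝓘(ℝ, F)) 𝓘(ℝ, F).tangent ∞
        (fun p : F × F ↦ (⟨p.1, p.2⟩ : TangentBundle 𝓘(ℝ, F) F)) := by
      have := contMDiff_tangentBundleModelSpaceHomeomorph_symm (I := 𝓘(ℝ, F)) (n := ∞)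
      convert! this
      rw [chartedSpaceSelf_prod]
      rfl
    exact h4.comp_contMDiffOn h3
  -- `Y` is the image of its pair of components under the tangent map of the inverse of the
  -- trivialization, and that map is smooth.
  have h5 := (contMDiff_equivTangentBundleProd_symm (n := ∞) (I := 𝓘(ℝ, R4)) (M := M)
    (I' := 𝓘(ℝ, F)) (M' := F)).comp_contMDiffOn (h1.prodMk hO2)
  have h6 : ContMDiffOn (𝓘(ℝ, R4).prod 𝓘(ℝ, F)).tangent (𝓘(ℝ, R4).prod 𝓘(ℝ, F)).tangent ∞
      (tangentMapWithin (𝓘(ℝ, R4).prod 𝓘(ℝ, F)) (𝓘(ℝ, R4).prod 𝓘(ℝ, F)) e.toOpenPartialHomeomorph.symm e.target)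
      (π (R4 × F) (TangentSpace (𝓘(ℝ, R4).prod 𝓘(ℝ, F))) ⁻¹' e.target) :=
    (e.contMDiffOn_symm (n := ∞) (IB := 𝓘(ℝ, R4))).contMDiffOn_tangentMapWithin (by simp)
      e.open_target.uniqueMDiffOn
  have hin : ∀ u ∈ O, (u.proj, (e u).2) ∈ e.target := fun u hu ↦ by
    have := e.map_source (hOe hu)
    rwa [← e.coe_fst (hOe hu)]
  refine (h6.comp h5 hin).congr fun u hu ↦ ?_
  have hus : u.proj ∈ e.baseSet := e.mem_source.1 (hOe hu)
  have hsym : e.toOpenPartialHomeomorph.symm (u.proj, (e u).2) = u := by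
    have := e.left_inv (hOe hu)
    rwa [← e.coe_fst (hOe hu)]
  have hda : MDifferentiableAt (𝓘(ℝ, R4).prod 𝓘(ℝ, F)) (𝓘(ℝ, R4).prod 𝓘(ℝ, F))
      e.toOpenPartialHomeomorph.symm (u.proj, (e u).2) :=
    ((e.contMDiffOn_symm (n := ∞) (IB := 𝓘(ℝ, R4))).contMDiffAt
      (e.open_target.mem_nhds (hin u hu))).mdifferentiableAt (by simp)
  set T := mfderiv (𝓘(ℝ, R4).prod 𝓘(ℝ, F)) (𝓘(ℝ, R4).prod 𝓘(ℝ, F))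
      e.toOpenPartialHomeomorph.symm (u.proj, (e u).2) with hT
  have key : ∀ w (_ : w = u) (ξ : TotTan w), (dproj ξ : R4) = (dproj (Y u) : R4) →
      dfib e ξ = dfib e (Y u) → (⟨u, Y u⟩ : TangentBundle (𝓘(ℝ, R4).prod 𝓘(ℝ, F)) (TotalSpace F V))
        = ⟨w, ξ⟩ := by
    rintro w rfl ξ h1 h2
    rw [totTan_ext hus h1.symm h2.symm]
  have h7 : tangentMapWithin (𝓘(ℝ, R4).prod 𝓘(ℝ, F)) (𝓘(ℝ, R4).prod 𝓘(ℝ, F))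
      e.toOpenPartialHomeomorph.symm e.target ⟨(u.proj, (e u).2), (dproj (Y u), dfib e (Y u))⟩
      = ⟨e.toOpenPartialHomeomorph.symm (u.proj, (e u).2), T (dproj (Y u), dfib e (Y u))⟩ := by
    simp only [tangentMapWithin]
    rw [mfderivWithin_of_isOpen e.open_target (hin u hu)]
  refine (key _ hsym _ ?_ ?_).trans h7.symm
  · have h8 := mfderiv_comp_apply (I'' := 𝓘(ℝ, R4)) _ (mdifferentiableAt_proj _)
      hda (dproj (Y u), dfib e (Y u))
    have h9 : ((TotalSpace.proj : TotalSpace F V → M) ∘ e.toOpenPartialHomeomorph.symm)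
        =ᶠ[𝓝 (u.proj, (e u).2)] Prod.fst := by
      filter_upwards [e.open_target.mem_nhds (hin u hu)] with p hp using e.proj_symm_apply hp
    refine h8.symm.trans ?_
    rw [h9.mfderiv_eq, mfderiv_fst]
    rfl
  · have h8 := mfderiv_comp_apply (I'' := 𝓘(ℝ, F)) _
      (mdifferentiableAt_fib_snd (e := e) (u := e.toOpenPartialHomeomorph.symm (u.proj, (e u).2))
        (by rw [hsym]; exact hus)) hda (dproj (Y u), dfib e (Y u))
    have h9 : ((fun p ↦ (e p).2) ∘ e.toOpenPartialHomeomorph.symm)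
        =ᶠ[𝓝 (u.proj, (e u).2)] Prod.snd := by
      filter_upwards [e.open_target.mem_nhds (hin u hu)] with p hp
      simp [Function.comp, e.apply_symm_apply hp]
    refine h8.symm.trans ?_
    rw [h9.mfderiv_eq, mfderiv_snd]
    rfl

lemma contMDiffOn_dfib {O : Set (TotalSpace F V)} (hO : IsOpen O) (hOe : O ⊆ e.source)
    {Y : ∀ u : TotalSpace F V, TotTan u} (hY : FieldSmoothOn (𝓘(ℝ, R4).prod 𝓘(ℝ, F)) O Y) :
    ContMDiffOn (𝓘(ℝ, R4).prod 𝓘(ℝ, F)) 𝓘(ℝ, F) ∞ (fun u ↦ dfib e (Y u)) O :=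
  contMDiffOn_mvfderiv hO (contMDiffOn_fib_snd.mono hOe) hY

lemma mvfderiv_comp_proj {A : Type*} [NormedAddCommGroup A] [NormedSpace ℝ A] {f : M → A}
    {u : TotalSpace F V} (hf : MDifferentiableAt 𝓘(ℝ, R4) 𝓘(ℝ, A) f u.proj) (ξ : TotTan u) :
    mvfderiv (𝓘(ℝ, R4).prod 𝓘(ℝ, F)) (fun w : TotalSpace F V ↦ f w.proj) u ξ
      = mvfderiv 𝓘(ℝ, R4) f u.proj (dproj ξ) :=
  mvfderiv_comp_vec u hf (mdifferentiableAt_proj u) ξ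

lemma contMDiffOn_comp_proj {A : Type*} [NormedAddCommGroup A] [NormedSpace ℝ A] {f : M → A}
    {W : Set M} (hf : ContMDiffOn 𝓘(ℝ, R4) 𝓘(ℝ, A) ∞ f W) :
    ContMDiffOn (𝓘(ℝ, R4).prod 𝓘(ℝ, F)) 𝓘(ℝ, A) ∞ (fun w : TotalSpace F V ↦ f w.proj)
      {u | u.proj ∈ W} :=
  hf.comp (contMDiff_proj (n := ∞) (IB := 𝓘(ℝ, R4)) V).contMDiffOn fun _ h ↦ h

variable (F V) in
lemma isOpen_over {W : Set M} (hW : IsOpen W) : IsOpen {u : TotalSpace F V | u.proj ∈ W} :=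
  hW.preimage (FiberBundle.continuous_proj F V)

/-- Tangent vectors of the base are determined by their action on functions. -/
lemma tan_ext {x : M} {X X' : Tan x} (h : ∀ f : M → R4, ∀ W, IsOpen W → x ∈ W →
    ContMDiffOn 𝓘(ℝ, R4) 𝓘(ℝ, R4) ∞ f W →
      mvfderiv 𝓘(ℝ, R4) f x X = mvfderiv 𝓘(ℝ, R4) f x X') : X = X' := by
  have h1 := isInvertible_mfderiv_extChartAt (I := 𝓘(ℝ, R4)) (mem_extChartAt_source (I := 𝓘(ℝ, R4)) x)
  refine h1.injective ?_
  refine h (extChartAt 𝓘(ℝ, R4) x) (chartAt R4 x).source (chartAt R4 x).open_source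
    (mem_chart_source R4 x) ?_
  exact contMDiffOn_extChartAt

/-- The bracket of projectable fields is projectable on the bracket. -/
lemma dproj_mlieBracket [CompleteSpace F] {W : Set M} (hW : IsOpen W) {Y Y' : ∀ u : TotalSpace F V, TotTan u}
    {X X' : ∀ x : M, Tan x} (hX : SmoothOn R4 W X) (hX' : SmoothOn R4 W X')
    (hY : FieldSmoothOn (𝓘(ℝ, R4).prod 𝓘(ℝ, F)) {u | u.proj ∈ W} Y)
    (hY' : FieldSmoothOn (𝓘(ℝ, R4).prod 𝓘(ℝ, F)) {u | u.proj ∈ W} Y')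
    (h : ∀ u : TotalSpace F V, u.proj ∈ W → dproj (Y u) = X u.proj)
    (h' : ∀ u : TotalSpace F V, u.proj ∈ W → dproj (Y' u) = X' u.proj)
    {u : TotalSpace F V} (hu : u.proj ∈ W) :
    dproj (VectorField.mlieBracket (𝓘(ℝ, R4).prod 𝓘(ℝ, F)) Y Y' u)
      = VectorField.mlieBracket 𝓘(ℝ, R4) X X' u.proj := by
  -- Both vectors are tested on functions `f` of the base. A derivative of `f ∘ proj` along `Y` only
  -- sees `X`, and both brackets act as commutators of derivations.
  refine tan_ext fun f W₁ hW₁ hx₁ hf ↦ ?_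
  have hW₂ : IsOpen (W ∩ W₁) := hW.inter hW₁
  have hu₂ : u.proj ∈ W ∩ W₁ := ⟨hu, hx₁⟩
  have hsub : {u : TotalSpace F V | u.proj ∈ W ∩ W₁} ⊆ {u | u.proj ∈ W} := fun w hw ↦ hw.1
  have hf₂ := hf.mono (inter_subset_right (s := W))
  have hO := isOpen_over F V hW₂
  have hX₂ := hX.mono (inter_subset_left (t := W₁))
  have hX₂' := hX'.mono (inter_subset_left (t := W₁))
  have c : ∀ {Y : ∀ u : TotalSpace F V, TotTan u} {X : ∀ x : M, Tan x},
      SmoothOn R4 (W ∩ W₁) X → (∀ u : TotalSpace F V, u.proj ∈ W → dproj (Y u) = X u.proj) →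
      ∀ ξ : TotTan u, mvfderiv (𝓘(ℝ, R4).prod 𝓘(ℝ, F)) (fun w ↦
        mvfderiv (𝓘(ℝ, R4).prod 𝓘(ℝ, F)) (fun w : TotalSpace F V ↦ f w.proj) w (Y w)) u ξ
        = mvfderiv 𝓘(ℝ, R4) (fun y ↦ mvfderiv 𝓘(ℝ, R4) f y (X y)) u.proj (dproj ξ) := by
    intro Y X hX hYX ξ
    rw [← mvfderiv_comp_proj (mdiffAt_of_smoothOn hW₂ (contMDiffOn_dfun hW₂ hf₂ hX) hu₂)]
    refine mvfderiv_congr_apply ?_ ξ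
    filter_upwards [hO.mem_nhds hu₂] with w hw
    rw [mvfderiv_comp_proj (mdiffAt_of_smoothOn hW₂ hf₂ hw), hYX w hw.1]
  have h3 := mvfderiv_mlieBracket hO hu₂ (contMDiffOn_comp_proj (V := V) (F := F) hf₂)
    (hY.mono hsub) (hY'.mono hsub)
  have h4 : _ = _ := mvfderiv_mlieBracket hW₂ hu₂ hf₂ hX₂ hX₂'
  rw [← mvfderiv_comp_proj (mdiffAt_of_smoothOn hW₂ hf₂ hu₂), h3, c hX₂' h', c hX₂ h, h u hu, h' u hu]
  exact h4.symm

end TotalFields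

/-! ### Fields that are affine on the fibres -/

section AffineFields

variable {M : Type*} [TopologicalSpace M] [ChartedSpace R4 M] [IsManifold 𝓘(ℝ, R4) ∞ M]
  {U : M → Type*} [TopologicalSpace (TotalSpace C2 U)]
  [∀ x, NormedAddCommGroup (U x)] [∀ x, InnerProductSpace ℂ (U x)] [FiberBundle C2 U]
  [VectorBundle ℝ C2 U] [ContMDiffVectorBundle ∞ C2 U 𝓘(ℝ, R4)]

/-- The endomorphisms of the model fibre. -/
abbrev End2 : Type := C2 →L[ℂ] C2

/-- Application of endomorphisms of the model fibre, as a real bilinear map. -/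
abbrev applyR : End2 →L[ℝ] C2 →L[ℝ] C2 := ContinuousLinearMap.restrictScalarsL ℂ C2 C2 ℝ ℝ

/-- In the trivialization `e` the vector field `Y` is `X^λ ∂_λ + (A^A_B z^B + b^A) ∂_A`. -/
structure AffRep (e : Trivialization C2 (π C2 U)) [MemTrivializationAtlas e] (W : Set M)
    (Y : ∀ u : TotalSpace C2 U, TotTan u) (X : ∀ x : M, Tan x) (A : M → End2) (b : M → C2) :
    Prop where
  smoothX : SmoothOn R4 W X
  smoothA : ContMDiffOn 𝓘(ℝ, R4) 𝓘(ℝ, End2) ∞ A W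
  smoothb : ContMDiffOn 𝓘(ℝ, R4) 𝓘(ℝ, C2) ∞ b W
  proj : ∀ u : TotalSpace C2 U, u.proj ∈ W → dproj (Y u) = X u.proj
  comp : ∀ u : TotalSpace C2 U, u.proj ∈ W → dfib e (Y u) = A u.proj (e u).2 + b u.proj

variable {e : Trivialization C2 (π C2 U)} [MemTrivializationAtlas e] {W : Set M}
  {Y Y' : ∀ u : TotalSpace C2 U, TotTan u} {X X' : ∀ x : M, Tan x} {A A' : M → End2}
  {b b' : M → C2}

lemma AffRep.mono (h : AffRep e W Y X A b) {W' : Set M} (hW : W' ⊆ W) : AffRep e W' Y X A b where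
  smoothX := h.smoothX.mono hW
  smoothA := h.smoothA.mono hW
  smoothb := h.smoothb.mono hW
  proj u hu := h.proj u (hW hu)
  comp u hu := h.comp u (hW hu)

lemma over_subset_source (hWe : W ⊆ e.baseSet) : {u : TotalSpace C2 U | u.proj ∈ W} ⊆ e.source :=
  fun _ hu ↦ e.mem_source.2 (hWe hu)

lemma AffRep.contMDiffOn_comp (h : AffRep e W Y X A b) (hWe : W ⊆ e.baseSet) :
    ContMDiffOn (𝓘(ℝ, R4).prod 𝓘(ℝ, C2)) 𝓘(ℝ, C2) ∞
      (fun u : TotalSpace C2 U ↦ A u.proj (e u).2 + b u.proj) {u | u.proj ∈ W} :=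
  (contMDiffOn_bilin applyR (contMDiffOn_comp_proj h.smoothA)
    (contMDiffOn_fib_snd.mono (over_subset_source hWe))).add (contMDiffOn_comp_proj h.smoothb)

lemma AffRep.smooth (h : AffRep e W Y X A b) (hWe : W ⊆ e.baseSet) :
    FieldSmoothOn (𝓘(ℝ, R4).prod 𝓘(ℝ, C2)) {u : TotalSpace C2 U | u.proj ∈ W} Y := by
  refine fieldSmoothOn_of_components (e := e) (over_subset_source hWe) ?_ ?_
  · have h1 : ContMDiffOn (𝓘(ℝ, R4).prod 𝓘(ℝ, C2)) 𝓘(ℝ, R4).tangent ∞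
        (fun u : TotalSpace C2 U ↦ (⟨u.proj, X u.proj⟩ : TangentBundle 𝓘(ℝ, R4) M))
        {u : TotalSpace C2 U | u.proj ∈ W} :=
      ContMDiffOn.comp (t := W) h.smoothX
        (contMDiff_proj (n := ∞) (IB := 𝓘(ℝ, R4)) U).contMDiffOn fun _ h ↦ h
    exact h1.congr fun u hu ↦ by rw [h.proj u hu]
  · exact (h.contMDiffOn_comp hWe).congr fun u hu ↦ h.comp u hu

lemma AffRep.mvfderiv_comp (h : AffRep e W Y X A b) (hW : IsOpen W) (hWe : W ⊆ e.baseSet)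
    {u : TotalSpace C2 U} (hu : u.proj ∈ W) (ξ : TotTan u) :
    mvfderiv (𝓘(ℝ, R4).prod 𝓘(ℝ, C2)) (fun w ↦ dfib e (Y w)) u ξ
      = (show End2 from mvfderiv 𝓘(ℝ, R4) A u.proj (dproj ξ)) (e u).2 + A u.proj (dfib e ξ)
        + mvfderiv 𝓘(ℝ, R4) b u.proj (dproj ξ) := by
  have hO := isOpen_over C2 U hW
  have hA := mdiffAt_of_smoothOn hW h.smoothA hu
  have hb := mdiffAt_of_smoothOn hW h.smoothb hu
  have hA' : MDifferentiableAt (𝓘(ℝ, R4).prod 𝓘(ℝ, C2)) 𝓘(ℝ, End2)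
      (fun u : TotalSpace C2 U ↦ A u.proj) u := hA.comp u (mdifferentiableAt_proj u)
  have hb' : MDifferentiableAt (𝓘(ℝ, R4).prod 𝓘(ℝ, C2)) 𝓘(ℝ, C2)
      (fun u : TotalSpace C2 U ↦ b u.proj) u := hb.comp u (mdifferentiableAt_proj u)
  have he := mdifferentiableAt_fib_snd (e := e) (hWe hu)
  have h1 : (fun w ↦ dfib e (Y w)) =ᶠ[𝓝 u]
      (fun w ↦ applyR (A w.proj) (e w).2) + fun w : TotalSpace C2 U ↦ b w.proj := by
    filter_upwards [hO.mem_nhds hu] with w hw using h.comp w hw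
  rw [mvfderiv_congr_apply h1, mvfderiv_add (mdifferentiableAt_bilin applyR hA' he) hb']
  have h2 := mvfderiv_bilin applyR hA' he ξ
  rw [mvfderiv_comp_proj hA] at h2
  have h3 := mvfderiv_comp_proj hb ξ
  exact congrArg₂ (· + ·) h2 h3

/-- The bracket of fields that are affine on the fibres. -/
lemma AffRep.bracket (hW : IsOpen W) (hWe : W ⊆ e.baseSet) (h : AffRep e W Y X A b)
    (h' : AffRep e W Y' X' A' b') :
    AffRep e W (VectorField.mlieBracket (𝓘(ℝ, R4).prod 𝓘(ℝ, C2)) Y Y')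
      (VectorField.mlieBracket 𝓘(ℝ, R4) X X')
      (fun x ↦ mvfderiv 𝓘(ℝ, R4) A' x (X x) - mvfderiv 𝓘(ℝ, R4) A x (X' x)
        + (A' x ∘L A x - A x ∘L A' x))
      (fun x ↦ mvfderiv 𝓘(ℝ, R4) b' x (X x) - mvfderiv 𝓘(ℝ, R4) b x (X' x)
        + (A' x (b x) - A x (b' x))) where
  smoothX := smoothOn_mlieBracket hW h.smoothX h'.smoothX
  smoothA := by
    let L : End2 →L[ℝ] End2 →L[ℝ] End2 :=
      (ContinuousLinearMap.restrictScalarsL ℂ End2 End2 ℝ ℝ) ∘L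
        (ContinuousLinearMap.compL ℂ C2 C2 C2).restrictScalars ℝ
    exact ((contMDiffOn_dfun hW h'.smoothA h.smoothX).sub
      (contMDiffOn_dfun hW h.smoothA h'.smoothX)).add
      ((contMDiffOn_bilin L h'.smoothA h.smoothA).sub (contMDiffOn_bilin L h.smoothA h'.smoothA))
  smoothb := ((contMDiffOn_dfun hW h'.smoothb h.smoothX).sub
      (contMDiffOn_dfun hW h.smoothb h'.smoothX)).add
      ((contMDiffOn_bilin applyR h'.smoothA h.smoothb).sub
        (contMDiffOn_bilin applyR h.smoothA h'.smoothb))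
  proj u hu := dproj_mlieBracket hW h.smoothX h'.smoothX (h.smooth hWe) (h'.smooth hWe)
    h.proj h'.proj hu
  comp u hu := by
    -- The fibre component of the bracket is the commutator of the two derivations applied to the
    -- fibre coordinate `z`; each of them sends `z` to an expression `A z + b`, to which the product
    -- rule applies.
    have h1 := mvfderiv_mlieBracket (isOpen_over C2 U hW) hu
      (contMDiffOn_fib_snd.mono (over_subset_source hWe)) (h.smooth hWe) (h'.smooth hWe)
    refine h1.trans ?_
    have h2 := h'.mvfderiv_comp hW hWe hu (Y u)
    have h3 := h.mvfderiv_comp hW hWe hu (Y' u)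
    rw [h.proj u hu, h.comp u hu] at h2
    rw [h'.proj u hu, h'.comp u hu] at h3
    refine (congrArg₂ (· - ·) h2 h3).trans ?_
    simp only [add_apply, sub_apply,
      ContinuousLinearMap.comp_apply, map_add]
    abel

end AffineFields

/-! ### The Lie algebra sheaf of Hermitian fields -/

section HermFields

variable {M : Type*} [TopologicalSpace M] [ChartedSpace R4 M] [IsManifold 𝓘(ℝ, R4) ∞ M]
  {U : M → Type*} [TopologicalSpace (TotalSpace C2 U)]
  [∀ x, NormedAddCommGroup (U x)] [∀ x, InnerProductSpace ℂ (U x)] [FiberBundle C2 U]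
  [VectorBundle ℝ C2 U] [ContMDiffVectorBundle ∞ C2 U 𝓘(ℝ, R4)]

/-- The Lie derivative of a section along a field on the total space. -/
def lieSec (Y : ∀ u : TotalSpace C2 U, TotTan u) (ψ : ∀ x, U x) (x : M) : U x :=
  vproj (TotalSpace.mk' C2 x (0 : U x))
    (VectorField.mlieBracket (𝓘(ℝ, R4).prod 𝓘(ℝ, C2)) Y
      (fun u ↦ vlift u (ψ u.proj)) (TotalSpace.mk' C2 x (0 : U x)))

variable {e : Trivialization C2 (π C2 U)} [MemTrivializationAtlas e] {W W' : Set M}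
  {Y Y' : ∀ u : TotalSpace C2 U, TotTan u} {X X' : ∀ x : M, Tan x} {A A' : M → End2}
  {φ ψ : ∀ x, U x} {x : M}

/-- A vertical lift is constant on the fibres, hence affine, so that `Y.ψ` is a special case of the
bracket of affine fields. -/
lemma affRep_vert (hWe : W ⊆ e.baseSet) (hψ : SmoothOn C2 W ψ) :
    AffRep e W (fun u ↦ vlift u (ψ u.proj)) 0 0 (fun y ↦ fib e y (ψ y)) where
  smoothX := SmoothOn.zero
  smoothA := contMDiffOn_const
  smoothb := (contMDiffOn_fib hψ).mono fun _ h ↦ ⟨h, hWe h⟩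
  proj u _ := dproj_vlift _
  comp u hu := by
    rw [dfib_vlift (hWe hu)]
    simp

lemma dproj_lieSec (h : AffRep e W Y X A 0) (hW : IsOpen W) (hWe : W ⊆ e.baseSet)
    (hψ : SmoothOn C2 W ψ) (hx : x ∈ W) :
    dproj (VectorField.mlieBracket (𝓘(ℝ, R4).prod 𝓘(ℝ, C2)) Y
      (fun u ↦ vlift u (ψ u.proj)) (TotalSpace.mk' C2 x (0 : U x))) = 0 := by
  have h1 := h.bracket hW hWe (affRep_vert hWe hψ)
  rw [h1.proj _ hx, VectorField.mlieBracket_zero_right]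
  rfl

/-- Bracket of the affine fields `(X, A, 0)` and `(0, 0, ψ)`, whose constant part is what the zero
vector sees. -/
lemma fib_lieSec (h : AffRep e W Y X A 0) (hW : IsOpen W) (hWe : W ⊆ e.baseSet)
    (hψ : SmoothOn C2 W ψ) (hx : x ∈ W) :
    fib e x (lieSec Y ψ x) = dcoord e ψ x (X x) - A x (fib e x (ψ x)) := by
  have h1 := h.bracket hW hWe (affRep_vert hWe hψ)
  rw [lieSec, fib_vproj (u := TotalSpace.mk' C2 x (0 : U x)) (hWe hx) (dproj_lieSec h hW hWe hψ hx),
    h1.comp _ hx]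
  have h2 : (e (TotalSpace.mk' C2 x (0 : U x))).2 = 0 := fib_zero (hWe hx)
  simp only [h2, map_zero, zero_add, Pi.zero_apply, zero_sub, sub_zero]
  rw [sub_eq_add_neg]

open Classical in
/-- The matrix of a linear projectable field in a trivialization. -/
def fieldMat (e : Trivialization C2 (π C2 U)) (Y : ∀ u : TotalSpace C2 U, TotTan u) (x : M) : End2 :=
  LinearMap.toContinuousLinearMap
    (if h : ∃ A : C2 →ₗ[ℂ] C2, ∀ w : U x, dfib e (Y (TotalSpace.mk' C2 x w)) = A (fib e x w)
      then h.choose else 0)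

lemma fieldMat_spec {A : C2 →ₗ[ℂ] C2}
    (h : ∀ w : U x, dfib e (Y (TotalSpace.mk' C2 x w)) = A (fib e x w)) (w : U x) :
    dfib e (Y (TotalSpace.mk' C2 x w)) = fieldMat e Y x (fib e x w) := by
  have h' : ∃ A : C2 →ₗ[ℂ] C2, ∀ w : U x, dfib e (Y (TotalSpace.mk' C2 x w)) = A (fib e x w) :=
    ⟨A, h⟩
  rw [fieldMat, dif_pos h']
  exact h'.choose_spec w

lemma AffRep.fieldMat_eq (h : AffRep e W Y X A 0) (hx : x ∈ W) (hxe : x ∈ e.baseSet) :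
    fieldMat e Y x = A x := by
  ext1 z
  obtain ⟨w, rfl⟩ := exists_fib_eq hxe z
  have h1 : ∀ w : U x, dfib e (Y (TotalSpace.mk' C2 x w)) = (A x).toLinearMap (fib e x w) := by
    intro w
    rw [h.comp _ hx]
    simp
  rw [← fieldMat_spec h1 w, h1 w]
  rfl

/-- An endomorphism depends through a fixed linear map on its two columns, so smoothness of the
columns suffices. -/
lemma contMDiffOn_end (h : ∀ z, ContMDiffOn 𝓘(ℝ, R4) 𝓘(ℝ, C2) ∞ (fun x ↦ A x z) W) :
    ContMDiffOn 𝓘(ℝ, R4) 𝓘(ℝ, End2) ∞ A W := by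
  let T : Fin 2 → C2 →L[ℝ] End2 := fun i ↦
    (ContinuousLinearMap.smulRightL ℂ C2 C2 (EuclideanSpace.proj i)).restrictScalars ℝ
  have h1 : A = fun x ↦ T 0 (A x (EuclideanSpace.single 0 1)) + T 1 (A x (EuclideanSpace.single 1 1)) := by
    funext x
    ext1 z
    have hz : z = z 0 • EuclideanSpace.single 0 1 + z 1 • EuclideanSpace.single 1 1 := by
      ext i
      fin_cases i <;> simp
    conv_lhs => rw [hz]
    simp [T]
  rw [h1]
  exact ((T 0).contMDiff.comp_contMDiffOn (h _)).add ((T 1).contMDiff.comp_contMDiffOn (h _))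

/-- A Hermitian linear projectable field over `W`. -/
structure HermField (W : Set M) (Y : ∀ u : TotalSpace C2 U, TotTan u) (X : ∀ x : M, Tan x) :
    Prop where
  rep : ∀ (e : Trivialization C2 (π C2 U)) [MemTrivializationAtlas e],
    AffRep e (W ∩ e.baseSet) Y X (fieldMat e Y) 0
  herm : ∀ (W' : Set M) (φ ψ : ∀ x, U x), IsOpen W' → W' ⊆ W → SmoothOn C2 W' φ →
    SmoothOn C2 W' ψ → ∀ x ∈ W',
      mvfderiv 𝓘(ℝ, R4) (fun y ↦ inner ℂ (φ y) (ψ y)) x (X x)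
        = inner ℂ (lieSec Y φ x) (ψ x) + inner ℂ (φ x) (lieSec Y ψ x)

lemma AffRep.toFieldMat (h : AffRep e W Y X A 0) (hWe : W ⊆ e.baseSet) :
    AffRep e W Y X (fieldMat e Y) 0 where
  smoothX := h.smoothX
  smoothA := h.smoothA.congr fun x hx ↦ h.fieldMat_eq hx (hWe hx)
  smoothb := h.smoothb
  proj := h.proj
  comp u hu := by rw [h.comp u hu, h.fieldMat_eq hu (hWe hu)]

lemma smoothOn_symm (z : C2) : SmoothOn C2 e.baseSet (fun y ↦ e.symm y z) :=
  smoothOn_of_fib subset_rfl ((contMDiffOn_const (c := z)).congr fun _ hy ↦ fib_symm hy z)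

variable {O : TopologicalSpace.Opens M}

lemma extField_apply (Y : FieldOver U O) {u : TotalSpace C2 U} (hu : u.proj ∈ O) :
    extField Y u = Y ⟨u, hu⟩ := dif_pos (c := u ∈ overSet U O) hu

/-- Smoothness on the total space is traded for smoothness of the projection and of the matrix in
every trivialization. The columns of the matrix are found by evaluating `Y` along the sections with
constant coordinates. -/
lemma isHermitianOver_iff (hO : IsOpen (O : Set M)) {Y : FieldOver U O} :
    IsHermitianOver Y X ↔ HermField (O : Set M) (extField Y) X := by
  constructor
  · intro h
    refine ⟨fun e _ ↦ ?_, h.hermitian⟩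
    have hcomp : ∀ x (hx : x ∈ (O : Set M) ∩ e.baseSet) (w : U x),
        dfib e (extField Y (TotalSpace.mk' C2 x w)) = fieldMat e (extField Y) x (fib e x w) := by
      intro x hx w
      obtain ⟨A, hA⟩ := h.linear e MemTrivializationAtlas.out x hx.1 hx.2
      refine fieldMat_spec (A := A) (fun w ↦ ?_) w
      rw [extField_apply (u := TotalSpace.mk' C2 x w) Y hx.1]
      exact hA w
    refine ⟨h.smooth_base.mono inter_subset_left, contMDiffOn_end fun z ↦ ?_, contMDiffOn_const,
      fun u hu ↦ ?_, fun u hu ↦ ?_⟩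
    · have h1 := contMDiffOn_dfib (isOpen_over C2 U (hO.inter e.open_baseSet))
        (over_subset_source inter_subset_right)
        (ContMDiffOn.mono h.smooth fun u hu ↦ hu.1)
      have h2 := h1.comp (f := fun y ↦ TotalSpace.mk' C2 y (e.symm y z))
        ((smoothOn_symm (e := e) z).mono (inter_subset_right (s := (O : Set M)))) fun y hy ↦ hy
      refine h2.congr fun y hy ↦ ?_
      rw [Function.comp_apply, hcomp y hy, fib_symm hy.2]
    · rw [extField_apply Y hu.1]
      exact h.projectable ⟨u, hu.1⟩
    · rw [Pi.zero_apply, add_zero]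
      exact hcomp u.proj hu u.snd
  · intro h
    refine ⟨fun u hu ↦ ?_, smoothOn_of_forall fun x hx ↦ ?_, fun u ↦ ?_, fun e he x hx hxe ↦ ?_,
      h.herm⟩
    · have h1 := (h.rep (trivializationAt C2 U u.proj)).smooth inter_subset_right
      refine ContMDiffAt.contMDiffWithinAt (ContMDiffOn.contMDiffAt h1 ?_)
      exact (isOpen_over C2 U (hO.inter (Trivialization.open_baseSet _))).mem_nhds
        ⟨hu, mem_baseSet_extend u.proj⟩
    · exact ⟨_, hO.inter (Trivialization.open_baseSet _), ⟨hx, mem_baseSet_extend x⟩,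
        (h.rep (trivializationAt C2 U x)).smoothX⟩
    · have h1 := (h.rep (trivializationAt C2 U u.1.proj)).proj u.1 ⟨u.2, mem_baseSet_extend u.1.proj⟩
      rw [extField_apply Y u.2] at h1
      exact h1
    · haveI : MemTrivializationAtlas e := ⟨he⟩
      refine ⟨(fieldMat e (extField Y) x).toLinearMap, fun w ↦ ?_⟩
      have h1 := (h.rep e).comp (TotalSpace.mk' C2 x w) ⟨hx, hxe⟩
      rw [extField_apply (u := TotalSpace.mk' C2 x w) Y hx, Pi.zero_apply, add_zero] at h1
      exact h1

/-- A neighbourhood on which a linear field has an expression in a trivialization. -/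
lemma HermField.exists_rep (h : HermField W Y X) (hW : IsOpen W) (hx : x ∈ W) :
    ∃ (e : Trivialization C2 (π C2 U)) (_ : MemTrivializationAtlas e) (W₁ : Set M), IsOpen W₁ ∧
      x ∈ W₁ ∧ W₁ ⊆ W ∧ W₁ ⊆ e.baseSet ∧ AffRep e W₁ Y X (fieldMat e Y) 0 :=
  ⟨trivializationAt C2 U x, inferInstance, W ∩ (trivializationAt C2 U x).baseSet,
    hW.inter (Trivialization.open_baseSet _), ⟨hx, mem_baseSet_extend x⟩, inter_subset_left,
    inter_subset_right, h.rep _⟩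

lemma lieSec_congr (hW : IsOpen W) (hx : x ∈ W)
    (h : ∀ u : TotalSpace C2 U, u.proj ∈ W → Y u = Y' u) :
    lieSec Y ψ x = lieSec Y' ψ x := by
  have h1 : Y =ᶠ[𝓝 (TotalSpace.mk' C2 x (0 : U x))] Y' := by
    filter_upwards [(isOpen_over C2 U hW).mem_nhds hx] with u hu using h u hu
  exact congrArg (vproj _)
    (Filter.EventuallyEq.mlieBracket_vectorField_eq h1 (Filter.EventuallyEq.refl _ _))

lemma AffRep.congr (h : AffRep e W Y X A 0)
    (hY : ∀ u : TotalSpace C2 U, u.proj ∈ W → Y' u = Y u) : AffRep e W Y' X A 0 where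
  smoothX := h.smoothX
  smoothA := h.smoothA
  smoothb := h.smoothb
  proj u hu := by rw [hY u hu, h.proj u hu]
  comp u hu := by rw [hY u hu, h.comp u hu]

lemma HermField.congr (h : HermField W Y X) (hW : IsOpen W)
    (hY : ∀ u : TotalSpace C2 U, u.proj ∈ W → Y' u = Y u) : HermField W Y' X where
  rep e _ := ((h.rep e).congr fun u hu ↦ hY u hu.1).toFieldMat inter_subset_right
  herm W₁ φ ψ hW₁ hsub hφ hψ x hx := by
    rw [h.herm W₁ φ ψ hW₁ hsub hφ hψ x hx, lieSec_congr hW (hsub hx) hY,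
      lieSec_congr hW (hsub hx) hY]

lemma hermField_of_local (hloc : ∀ x ∈ W, ∃ W₁, IsOpen W₁ ∧ x ∈ W₁ ∧ W₁ ⊆ W ∧ HermField W₁ Y X) :
    HermField W Y X where
  rep e _ := by
    refine ⟨smoothOn_of_forall fun x hx ↦ ?_, fun x hx ↦ ?_, contMDiffOn_const, fun u hu ↦ ?_,
      fun u hu ↦ ?_⟩
    · obtain ⟨W₁, h1, h2, -, h3⟩ := hloc x hx.1
      exact ⟨_, h1.inter e.open_baseSet, ⟨h2, hx.2⟩, (h3.rep e).smoothX⟩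
    · obtain ⟨W₁, h1, h2, -, h3⟩ := hloc x hx.1
      exact ((h3.rep e).smoothA.contMDiffAt
        ((h1.inter e.open_baseSet).mem_nhds ⟨h2, hx.2⟩)).contMDiffWithinAt
    · obtain ⟨W₁, h1, h2, -, h3⟩ := hloc _ hu.1
      exact (h3.rep e).proj u ⟨h2, hu.2⟩
    · obtain ⟨W₁, h1, h2, -, h3⟩ := hloc _ hu.1
      exact (h3.rep e).comp u ⟨h2, hu.2⟩
  herm W' φ ψ hW' hsub hφ hψ x hx := by
    obtain ⟨W₁, h1, h2, -, h3⟩ := hloc x (hsub hx)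
    exact h3.herm (W' ∩ W₁) φ ψ (hW'.inter h1) inter_subset_right (hφ.mono inter_subset_left)
      (hψ.mono inter_subset_left) x ⟨hx, h2⟩

lemma HermField.add (h : HermField W Y X) (h' : HermField W Y' X') :
    HermField W (Y + Y') (X + X') := by
  have hr : ∀ (e : Trivialization C2 (π C2 U)) [MemTrivializationAtlas e],
      AffRep e (W ∩ e.baseSet) (Y + Y') (X + X') (fun x ↦ fieldMat e Y x + fieldMat e Y' x) 0 := by
    intro e _
    refine ⟨(h.rep e).smoothX.add (h'.rep e).smoothX, (h.rep e).smoothA.add (h'.rep e).smoothA,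
      contMDiffOn_const, fun u hu ↦ ?_, fun u hu ↦ ?_⟩
    · rw [Pi.add_apply, dproj_add, (h.rep e).proj u hu, (h'.rep e).proj u hu, Pi.add_apply]
    · rw [Pi.add_apply, dfib_add, (h.rep e).comp u hu, (h'.rep e).comp u hu]
      simp
  refine ⟨fun e _ ↦ (hr e).toFieldMat inter_subset_right, fun W₁ φ ψ hW₁ hsub hφ hψ x hx ↦ ?_⟩
  have hl : ∀ {ψ : ∀ x, U x}, SmoothOn C2 W₁ ψ →
      lieSec (Y + Y') ψ x = lieSec Y ψ x + lieSec Y' ψ x := by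
    intro ψ hψ
    set e := trivializationAt C2 U x
    have hxe : x ∈ W₁ ∩ e.baseSet := ⟨hx, mem_baseSet_extend x⟩
    have ho := hW₁.inter e.open_baseSet
    have hs : W₁ ∩ e.baseSet ⊆ W ∩ e.baseSet := inter_subset_inter_left _ hsub
    have hψ' := hψ.mono (inter_subset_left (t := e.baseSet))
    refine fib_injective hxe.2 ?_
    rw [fib_add hxe.2, fib_lieSec ((hr e).mono hs) ho inter_subset_right hψ' hxe,
      fib_lieSec ((h.rep e).mono hs) ho inter_subset_right hψ' hxe,
      fib_lieSec ((h'.rep e).mono hs) ho inter_subset_right hψ' hxe, Pi.add_apply, dcoord, map_add]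
    simp only [add_apply]
    abel
  have h1 := h.herm W₁ φ ψ hW₁ hsub hφ hψ x hx
  have h2 := h'.herm W₁ φ ψ hW₁ hsub hφ hψ x hx
  rw [Pi.add_apply, map_add, h1, h2, hl hφ, hl hψ, inner_add_left, inner_add_right]
  abel

lemma HermField.smul (h : HermField W Y X) (c : ℝ) : HermField W (c • Y) (c • X) := by
  have hr : ∀ (e : Trivialization C2 (π C2 U)) [MemTrivializationAtlas e],
      AffRep e (W ∩ e.baseSet) (c • Y) (c • X) (fun x ↦ c • fieldMat e Y x) 0 := by
    intro e _
    refine ⟨(h.rep e).smoothX.smul (f := fun _ ↦ c) contMDiffOn_const,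
      (c • ContinuousLinearMap.id ℝ End2).contMDiff.comp_contMDiffOn (h.rep e).smoothA,
      contMDiffOn_const, fun u hu ↦ ?_, fun u hu ↦ ?_⟩
    · rw [Pi.smul_apply, dproj_smul, (h.rep e).proj u hu, Pi.smul_apply]
    · rw [Pi.smul_apply, dfib_smul, (h.rep e).comp u hu]
      simp
  refine ⟨fun e _ ↦ (hr e).toFieldMat inter_subset_right, fun W₁ φ ψ hW₁ hsub hφ hψ x hx ↦ ?_⟩
  have hl : ∀ {ψ : ∀ x, U x}, SmoothOn C2 W₁ ψ → lieSec (c • Y) ψ x = c • lieSec Y ψ x := by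
    intro ψ hψ
    set e := trivializationAt C2 U x
    have hxe : x ∈ W₁ ∩ e.baseSet := ⟨hx, mem_baseSet_extend x⟩
    have ho := hW₁.inter e.open_baseSet
    have hs : W₁ ∩ e.baseSet ⊆ W ∩ e.baseSet := inter_subset_inter_left _ hsub
    have hψ' := hψ.mono (inter_subset_left (t := e.baseSet))
    refine fib_injective hxe.2 ?_
    rw [fib_smul hxe.2, fib_lieSec ((hr e).mono hs) ho inter_subset_right hψ' hxe,
      fib_lieSec ((h.rep e).mono hs) ho inter_subset_right hψ' hxe, Pi.smul_apply, dcoord, map_smul,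
      smul_sub]
    rfl
  have h1 := h.herm W₁ φ ψ hW₁ hsub hφ hψ x hx
  rw [Pi.smul_apply, map_smul, h1, hl hφ, hl hψ, inner_smul_left_eq_smul, inner_smul_right_eq_smul,
    smul_add]

lemma HermField.zero : HermField W (0 : ∀ u : TotalSpace C2 U, TotTan u) 0 := by
  have hr : ∀ (e : Trivialization C2 (π C2 U)) [MemTrivializationAtlas e],
      AffRep e (W ∩ e.baseSet) (0 : ∀ u : TotalSpace C2 U, TotTan u) 0 0 0 := fun e _ ↦
    ⟨SmoothOn.zero, contMDiffOn_const, contMDiffOn_const, fun u _ ↦ dproj_zero,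
      fun u _ ↦ by simp [dfib_zero]⟩
  refine ⟨fun e _ ↦ (hr e).toFieldMat inter_subset_right, fun W₁ φ ψ hW₁ hsub hφ hψ x hx ↦ ?_⟩
  have hl : ∀ {ψ : ∀ x, U x}, lieSec (0 : ∀ u : TotalSpace C2 U, TotTan u) ψ x = 0 := by
    intro ψ
    rw [lieSec, VectorField.mlieBracket_zero_left]
    refine vlift_injective (u := TotalSpace.mk' C2 x (0 : U x)) ?_
    rw [Pi.zero_apply, vlift_vproj dproj_zero]
    have := vlift_smul (u := TotalSpace.mk' C2 x (0 : U x)) 0 (0 : U x)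
    simpa using this.symm
  rw [hl, hl, Pi.zero_apply, map_zero, inner_zero_left, inner_zero_right, add_zero]

lemma HermField.smoothOn_lieSec (h : HermField W Y X) (hW' : IsOpen W') (hsub : W' ⊆ W)
    (hψ : SmoothOn C2 W' ψ) : SmoothOn C2 W' (lieSec Y ψ) := by
  refine smoothOn_of_forall fun x hx ↦ ?_
  set e := trivializationAt C2 U x
  have ho := hW'.inter e.open_baseSet
  have hr := (h.rep e).mono (inter_subset_inter_left _ hsub)
  have hψ' := hψ.mono (inter_subset_left (t := e.baseSet))
  have hf : ContMDiffOn 𝓘(ℝ, R4) 𝓘(ℝ, C2) ∞ (fun y ↦ fib e y (ψ y)) (W' ∩ e.baseSet) :=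
    contMDiffOn_fib hψ
  refine ⟨W' ∩ e.baseSet, ho, ⟨hx, mem_baseSet_extend x⟩, smoothOn_of_fib inter_subset_right ?_⟩
  refine ((contMDiffOn_dfun ho hf hr.smoothX).sub (contMDiffOn_bilin applyR hr.smoothA hf)).congr
    fun y hy ↦ ?_
  exact fib_lieSec hr ho inter_subset_right hψ' hy

/-- The Lie derivative of sections is a representation. In coordinates it is the operator `X - A`;
the second derivatives in the commutator of two such operators give `[X, X']`, and the remaining
terms are the matrix of the bracket of affine fields. -/
lemma HermField.lieSec_bracket (h : HermField W Y X) (h' : HermField W Y' X') (hW' : IsOpen W')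
    (hsub : W' ⊆ W) (hψ : SmoothOn C2 W' ψ) (hx : x ∈ W') :
    lieSec (VectorField.mlieBracket (𝓘(ℝ, R4).prod 𝓘(ℝ, C2)) Y Y') ψ x
      = lieSec Y (lieSec Y' ψ) x - lieSec Y' (lieSec Y ψ) x := by
  set e := trivializationAt C2 U x
  have ho := hW'.inter e.open_baseSet
  have hxe : x ∈ W' ∩ e.baseSet := ⟨hx, mem_baseSet_extend x⟩
  have hr := (h.rep e).mono (inter_subset_inter_left _ hsub)
  have hr' := (h'.rep e).mono (inter_subset_inter_left _ hsub)
  have hψ' := hψ.mono (inter_subset_left (t := e.baseSet))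
  have hf : ContMDiffOn 𝓘(ℝ, R4) 𝓘(ℝ, C2) ∞ (fun y ↦ fib e y (ψ y)) (W' ∩ e.baseSet) :=
    contMDiffOn_fib hψ
  have key : ∀ {Y Y' : ∀ u : TotalSpace C2 U, TotTan u} {X X' : ∀ x : M, Tan x},
      HermField W Y X → AffRep e (W' ∩ e.baseSet) Y X (fieldMat e Y) 0 → HermField W Y' X' →
      AffRep e (W' ∩ e.baseSet) Y' X' (fieldMat e Y') 0 →
      fib e x (lieSec Y (lieSec Y' ψ) x) =
        mvfderiv 𝓘(ℝ, R4) (fun y ↦ mvfderiv 𝓘(ℝ, R4) (fun y ↦ fib e y (ψ y)) y (X' y)) x (X x)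
        - ((show End2 from mvfderiv 𝓘(ℝ, R4) (fieldMat e Y') x (X x)) (fib e x (ψ x))
          + fieldMat e Y' x (dcoord e ψ x (X x)))
        - fieldMat e Y x (dcoord e ψ x (X' x) - fieldMat e Y' x (fib e x (ψ x))) := by
    intro Y Y' X X' h hr h' hr'
    rw [fib_lieSec hr ho inter_subset_right ((h'.smoothOn_lieSec hW' hsub hψ).mono inter_subset_left) hxe,
      fib_lieSec hr' ho inter_subset_right hψ' hxe]
    congr 1
    have h1 : (fun y ↦ fib e y (lieSec Y' ψ y)) =ᶠ[𝓝 x]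
        (fun y ↦ mvfderiv 𝓘(ℝ, R4) (fun y ↦ fib e y (ψ y)) y (X' y))
          - fun y ↦ applyR (fieldMat e Y' y) (fib e y (ψ y)) := by
      filter_upwards [ho.mem_nhds hxe] with y hy using fib_lieSec hr' ho inter_subset_right hψ' hy
    rw [dcoord, mvfderiv_congr_apply h1, mvfderiv_sub
      (mdiffAt_of_smoothOn ho (contMDiffOn_dfun ho hf hr'.smoothX) hxe)
      (mdiffAt_of_smoothOn ho (contMDiffOn_bilin applyR hr'.smoothA hf) hxe)]
    have h2 := mvfderiv_bilin applyR (mdiffAt_of_smoothOn ho hr'.smoothA hxe)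
      (mdiffAt_of_smoothOn ho hf hxe) (X x)
    exact congrArg (_ - ·) h2
  have hb := hr.bracket ho inter_subset_right hr'
  have hb0 : AffRep e (W' ∩ e.baseSet) (VectorField.mlieBracket (𝓘(ℝ, R4).prod 𝓘(ℝ, C2)) Y Y')
      (VectorField.mlieBracket 𝓘(ℝ, R4) X X')
      (fun x ↦ mvfderiv 𝓘(ℝ, R4) (fieldMat e Y') x (X x) - mvfderiv 𝓘(ℝ, R4) (fieldMat e Y) x (X' x)
        + (fieldMat e Y' x ∘L fieldMat e Y x - fieldMat e Y x ∘L fieldMat e Y' x)) 0 := by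
    refine ⟨hb.smoothX, hb.smoothA, contMDiffOn_const, hb.proj, fun u hu ↦ ?_⟩
    rw [hb.comp u hu]
    have h0 : ∀ v : Tan u.proj, mvfderiv 𝓘(ℝ, R4) (0 : M → C2) u.proj v = 0 := fun v ↦ by
      rw [mvfderiv_zero]
      rfl
    simp only [h0, Pi.zero_apply, map_zero, sub_zero, add_zero]
  refine fib_injective hxe.2 ?_
  rw [fib_sub hxe.2, key h hr h' hr', key h' hr' h hr, fib_lieSec hb0 ho inter_subset_right hψ' hxe]
  have h3 := mvfderiv_mlieBracket ho hxe hf hr.smoothX hr'.smoothX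
  rw [dcoord, h3]
  simp only [add_apply, sub_apply, ContinuousLinearMap.comp_apply, map_sub]
  abel

/-- Differentiate `h(φ, ψ)` along `X'` and then along `X`. In the commutator the mixed terms
`h(Y'.φ, Y.ψ)` and `h(Y.φ, Y'.ψ)` cancel, and `lieSec_bracket` identifies the others. -/
lemma HermField.bracket (hU : SmoothHermitian C2 U) (h : HermField W Y X) (h' : HermField W Y' X')
    (hW : IsOpen W) :
    HermField W (VectorField.mlieBracket (𝓘(ℝ, R4).prod 𝓘(ℝ, C2)) Y Y')
      (VectorField.mlieBracket 𝓘(ℝ, R4) X X') := by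
  refine ⟨fun e _ ↦ ?_, fun W₁ φ ψ hW₁ hsub hφ hψ x hx ↦ ?_⟩
  · have hb := (h.rep e).bracket (hW.inter e.open_baseSet) inter_subset_right (h'.rep e)
    refine AffRep.toFieldMat (A := _) ⟨hb.smoothX, hb.smoothA, contMDiffOn_const, hb.proj, fun u hu ↦ ?_⟩
      inter_subset_right
    rw [hb.comp u hu]
    have h0 : ∀ v : Tan u.proj, mvfderiv 𝓘(ℝ, R4) (0 : M → C2) u.proj v = 0 := fun v ↦ by
      rw [mvfderiv_zero]
      rfl
    simp only [h0, Pi.zero_apply, map_zero, sub_zero, add_zero]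
  · have hs : ∀ {Y : ∀ u : TotalSpace C2 U, TotTan u} {X : ∀ x : M, Tan x}, HermField W Y X →
        SmoothOn R4 W₁ X := fun h ↦ smoothOn_of_forall fun x hx ↦
      ⟨_, hW₁.inter (Trivialization.open_baseSet _), ⟨hx, mem_baseSet_extend x⟩,
        (h.rep (trivializationAt C2 U x)).smoothX.mono (inter_subset_inter_left _ hsub)⟩
    have key : ∀ {Y Y' : ∀ u : TotalSpace C2 U, TotTan u} {X X' : ∀ x : M, Tan x},
        HermField W Y X → HermField W Y' X' →
        mvfderiv 𝓘(ℝ, R4) (fun y ↦ mvfderiv 𝓘(ℝ, R4) (fun y ↦ inner ℂ (φ y) (ψ y)) y (X' y)) x (X x)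
          = (inner ℂ (lieSec Y (lieSec Y' φ) x) (ψ x) + inner ℂ (lieSec Y' φ x) (lieSec Y ψ x))
            + (inner ℂ (lieSec Y φ x) (lieSec Y' ψ x)
              + inner ℂ (φ x) (lieSec Y (lieSec Y' ψ) x)) := by
      intro Y Y' X X' h h'
      have e1 := h'.smoothOn_lieSec hW₁ hsub hφ
      have e2 := h'.smoothOn_lieSec hW₁ hsub hψ
      have h1 : (fun y ↦ mvfderiv 𝓘(ℝ, R4) (fun y ↦ inner ℂ (φ y) (ψ y)) y (X' y)) =ᶠ[𝓝 x]
          (fun y ↦ inner ℂ (lieSec Y' φ y) (ψ y)) + fun y ↦ inner ℂ (φ y) (lieSec Y' ψ y) := by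
        filter_upwards [hW₁.mem_nhds hx] with y hy using h'.herm W₁ φ ψ hW₁ hsub hφ hψ y hy
      rw [mvfderiv_congr_apply h1, mvfderiv_add
        (mdiffAt_of_smoothOn hW₁ (hU W₁ _ _ hW₁ e1 hψ) hx)
        (mdiffAt_of_smoothOn hW₁ (hU W₁ _ _ hW₁ hφ e2) hx)]
      exact congrArg₂ (· + ·) (h.herm W₁ _ _ hW₁ hsub e1 hψ x hx)
        (h.herm W₁ _ _ hW₁ hsub hφ e2 x hx)
    have h3 := mvfderiv_mlieBracket hW₁ hx (hU W₁ _ _ hW₁ hφ hψ) (hs h) (hs h')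
    refine h3.trans ?_
    rw [key h h', key h' h, h.lieSec_bracket h' hW₁ hsub hφ hx,
      h.lieSec_bracket h' hW₁ hsub hψ hx, inner_sub_left, inner_sub_right]
    abel

lemma HermField.smooth (h : HermField W Y X) (hW : IsOpen W) :
    FieldSmoothOn (𝓘(ℝ, R4).prod 𝓘(ℝ, C2)) {u : TotalSpace C2 U | u.proj ∈ W} Y := by
  intro u hu
  obtain ⟨e, _, W₁, h1, h2, -, h3, h4⟩ := h.exists_rep hW hu
  exact ((h4.smooth h3).contMDiffAt ((isOpen_over C2 U h1).mem_nhds h2)).contMDiffWithinAt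

lemma HermField.proj (h : HermField W Y X) {u : TotalSpace C2 U} (hu : u.proj ∈ W) :
    dproj (Y u) = X u.proj :=
  (h.rep (trivializationAt C2 U u.proj)).proj u ⟨hu, mem_baseSet_extend u.proj⟩

lemma HermField.congr_base (h : HermField W Y X) (hX : ∀ x ∈ W, X' x = X x) : HermField W Y X' where
  rep e _ :=
    { smoothX := (h.rep e).smoothX.congr fun x hx ↦ hX x hx.1
      smoothA := (h.rep e).smoothA
      smoothb := (h.rep e).smoothb
      proj := fun u hu ↦ by rw [(h.rep e).proj u hu, hX _ hu.1]
      comp := (h.rep e).comp }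
  herm W₁ φ ψ hW₁ hsub hφ hψ x hx := by
    rw [hX x (hsub hx)]
    exact h.herm W₁ φ ψ hW₁ hsub hφ hψ x hx

lemma mem_hermFields_iff {Y : FieldOver U O} :
    Y ∈ hermFields U O ↔ ∃ X, HermField (O : Set M) (extField Y) X :=
  exists_congr fun _ ↦ isHermitianOver_iff O.isOpen

lemma extField_add (Y Y' : FieldOver U O) : extField (Y + Y') = extField Y + extField Y' := by
  funext u
  by_cases hu : u.proj ∈ O
  · rw [Pi.add_apply, extField_apply _ hu, extField_apply _ hu, extField_apply _ hu, Pi.add_apply]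
  · have h0 : ∀ Y : FieldOver U O, extField Y u = 0 := fun Y ↦ dif_neg (c := u ∈ overSet U O) hu
    rw [Pi.add_apply, h0, h0, h0, add_zero]

lemma extField_smul (c : ℝ) (Y : FieldOver U O) : extField (c • Y) = c • extField Y := by
  funext u
  by_cases hu : u.proj ∈ O
  · rw [Pi.smul_apply, extField_apply _ hu, extField_apply _ hu, Pi.smul_apply]
  · have h0 : ∀ Y : FieldOver U O, extField Y u = 0 := fun Y ↦ dif_neg (c := u ∈ overSet U O) hu
    rw [Pi.smul_apply, h0, h0, smul_zero]

lemma extField_lieField (Y Y' : FieldOver U O) {u : TotalSpace C2 U} (hu : u.proj ∈ O) :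
    extField (lieField Y Y') u
      = VectorField.mlieBracket (𝓘(ℝ, R4).prod 𝓘(ℝ, C2)) (extField Y) (extField Y') u :=
  extField_apply _ hu

lemma extField_lieField_eventuallyEq (Y Y' : FieldOver U O) {u : TotalSpace C2 U}
    (hu : u.proj ∈ O) : extField (lieField Y Y') =ᶠ[𝓝 u]
      VectorField.mlieBracket (𝓘(ℝ, R4).prod 𝓘(ℝ, C2)) (extField Y) (extField Y') := by
  filter_upwards [(isOpen_over C2 U O.isOpen).mem_nhds hu] with w hw using extField_lieField Y Y' hw

lemma extField_resField {O' : TopologicalSpace.Opens M} (h : O' ≤ O) (Y : FieldOver U O)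
    {u : TotalSpace C2 U} (hu : u.proj ∈ O') : extField (resField h Y) u = extField Y u := by
  rw [extField_apply _ hu, extField_apply Y (h hu)]
  rfl

lemma lieField_mem (hU : SmoothHermitian C2 U) {Y Y' : FieldOver U O} (h : Y ∈ hermFields U O)
    (h' : Y' ∈ hermFields U O) : lieField Y Y' ∈ hermFields U O := by
  obtain ⟨X, h⟩ := mem_hermFields_iff.1 h
  obtain ⟨X', h'⟩ := mem_hermFields_iff.1 h'
  exact mem_hermFields_iff.2 ⟨_, (h.bracket hU h' O.isOpen).congr O.isOpen
    fun u hu ↦ extField_lieField Y Y' hu⟩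

lemma mdifferentiableAt_of_mem_hermFields {Y : FieldOver U O} (h : Y ∈ hermFields U O)
    {u : TotalSpace C2 U} (hu : u.proj ∈ O) :
    MDifferentiableAt (𝓘(ℝ, R4).prod 𝓘(ℝ, C2)) (𝓘(ℝ, R4).prod 𝓘(ℝ, C2)).tangent
      (fun u ↦ (⟨u, extField Y u⟩ : TangentBundle (𝓘(ℝ, R4).prod 𝓘(ℝ, C2)) (TotalSpace C2 U))) u := by
  obtain ⟨X, h⟩ := mem_hermFields_iff.1 h
  exact (h.smooth O.isOpen).mdifferentiableAt (isOpen_over C2 U O.isOpen) hu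

lemma isLieAlgebraOn_hermFields (hU : SmoothHermitian C2 U) (O : TopologicalSpace.Opens M) :
    IsLieAlgebraOn (hermFields U O) (fun Y Y' ↦ lieField Y Y') where
  zero_mem := by
    refine mem_hermFields_iff.2 ⟨0, HermField.zero.congr O.isOpen fun u hu ↦ ?_⟩
    rw [extField_apply _ hu]
    rfl
  add_mem Y h Y' h' := by
    obtain ⟨X, h⟩ := mem_hermFields_iff.1 h
    obtain ⟨X', h'⟩ := mem_hermFields_iff.1 h'
    exact mem_hermFields_iff.2 ⟨X + X', by rw [extField_add]; exact h.add h'⟩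
  smul_mem c Y h := by
    obtain ⟨X, h⟩ := mem_hermFields_iff.1 h
    exact mem_hermFields_iff.2 ⟨c • X, by rw [extField_smul]; exact h.smul c⟩
  br_mem Y h Y' h' := lieField_mem hU h h'
  add_br Y h Y' h' Z hZ := by
    funext u
    change VectorField.mlieBracket _ _ _ _ = _
    rw [extField_add, VectorField.mlieBracket_add_left (mdifferentiableAt_of_mem_hermFields h u.2)
      (mdifferentiableAt_of_mem_hermFields h' u.2)]
    rfl
  smul_br c Y h Y' h' := by
    funext u
    change VectorField.mlieBracket _ _ _ _ = _
    rw [extField_smul, VectorField.mlieBracket_const_smul_left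
      (mdifferentiableAt_of_mem_hermFields h u.2)]
    rfl
  br_self Y h := by
    funext u
    change VectorField.mlieBracket _ _ _ _ = _
    rw [VectorField.mlieBracket_self]
    rfl
  jacobi Y h Y' h' Z hZ := by
    funext u
    have hs : ∀ {Y : FieldOver U O}, Y ∈ hermFields U O →
        ContMDiffAt (𝓘(ℝ, R4).prod 𝓘(ℝ, C2)) (𝓘(ℝ, R4).prod 𝓘(ℝ, C2)).tangent (minSmoothness ℝ 2)
        (fun u ↦ (⟨u, extField Y u⟩ : TangentBundle (𝓘(ℝ, R4).prod 𝓘(ℝ, C2)) (TotalSpace C2 U)))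
        u.1 := by
      intro Y h
      obtain ⟨X, h⟩ := mem_hermFields_iff.1 h
      have h1 := ContMDiffOn.contMDiffAt (h.smooth O.isOpen) ((isOpen_over C2 U O.isOpen).mem_nhds u.2)
      refine h1.of_le ?_
      simp only [minSmoothness_of_isRCLikeNormedField]
      exact ENat.LEInfty.out
    haveI : IsManifold (𝓘(ℝ, R4).prod 𝓘(ℝ, C2)) (minSmoothness ℝ 3) (TotalSpace C2 U) := by
      simp only [minSmoothness_of_isRCLikeNormedField]
      infer_instance
    -- The Jacobi identity in the form `[Y, [Y', Z]] = [[Y, Y'], Z] + [Y', [Y, Z]]`; antisymmetry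
    -- makes it cyclic.
    have h1 := VectorField.leibniz_identity_mlieBracket_apply (hs h) (hs h') (hs hZ)
    have h2 : ∀ Y Y' Z : FieldOver U O, lieField Y (lieField Y' Z) u
        = VectorField.mlieBracket (𝓘(ℝ, R4).prod 𝓘(ℝ, C2)) (extField Y)
          (VectorField.mlieBracket (𝓘(ℝ, R4).prod 𝓘(ℝ, C2)) (extField Y') (extField Z)) u.1 :=
      fun Y Y' Z ↦ Filter.EventuallyEq.mlieBracket_vectorField_eq (Filter.EventuallyEq.refl _ _)
        (extField_lieField_eventuallyEq Y' Z u.2)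
    have h3 : lieField Y' (lieField Z Y) u = - VectorField.mlieBracket (𝓘(ℝ, R4).prod 𝓘(ℝ, C2))
        (extField Y') (VectorField.mlieBracket (𝓘(ℝ, R4).prod 𝓘(ℝ, C2)) (extField Y) (extField Z))
        u.1 := by
      rw [h2, VectorField.mlieBracket_swap (V := extField Z), ← neg_one_smul ℝ,
        VectorField.mlieBracket_const_smul_right, neg_one_smul]
      obtain ⟨X, h⟩ := mem_hermFields_iff.1 h
      obtain ⟨X', hZ⟩ := mem_hermFields_iff.1 hZ
      have hO := isOpen_over C2 U O.isOpen
      exact ((h.smooth O.isOpen).mlieBracket hO (hZ.smooth O.isOpen)).mdifferentiableAt hO u.2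
    change lieField Y (lieField Y' Z) u + lieField Y' (lieField Z Y) u + lieField Z (lieField Y Y') u = 0
    rw [h3, h2, h2, h1, VectorField.mlieBracket_swap_apply (V := extField Z)]
    abel

lemma resField_lieField {O' : TopologicalSpace.Opens M} (h : O' ≤ O) (Y Y' : FieldOver U O) :
    resField h (lieField Y Y') = lieField (resField h Y) (resField h Y') := by
  funext u
  have h1 : ∀ Y : FieldOver U O, extField Y =ᶠ[𝓝 u.1] extField (resField h Y) := fun Y ↦ by
    filter_upwards [(isOpen_over C2 U O'.isOpen).mem_nhds u.2] with w hw
    exact (extField_resField h Y hw).symm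
  exact Filter.EventuallyEq.mlieBracket_vectorField_eq (h1 Y) (h1 Y')

open Classical in
lemma isLieSheaf_hermFields (hU : SmoothHermitian C2 U) :
    IsLieSheaf (A := fun V : TopologicalSpace.Opens M ↦ FieldOver U V) resField
      (fun V ↦ hermFields U V) (fun _ Y Y' ↦ lieField Y Y') where
  lie := isLieAlgebraOn_hermFields hU
  res_br h Y _ Y' _ := resField_lieField h Y Y'
  mem_iff O Y := by
    refine ⟨fun h x hx ↦ ⟨O, le_rfl, hx, h⟩, fun h ↦ ?_⟩
    -- The projections given on the small open sets glue, because each of them is the projection of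
    -- `Y` itself, read at the zero vectors.
    let X : ∀ x : M, Tan x := fun x ↦ if hx : x ∈ O then projField Y ⟨x, hx⟩ else 0
    refine mem_hermFields_iff.2 ⟨X, hermField_of_local fun x hx ↦ ?_⟩
    obtain ⟨W, hW, hxW, hm⟩ := h x hx
    obtain ⟨X', hX'⟩ := mem_hermFields_iff.1 hm
    have h1 : HermField (W : Set M) (extField Y) X' :=
      hX'.congr W.isOpen fun u hu ↦ (extField_resField hW Y hu).symm
    refine ⟨W, W.isOpen, hxW, hW, h1.congr_base fun y hy ↦ ?_⟩
    rw [← h1.proj (u := TotalSpace.mk' C2 y (0 : U y)) hy,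
      extField_apply (u := TotalSpace.mk' C2 y (0 : U y)) Y (hW hy)]
    exact dif_pos (hW hy)

end HermFields

/-! ### Spacelike algebra -/

section SpacelikeAlgebra

variable {M : Type*} [TopologicalSpace M] [ChartedSpace R4 M] [IsManifold 𝓘(ℝ, R4) ∞ M]

namespace Spacetime

variable (S : Spacetime M)

instance finiteDimensional_tan (x : M) : FiniteDimensional ℝ (Tan x) :=
  inferInstanceAs (FiniteDimensional ℝ R4)

lemma finrank_VE (x : M) : Module.finrank ℝ (S.VE x) = 3 := by
  have h1 : Function.Surjective (S.dt x).toLinearMap := by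
    refine LinearMap.surjective ?_
    intro h
    exact S.t_submersion x (ContinuousLinearMap.coe_injective h)
  have h2 := LinearMap.finrank_range_add_finrank_ker (S.dt x).toLinearMap
  rw [LinearMap.range_eq_top.2 h1, finrank_top, Module.finrank_self] at h2
  have h3 : Module.finrank ℝ (Tan x) = 4 := by
    have : Module.finrank ℝ R4 = 4 := by simp
    exact this
  rw [h3] at h2
  change Module.finrank ℝ (LinearMap.ker (S.dt x).toLinearMap) = 3
  omega

/-- A positively oriented orthonormal basis of `VE`. -/
structure OrientedFrame (x : M) where
  b : Module.Basis (Fin 3) ℝ (S.VE x)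
  ortho : ∀ i j, S.g x (b i) (b j) = if i = j then 1 else 0
  orient : S.vol x b = 1

/-- Normalize an orthogonal basis. By `vol_sq` its volume is `±1`, and in dimension three changing
the sign of all the vectors corrects the orientation. -/
lemma exists_orientedFrame (x : M) : Nonempty (S.OrientedFrame x) := by
  obtain ⟨v, hv⟩ := LinearMap.BilinForm.exists_orthogonal_basis (B := S.g x) ⟨fun u w ↦ S.g_symm x u w⟩
  let v' : Module.Basis (Fin 3) ℝ (S.VE x) := v.reindex (finCongr (S.finrank_VE x))
  have hv' : ∀ i j, i ≠ j → S.g x (v' i) (v' j) = 0 := by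
    intro i j hij
    simp only [v', Module.Basis.reindex_apply]
    exact hv (by simpa using hij)
  have hpos : ∀ i, 0 < S.g x (v' i) (v' i) := fun i ↦ S.g_pos x _ (v'.ne_zero i)
  let w : Module.Basis (Fin 3) ℝ (S.VE x) := v'.isUnitSMul
    (w := fun i ↦ (Real.sqrt (S.g x (v' i) (v' i)))⁻¹)
    (fun i ↦ (inv_ne_zero (Real.sqrt_pos.2 (hpos i)).ne').isUnit)
  have hw : ∀ i j, S.g x (w i) (w j) = if i = j then 1 else 0 := by
    intro i j
    simp only [w, Module.Basis.isUnitSMul_apply, map_smul, LinearMap.smul_apply, smul_eq_mul]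
    split_ifs with h
    · subst h
      have h1 := Real.mul_self_sqrt (hpos i).le
      have h2 := (Real.sqrt_pos.2 (hpos i)).ne'
      field_simp
      nlinarith
    · rw [hv' i j h]
      simp
  have hvol : S.vol x w ^ 2 = 1 := by
    rw [S.vol_sq]
    have : (Matrix.of fun i j ↦ S.g x (w i) (w j)) = 1 := by
      ext i j
      rw [Matrix.of_apply, hw, Matrix.one_apply]
    rw [this, Matrix.det_one]
  rcases mul_self_eq_one_iff.1 (sq (S.vol x w) ▸ hvol) with h | h
  · exact ⟨⟨w, hw, h⟩⟩
  · let c : Fin 3 → ℝ := fun _ ↦ -1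
    let w' : Module.Basis (Fin 3) ℝ (S.VE x) := w.isUnitSMul (w := c)
      (fun i ↦ (by norm_num : (-1 : ℝ) ≠ 0).isUnit)
    refine ⟨⟨w', fun i j ↦ ?_, ?_⟩⟩
    · simp only [w', Module.Basis.isUnitSMul_apply, map_smul, LinearMap.smul_apply, smul_eq_mul, c]
      rw [hw]
      ring
    · have h1 : (w' : Fin 3 → S.VE x) = fun i ↦ c i • w i := by
        funext i
        simp [w', Module.Basis.isUnitSMul_apply]
      rw [h1, (S.vol x).map_smul_univ, h]
      norm_num [c]

variable {S} {x : M}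

lemma g_ext {u u' : S.VE x} (h : ∀ w, S.g x u w = S.g x u' w) : u = u' := by
  by_contra hne
  have h1 := S.g_pos x (u - u') (sub_ne_zero.2 hne)
  rw [map_sub (S.g x), LinearMap.sub_apply, h, sub_self] at h1
  exact lt_irrefl _ h1

lemma OrientedFrame.repr_eq (e : S.OrientedFrame x) (u : S.VE x) (i : Fin 3) :
    e.b.repr u i = S.g x (e.b i) u := by
  conv_rhs => rw [← e.b.sum_repr u]
  simp only [map_sum, map_smul, smul_eq_mul, e.ortho]
  simp

lemma OrientedFrame.sum_eq (e : S.OrientedFrame x) (u : S.VE x) :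
    u = ∑ i, S.g x (e.b i) u • e.b i := by
  conv_lhs => rw [← e.b.sum_repr u]
  exact Finset.sum_congr rfl fun i _ ↦ by rw [e.repr_eq]

lemma sharp_spec (α : Module.Dual ℝ (S.VE x)) (w : S.VE x) : S.g x (S.sharp x α) w = α w := by
  obtain ⟨e⟩ := S.exists_orientedFrame x
  have h : ∃ u : S.VE x, ∀ w, S.g x u w = α w := by
    refine ⟨∑ i, α (e.b i) • e.b i, fun w ↦ ?_⟩
    conv_rhs => rw [e.sum_eq w]
    simp only [map_sum, LinearMap.sum_apply, map_smul, LinearMap.smul_apply, smul_eq_mul]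
    exact Finset.sum_congr rfl fun i _ ↦ mul_comm _ _
  rw [sharp, dif_pos h]
  exact h.choose_spec w

lemma eq_sharp {u : S.VE x} {α : Module.Dual ℝ (S.VE x)} (h : ∀ w, S.g x u w = α w) :
    u = S.sharp x α := g_ext fun w ↦ by rw [h, sharp_spec]

lemma g_cross (u u' w : S.VE x) : S.g x (S.cross x u u') w = S.vol x ![u, u', w] :=
  sharp_spec _ w

lemma vol_swap (u u' w : S.VE x) : S.vol x ![u', u, w] = - S.vol x ![u, u', w] := by
  have h := (S.vol x).map_swap ![u, u', w] (i := 0) (j := 1) (by decide)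
  rw [← h]
  congr 1
  ext1 i
  fin_cases i <;> rfl

lemma vol_cycle (u u' w : S.VE x) : S.vol x ![u', w, u] = S.vol x ![u, u', w] := by
  have h := (S.vol x).map_swap ![u', u, w] (i := 1) (j := 2) (by decide)
  rw [vol_swap u u' w, neg_neg] at h
  rw [← h]
  congr 1
  ext1 i
  fin_cases i <;> rfl

lemma cross_swap (u w : S.VE x) : S.cross x w u = - S.cross x u w :=
  g_ext fun v ↦ by rw [map_neg, LinearMap.neg_apply, g_cross, g_cross, vol_swap]

lemma vol_eq_crossForm (u u' w : S.VE x) : S.vol x ![u, u', w] = S.crossForm x w u u' := by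
  rw [← vol_cycle u, ← vol_cycle u']
  rfl

lemma cross_add (u w w' : S.VE x) : S.cross x u (w + w') = S.cross x u w + S.cross x u w' :=
  g_ext fun v ↦ by
    rw [map_add, LinearMap.add_apply, g_cross, g_cross, g_cross, vol_eq_crossForm, vol_eq_crossForm,
      vol_eq_crossForm, map_add]

lemma cross_smul (c : ℝ) (u w : S.VE x) : S.cross x u (c • w) = c • S.cross x u w :=
  g_ext fun v ↦ by
    rw [map_smul, LinearMap.smul_apply, g_cross, g_cross, vol_eq_crossForm, vol_eq_crossForm,
      map_smul]

lemma add_cross (u u' w : S.VE x) : S.cross x (u + u') w = S.cross x u w + S.cross x u' w := by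
  rw [cross_swap w, cross_swap w u, cross_swap w u', cross_add, neg_add]

lemma smul_cross (c : ℝ) (u w : S.VE x) : S.cross x (c • u) w = c • S.cross x u w := by
  rw [cross_swap w, cross_swap w u, cross_smul, smul_neg]

variable (S x) in
/-- The cross product as a bilinear map. -/
def crossL : S.VE x →ₗ[ℝ] S.VE x →ₗ[ℝ] S.VE x :=
  LinearMap.mk₂ ℝ (S.cross x) add_cross smul_cross cross_add cross_smul

lemma cross_self (u : S.VE x) : S.cross x u u = 0 := by
  have h := cross_swap u u
  have h2 : (2 : ℝ) • S.cross x u u = 0 := by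
    rw [two_smul]
    nth_rewrite 1 [h]
    simp
  exact (smul_eq_zero.1 h2).resolve_left two_ne_zero

lemma vol_eq_zero_right (u w : S.VE x) : S.vol x ![u, w, w] = 0 := by
  have h := cross_self (S := S) w
  rw [← vol_cycle, ← g_cross, h]
  simp

lemma vol_eq_zero_left (u w : S.VE x) : S.vol x ![u, u, w] = 0 := by
  rw [← g_cross, cross_self]
  simp

lemma OrientedFrame.vol_eq (e : S.OrientedFrame x) : S.vol x ![e.b 0, e.b 1, e.b 2] = 1 := by
  rw [← e.orient]
  congr 1
  ext1 i
  fin_cases i <;> rfl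

lemma OrientedFrame.cross01 (e : S.OrientedFrame x) : S.cross x (e.b 0) (e.b 1) = e.b 2 := by
  rw [e.sum_eq (S.cross x (e.b 0) (e.b 1))]
  simp only [S.g_symm x _ (S.cross x _ _), g_cross]
  rw [Fin.sum_univ_three, e.vol_eq, vol_eq_zero_right, ← vol_cycle, ← vol_cycle, vol_eq_zero_left]
  simp

/-- The cyclic permutation of an oriented frame. -/
def OrientedFrame.cycle (e : S.OrientedFrame x) : S.OrientedFrame x where
  b := e.b.reindex (finRotate 3).symm
  ortho i j := by
    simp only [Module.Basis.reindex_apply, e.ortho]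
    simp
  orient := by
    rw [← e.vol_eq, ← vol_cycle]
    congr 1
    ext1 i
    fin_cases i <;> simp [Module.Basis.reindex_apply]

lemma OrientedFrame.cycle_b (e : S.OrientedFrame x) :
    e.cycle.b 0 = e.b 1 ∧ e.cycle.b 1 = e.b 2 ∧ e.cycle.b 2 = e.b 0 := by
  refine ⟨?_, ?_, ?_⟩ <;> simp [OrientedFrame.cycle, Module.Basis.reindex_apply]

lemma OrientedFrame.cross12 (e : S.OrientedFrame x) : S.cross x (e.b 1) (e.b 2) = e.b 0 := by
  have h := e.cycle.cross01
  rwa [e.cycle_b.1, e.cycle_b.2.1, e.cycle_b.2.2] at h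

lemma OrientedFrame.cross20 (e : S.OrientedFrame x) : S.cross x (e.b 2) (e.b 0) = e.b 1 := by
  have h := e.cycle.cross12
  rwa [e.cycle_b.1, e.cycle_b.2.1, e.cycle_b.2.2] at h

/-- Both sides are bilinear, so the nine pairs of vectors of an oriented orthonormal frame decide.
This evaluates the trace in the definition of `ρ`. -/
lemma trace_cross_cross (u w : S.VE x) :
    LinearMap.trace ℝ (S.VE x) (crossL S x u ∘ₗ crossL S x w) = -2 * S.g x u w := by
  obtain ⟨e⟩ := S.exists_orientedFrame x
  have c10 : S.cross x (e.b 1) (e.b 0) = - e.b 2 := by rw [cross_swap, e.cross01]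
  have c21 : S.cross x (e.b 2) (e.b 1) = - e.b 0 := by rw [cross_swap, e.cross12]
  have c02 : S.cross x (e.b 0) (e.b 2) = - e.b 1 := by rw [cross_swap, e.cross20]
  have key : ((LinearMap.llcomp ℝ (S.VE x) (S.VE x) (S.VE x)).compl₁₂ (crossL S x) (crossL S x)).compr₂
      (LinearMap.trace ℝ (S.VE x)) = (-2 : ℝ) • S.g x := by
    refine e.b.ext fun i ↦ e.b.ext fun j ↦ ?_
    change LinearMap.trace ℝ (S.VE x) (crossL S x (e.b i) ∘ₗ crossL S x (e.b j)) = -2 * S.g x (e.b i) (e.b j)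
    rw [LinearMap.trace_eq_matrix_trace ℝ e.b, Matrix.trace, Fin.sum_univ_three]
    simp only [Matrix.diag_apply, LinearMap.toMatrix_apply, e.repr_eq, LinearMap.comp_apply]
    change S.g x (e.b 0) (S.cross x (e.b i) (S.cross x (e.b j) (e.b 0)))
      + S.g x (e.b 1) (S.cross x (e.b i) (S.cross x (e.b j) (e.b 1)))
      + S.g x (e.b 2) (S.cross x (e.b i) (S.cross x (e.b j) (e.b 2))) = _
    have hz : ∀ u : S.VE x, S.cross x u 0 = 0 := fun u ↦ (crossL S x u).map_zero
    have hn : ∀ u w : S.VE x, S.cross x u (-w) = - S.cross x u w := fun u w ↦ (crossL S x u).map_neg w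
    fin_cases i <;> fin_cases j <;>
      simp [e.cross01, e.cross12, e.cross20, c10, c21, c02, cross_self, e.ortho, hz, hn] <;> norm_num
  have := LinearMap.congr_fun (LinearMap.congr_fun key u) w
  exact this

/-- If `Ř (X, Y)` is the cross product with `r`, then `ρ (X, Y)` is the covector of `r`. -/
lemma rho_eq {X Y : Tan x} {r : S.VE x} (h : ∀ u, S.curvVer x X Y u = S.cross x r u) (w : S.VE x) :
    S.rho x X Y w = S.g x r w := by
  have h1 := LinearMap.trace_eq_matrix_trace ℝ (Module.finBasis ℝ (S.VE x))
    (crossL S x w ∘ₗ crossL S x r)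
  rw [trace_cross_cross, Matrix.trace] at h1
  simp only [Matrix.diag_apply, LinearMap.toMatrix_apply] at h1
  rw [rho]
  simp only [h]
  change -(1 / 2) * (∑ j, (Module.finBasis ℝ (S.VE x)).repr ((crossL S x w ∘ₗ crossL S x r)
    (Module.finBasis ℝ (S.VE x) j)) j) = _
  rw [← h1, S.g_symm]
  ring

end Spacetime

end SpacelikeAlgebra

/-! ### Traceless anti-Hermitian endomorphisms and the Pauli map -/

section AntiHermitian

variable {H : Type*} [NormedAddCommGroup H] [InnerProductSpace ℂ H]

/-- Anti-Hermitian endomorphisms. -/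
def IsAntiHerm (N : H →ₗ[ℂ] H) : Prop := ∀ u u' : H, inner ℂ (N u) u' = - inner ℂ u (N u')

variable (H) in
/-- The real vector space of traceless anti-Hermitian endomorphisms. -/
def su2 : Submodule ℝ (H →ₗ[ℂ] H) where
  carrier := {N | IsAntiHerm N ∧ LinearMap.trace ℂ H N = 0}
  add_mem' := by
    rintro N N' ⟨h1, h2⟩ ⟨h1', h2'⟩
    refine ⟨fun u u' ↦ ?_, by rw [map_add, h2, h2', add_zero]⟩
    rw [LinearMap.add_apply, LinearMap.add_apply, inner_add_left, inner_add_right, h1, h1', neg_add]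
  zero_mem' := ⟨fun u u' ↦ by simp, map_zero _⟩
  smul_mem' := by
    rintro c N ⟨h1, h2⟩
    have hc : c • N = (c : ℂ) • N := by ext u; simp
    refine ⟨fun u u' ↦ ?_, by rw [hc, map_smul, h2, smul_zero]⟩
    rw [hc, LinearMap.smul_apply, LinearMap.smul_apply, inner_smul_left, inner_smul_right, h1]
    simp

variable [FiniteDimensional ℂ H]

lemma re_trace_antiHerm {N : H →ₗ[ℂ] H} (hN : IsAntiHerm N) : (LinearMap.trace ℂ H N).re = 0 := by
  rw [LinearMap.trace_eq_sum_inner N (stdOrthonormalBasis ℂ H), Complex.re_sum]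
  refine Finset.sum_eq_zero fun i _ ↦ ?_
  have h1 := hN (stdOrthonormalBasis ℂ H i) (stdOrthonormalBasis ℂ H i)
  rw [← inner_conj_symm] at h1
  have h2 := congrArg Complex.re h1
  simp only [Complex.conj_re, Complex.neg_re] at h2
  linarith

/-- In an orthonormal basis such an endomorphism is determined by the imaginary part of one diagonal
entry and by one complex off-diagonal entry. The upper bound is enough, because the Pauli map
supplies three independent elements. -/
lemma finrank_su2_le (h : Module.finrank ℂ H = 2) :
    FiniteDimensional ℝ (su2 H) ∧ Module.finrank ℝ (su2 H) ≤ 3 := by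
  let o := (stdOrthonormalBasis ℂ H).reindex (finCongr h)
  let T : su2 H →ₗ[ℝ] (Fin 3 → ℝ) :=
    { toFun := fun N ↦ ![(inner ℂ (o 0) (N.1 (o 0))).im, (inner ℂ (o 0) (N.1 (o 1))).re,
        (inner ℂ (o 0) (N.1 (o 1))).im]
      map_add' := fun N N' ↦ by
        ext i
        fin_cases i <;> simp
      map_smul' := fun c N ↦ by
        ext i
        fin_cases i <;> simp [inner_smul_right_eq_smul] }
  have hT : Function.Injective T := by
    refine (injective_iff_map_eq_zero T).2 fun N hN ↦ ?_
    obtain ⟨h1, h2⟩ := N.2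
    have a1 : (inner ℂ (o 0) (N.1 (o 0))).im = 0 := congrFun hN 0
    have a2 : (inner ℂ (o 0) (N.1 (o 1))).re = 0 := congrFun hN 1
    have a3 : (inner ℂ (o 0) (N.1 (o 1))).im = 0 := congrFun hN 2
    have a4 : (inner ℂ (o 0) (N.1 (o 0))).re = 0 := by
      have h3 := h1 (o 0) (o 0)
      rw [← inner_conj_symm] at h3
      have h4 := congrArg Complex.re h3
      simp only [Complex.conj_re, Complex.neg_re] at h4
      linarith
    have e00 : inner ℂ (o 0) (N.1 (o 0)) = 0 := Complex.ext a4 a1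
    have e01 : inner ℂ (o 0) (N.1 (o 1)) = 0 := Complex.ext a2 a3
    have e10 : inner ℂ (o 1) (N.1 (o 0)) = 0 := by
      have h3 := h1 (o 0) (o 1)
      rw [e01, neg_zero, inner_eq_zero_symm] at h3
      exact h3
    have e11 : inner ℂ (o 1) (N.1 (o 1)) = 0 := by
      have h3 := LinearMap.trace_eq_sum_inner N.1 o
      rw [Fin.sum_univ_two, h2, e00, zero_add] at h3
      exact h3.symm
    refine Subtype.ext (o.toBasis.ext fun i ↦ o.toBasis.ext_elem fun j ↦ ?_)
    fin_cases i <;> fin_cases j <;> simp [OrthonormalBasis.repr_apply_apply, e00, e01, e10, e11]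
  haveI : FiniteDimensional ℝ (su2 H) := Module.Finite.of_injective T hT
  refine ⟨inferInstance, ?_⟩
  have := LinearMap.finrank_le_finrank_of_injective hT
  simpa using this

end AntiHermitian

/-! ### The Pauli map -/

section Pauli

variable {M : Type*} [TopologicalSpace M] [ChartedSpace R4 M] [IsManifold 𝓘(ℝ, R4) ∞ M]
  {S : Spacetime M} {Q U' U : M → Type*}
  [TopologicalSpace (TotalSpace ℂ Q)] [∀ x, NormedAddCommGroup (Q x)]
  [∀ x, InnerProductSpace ℂ (Q x)] [FiberBundle ℂ Q]
  [TopologicalSpace (TotalSpace C2 U')] [∀ x, NormedAddCommGroup (U' x)]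
  [∀ x, InnerProductSpace ℂ (U' x)] [FiberBundle C2 U'] [VectorBundle ℝ C2 U']
  [TopologicalSpace (TotalSpace C2 U)] [∀ x, NormedAddCommGroup (U x)]
  [∀ x, InnerProductSpace ℂ (U x)] [FiberBundle C2 U]

lemma finrank_fibre (F : Type*) [NormedAddCommGroup F] [NormedSpace ℂ F] (V : M → Type*)
    [TopologicalSpace (TotalSpace F V)] [∀ x, NormedAddCommGroup (V x)]
    [∀ x, InnerProductSpace ℂ (V x)] [FiberBundle F V] [VectorBundle ℂ F V]
    [FiniteDimensional ℂ F] (x : M) :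
    FiniteDimensional ℂ (V x) ∧ Module.finrank ℂ (V x) = Module.finrank ℂ F := by
  let L := (trivializationAt F V x).linearEquivAt ℂ x (mem_baseSet_trivializationAt F V x)
  exact ⟨Module.Finite.equiv L.symm, L.finrank_eq⟩

namespace SpinQuantum

variable (P : SpinQuantum S Q U' U)

/-- The isometry condition gives `g(w, w) = 0` for `w` in the kernel, and `g` is positive. -/
lemma pauli_injective (x : M) : Function.Injective (P.pauli x) := by
  refine (injective_iff_map_eq_zero _).2 fun w hw ↦ ?_
  by_contra h
  have h1 := P.pauli_isometry x w w
  rw [hw, LinearMap.comp_zero, map_zero, mul_zero] at h1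
  exact (S.g_pos x w h).ne' (by exact_mod_cast h1.symm)

/-- The orientation condition only gives `[Σe₁, Σe₂] = Σe₃`. Applied to the cyclic permutations of
one oriented frame it determines all the commutators of basis vectors, and bilinearity does the
rest. -/
lemma pauli_commutator (x : M) (u w : S.VE x) :
    P.pauli x u ∘ₗ P.pauli x w - P.pauli x w ∘ₗ P.pauli x u = P.pauli x (S.cross x u w) := by
  have hF : ∀ e : S.OrientedFrame x, P.pauli x (e.b 0) ∘ₗ P.pauli x (e.b 1)
      - P.pauli x (e.b 1) ∘ₗ P.pauli x (e.b 0) = P.pauli x (e.b 2) :=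
    fun e ↦ P.pauli_oriented x e.b e.ortho e.orient
  obtain ⟨e⟩ := S.exists_orientedFrame x
  have h01 := hF e
  have h12 := hF e.cycle
  have h20 := hF e.cycle.cycle
  simp only [e.cycle_b.1, e.cycle_b.2.1, e.cycle_b.2.2, e.cycle.cycle_b.1, e.cycle.cycle_b.2.1,
    e.cycle.cycle_b.2.2] at h12 h20
  let B₁ : S.VE x →ₗ[ℝ] S.VE x →ₗ[ℝ] (U x →ₗ[ℂ] U x) :=
    LinearMap.mk₂ ℝ (fun u w ↦ P.pauli x u ∘ₗ P.pauli x w - P.pauli x w ∘ₗ P.pauli x u)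
      (fun u u' w ↦ by ext; simp; abel) (fun c u w ↦ by ext; simp [smul_sub])
      (fun u w w' ↦ by ext; simp; abel) (fun c u w ↦ by ext; simp [smul_sub])
  have key : B₁ = (Spacetime.crossL S x).compr₂ (P.pauli x) := by
    refine e.b.ext fun i ↦ e.b.ext fun j ↦ ?_
    change P.pauli x (e.b i) ∘ₗ P.pauli x (e.b j) - P.pauli x (e.b j) ∘ₗ P.pauli x (e.b i)
      = P.pauli x (S.cross x (e.b i) (e.b j))
    fin_cases i <;> fin_cases j <;> simp only [Fin.zero_eta, Fin.mk_one, Fin.reduceFinMk]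
    · rw [Spacetime.cross_self, sub_self, map_zero]
    · rw [h01, e.cross01]
    · rw [Spacetime.cross_swap, e.cross20, map_neg, ← h20, neg_sub]
    · rw [Spacetime.cross_swap, e.cross01, map_neg, ← h01, neg_sub]
    · rw [Spacetime.cross_self, sub_self, map_zero]
    · rw [h12, e.cross12]
    · rw [h20, e.cross20]
    · rw [Spacetime.cross_swap, e.cross12, map_neg, ← h12, neg_sub]
    · rw [Spacetime.cross_self, sub_self, map_zero]
  exact LinearMap.congr_fun (LinearMap.congr_fun key u) w

variable [VectorBundle ℂ C2 U]

lemma finrank_U (x : M) : Module.finrank ℂ (U x) = 2 := by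
  rw [(finrank_fibre C2 U x).2]
  simp

/-- The image of the Pauli map has dimension three inside a space of dimension at most three. -/
lemma exists_pauli_eq {x : M} {N : U x →ₗ[ℂ] U x} (hN : IsAntiHerm N)
    (h0 : LinearMap.trace ℂ (U x) N = 0) : ∃ w, P.pauli x w = N := by
  haveI : FiniteDimensional ℂ (U x) := (finrank_fibre C2 U x).1
  obtain ⟨h1, h2⟩ := finrank_su2_le (H := U x) (finrank_U x)
  have hle : LinearMap.range (P.pauli x) ≤ su2 (U x) := by
    rintro _ ⟨w, rfl⟩
    exact ⟨P.pauli_antiherm x w, P.pauli_trace x w⟩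
  have h3 : Module.finrank ℝ (LinearMap.range (P.pauli x)) = 3 := by
    rw [LinearMap.finrank_range_of_inj (P.pauli_injective x)]
    exact S.finrank_VE x
  have h4 := Submodule.eq_of_le_of_finrank_le hle (by rw [h3]; exact h2)
  have h5 : N ∈ su2 (U x) := ⟨hN, h0⟩
  rw [← h4] at h5
  exact h5

/-- Anti-Hermitian endomorphisms are of the form `i c 1 + Σ (w)`. -/
lemma exists_decomposition {x : M} {N : U x →ₗ[ℂ] U x} (hN : IsAntiHerm N) :
    ∃ w, ∀ u, N u = (Complex.I * (((LinearMap.trace ℂ (U x) N).im / 2 : ℝ) : ℂ)) • u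
      + P.pauli x w u := by
  haveI : FiniteDimensional ℂ (U x) := (finrank_fibre C2 U x).1
  -- The trace of `N` is imaginary and that of the identity is two, so subtracting `c 1` removes the
  -- trace.
  set c : ℂ := Complex.I * (((LinearMap.trace ℂ (U x) N).im / 2 : ℝ) : ℂ) with hc
  have hcc : (starRingEnd ℂ) c = - c := by
    rw [hc, map_mul, Complex.conj_I, Complex.conj_ofReal, neg_mul]
  have h1 : IsAntiHerm (N - c • LinearMap.id) := by
    intro u u'
    simp only [LinearMap.sub_apply, LinearMap.smul_apply, LinearMap.id_apply, inner_sub_left,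
      inner_sub_right, inner_smul_left, inner_smul_right, hN u u', hcc]
    ring
  have h2 : LinearMap.trace ℂ (U x) (N - c • LinearMap.id) = 0 := by
    rw [map_sub, map_smul, LinearMap.trace_id, finrank_U]
    refine Complex.ext ?_ ?_
    · simp [hc, re_trace_antiHerm hN]
    · simp [hc]
  obtain ⟨w, hw⟩ := P.exists_pauli_eq h1 h2
  refine ⟨w, fun u ↦ ?_⟩
  rw [hw]
  simp

/-- The trace sees `c` alone, as `Σ` is traceless; injectivity of `Σ` then gives `w`. -/
lemma decomposition_unique {x : M} {c c' : ℝ} {w w' : S.VE x}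
    (h : ∀ u : U x, (Complex.I * (c : ℂ)) • u + P.pauli x w u
      = (Complex.I * (c' : ℂ)) • u + P.pauli x w' u) : c = c' ∧ w = w' := by
  haveI : FiniteDimensional ℂ (U x) := (finrank_fibre C2 U x).1
  have h1 : (Complex.I * (c : ℂ)) • LinearMap.id + P.pauli x w
      = (Complex.I * (c' : ℂ)) • LinearMap.id + P.pauli x w' := LinearMap.ext h
  have h2 := congrArg (LinearMap.trace ℂ (U x)) h1
  simp only [map_add, map_smul, P.pauli_trace, LinearMap.trace_id, finrank_U, add_zero] at h2
  have hc : c = c' := by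
    have h3 := congrArg Complex.im h2
    simp at h3
    exact h3
  subst hc
  exact ⟨rfl, P.pauli_injective x (add_left_cancel h1)⟩

end SpinQuantum

end Pauli

/-! ### Smoothness of covariant derivatives -/

section GlobalConnections

variable {M : Type*} [TopologicalSpace M] [ChartedSpace R4 M] [IsManifold 𝓘(ℝ, R4) ∞ M]
  {F : Type*} [NormedAddCommGroup F] [NormedSpace ℝ F] [FiniteDimensional ℝ F]
  {V : M → Type*} [TopologicalSpace (TotalSpace F V)]
  [∀ x, AddCommGroup (V x)] [∀ x, Module ℝ (V x)] [∀ x, TopologicalSpace (V x)]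
  [∀ x, IsTopologicalAddGroup (V x)] [∀ x, ContinuousSMul ℝ (V x)]
  [FiberBundle F V] [VectorBundle ℝ F V] [ContMDiffVectorBundle ∞ F V 𝓘(ℝ, R4)]

lemma isConnAt_of_isCovariantDerivativeOn {cov : (∀ x, V x) → ∀ x : M, Tan x →L[ℝ] V x}
    (h : IsCovariantDerivativeOn F (I := 𝓘(ℝ, R4)) (V := V) cov) (x : M) :
    IsConnAt F (fun s x X ↦ cov s x X) x where
  add s s' X hs hs' := by rw [h.add hs hs']; rfl
  leibniz f s X hf hs := by rw [h.leibniz hs hf]; rfl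

/-- Smoothness of `K` is applied to a global section with the same germ, which has the same
covariant derivative near the point. -/
lemma isSmoothConnOn_of_contMDiff [T2Space M] (K : CovariantDerivative 𝓘(ℝ, R4) F V)
    (hK : K.ContMDiffCovariantDerivative ∞) : IsSmoothConnOn F univ (fun s x X ↦ K s x X) where
  conn x _ := isConnAt_of_isCovariantDerivativeOn K.isCovariantDerivativeOn x
  map_add s x X Y := map_add _ _ _
  map_smul s x c X := map_smul _ _ _
  smooth W _ hW s X hs hX := by
    intro x hx
    obtain ⟨s', hs', W', hW', hWo, hxW', heq⟩ := exists_global_section hW hx hs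
    have h1 := hK.contMDiff.contMDiff (σ := s') (by
      rw [show (∞ + 1 : ℕ∞ω) = ∞ from by simp]
      exact hs')
    have h2 : SmoothOn F W' (fun y ↦ K s' y (X y)) :=
      ContMDiffOn.clm_bundle_apply (h1.mono (subset_univ _)) (hX.mono hW')
    have h3 : SmoothOn F W' (fun y ↦ K s y (X y)) := h2.congr fun y hy ↦ by
      refine (isConnAt_of_isCovariantDerivativeOn K.isCovariantDerivativeOn y).congr
        (hs'.diffAt isOpen_univ (mem_univ y)) ?_ (X y)
      filter_upwards [hWo.mem_nhds hy] with z hz using (heq z hz).symm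
    exact (h3.contMDiffAt (hWo.mem_nhds hxW')).contMDiffWithinAt

end GlobalConnections

/-! ### Observers with prescribed first jets; spacelike frames -/

section SpacetimeConnection

variable {M : Type*} [TopologicalSpace M] [ChartedSpace R4 M] [IsManifold 𝓘(ℝ, R4) ∞ M]

/-- There are functions with a prescribed differential at a point. -/
lemma exists_fun_deriv {x : M} (l : Tan x →L[ℝ] ℝ) : ∃ (f : M → ℝ) (W : Set M), IsOpen W ∧ x ∈ W ∧
    ContMDiffOn 𝓘(ℝ, R4) 𝓘(ℝ, ℝ) ∞ f W ∧ f x = 0 ∧ ∀ X, mvfderiv 𝓘(ℝ, R4) f x X = l X := by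
  obtain ⟨T, hT⟩ := isInvertible_mfderiv_extChartAt (I := 𝓘(ℝ, R4)) (mem_extChartAt_source (I := 𝓘(ℝ, R4)) x)
  let φ : M → R4 := fun y ↦ extChartAt 𝓘(ℝ, R4) x y - extChartAt 𝓘(ℝ, R4) x x
  let Ts : Tan (extChartAt 𝓘(ℝ, R4) x x) →L[ℝ] Tan x := T.symm
  let L : R4 →L[ℝ] ℝ := l ∘L Ts
  have h1 : ContMDiffOn 𝓘(ℝ, R4) 𝓘(ℝ, R4) ∞ (fun y ↦ extChartAt 𝓘(ℝ, R4) x y) (chartAt R4 x).source :=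
    contMDiffOn_extChartAt
  have hφ : ContMDiffOn 𝓘(ℝ, R4) 𝓘(ℝ, R4) ∞ φ (chartAt R4 x).source := h1.sub contMDiffOn_const
  have ho := (chartAt R4 x).open_source
  have hx := mem_chart_source R4 x
  refine ⟨fun y ↦ L (φ y), (chartAt R4 x).source, ho, hx, L.contMDiff.comp_contMDiffOn hφ, ?_, fun X ↦ ?_⟩
  · simp [φ]
  · rw [mvfderiv_clm L (mdiffAt_of_smoothOn ho hφ hx)]
    have h2 : mvfderiv 𝓘(ℝ, R4) φ x X = mfderiv 𝓘(ℝ, R4) 𝓘(ℝ, R4) (extChartAt 𝓘(ℝ, R4) x) x X := by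
      have h3 : φ = (fun y ↦ extChartAt 𝓘(ℝ, R4) x y) - fun _ ↦ extChartAt 𝓘(ℝ, R4) x x := rfl
      rw [h3, mvfderiv_sub (mdiffAt_of_smoothOn ho h1 hx) mdifferentiableAt_const, mvfderiv_const,
        sub_zero]
      rfl
    rw [h2, ← hT]
    exact congrArg l (T.symm_apply_apply X)

/-- There are vector fields with a prescribed value and covariant differential at a point. -/
lemma exists_field_deriv {cov : (∀ x : M, Tan x) → ∀ x : M, Tan x → Tan x} {x : M}
    (hc : IsConnAt R4 cov x) (hadd : ∀ s X Y, cov s x (X + Y) = cov s x X + cov s x Y)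
    (hsmul : ∀ s (c : ℝ) X, cov s x (c • X) = c • cov s x X) (v : Tan x)
    (L : Tan x →ₗ[ℝ] Tan x) : ∃ (Z : ∀ x : M, Tan x) (W : Set M), IsOpen W ∧ x ∈ W ∧
      SmoothOn R4 W Z ∧ Z x = v ∧ ∀ X, cov Z x X = L X := by
  classical
  haveI : T2Space (Tan x) := inferInstanceAs (T2Space R4)
  let b : Module.Basis (Fin 4) ℝ (Tan x) := (EuclideanSpace.basisFun (Fin 4) ℝ).toBasis
  let Z₀ : ∀ y : M, Tan y := FiberBundle.extend R4 v
  -- `D` is the error made by an arbitrary extension `Z₀` of `v`. It is corrected by fields `fᵢ bᵢ`,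
  -- where `fᵢ` vanishes at `x` and has the `i`-th component of `D` as differential.
  let D : Tan x →ₗ[ℝ] Tan x := L - { toFun := fun X ↦ cov Z₀ x X, map_add' := hadd Z₀, map_smul' := hsmul Z₀ }
  choose f Wf hWf hxf hfs hf0 hfd using fun i ↦
    exists_fun_deriv (x := x) (LinearMap.toContinuousLinearMap (b.coord i ∘ₗ D))
  have hi : ∀ t : Finset (Fin 4), ∃ (Z : ∀ x : M, Tan x) (W : Set M), IsOpen W ∧ x ∈ W ∧
      SmoothOn R4 W Z ∧ Z x = v ∧ ∀ X, cov Z x X = cov Z₀ x X + ∑ i ∈ t, b.coord i (D X) • b i := by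
    intro t
    induction t using Finset.induction_on with
    | empty =>
      exact ⟨Z₀, _, Trivialization.open_baseSet _, mem_baseSet_extend x, smoothOn_extend v,
        FiberBundle.extend_apply_self R4 v, fun X ↦ by simp⟩
    | insert i t hit ih =>
      obtain ⟨Z, W, hW, hx, hZ, hZx, hZd⟩ := ih
      let E : ∀ y : M, Tan y := FiberBundle.extend R4 (b i)
      have hEx : E x = b i := FiberBundle.extend_apply_self R4 (b i)
      have hE : DiffAt R4 E x := diffAt_extend R4 (b i)
      have hfx := mdiffAt_of_smoothOn (hWf i) (hfs i) (hxf i)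
      have hE' : SmoothOn R4 (trivializationAt R4 (TangentSpace 𝓘(ℝ, R4) : M → Type) x).baseSet E :=
        smoothOn_extend (b i)
      let W' := W ∩ Wf i ∩ (trivializationAt R4 (TangentSpace 𝓘(ℝ, R4) : M → Type) x).baseSet
      have hfE : SmoothOn R4 W' (f i • E) :=
        (hE'.mono fun y hy ↦ hy.2).smul ((hfs i).mono fun y hy ↦ hy.1.2)
      have hW' : IsOpen W' := (hW.inter (hWf i)).inter (Trivialization.open_baseSet _)
      have hx' : x ∈ W' := ⟨⟨hx, hxf i⟩, mem_baseSet_extend x⟩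
      refine ⟨Z + f i • E, W', hW', hx', (hZ.mono fun y hy ↦ hy.1.1).add hfE, ?_, fun X ↦ ?_⟩
      · simp [hf0, hZx]
      · rw [hc.add Z (f i • E) X (hZ.diffAt hW hx) (hfE.diffAt hW' hx'),
          hc.leibniz _ _ _ hfx hE, hf0, hfd, hZd, Finset.sum_insert hit, hEx, zero_smul, zero_add]
        change _ + _ + b.coord i (D X) • b i = _
        abel
  obtain ⟨Z, W, hW, hx, hZ, hZx, hZd⟩ := hi Finset.univ
  refine ⟨Z, W, hW, hx, hZ, hZx, fun X ↦ ?_⟩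
  rw [hZd]
  have : ∑ i, b.coord i (D X) • b i = D X := b.sum_repr (D X)
  rw [this]
  change cov Z₀ x X + (L X - cov Z₀ x X) = L X
  abel

lemma coe_toVer {t : M → ℝ} {x : M} {w : Tan x} (h : w ∈ Ver t x) : (toVer t x w : Tan x) = w := by
  rw [toVer, dif_pos h]

lemma mem_Ver {t : M → ℝ} {x : M} {w : Tan x} : w ∈ Ver t x ↔ dtime t x w = 0 := LinearMap.mem_ker

namespace Spacetime

variable (S : Spacetime M)

lemma isSmoothConnOn_K [T2Space M] : IsSmoothConnOn R4 univ (fun s x X ↦ S.K s x X) :=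
  isSmoothConnOn_of_contMDiff S.K S.K_smooth

lemma isConnAt_K (x : M) : IsConnAt R4 (fun s x X ↦ S.K s x X) x :=
  isConnAt_of_isCovariantDerivativeOn S.K.isCovariantDerivativeOn x

variable {S} {W : Set M} {x : M}

lemma contMDiffOn_dt (hW : IsOpen W) {X : ∀ x : M, Tan x} (hX : SmoothOn R4 W X) :
    ContMDiffOn 𝓘(ℝ, R4) 𝓘(ℝ, ℝ) ∞ (fun y ↦ S.dt y (X y)) W :=
  contMDiffOn_dfun hW S.t_smooth.contMDiffOn hX

/-- Since `∇ dt = 0`, the value of `dt` on `∇_X Y` is the derivative of `dt(Y) = 0`. -/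
lemma K_mem {Y : ∀ x, S.VE x} (hY : DiffAt R4 (fun y ↦ (Y y : Tan y)) x) (X : Tan x) :
    S.K (fun y ↦ (Y y : Tan y)) x X ∈ S.VE x := by
  rw [mem_Ver, ← S.K_time _ x X hY]
  have : (fun y ↦ dtime S.t y (Y y : Tan y)) = 0 := funext fun y ↦ (Y y).2
  rw [this, mvfderiv_zero]
  rfl

lemma coe_covVer {Y : ∀ x, S.VE x} (hY : DiffAt R4 (fun y ↦ (Y y : Tan y)) x) (X : Tan x) :
    (S.covVer Y x X : Tan x) = S.K (fun y ↦ (Y y : Tan y)) x X :=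
  coe_toVer (K_mem hY X)

lemma verSmoothOn_covVer [T2Space M] (hW : IsOpen W) {Y : ∀ x, S.VE x} (hY : VerSmoothOn S.t W Y)
    {X : ∀ x : M, Tan x} (hX : SmoothOn R4 W X) :
    VerSmoothOn S.t W (fun y ↦ S.covVer Y y (X y)) :=
  (S.isSmoothConnOn_K.smooth W (subset_univ W) hW _ X hY hX).congr
    fun y hy ↦ coe_covVer (SmoothOn.diffAt hW hY hy) (X y)

variable (S) in
lemma exists_dt_eq_one (x : M) : ∃ v : Tan x, S.dt x v = 1 := by
  by_contra! h
  refine S.t_submersion x (ContinuousLinearMap.ext fun w ↦ ?_)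
  by_contra hw
  refine h ((S.dt x w)⁻¹ • w) ?_
  rw [map_smul, smul_eq_mul, inv_mul_cancel₀ hw]

variable (S) in
/-- Some observer, not necessarily smooth. -/
def someObserver (x : M) : S.J1 x := ⟨(S.exists_dt_eq_one x).choose, (S.exists_dt_eq_one x).choose_spec⟩

open Classical in
/-- An observer with a given velocity at a point. -/
def obsAt (x : M) (v : S.J1 x) : ∀ y, S.J1 y := Function.update S.someObserver x v

lemma obsAt_self (v : S.J1 x) : obsAt x v x = v := by
  classical
  unfold obsAt
  simp [Function.update]

lemma J1.ext {v v' : S.J1 x} (h : v.1 = v'.1) : v = v' := Subtype.ext h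

variable (S) in
/-- There are observers with a prescribed velocity and a prescribed covariant differential. -/
lemma exists_observer (v : S.J1 x) (L : Tan x →ₗ[ℝ] S.VE x) :
    ∃ (o : ∀ x, S.J1 x) (W : Set M), IsOpen W ∧ x ∈ W ∧ S.IsObserverOn W o ∧ o x = v ∧
      ∀ X, S.K (fun y ↦ (o y).1) x X = L X := by
  classical
  obtain ⟨Z, W, hW, hx, hZ, hZx, hZd⟩ := exists_field_deriv (S.isConnAt_K x) (fun s X Y ↦ map_add _ _ _)
    (fun s c X ↦ map_smul _ _ _) v.1 ((S.VE x).subtype ∘ₗ L)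
  have hdt := contMDiffOn_dt (S := S) hW hZ
  let W' := W ∩ (fun y ↦ S.dt y (Z y)) ⁻¹' {0}ᶜ
  have hW' : IsOpen W' := hdt.continuousOn.isOpen_inter_preimage hW isOpen_compl_singleton
  have hZx1 : S.dt x (Z x) = 1 := by rw [hZx]; exact v.2
  have hx' : x ∈ W' := ⟨hx, by simp [hZx1]⟩
  -- Normalizing `Z` by `dt(Z)` keeps the covariant differential at `x`: there `dt(Z)` is one, and
  -- its differential vanishes because `L` has spacelike values and `∇ dt = 0`.
  let o : ∀ y, S.J1 y := fun y ↦ if h : S.dt y (Z y) ≠ 0 then J1.ofTan S (Z y) h else S.someObserver y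
  have hoy : ∀ y ∈ W', (o y).1 = (S.dt y (Z y))⁻¹ • Z y := fun y hy ↦ by
    have : S.dt y (Z y) ≠ 0 := hy.2
    simp only [o, dif_pos this]
    rfl
  have hinv : ContMDiffOn 𝓘(ℝ, R4) 𝓘(ℝ, ℝ) ∞ (fun y ↦ (S.dt y (Z y))⁻¹) W' := by
    intro y hy
    have h1 : ContMDiffAt 𝓘(ℝ, ℝ) 𝓘(ℝ, ℝ) ∞ (fun r : ℝ ↦ r⁻¹) (S.dt y (Z y)) :=
      (contDiffAt_inv ℝ hy.2).contMDiffAt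
    exact (h1.comp y (hdt.contMDiffAt (hW.mem_nhds hy.1))).contMDiffWithinAt
  have hoS : SmoothOn R4 W' ((fun y ↦ (S.dt y (Z y))⁻¹) • Z) := (hZ.mono inter_subset_left).smul hinv
  refine ⟨o, W', hW', hx', hoS.congr hoy, J1.ext ?_, fun X ↦ ?_⟩
  · rw [hoy x hx', hZx1, inv_one, one_smul, hZx]
  · have h1 : S.K (fun y ↦ (o y).1) x X = S.K ((fun y ↦ (S.dt y (Z y))⁻¹) • Z) x X := by
      refine (S.isConnAt_K x).congr (hoS.diffAt hW' hx') ?_ X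
      filter_upwards [hW'.mem_nhds hx'] with y hy using hoy y hy
    have h2 := (S.isConnAt_K x).leibniz (fun y ↦ (S.dt y (Z y))⁻¹) Z X
      (mdiffAt_of_smoothOn hW' hinv hx') (hZ.diffAt hW hx)
    have h3 : mvfderiv 𝓘(ℝ, R4) (fun y ↦ S.dt y (Z y)) x X = 0 := by
      rw [S.K_time Z x X (hZ.diffAt hW hx)]
      change S.dt x (S.K Z x X) = 0
      rw [hZd X]
      exact (L X).2
    have h4 : mvfderiv 𝓘(ℝ, R4) (fun y ↦ (S.dt y (Z y))⁻¹) x X = 0 := by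
      have h5 := mdiffAt_of_smoothOn hW hdt hx
      have h6 := mdiffAt_of_smoothOn hW' hinv hx'
      have h7 := mvfderiv_bilin (ContinuousLinearMap.mul ℝ ℝ) h5 h6 X
      have h8 : (fun y ↦ ContinuousLinearMap.mul ℝ ℝ (S.dt y (Z y)) (S.dt y (Z y))⁻¹) =ᶠ[𝓝 x]
          fun _ ↦ (1 : ℝ) := by
        filter_upwards [hW'.mem_nhds hx'] with y hy
        exact mul_inv_cancel₀ hy.2
      rw [mvfderiv_congr_apply h8, mvfderiv_const, h3, hZx1] at h7
      simpa using h7.symm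
    rw [h1, h2, h4, zero_smul, add_zero, hZx1, inv_one, one_smul, hZd]
    rfl

/-- An observer that is parallel at a point. -/
lemma exists_parallel_observer (v : S.J1 x) :
    ∃ (o : ∀ x, S.J1 x) (W : Set M), IsOpen W ∧ x ∈ W ∧ S.IsObserverOn W o ∧ o x = v ∧
      ∀ X, S.K (fun y ↦ (o y).1) x X = 0 :=
  S.exists_observer v 0

/-- The spacelike part of a vector field with respect to an observer is smooth. -/
lemma verSmoothOn_spacePart (hW : IsOpen W) {o : ∀ x, S.J1 x} (ho : S.IsObserverOn W o)
    {X : ∀ x : M, Tan x} (hX : SmoothOn R4 W X) :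
    VerSmoothOn S.t W (fun y ↦ S.spacePart y (o y) (X y)) :=
  hX.sub (SmoothOn.smul (contMDiffOn_dt hW hX) ho)

lemma VerSmoothOn.add {Y Z : ∀ x, S.VE x} (hY : VerSmoothOn S.t W Y) (hZ : VerSmoothOn S.t W Z) :
    VerSmoothOn S.t W (fun y ↦ Y y + Z y) := SmoothOn.add hY hZ

lemma VerSmoothOn.sub {Y Z : ∀ x, S.VE x} (hY : VerSmoothOn S.t W Y) (hZ : VerSmoothOn S.t W Z) :
    VerSmoothOn S.t W (fun y ↦ Y y - Z y) := SmoothOn.sub hY hZ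

lemma VerSmoothOn.smul {Y : ∀ x, S.VE x} {f : M → ℝ} (hf : ContMDiffOn 𝓘(ℝ, R4) 𝓘(ℝ, ℝ) ∞ f W)
    (hY : VerSmoothOn S.t W Y) : VerSmoothOn S.t W (fun y ↦ f y • Y y) := SmoothOn.smul hf hY

lemma contMDiffOn_div {f h : M → ℝ} (hf : ContMDiffOn 𝓘(ℝ, R4) 𝓘(ℝ, ℝ) ∞ f W)
    (hh : ContMDiffOn 𝓘(ℝ, R4) 𝓘(ℝ, ℝ) ∞ h W) (h0 : ∀ x ∈ W, h x ≠ 0) :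
    ContMDiffOn 𝓘(ℝ, R4) 𝓘(ℝ, ℝ) ∞ (fun x ↦ f x / h x) W := by
  intro y hy
  have h1 : ContMDiffAt 𝓘(ℝ, ℝ) 𝓘(ℝ, ℝ) ∞ (fun r : ℝ ↦ r⁻¹) (h y) :=
    (contDiffAt_inv ℝ (h0 y hy)).contMDiffAt
  have h2 : ContMDiffWithinAt 𝓘(ℝ, R4) 𝓘(ℝ, ℝ) ∞ (fun x ↦ (h x)⁻¹) W y :=
    h1.comp_contMDiffWithinAt y (hh y hy)
  exact ((hf y hy).mul h2).congr (fun _ _ ↦ div_eq_mul_inv _ _) (div_eq_mul_inv _ _)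

variable (S) in
/-- Local orthogonal frames of the vertical bundle. -/
lemma exists_orthogonal_frame (x : M) : ∃ (W : Set M) (E : Fin 3 → ∀ y, S.VE y), IsOpen W ∧ x ∈ W ∧
    (∀ i, VerSmoothOn S.t W (E i)) ∧ (∀ y ∈ W, ∀ i j, i ≠ j → S.g y (E i y) (E j y) = 0) ∧
    ∀ y ∈ W, ∀ i, E i y ≠ 0 := by
  obtain ⟨e⟩ := S.exists_orientedFrame x
  obtain ⟨o, W, hW, hx, ho, -, -⟩ := S.exists_parallel_observer (S.someObserver x)
  let W₁ := W ∩ (trivializationAt R4 (TangentSpace 𝓘(ℝ, R4) : M → Type) x).baseSet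
  have hW₁ : IsOpen W₁ := hW.inter (Trivialization.open_baseSet _)
  have hx₁ : x ∈ W₁ := ⟨hx, mem_baseSet_extend x⟩
  -- Spacelike extensions of an orthonormal basis at `x`. Gram–Schmidt is run on them without
  -- normalization, hence without square roots, shrinking the neighbourhood so that the vectors stay
  -- nonzero.
  let B : Fin 3 → ∀ y, S.VE y := fun i y ↦ S.spacePart y (o y) (FiberBundle.extend R4 (e.b i : Tan x) y)
  have hB : ∀ i, VerSmoothOn S.t W₁ (B i) := fun i ↦ verSmoothOn_spacePart hW₁
    (SmoothOn.mono ho inter_subset_left) ((smoothOn_extend (e.b i : Tan x)).mono inter_subset_right)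
  have hBx : ∀ i, B i x = e.b i := fun i ↦ by
    refine Subtype.ext ?_
    change FiberBundle.extend R4 (e.b i : Tan x) x - S.dt x (FiberBundle.extend R4 (e.b i : Tan x) x) • (o x).1 = _
    rw [FiberBundle.extend_apply_self]
    have : S.dt x (e.b i : Tan x) = 0 := (e.b i).2
    rw [this, zero_smul, sub_zero]
  have hcut : ∀ (W₁ : Set M) (Y : ∀ y, S.VE y), IsOpen W₁ → x ∈ W₁ → VerSmoothOn S.t W₁ Y → Y x ≠ 0 →
      ∃ W₂ ⊆ W₁, IsOpen W₂ ∧ x ∈ W₂ ∧ ∀ y ∈ W₂, S.g y (Y y) (Y y) ≠ 0 := by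
    intro W₁ Y hW₁ hx₁ hY h0
    exact ⟨W₁ ∩ (fun y ↦ S.g y (Y y) (Y y)) ⁻¹' {0}ᶜ, inter_subset_left,
      (S.g_smooth W₁ Y Y hW₁ hY hY).continuousOn.isOpen_inter_preimage hW₁ isOpen_compl_singleton,
      ⟨hx₁, (S.g_pos x _ h0).ne'⟩, fun y hy ↦ hy.2⟩
  let E₀ := B 0
  obtain ⟨W₂, hW₂₁, hW₂, hx₂, h₂⟩ := hcut W₁ E₀ hW₁ hx₁ (hB 0) (by
    change B 0 x ≠ 0
    rw [hBx]
    exact e.b.ne_zero 0)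
  let E₁ : ∀ y, S.VE y := fun y ↦ B 1 y - (S.g y (E₀ y) (B 1 y) / S.g y (E₀ y) (E₀ y)) • E₀ y
  have s₀ : VerSmoothOn S.t W₂ E₀ := SmoothOn.mono (hB 0) hW₂₁
  have s₁ : VerSmoothOn S.t W₂ E₁ := by
    have h1 : VerSmoothOn S.t W₂ (B 1) := SmoothOn.mono (hB 1) hW₂₁
    exact VerSmoothOn.sub h1 (VerSmoothOn.smul (contMDiffOn_div (S.g_smooth _ _ _ hW₂ s₀ h1)
      (S.g_smooth _ _ _ hW₂ s₀ s₀) h₂) s₀)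
  have g01 : S.g x (e.b 0) (e.b 1) = 0 := by simp [e.ortho]
  have g02 : S.g x (e.b 0) (e.b 2) = 0 := by simp [e.ortho]
  have g12 : S.g x (e.b 1) (e.b 2) = 0 := by simp [e.ortho]
  have hE₁x : E₁ x = e.b 1 := by
    simp only [E₁, E₀, hBx, g01, zero_div, zero_smul, sub_zero]
  obtain ⟨W₃, hW₃₂, hW₃, hx₃, h₃⟩ := hcut W₂ E₁ hW₂ hx₂ s₁ (by rw [hE₁x]; exact e.b.ne_zero 1)
  let E₂ : ∀ y, S.VE y := fun y ↦ B 2 y - (S.g y (E₀ y) (B 2 y) / S.g y (E₀ y) (E₀ y)) • E₀ y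
    - (S.g y (E₁ y) (B 2 y) / S.g y (E₁ y) (E₁ y)) • E₁ y
  have s₀' : VerSmoothOn S.t W₃ E₀ := SmoothOn.mono s₀ hW₃₂
  have s₁' : VerSmoothOn S.t W₃ E₁ := SmoothOn.mono s₁ hW₃₂
  have s₂ : VerSmoothOn S.t W₃ E₂ := by
    have h1 : VerSmoothOn S.t W₃ (B 2) := SmoothOn.mono (hB 2) (hW₃₂.trans hW₂₁)
    exact VerSmoothOn.sub (VerSmoothOn.sub h1 (VerSmoothOn.smul (contMDiffOn_div
      (S.g_smooth _ _ _ hW₃ s₀' h1) (S.g_smooth _ _ _ hW₃ s₀' s₀') fun y hy ↦ h₂ y (hW₃₂ hy)) s₀'))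
      (VerSmoothOn.smul (contMDiffOn_div (S.g_smooth _ _ _ hW₃ s₁' h1)
      (S.g_smooth _ _ _ hW₃ s₁' s₁') h₃) s₁')
  have hE₂x : E₂ x = e.b 2 := by
    simp only [E₂, hE₁x]
    simp only [E₀, hBx, g02, g12, zero_div, zero_smul, sub_zero]
  obtain ⟨W₄, hW₄₃, hW₄, hx₄, h₄⟩ := hcut W₃ E₂ hW₃ hx₃ s₂ (by rw [hE₂x]; exact e.b.ne_zero 2)
  have o01 : ∀ y ∈ W₄, S.g y (E₀ y) (E₁ y) = 0 := fun y hy ↦ by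
    have := h₂ y (hW₃₂ (hW₄₃ hy))
    simp only [E₁, map_sub, map_smul, smul_eq_mul]
    rw [div_mul_cancel₀ _ this, sub_self]
  have o02 : ∀ y ∈ W₄, S.g y (E₀ y) (E₂ y) = 0 := fun y hy ↦ by
    have := h₂ y (hW₃₂ (hW₄₃ hy))
    simp only [E₂, map_sub, map_smul, smul_eq_mul]
    rw [div_mul_cancel₀ _ this, o01 y hy, mul_zero, sub_self, sub_zero]
  have o12 : ∀ y ∈ W₄, S.g y (E₁ y) (E₂ y) = 0 := fun y hy ↦ by
    have := h₃ y (hW₄₃ hy)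
    simp only [E₂, map_sub, map_smul, smul_eq_mul]
    rw [div_mul_cancel₀ _ this, S.g_symm y (E₁ y) (E₀ y), o01 y hy, mul_zero, sub_zero, sub_self]
  have z : ∀ y, S.g y 0 0 = 0 := fun y ↦ by simp
  refine ⟨W₄, ![E₀, E₁, E₂], hW₄, hx₄, fun i ↦ ?_, fun y hy i j hij ↦ ?_, fun y hy i ↦ ?_⟩
  · fin_cases i
    exacts [SmoothOn.mono s₀' hW₄₃, SmoothOn.mono s₁' hW₄₃, SmoothOn.mono s₂ hW₄₃]
  · fin_cases i <;> fin_cases j <;> first | exact absurd rfl hij | skip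
    exacts [o01 y hy, o02 y hy, (S.g_symm y _ _).trans (o01 y hy), o12 y hy,
      (S.g_symm y _ _).trans (o02 y hy), (S.g_symm y _ _).trans (o12 y hy)]
  · fin_cases i
    · exact fun h ↦ h₂ y (hW₃₂ (hW₄₃ hy)) (by rw [show E₀ y = 0 from h]; exact z y)
    · exact fun h ↦ h₃ y (hW₄₃ hy) (by rw [show E₁ y = 0 from h]; exact z y)
    · exact fun h ↦ h₄ y hy (by rw [show E₂ y = 0 from h]; exact z y)

/-- The vertical field of a smooth covector field is smooth. -/
lemma verSmoothOn_sharp (hW : IsOpen W) {φ : ∀ x, Module.Dual ℝ (S.VE x)}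
    (hφ : S.CovecSmoothOn W φ) : VerSmoothOn S.t W (fun x ↦ S.sharp x (φ x)) := by
  refine smoothOn_of_forall fun x hx ↦ ?_
  obtain ⟨W₁, E, hW₁, hx₁, hE, hort, h0⟩ := S.exists_orthogonal_frame x
  have hW₂ : IsOpen (W ∩ W₁) := hW.inter hW₁
  have hE' : ∀ i, VerSmoothOn S.t (W ∩ W₁) (E i) := fun i ↦ SmoothOn.mono (hE i) inter_subset_right
  -- In an orthogonal frame `φ^♯` is the sum of the terms `φ(Eᵢ) / g(Eᵢ, Eᵢ) Eᵢ`.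
  have hs : ∀ i, VerSmoothOn S.t (W ∩ W₁)
      (fun y ↦ (φ y (E i y) / S.g y (E i y) (E i y)) • E i y) := fun i ↦
    VerSmoothOn.smul (contMDiffOn_div (hφ _ _ hW₂ inter_subset_left (hE' i))
      (S.g_smooth _ _ _ hW₂ (hE' i) (hE' i)) fun y hy ↦ (S.g_pos y _ (h0 y hy.2 i)).ne') (hE' i)
  refine ⟨W ∩ W₁, hW₂, ⟨hx, hx₁⟩, ?_⟩
  refine SmoothOn.congr (VerSmoothOn.add (VerSmoothOn.add (hs 0) (hs 1)) (hs 2)) fun y hy ↦ ?_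
  congr 1
  symm
  refine eq_sharp fun w ↦ ?_
  have hort := hort y hy.2
  have hne : ∀ i, S.g y (E i y) (E i y) ≠ 0 := fun i ↦ (S.g_pos y _ (h0 y hy.2 i)).ne'
  have hli : LinearIndependent ℝ (fun i ↦ E i y) := by
    refine LinearMap.BilinForm.linearIndependent_of_iIsOrtho (B := S.g y) ?_ ?_
    · exact fun i j hij ↦ hort i j hij
    · exact fun i h ↦ hne i h
  let b := basisOfLinearIndependentOfCardEqFinrank hli (by rw [Fintype.card_fin]; exact (S.finrank_VE y).symm)
  have hb : ∀ i, b i = E i y := fun i ↦ by simp [b]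
  rw [← b.sum_repr w]
  simp only [map_sum, map_smul, hb]
  refine Finset.sum_congr rfl fun i _ ↦ ?_
  congr 1
  simp only [map_add, LinearMap.add_apply, map_smul, LinearMap.smul_apply, smul_eq_mul]
  fin_cases i
  · simp only [Fin.zero_eta, hort 1 0 (by decide), hort 2 0 (by decide), div_mul_cancel₀ _ (hne 0)]
    ring
  · simp only [Fin.mk_one, hort 0 1 (by decide), hort 2 1 (by decide), div_mul_cancel₀ _ (hne 1)]
    ring
  · simp only [Fin.reduceFinMk, hort 0 2 (by decide), hort 1 2 (by decide), div_mul_cancel₀ _ (hne 2)]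
    ring

end Spacetime

end SpacetimeConnection

/-! ### The quantum connection -/

section TangentOfSections

variable {M : Type*} [TopologicalSpace M] [ChartedSpace R4 M] [IsManifold 𝓘(ℝ, R4) ∞ M]
  {F : Type*} [NormedAddCommGroup F] [NormedSpace ℝ F] [FiniteDimensional ℝ F]
  {V : M → Type*} [TopologicalSpace (TotalSpace F V)]
  [∀ x, AddCommGroup (V x)] [∀ x, Module ℝ (V x)] [∀ x, TopologicalSpace (V x)]
  [FiberBundle F V] [VectorBundle ℝ F V] [ContMDiffVectorBundle ∞ F V 𝓘(ℝ, R4)]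
  {cov : (∀ x, V x) → ∀ x : M, Tan x → V x} {x : M}
  {A : Type*} [NormedAddCommGroup A] [NormedSpace ℝ A]

/-- The covariant derivative is the vertical part of the tangent map of the section. -/
lemma tsec_eq_hlift_add (hc : IsConnAt F cov x) {s : ∀ x, V x} (hs : DiffAt F s x) (X : Tan x) :
    tsec (F := F) s x X = hlift cov (TotalSpace.mk' F x (s x)) X
      + vlift (TotalSpace.mk' F x (s x)) (cov s x X) := by
  have hx := mem_baseSet_extend (F := F) (V := V) x
  refine totTan_ext (u := TotalSpace.mk' F x (s x)) hx ?_ ?_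
  · rw [dproj_add, dproj_hlift, dproj_vlift, add_zero, dproj_tsec hs]
  · rw [dfib_add, dfib_hlift (u := TotalSpace.mk' F x (s x)) hx hc hs rfl,
      dfib_vlift (u := TotalSpace.mk' F x (s x)) hx, dfib_tsec hx hs]
    exact (sub_add_cancel _ _).symm

/-- Turns derivatives along vertical vectors into ordinary derivatives along affine lines of the
fibre. -/
lemma hasDerivAt_vlift {g : TotalSpace F V → A} {w : V x}
    (hg : MDifferentiableAt (𝓘(ℝ, R4).prod 𝓘(ℝ, F)) 𝓘(ℝ, A) g (TotalSpace.mk' F x w)) (a : V x) :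
    HasDerivAt (fun s : ℝ ↦ g (TotalSpace.mk' F x (w + s • a)))
      (mvfderiv (𝓘(ℝ, R4).prod 𝓘(ℝ, F)) g (TotalSpace.mk' F x w)
        (vlift (TotalSpace.mk' F x w) a)) 0 := by
  have hcur := mdifferentiableAt_vcurve (TotalSpace.mk' F x w) a 0
  have h0 : TotalSpace.mk' F x w = TotalSpace.mk' F x (w + (0 : ℝ) • a) := by simp
  have key : ∀ u, u = TotalSpace.mk' F x (w + (0 : ℝ) • a) →
      MDifferentiableAt (𝓘(ℝ, R4).prod 𝓘(ℝ, F)) 𝓘(ℝ, A) g u →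
      MDifferentiableAt (𝓘(ℝ, R4).prod 𝓘(ℝ, F)) 𝓘(ℝ, A) g (TotalSpace.mk' F x (w + (0 : ℝ) • a)) :=
    fun u hu h ↦ hu ▸ h
  have hg' := key _ h0 hg
  have hcomp : MDifferentiableAt 𝓘(ℝ, ℝ) 𝓘(ℝ, A)
      (fun s : ℝ ↦ g (TotalSpace.mk' F x (w + s • a))) 0 := MDifferentiableAt.comp (0 : ℝ) hg' hcur
  have hd := hcomp.differentiableAt.hasDerivAt
  have h1 := mfderiv_comp_apply_of_eq (I'' := 𝓘(ℝ, A)) (0 : ℝ) hg hcur h0.symm (1 : ℝ)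
  convert hd using 1
  have h2 : mfderiv 𝓘(ℝ, ℝ) 𝓘(ℝ, A) (fun s : ℝ ↦ g (TotalSpace.mk' F x (w + s • a))) 0
      = fderiv ℝ (fun s : ℝ ↦ g (TotalSpace.mk' F x (w + s • a))) 0 := mfderiv_eq_fderiv
  have h3 : fderiv ℝ (fun s : ℝ ↦ g (TotalSpace.mk' F x (w + s • a))) 0 1
      = deriv (fun s : ℝ ↦ g (TotalSpace.mk' F x (w + s • a))) 0 := fderiv_apply_one_eq_deriv
  exact h1.symm.trans ((congrArg (fun T : ℝ →L[ℝ] A ↦ T (1 : ℝ)) h2).trans h3)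

end TangentOfSections

/-! ### Differentiation along observers -/

namespace Spacetime

variable {M : Type*} [TopologicalSpace M] [ChartedSpace R4 M] [IsManifold 𝓘(ℝ, R4) ∞ M]
  {S : Spacetime M} {x : M} {A : Type*} [NormedAddCommGroup A] [NormedSpace ℝ A]

/-- Differentiation of a function of velocities along an observer. -/
lemma mvfderiv_comp_observer {g : TangentBundle 𝓘(ℝ, R4) M → A} {v : S.J1 x} {o : ∀ x, S.J1 x}
    (hg : MDifferentiableAt (𝓘(ℝ, R4).prod 𝓘(ℝ, R4)) 𝓘(ℝ, A) g (TotalSpace.mk' R4 x v.1))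
    (ho : DiffAt R4 (fun y ↦ (o y).1) x) (h : o x = v) (X : Tan x) :
    mvfderiv 𝓘(ℝ, R4) (fun y ↦ g (TotalSpace.mk' R4 y (o y).1)) x X
      = mvfderiv (𝓘(ℝ, R4).prod 𝓘(ℝ, R4)) g (TotalSpace.mk' R4 x v.1)
          (hlift (F := R4) (V := (TangentSpace 𝓘(ℝ, R4) : M → Type)) (fun s y Z ↦ S.K s y Z)
            (TotalSpace.mk' R4 x v.1) X)
        + mvfderiv (𝓘(ℝ, R4).prod 𝓘(ℝ, R4)) g (TotalSpace.mk' R4 x v.1)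
          (vlift (F := R4) (V := (TangentSpace 𝓘(ℝ, R4) : M → Type))
            (TotalSpace.mk' R4 x v.1) (S.K (fun y ↦ (o y).1) x X)) := by
  subst h
  rw [← map_add]
  have h1 := tsec_eq_hlift_add (S.isConnAt_K x) ho X
  refine (mvfderiv_comp_vec x hg ho X).trans ?_
  exact congrArg _ h1

/-- The velocity obtained by adding a spacelike vector. -/
def J1.add (v : S.J1 x) (a : S.VE x) : S.J1 x :=
  ⟨v.1 + (a : Tan x), by
    have h := v.2
    have h' : S.dt x a = 0 := a.2
    rw [map_add, h, h', add_zero]⟩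

lemma J1.add_sub (v v' : S.J1 x) : v.add (v'.sub v) = v' := J1.ext (add_sub_cancel v.1 v'.1)

lemma J1.sub_add (v : S.J1 x) (a : S.VE x) : (v.add a).sub v = a :=
  Subtype.ext (add_sub_cancel_left v.1 (a : Tan x))

lemma spacePart_add (v : S.J1 x) (a : S.VE x) (X : Tan x) :
    S.spacePart x (v.add a) X = S.spacePart x v X - S.dt x X • a := by
  refine Subtype.ext ?_
  change X - S.dt x X • (v.1 + (a : Tan x)) = X - S.dt x X • v.1 - S.dt x X • (a : Tan x)
  module

lemma coe_spacePart (v : S.J1 x) (X : Tan x) :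
    (S.spacePart x v X : Tan x) = X - S.dt x X • v.1 := rfl

lemma ofTan_coe (v : S.J1 x) (h : S.dt x v.1 ≠ 0) : J1.ofTan S v.1 h = v := by
  refine J1.ext ?_
  change (S.dt x v.1)⁻¹ • v.1 = v.1
  rw [show S.dt x v.1 = 1 from v.2, inv_one, one_smul]

lemma dt_ne_zero (v : S.J1 x) : S.dt x v.1 ≠ 0 := by
  rw [show S.dt x v.1 = 1 from v.2]
  exact one_ne_zero

lemma toVer_zero : toVer S.t x 0 = 0 := Subtype.ext (coe_toVer (S.VE x).zero_mem)

/-- Every term of `Ω` contains a vertical component, and the vertical component of `To` is `∇o`. -/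
lemma pullOmega_of_parallel {o : ∀ x, S.J1 x} (h : ∀ X, S.K (fun y ↦ (o y).1) x X = 0)
    (X Y : Tan x) : S.pullOmega o x X Y = 0 := by
  simp [pullOmega, Omega, h, toVer_zero]

end Spacetime

/-! ### Smoothness of the quantum connection in the velocity -/

namespace QuantumConnection

open Spacetime

variable {M : Type*} [TopologicalSpace M] [T2Space M] [ChartedSpace R4 M]
  [IsManifold 𝓘(ℝ, R4) ∞ M] {S : Spacetime M} {Q : M → Type*}
  [TopologicalSpace (TotalSpace ℂ Q)] [∀ x, NormedAddCommGroup (Q x)]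
  [∀ x, InnerProductSpace ℂ (Q x)] [FiberBundle ℂ Q] [VectorBundle ℂ ℂ Q]
  [VectorBundle ℝ ℂ Q] [ContMDiffVectorBundle ∞ ℂ Q 𝓘(ℝ, R4)]
  (P : QuantumConnection S Q) {W : Set M} {x : M} {o : ∀ x, S.J1 x} {s : ∀ x, Q x}
  {X : ∀ x : M, Tan x}

lemma isConnAt (o : ∀ x, S.J1 x) (x : M) : IsConnAt ℂ (fun s y X ↦ P.Ch s y (o y) X) x :=
  isConnAt_of_isCovariantDerivativeOn (P.isCov o) x

/-- By universality the value at `v` is that of an ordinary connection at `x`, for any observer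
through `v`, smooth or not; `obsAt` provides one. -/
lemma Ch_congr {s s' : ∀ x, Q x} (hs : DiffAt ℂ s x) (h : ∀ᶠ y in 𝓝 x, s' y = s y) (v : S.J1 x)
    (X : Tan x) : P.Ch s' x v X = P.Ch s x v X := by
  have := (P.isConnAt (obsAt x v) x).congr hs h X
  simpa only [obsAt_self] using this

open Classical in
/-- The quantum connection at a tangent vector that is not spacelike. -/
def chTan (s : ∀ x, Q x) (w : TangentBundle 𝓘(ℝ, R4) M) (X : Tan w.proj) : Q w.proj :=
  if h : S.dt w.proj w.snd ≠ 0 then P.Ch s w.proj (J1.ofTan S w.snd h) X else 0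

lemma chTan_coe (v : S.J1 x) (X : Tan x) :
    P.chTan s (TotalSpace.mk' R4 x v.1) X = P.Ch s x v X := by
  rw [chTan, dif_pos (dt_ne_zero v)]
  exact congrArg (fun z ↦ P.Ch s x z X) (ofTan_coe v _)

lemma contMDiffOn_chTan (hW : IsOpen W) (hs : SmoothOn ℂ W s) (hX : SmoothOn R4 W X) :
    ContMDiffOn (𝓘(ℝ, R4).prod 𝓘(ℝ, R4)) (𝓘(ℝ, R4).prod 𝓘(ℝ, ℂ)) ∞
      (fun w : TangentBundle 𝓘(ℝ, R4) M ↦ TotalSpace.mk' ℂ (E := Q) w.proj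
        (P.chTan s w (X w.proj))) {w | w.proj ∈ W ∧ S.dt w.proj w.snd ≠ 0} := by
  intro w hw
  obtain ⟨s', hs', W₁, h₁, hW₁, hx₁, e₁⟩ := exists_global_section hW hw.1 hs
  obtain ⟨X', hX', W₂, h₂, hW₂, hx₂, e₂⟩ := exists_global_section hW hw.1 hX
  have h := (P.smooth s' X' hs' hX' w hw.2).mono
    (show {w | w.proj ∈ W ∧ S.dt w.proj w.snd ≠ 0} ⊆ _ from fun w hw ↦ hw.2)
  have key : ∀ w : TangentBundle 𝓘(ℝ, R4) M, w.proj ∈ W₁ ∩ W₂ →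
      P.chTan s w (X w.proj) = P.chTan s' w (X' w.proj) := by
    intro w hw
    unfold chTan
    split_ifs
    · rw [e₂ _ hw.2]
      refine P.Ch_congr (hs'.diffAt isOpen_univ (mem_univ _)) ?_ _ _
      filter_upwards [hW₁.mem_nhds hw.1] with y hy using (e₁ y hy).symm
    · rfl
  refine h.congr_of_eventuallyEq ?_ ?_
  · filter_upwards [mem_nhdsWithin_of_mem_nhds ((isOpen_over R4 (TangentSpace 𝓘(ℝ, R4) : M → Type)
      (hW₁.inter hW₂)).mem_nhds ⟨hx₁, hx₂⟩)] with y hy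
    exact congrArg _ (key y hy)
  · exact congrArg _ (key w ⟨hx₁, hx₂⟩)

lemma isSmoothConnOn_Ch (ho : S.IsObserverOn W o) :
    IsSmoothConnOn ℂ W (fun s y X ↦ P.Ch s y (o y) X) where
  conn x _ := P.isConnAt o x
  map_add s x X Y := map_add _ _ _
  map_smul s x c X := map_smul _ _ _
  smooth W' h hW' s X hs hX := by
    have h1 := (P.contMDiffOn_chTan hW' hs hX).comp (SmoothOn.mono ho h)
      (fun y hy ↦ ⟨hy, dt_ne_zero (o y)⟩)
    refine ContMDiffOn.congr h1 fun y hy ↦ ?_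
    exact congrArg (TotalSpace.mk' ℂ y) (P.chTan_coe (o y) (X y)).symm

/-- The fibre coordinate of the quantum connection is differentiable in the velocity. -/
lemma mdifferentiableAt_chTan {e : Trivialization ℂ (π ℂ Q)} [MemTrivializationAtlas e]
    (hW : IsOpen W) (hs : SmoothOn ℂ W s) (hX : SmoothOn R4 W X) (hx : x ∈ W)
    (hxe : x ∈ e.baseSet) (v : S.J1 x) :
    MDifferentiableAt (𝓘(ℝ, R4).prod 𝓘(ℝ, R4)) 𝓘(ℝ, ℂ)
      (fun w : TangentBundle 𝓘(ℝ, R4) M ↦ fib e w.proj (P.chTan s w (X w.proj)))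
      (TotalSpace.mk' R4 x v.1) := by
  have hopen : IsOpen {w : TangentBundle 𝓘(ℝ, R4) M | w.proj ∈ W ∧ S.dt w.proj w.snd ≠ 0} := by
    have h1 := S.t_smooth.continuous_tangentMap (by simp)
    have h2 : Continuous (fun w : TangentBundle 𝓘(ℝ, R4) M ↦ S.dt w.proj w.snd) :=
      (contMDiff_snd_tangentBundle_modelSpace (n := ∞) ℝ 𝓘(ℝ, ℝ)).continuous.comp h1
    exact (isOpen_over R4 (TangentSpace 𝓘(ℝ, R4) : M → Type) hW).inter
      (isOpen_compl_singleton.preimage h2)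
  have h1 := (P.contMDiffOn_chTan hW hs hX).contMDiffAt
    (hopen.mem_nhds (x := TotalSpace.mk' R4 x v.1) ⟨hx, dt_ne_zero v⟩)
  have h2 := (h1.mdifferentiableAt (by simp))
  exact MDifferentiableAt.comp (I' := 𝓘(ℝ, R4).prod 𝓘(ℝ, ℂ))
    (g := fun p : TotalSpace ℂ Q ↦ (e p).2) (TotalSpace.mk' R4 x v.1)
    (mdifferentiableAt_fib_snd (u := TotalSpace.mk' ℂ x _) hxe) h2

end QuantumConnection

lemma fib_csmul {M : Type*} [TopologicalSpace M] {F : Type*} [NormedAddCommGroup F]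
    [NormedSpace ℂ F] {V : M → Type*} [TopologicalSpace (TotalSpace F V)]
    [∀ x, NormedAddCommGroup (V x)] [∀ x, InnerProductSpace ℂ (V x)] [FiberBundle F V]
    [VectorBundle ℂ F V] {e : Trivialization F (π F V)} [MemTrivializationAtlas e] {x : M}
    (hx : x ∈ e.baseSet) (c : ℂ) (w : V x) : fib e x (c • w) = c • fib e x w :=
  (e.linear ℂ hx).map_smul c w

/-! ### Dependence of the quantum connection on the velocity -/

namespace QuantumConnection

open Spacetime

variable {M : Type*} [TopologicalSpace M] [T2Space M] [ChartedSpace R4 M]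
  [IsManifold 𝓘(ℝ, R4) ∞ M] {S : Spacetime M} {Q : M → Type*}
  [TopologicalSpace (TotalSpace ℂ Q)] [∀ x, NormedAddCommGroup (Q x)]
  [∀ x, InnerProductSpace ℂ (Q x)] [FiberBundle ℂ Q] [VectorBundle ℂ ℂ Q]
  [VectorBundle ℝ ℂ Q] [ContMDiffVectorBundle ∞ ℂ Q 𝓘(ℝ, R4)]
  (P : QuantumConnection S Q) {W : Set M} {x : M} {o : ∀ x, S.J1 x} {s : ∀ x, Q x}
  {X : ∀ x : M, Tan x}

/-- The derivative of `fib (Ch_Y q)` at the velocity `v` along the spacelike vector `a`. -/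
def chVer (q : Q x) (Y : Tan x) (v : S.J1 x) (a : Tan x) : ℂ :=
  mvfderiv (𝓘(ℝ, R4).prod 𝓘(ℝ, R4))
    (fun w : TangentBundle 𝓘(ℝ, R4) M ↦ fib (trivializationAt ℂ Q x) w.proj
      (P.chTan (FiberBundle.extend ℂ q) w (FiberBundle.extend R4 Y w.proj : Tan w.proj)))
    (TotalSpace.mk' R4 x v.1)
    (vlift (F := R4) (V := (TangentSpace 𝓘(ℝ, R4) : M → Type)) (TotalSpace.mk' R4 x v.1) a)

lemma mdifferentiableAt_chTan_extend (q : Q x) (Y : Tan x) (v : S.J1 x) :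
    MDifferentiableAt (𝓘(ℝ, R4).prod 𝓘(ℝ, R4)) 𝓘(ℝ, ℂ)
    (fun w : TangentBundle 𝓘(ℝ, R4) M ↦ fib (trivializationAt ℂ Q x) w.proj
      (P.chTan (FiberBundle.extend ℂ q) w (FiberBundle.extend R4 Y w.proj : Tan w.proj)))
    (TotalSpace.mk' R4 x v.1) := by
  have h1 := smoothOn_extend (F := ℂ) q
  have h2 := smoothOn_extend (F := R4) Y
  have hx := mem_baseSet_extend (F := ℂ) (V := Q) x
  have hx' := mem_baseSet_extend (F := R4) (V := (TangentSpace 𝓘(ℝ, R4) : M → Type)) x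
  exact P.mdifferentiableAt_chTan
    ((Trivialization.open_baseSet _).inter (Trivialization.open_baseSet _))
    (h1.mono inter_subset_left) (h2.mono inter_subset_right) ⟨hx, hx'⟩ hx v

/-- Chain rule along two observers through `v`: the horizontal contributions agree, and the vertical
one is absent for `o` because `∇_X o = 0`. -/
lemma dcoord_Ch_sub (q : Q x) (X Y : Tan x) (v : S.J1 x) {o o' : ∀ x, S.J1 x}
    (ho : DiffAt R4 (fun y ↦ (o y).1) x) (ho' : DiffAt R4 (fun y ↦ (o' y).1) x)
    (h : o x = v) (h' : o' x = v) (hp : S.K (fun y ↦ (o y).1) x X = 0) :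
    dcoord (trivializationAt ℂ Q x) (fun y ↦ P.Ch (FiberBundle.extend ℂ q) y (o' y)
        (FiberBundle.extend R4 Y y)) x X
      - dcoord (trivializationAt ℂ Q x) (fun y ↦ P.Ch (FiberBundle.extend ℂ q) y (o y)
        (FiberBundle.extend R4 Y y)) x X
      = P.chVer q Y v (S.K (fun y ↦ (o' y).1) x X) := by
  have key : ∀ {o : ∀ x, S.J1 x}, DiffAt R4 (fun y ↦ (o y).1) x → o x = v →
      dcoord (trivializationAt ℂ Q x) (fun y ↦ P.Ch (FiberBundle.extend ℂ q) y (o y)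
        (FiberBundle.extend R4 Y y)) x X
      = mvfderiv (𝓘(ℝ, R4).prod 𝓘(ℝ, R4))
        (fun w : TangentBundle 𝓘(ℝ, R4) M ↦ fib (trivializationAt ℂ Q x) w.proj
          (P.chTan (FiberBundle.extend ℂ q) w (FiberBundle.extend R4 Y w.proj : Tan w.proj)))
        (TotalSpace.mk' R4 x v.1)
        (hlift (F := R4) (V := (TangentSpace 𝓘(ℝ, R4) : M → Type)) (fun s y Z ↦ S.K s y Z)
            (TotalSpace.mk' R4 x v.1) X) + P.chVer q Y v (S.K (fun y ↦ (o y).1) x X) := by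
    intro o ho h
    refine Eq.trans ?_ (mvfderiv_comp_observer (P.mdifferentiableAt_chTan_extend q Y v) ho h X)
    refine congrArg (fun f ↦ mvfderiv 𝓘(ℝ, R4) f x X) (funext fun y ↦ ?_)
    exact congrArg (fib _ y) (P.chTan_coe (o y) _).symm
  have hz : P.chVer q Y v 0 = 0 := by
    have : vlift (F := R4) (V := (TangentSpace 𝓘(ℝ, R4) : M → Type)) (TotalSpace.mk' R4 x v.1) 0
        = 0 := by
      have := vlift_smul (F := R4) (V := (TangentSpace 𝓘(ℝ, R4) : M → Type))
        (u := TotalSpace.mk' R4 x v.1) 0 0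
      simpa using this
    rw [chVer, this, map_zero]
  rw [key ho h, key ho' h', hp, hz]
  ring


/-- The vertical derivative of the quantum connection, from its curvature. -/
lemma chVer_eq (q : Q x) (Y : Tan x) (v : S.J1 x) (a : S.VE x) :
    P.chVer q Y v a = -Complex.I * ((S.coef * S.g x a (S.spacePart x v Y) : ℝ) : ℂ)
      * fib (trivializationAt ℂ Q x) x q := by
  -- With `l X = 1` and `l Y = 0`, an observer `o'` with covariant differential `l ⊗ a` moves by `a`
  -- in the direction `X` and is stationary in the direction `Y`. Compared with a parallel observer
  -- through `v`, only one of the two second derivatives in the curvature changes.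
  obtain ⟨l, hl, hlY⟩ : ∃ l : Tan x →ₗ[ℝ] ℝ, l ≠ 0 ∧ l Y = 0 := by
    have h1 : Submodule.span ℝ {Y} < ⊤ := by
      refine lt_top_iff_ne_top.2 fun h ↦ ?_
      have h2 : Module.finrank ℝ (Submodule.span ℝ {Y}) ≤ 1 := by
        simpa using finrank_span_le_card (R := ℝ) ({Y} : Set (Tan x))
      rw [h, finrank_top] at h2
      have h3 : Module.finrank ℝ (Tan x) = 4 := finrank_euclideanSpace_fin
      omega
    obtain ⟨l, hl, h⟩ := Submodule.exists_le_ker_of_lt_top _ h1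
    exact ⟨l, hl, h (Submodule.mem_span_singleton_self Y)⟩
  obtain ⟨X, hlX⟩ : ∃ X, l X = 1 := by
    obtain ⟨X, hX⟩ : ∃ X, l X ≠ 0 := by
      by_contra! h
      exact hl (LinearMap.ext h)
    exact ⟨(l X)⁻¹ • X, by rw [map_smul, smul_eq_mul, inv_mul_cancel₀ hX]⟩
  obtain ⟨o, W, hW, hx, ho, hox, hod⟩ := S.exists_parallel_observer v
  obtain ⟨o', W', hW', hx', ho', hox', hod'⟩ := S.exists_observer v (l.smulRight a)
  have hx0 := mem_baseSet_extend (F := ℂ) (V := Q) x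
  have hx1 := mem_baseSet_extend (F := R4) (V := (TangentSpace 𝓘(ℝ, R4) : M → Type)) x
  have hs := smoothOn_extend (F := ℂ) q
  have c1 := P.curvature W o hW ho x hx X Y q
  have c2 := P.curvature W' o' hW' ho' x hx' X Y q
  have dT : ∀ {o : ∀ x, S.J1 x} {W : Set M}, IsOpen W → x ∈ W → S.IsObserverOn W o →
      ∀ Z : Tan x, DiffAt ℂ (fun y ↦ P.Ch (FiberBundle.extend ℂ q) y (o y)
        (FiberBundle.extend R4 Z y)) x := by
    intro o W hW hx ho Z
    have h1 := (P.isSmoothConnOn_Ch ho).smooth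
      (W ∩ ((trivializationAt ℂ Q x).baseSet
        ∩ (trivializationAt R4 (TangentSpace 𝓘(ℝ, R4) : M → Type) x).baseSet)) inter_subset_left
      (hW.inter ((Trivialization.open_baseSet _).inter (Trivialization.open_baseSet _))) _ _
      (hs.mono fun y hy ↦ hy.2.1)
      ((smoothOn_extend (F := R4) Z).mono fun y hy ↦ hy.2.2)
    exact h1.diffAt (hW.inter ((Trivialization.open_baseSet _).inter
      (Trivialization.open_baseSet _))) ⟨hx, hx0, hx1⟩
  -- Change of an iterated covariant derivative. The inner sections for `o` and `o'` agree at `x`,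
  -- so the outer connection, whose velocity at `x` is `v` in both cases, contributes the same
  -- tensor term.
  have key : ∀ Z T : Tan x, fib (trivializationAt ℂ Q x) x (P.Ch (fun y ↦ P.Ch
        (FiberBundle.extend ℂ q) y (o' y) (FiberBundle.extend R4 Z y)) x v T)
      - fib (trivializationAt ℂ Q x) x (P.Ch (fun y ↦ P.Ch
        (FiberBundle.extend ℂ q) y (o y) (FiberBundle.extend R4 Z y)) x v T)
      = P.chVer q Z v (l T • (a : Tan x)) := by
    intro Z T
    have h1 := (P.isConnAt o x).fib_sub_dcoord hx0 (dT hW' hx' ho' Z) (dT hW hx ho Z)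
      (by rw [hox, hox']) T
    have h2 := P.dcoord_Ch_sub q T Z v (SmoothOn.diffAt hW ho hx) (SmoothOn.diffAt hW' ho' hx')
      hox hox' (hod T)
    rw [hod' T] at h2
    rw [hox] at h1
    have h3 : ((l.smulRight a T : S.VE x) : Tan x) = l T • (a : Tan x) := rfl
    rw [h3] at h2
    rw [← h2]
    linear_combination h1
  have c3 := congrArg (fib (trivializationAt ℂ Q x) x) c1
  have c4 := congrArg (fib (trivializationAt ℂ Q x) x) c2
  have z0 : P.chVer q X v (0 : Tan x) = 0 := by
    have h := key X Y
    have h2 := P.dcoord_Ch_sub q Y X v (SmoothOn.diffAt hW ho hx) (SmoothOn.diffAt hW ho hx)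
      hox hox (hod Y)
    rw [hod, sub_self] at h2
    exact h2.symm
  have k1 := key Y X
  have k2 := key X Y
  rw [hlX, one_smul] at k1
  rw [hlY, zero_smul, z0] at k2
  rw [pullOmega_of_parallel hod] at c3
  simp only [curv] at c3 c4
  rw [fib_sub hx0, fib_sub hx0, fib_csmul hx0, hox] at c3
  rw [fib_sub hx0, fib_sub hx0, fib_csmul hx0, hox'] at c4
  have hO : S.pullOmega o' x X Y = S.coef * S.g x a (S.spacePart x v Y) := by
    have h1 : ∀ T, toVer S.t x (S.K (fun y ↦ (o' y).1) x T) = l T • a := fun T ↦ by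
      rw [hod' T]
      exact Subtype.ext (coe_toVer ((l.smulRight a) T).2)
    rw [pullOmega, Omega, h1, h1, hlX, hlY, hox']
    simp
  rw [hO] at c4
  rw [← k1]
  simp only [smul_eq_mul, Complex.ofReal_zero, mul_zero, zero_mul] at c3 c4
  linear_combination c4 - c3 + k2

/-- The dependence of the quantum connection on the velocity. -/
lemma Ch_sub (hs : DiffAt ℂ s x) (v v' : S.J1 x) (Y : Tan x) :
    P.Ch s x v' Y - P.Ch s x v Y
      = (-Complex.I * ((S.coef * (S.g x (v'.sub v) (S.spacePart x v Y)
          - S.dt x Y / 2 * S.g x (v'.sub v) (v'.sub v)) : ℝ) : ℂ)) • s x := by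
  set e := trivializationAt ℂ Q x
  have hx : x ∈ e.baseSet := mem_baseSet_extend x
  set a := v'.sub v
  set q := s x
  -- The connection along the segment from `v` at `r = 0` to `v'` at `r = 1`; its derivative is
  -- known from `chVer_eq` and is affine in `r`.
  let F : ℝ → ℂ := fun r ↦ fib e x (P.Ch (FiberBundle.extend ℂ q) x (v.add (r • a)) Y)
  have hF : ∀ r, HasDerivAt F (-Complex.I * ((S.coef * (S.g x a (S.spacePart x v Y)
      - r * S.dt x Y * S.g x a a) : ℝ) : ℂ) * fib e x q) r := by
    intro r
    have h1 := hasDerivAt_vlift (P.mdifferentiableAt_chTan_extend q Y (v.add (r • a))) (a : Tan x)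
    have h2 := P.chVer_eq q Y (v.add (r • a)) a
    rw [chVer] at h2
    rw [h2] at h1
    have h3 := HasDerivAt.comp_sub_const (x := r) (a := r) (by rwa [sub_self])
    refine (h3.congr_of_eventuallyEq (Filter.Eventually.of_forall fun t ↦ ?_)).congr_deriv ?_
    · have h4 : (v.add (r • a)).1 + (t - r) • (a : Tan x) = (v.add (t • a)).1 := by
        change v.1 + r • (a : Tan x) + (t - r) • (a : Tan x) = v.1 + t • (a : Tan x)
        module
      have h5 := congrArg (fun z : Tan x ↦ fib e x (P.chTan (FiberBundle.extend ℂ q)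
        (TotalSpace.mk' R4 x z) (FiberBundle.extend R4 Y x : Tan x))) h4
      refine Eq.trans ?_ h5.symm
      refine congrArg (fib e x) ?_
      refine (congrArg (P.Ch _ x _) ?_).trans (P.chTan_coe (v.add (t • a)) _).symm
      exact (FiberBundle.extend_apply_self R4 Y).symm
    · rw [spacePart_add]
      simp only [map_sub, map_smul, smul_eq_mul]
      push_cast
      ring
  -- An antiderivative of `F'` is subtracted from `F`, so that `G` is constant; comparing `G 1` and
  -- `G 0` integrates `F'`.
  let G : ℝ → ℂ := fun r ↦ F r + Complex.I * ((S.coef * (r * S.g x a (S.spacePart x v Y)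
      - r ^ 2 / 2 * S.dt x Y * S.g x a a) : ℝ) : ℂ) * fib e x q
  have hG : ∀ r, HasDerivAt G 0 r := by
    intro r
    have h1 : HasDerivAt (fun r : ℝ ↦ S.coef * (r * S.g x a (S.spacePart x v Y)
      - r ^ 2 / 2 * S.dt x Y * S.g x a a)) (S.coef * (S.g x a (S.spacePart x v Y)
      - r * S.dt x Y * S.g x a a)) r := by
      have h2 := (hasDerivAt_id r).mul_const (S.g x a (S.spacePart x v Y))
      have h3 := ((((hasDerivAt_pow 2 r).div_const 2).mul_const (S.dt x Y)).mul_const (S.g x a a))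
      have h4 := (h2.sub h3).const_mul S.coef
      refine h4.congr_deriv ?_
      simp
    have h2 := (hF r).add ((h1.ofReal_comp.const_mul Complex.I).mul_const (fib e x q))
    refine h2.congr_deriv ?_
    ring
  have hconst := is_const_of_deriv_eq_zero (fun r ↦ (hG r).differentiableAt)
    (fun r ↦ (hG r).deriv) 1 0
  have v0 : v.add ((0 : ℝ) • a) = v := J1.ext (by
    change v.1 + (0 : ℝ) • (a : Tan x) = v.1
    simp)
  have v1 : v.add ((1 : ℝ) • a) = v' := by rw [one_smul, J1.add_sub]
  have hE : fib e x (P.Ch (FiberBundle.extend ℂ q) x v' Y)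
      - fib e x (P.Ch (FiberBundle.extend ℂ q) x v Y) = -Complex.I * ((S.coef *
      (S.g x a (S.spacePart x v Y) - S.dt x Y / 2 * S.g x a a) : ℝ) : ℂ) * fib e x q := by
    simp only [G, F, v0, v1] at hconst
    push_cast at hconst ⊢
    linear_combination hconst
  -- From the extension of `s x` back to `s`: the correction is the difference of the coordinate
  -- differentials, the same for `v` and for `v'`.
  have h5 := (P.isConnAt (obsAt x v) x).fib_sub_dcoord hx hs (diffAt_extend ℂ q)
    (FiberBundle.extend_apply_self ℂ q).symm Y
  have h6 := (P.isConnAt (obsAt x v') x).fib_sub_dcoord hx hs (diffAt_extend ℂ q)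
    (FiberBundle.extend_apply_self ℂ q).symm Y
  simp only [obsAt_self] at h5 h6
  refine fib_injective hx ?_
  rw [fib_sub hx, fib_csmul hx, smul_eq_mul]
  linear_combination hE + h6 - h5

end QuantumConnection

/-! ### Hermitian connections and their curvature -/

section ComplexConnections

variable {M : Type*} [TopologicalSpace M] [ChartedSpace R4 M] [IsManifold 𝓘(ℝ, R4) ∞ M]
  {F : Type*} [NormedAddCommGroup F] [NormedSpace ℂ F] [FiniteDimensional ℝ F]
  {V : M → Type*} [TopologicalSpace (TotalSpace F V)]
  [∀ x, NormedAddCommGroup (V x)] [∀ x, InnerProductSpace ℂ (V x)]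
  [FiberBundle F V] [VectorBundle ℂ F V] [VectorBundle ℝ F V]
  [ContMDiffVectorBundle ∞ F V 𝓘(ℝ, R4)]
  {W : Set M} {x : M} {f : M → ℂ} {s : ∀ x, V x} {cov : (∀ x, V x) → ∀ x : M, Tan x → V x}
  {X Y : ∀ x : M, Tan x}

lemma SmoothOn.csmul (hf : ContMDiffOn 𝓘(ℝ, R4) 𝓘(ℝ, ℂ) ∞ f W) (hs : SmoothOn F W s) :
    SmoothOn F W (fun y ↦ f y • s y) := by
  intro x hx
  have hxe := mem_baseSet_extend (F := F) (V := V) x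
  have h1 := contMDiffOn_bilin (ContinuousLinearMap.lsmul ℝ ℂ (E := F))
    (hf.mono (inter_subset_left (t := (trivializationAt F V x).baseSet)))
    (contMDiffOn_fib (e := trivializationAt F V x) hs)
  have h2 : SmoothOn F (W ∩ (trivializationAt F V x).baseSet) (fun y ↦ f y • s y) :=
    smoothOn_of_fib inter_subset_right (h1.congr fun y hy ↦ fib_csmul hy.2 _ _)
  exact (h2 x ⟨hx, hxe⟩).mono_of_mem_nhdsWithin
    (Filter.inter_mem self_mem_nhdsWithin
      (mem_nhdsWithin_of_mem_nhds ((Trivialization.open_baseSet _).mem_nhds hxe)))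

lemma DiffAt.csmul (hf : MDifferentiableAt 𝓘(ℝ, R4) 𝓘(ℝ, ℂ) f x) (hs : DiffAt F s x) :
    DiffAt F (fun y ↦ f y • s y) x := by
  have hxe := mem_baseSet_extend (F := F) (V := V) x
  have h1 := mdifferentiableAt_bilin (ContinuousLinearMap.lsmul ℝ ℂ (E := F)) hf
    (mdifferentiableAt_fib hxe hs)
  refine diffAt_of_fib hxe (h1.congr_of_eventuallyEq ?_)
  filter_upwards [(Trivialization.open_baseSet _).mem_nhds hxe] with y hy
  exact fib_csmul hy _ _

/-- The Leibniz rule for complex functions. -/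
lemma IsConnAt.leibniz_complex (hc : IsConnAt F cov x)
    (hI : ∀ s X, DiffAt F s x → cov (fun y ↦ Complex.I • s y) x X = Complex.I • cov s x X)
    (hf : MDifferentiableAt 𝓘(ℝ, R4) 𝓘(ℝ, ℂ) f x) (hs : DiffAt F s x) (X : Tan x) :
    cov (fun y ↦ f y • s y) x X
      = f x • cov s x X + (show ℂ from mvfderiv 𝓘(ℝ, R4) f x X) • s x := by
  have hre : MDifferentiableAt 𝓘(ℝ, R4) 𝓘(ℝ, ℝ) (fun y ↦ (f y).re) x :=
    MDifferentiableAt.comp x Complex.reCLM.differentiableAt.mdifferentiableAt hf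
  have him : MDifferentiableAt 𝓘(ℝ, R4) 𝓘(ℝ, ℝ) (fun y ↦ (f y).im) x :=
    MDifferentiableAt.comp x Complex.imCLM.differentiableAt.mdifferentiableAt hf
  have dI : DiffAt F (fun y ↦ Complex.I • s y) x := DiffAt.csmul mdifferentiableAt_const hs
  have d1 : DiffAt F ((fun y ↦ (f y).re) • s) x := by
    have := DiffAt.csmul (f := fun y ↦ ((f y).re : ℂ))
      (MDifferentiableAt.comp x Complex.ofRealCLM.differentiableAt.mdifferentiableAt hre) hs
    exact this
  have d2 : DiffAt F ((fun y ↦ (f y).im) • fun y ↦ Complex.I • s y) x := by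
    have := DiffAt.csmul (f := fun y ↦ ((f y).im : ℂ))
      (MDifferentiableAt.comp x Complex.ofRealCLM.differentiableAt.mdifferentiableAt him) dI
    exact this
  have e0 : ∀ (c : ℂ) {y : M} (w : V y), c • w = c.re • w + c.im • Complex.I • w := by
    intro c y w
    conv_lhs => rw [← Complex.re_add_im c, add_smul, mul_smul]
    rfl
  have h1 : (fun y ↦ f y • s y) = (fun y ↦ (f y).re) • s
      + (fun y ↦ (f y).im) • fun y ↦ Complex.I • s y := funext fun y ↦ e0 (f y) (s y)
  rw [h1, hc.add _ _ X d1 d2, hc.leibniz _ _ X hre hs, hc.leibniz _ _ X him dI, hI s X hs]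
  have h2 : mvfderiv 𝓘(ℝ, R4) (fun y ↦ (f y).re) x X = (show ℂ from mvfderiv 𝓘(ℝ, R4) f x X).re :=
    mvfderiv_clm Complex.reCLM hf X
  have h3 : mvfderiv 𝓘(ℝ, R4) (fun y ↦ (f y).im) x X = (show ℂ from mvfderiv 𝓘(ℝ, R4) f x X).im :=
    mvfderiv_clm Complex.imCLM hf X
  rw [h2, h3, e0 (f x), e0 (show ℂ from mvfderiv 𝓘(ℝ, R4) f x X)]
  abel

lemma curvOp_csmul (hc : IsSmoothConnOn F W cov) (hW : IsOpen W) (hx : x ∈ W)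
    (hI : ∀ s y X, DiffAt F s y → cov (fun y ↦ Complex.I • s y) y X = Complex.I • cov s y X)
    (hX : SmoothOn R4 W X) (hY : SmoothOn R4 W Y) (hs : SmoothOn F W s) (c : ℂ) :
    curvOp cov X Y (fun y ↦ c • s y) x = c • curvOp cov X Y s x := by
  have h0 : ∀ {s : ∀ x, V x}, SmoothOn F W s → ∀ y ∈ W, ∀ v : Tan y,
      cov (fun y ↦ c • s y) y v = c • cov s y v := by
    intro s hs y hy v
    have := (hc.conn y hy).leibniz_complex (f := fun _ ↦ c) (fun s X ↦ hI s y X)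
      mdifferentiableAt_const (hs.diffAt hW hy) v
    rw [this, mvfderiv_const]
    exact (congrArg _ (zero_smul ℂ _)).trans (add_zero _)
  have h1 : ∀ {Z : ∀ x : M, Tan x}, SmoothOn R4 W Z → ∀ v : Tan x,
      cov (fun y ↦ cov (fun y ↦ c • s y) y (Z y)) x v = c • cov (fun y ↦ cov s y (Z y)) x v := by
    intro Z hZ v
    have hd := hc.smooth W subset_rfl hW s Z hs hZ
    rw [← h0 hd x hx]
    refine (hc.conn x hx).congr ((SmoothOn.csmul contMDiffOn_const hd).diffAt hW hx) ?_ v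
    filter_upwards [hW.mem_nhds hx] with y hy using h0 hs y hy _
  rw [curvOp, curvOp, h1 hX, h1 hY, h0 hs x hx, smul_sub, smul_sub]

/-- The curvature of a complex connection is complex linear. -/
lemma exists_curv_linear (hc : IsSmoothConnOn F W cov) (hW : IsOpen W) (hx : x ∈ W)
    (hI : ∀ s y X, DiffAt F s y → cov (fun y ↦ Complex.I • s y) y X = Complex.I • cov s y X)
    (X Y : Tan x) : ∃ R : V x →ₗ[ℂ] V x, ∀ u, R u = curv F cov x X Y u := by
  let W' : Set M := W ∩ (trivializationAt R4 (TangentSpace 𝓘(ℝ, R4)) x).baseSet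
    ∩ (trivializationAt F V x).baseSet
  have hW' : IsOpen W' := (hW.inter (Trivialization.open_baseSet _)).inter
    (Trivialization.open_baseSet _)
  have hxW' : x ∈ W' := ⟨⟨hx, mem_baseSet_extend x⟩, mem_baseSet_extend x⟩
  have hc' : IsSmoothConnOn F W' cov := hc.mono fun y hy ↦ hy.1.1
  have hX : SmoothOn R4 W' (FiberBundle.extend R4 X : ∀ y : M, Tan y) :=
    (smoothOn_extend X).mono fun y hy ↦ hy.1.2
  have hY : SmoothOn R4 W' (FiberBundle.extend R4 Y : ∀ y : M, Tan y) :=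
    (smoothOn_extend Y).mono fun y hy ↦ hy.1.2
  have hs : ∀ u : V x, SmoothOn F W' (FiberBundle.extend F u : ∀ y : M, V y) := fun u ↦
    (smoothOn_extend u).mono fun y hy ↦ hy.2
  have key : ∀ {s : ∀ x, V x} {u : V x}, SmoothOn F W' s → s x = u → curv F cov x X Y u
      = curvOp cov (FiberBundle.extend R4 X) (FiberBundle.extend R4 Y) s x := by
    intro s u hs hu
    have := curv_eq_curvOp hc' hW' hxW' hX hY hs
    rwa [FiberBundle.extend_apply_self, FiberBundle.extend_apply_self, hu] at this
  refine ⟨{ toFun := curv F cov x X Y, map_add' := fun u u' ↦ ?_, map_smul' := fun c u ↦ ?_ },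
    fun u ↦ rfl⟩
  · rw [key ((hs u).add (hs u')) (by simp), key (hs u) (by simp), key (hs u') (by simp),
      curvOp_add_section hc' hW' hxW' hX hY (hs u) (hs u')]
  · rw [key (SmoothOn.csmul (f := fun _ ↦ c) contMDiffOn_const (hs u)) (by simp),
      key (hs u) (by simp), curvOp_csmul hc' hW' hxW' hI hX hY (hs u)]
    rfl

/-- The curvature of a Hermitian connection is anti-Hermitian. -/
lemma curvOp_antiHerm (hc : IsSmoothConnOn F W cov) (hW : IsOpen W) (hx : x ∈ W)
    (hh : SmoothHermitian F V)
    (hm : ∀ s s' : ∀ x, V x, SmoothOn F W s → SmoothOn F W s' → ∀ y ∈ W, ∀ v : Tan y,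
      mvfderiv 𝓘(ℝ, R4) (fun y ↦ inner ℂ (s y) (s' y)) y v
        = inner ℂ (cov s y v) (s' y) + inner ℂ (s y) (cov s' y v))
    {s' : ∀ x, V x} (hX : SmoothOn R4 W X) (hY : SmoothOn R4 W Y) (hs : SmoothOn F W s)
    (hs' : SmoothOn F W s') :
    inner ℂ (curvOp cov X Y s x) (s' x) + inner ℂ (s x) (curvOp cov X Y s' x) = (0 : ℂ) := by
  -- `[X, Y]` acts on `h(s, s')` as the commutator of derivatives. Expanded with the metric
  -- property, its mixed terms cancel and only the two curvature terms remain.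
  have h0 := mvfderiv_mlieBracket hW hx (hh W s s' hW hs hs') hX hY
  have h1 : ∀ {Z : ∀ x : M, Tan x}, SmoothOn R4 W Z → ∀ v : Tan x,
      mvfderiv 𝓘(ℝ, R4) (fun y ↦ mvfderiv 𝓘(ℝ, R4) (fun y ↦ inner ℂ (s y) (s' y)) y (Z y)) x v
        = (inner ℂ (cov (fun y ↦ cov s y (Z y)) x v) (s' x)
            + inner ℂ (cov s x (Z x)) (cov s' x v))
          + (inner ℂ (cov s x v) (cov s' x (Z x))
            + inner ℂ (s x) (cov (fun y ↦ cov s' y (Z y)) x v)) := by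
    intro Z hZ v
    have hd := hc.smooth W subset_rfl hW s Z hs hZ
    have hd' := hc.smooth W subset_rfl hW s' Z hs' hZ
    rw [← hm _ _ hd hs' x hx v, ← hm _ _ hs hd' x hx v]
    have e1 : (fun y ↦ mvfderiv 𝓘(ℝ, R4) (fun y ↦ inner ℂ (s y) (s' y)) y (Z y)) =ᶠ[𝓝 x]
        (fun y ↦ inner ℂ (cov s y (Z y)) (s' y)) + fun y ↦ inner ℂ (s y) (cov s' y (Z y)) := by
      filter_upwards [hW.mem_nhds hx] with y hy using hm s s' hs hs' y hy (Z y)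
    rw [mvfderiv_congr_apply e1, mvfderiv_add (mdiffAt_of_smoothOn hW (hh W _ _ hW hd hs') hx)
      (mdiffAt_of_smoothOn hW (hh W _ _ hW hs hd') hx)]
    rfl
  rw [h1 hX, h1 hY, hm s s' hs hs' x hx] at h0
  simp only [curvOp, inner_sub_left, inner_sub_right]
  linear_combination -h0

end ComplexConnections

/-! ### Curvature and parallel bilinear operations -/

section BilinearCurvature

variable {M : Type*} [TopologicalSpace M] [ChartedSpace R4 M] [IsManifold 𝓘(ℝ, R4) ∞ M]
  {F : Type*} [NormedAddCommGroup F] [NormedSpace ℝ F] [FiniteDimensional ℝ F]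
  {V : M → Type*} [TopologicalSpace (TotalSpace F V)]
  [∀ x, AddCommGroup (V x)] [∀ x, Module ℝ (V x)] [∀ x, TopologicalSpace (V x)]
  [FiberBundle F V] [VectorBundle ℝ F V] [ContMDiffVectorBundle ∞ F V 𝓘(ℝ, R4)]
  {V₁ V₂ : M → Type*} [∀ x, AddCommGroup (V₁ x)] [∀ x, AddCommGroup (V₂ x)]

/-- The curvature is a derivation of parallel bilinear operations. -/
lemma curvOp_bilin {W : Set M} {x : M} {X Y : ∀ x : M, Tan x}
    {cov : (∀ x, V x) → ∀ x : M, Tan x → V x}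
    {cov₁ : (∀ x, V₁ x) → ∀ x : M, Tan x → V₁ x} {cov₂ : (∀ x, V₂ x) → ∀ x : M, Tan x → V₂ x}
    {p₁ : (∀ x, V₁ x) → Prop} {p₂ : (∀ x, V₂ x) → Prop} {B : ∀ x, V₁ x → V₂ x → V x}
    (hB₁ : ∀ a a' b, B x (a - a') b = B x a b - B x a' b)
    (hB₂ : ∀ a b b', B x a (b - b') = B x a b - B x a b')
    (hB : ∀ a b, p₁ a → p₂ b → SmoothOn F W (fun y ↦ B y (a y) (b y)))
    (h₁ : ∀ a Z, p₁ a → SmoothOn R4 W Z → p₁ (fun y ↦ cov₁ a y (Z y)))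
    (h₂ : ∀ b Z, p₂ b → SmoothOn R4 W Z → p₂ (fun y ↦ cov₂ b y (Z y)))
    (hc : IsSmoothConnOn F W cov)
    (hL : ∀ a b, p₁ a → p₂ b → ∀ y ∈ W, ∀ v : Tan y, cov (fun y ↦ B y (a y) (b y)) y v
      = B y (cov₁ a y v) (b y) + B y (a y) (cov₂ b y v))
    (hW : IsOpen W) (hx : x ∈ W) (hX : SmoothOn R4 W X) (hY : SmoothOn R4 W Y)
    {a : ∀ x, V₁ x} {b : ∀ x, V₂ x} (ha : p₁ a) (hb : p₂ b) :
    curvOp cov X Y (fun y ↦ B y (a y) (b y)) x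
      = B x (curvOp cov₁ X Y a x) (b x) + B x (a x) (curvOp cov₂ X Y b x) := by
  -- Second order Leibniz rule. The predicates `p₁` and `p₂` take the place of smoothness of the
  -- factors, so that these need no bundle structure and spacelike fields can be one of them. The
  -- mixed terms are symmetric and drop out of the commutator.
  have h : ∀ {Z : ∀ x : M, Tan x}, SmoothOn R4 W Z → ∀ v : Tan x,
      cov (fun y ↦ cov (fun y ↦ B y (a y) (b y)) y (Z y)) x v
        = (B x (cov₁ (fun y ↦ cov₁ a y (Z y)) x v) (b x) + B x (cov₁ a x (Z x)) (cov₂ b x v))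
          + (B x (cov₁ a x v) (cov₂ b x (Z x))
            + B x (a x) (cov₂ (fun y ↦ cov₂ b y (Z y)) x v)) := by
    intro Z hZ v
    have hda := h₁ a Z ha hZ
    have hdb := h₂ b Z hb hZ
    rw [← hL _ _ hda hb x hx v, ← hL _ _ ha hdb x hx v,
      ← (hc.conn x hx).add _ _ v ((hB _ _ hda hb).diffAt hW hx) ((hB _ _ ha hdb).diffAt hW hx)]
    refine (hc.conn x hx).congr (((hB _ _ hda hb).add (hB _ _ ha hdb)).diffAt hW hx) ?_ v
    filter_upwards [hW.mem_nhds hx] with y hy using hL a b ha hb y hy (Z y)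
  rw [curvOp, curvOp, curvOp, h hX, h hY, hL a b ha hb x hx, hB₁, hB₁, hB₂, hB₂]
  abel

end BilinearCurvature

/-! ### The connection of the Pauli bundle -/

namespace SpinQuantum

open Spacetime

variable {M : Type*} [TopologicalSpace M] [T2Space M] [ChartedSpace R4 M]
  [IsManifold 𝓘(ℝ, R4) ∞ M] {S : Spacetime M} {Q U' U : M → Type*}
  [TopologicalSpace (TotalSpace ℂ Q)] [∀ x, NormedAddCommGroup (Q x)]
  [∀ x, InnerProductSpace ℂ (Q x)] [FiberBundle ℂ Q] [VectorBundle ℂ ℂ Q]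
  [VectorBundle ℝ ℂ Q] [ContMDiffVectorBundle ∞ ℂ Q 𝓘(ℝ, R4)]
  [TopologicalSpace (TotalSpace C2 U')] [∀ x, NormedAddCommGroup (U' x)]
  [∀ x, InnerProductSpace ℂ (U' x)] [FiberBundle C2 U'] [VectorBundle ℂ C2 U']
  [VectorBundle ℝ C2 U'] [ContMDiffVectorBundle ∞ C2 U' 𝓘(ℝ, R4)]
  [TopologicalSpace (TotalSpace C2 U)] [∀ x, NormedAddCommGroup (U x)]
  [∀ x, InnerProductSpace ℂ (U x)] [FiberBundle C2 U] [VectorBundle ℂ C2 U]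
  [VectorBundle ℝ C2 U] [ContMDiffVectorBundle ∞ C2 U 𝓘(ℝ, R4)]
  (P : SpinQuantum S Q U' U) {W : Set M} {x : M} {o : ∀ x, S.J1 x} {q : ∀ x, Q x}
  {s : ∀ x, U' x} {ψ : ∀ x, U x}

/-- The squared norm of `q ⊗ s` is the product of the squared norms of `q` and `s`. -/
lemma tens_injective {q : Q x} (hq : q ≠ 0) : Function.Injective (P.tens x q) := by
  refine (injective_iff_map_eq_zero _).2 fun s hs ↦ ?_
  have h := P.tens_inner x q q s s
  rw [hs, inner_zero_left, eq_comm, mul_eq_zero] at h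
  rcases h with h | h
  · exact absurd (inner_self_eq_zero.1 h) hq
  · exact inner_self_eq_zero.1 h

lemma tens_surjective {q : Q x} (hq : q ≠ 0) : Function.Surjective (P.tens x q) := by
  obtain ⟨h1, h2⟩ := finrank_fibre C2 U' x
  obtain ⟨h3, h4⟩ := finrank_fibre C2 U x
  exact (LinearMap.injective_iff_surjective_of_finrank_eq_finrank (h2.trans h4.symm)).1
    (P.tens_injective hq)

lemma tens_invFun {q : Q x} (hq : q ≠ 0) (u : U x) :
    P.tens x q (Function.invFun (P.tens x q) u) = u :=
  Function.invFun_eq (P.tens_surjective hq u)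

lemma invFun_tens {q : Q x} (hq : q ≠ 0) (s : U' x) :
    Function.invFun (P.tens x q) (P.tens x q s) = s :=
  Function.leftInverse_invFun (P.tens_injective hq) s

/-- Division by a section of `Q` is smooth. -/
lemma exists_division (hW : IsOpen W) (hx : x ∈ W) (hq : SmoothOn ℂ W q) (h0 : ∀ y ∈ W, q y ≠ 0) :
    ∃ (W₁ : Set M) (B : M → End2), IsOpen W₁ ∧ x ∈ W₁ ∧ W₁ ⊆ W ∧
      W₁ ⊆ (trivializationAt C2 U' x).baseSet ∧ W₁ ⊆ (trivializationAt C2 U x).baseSet ∧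
      ContMDiffOn 𝓘(ℝ, R4) 𝓘(ℝ, End2) ∞ B W₁ ∧ ∀ y ∈ W₁, ∀ u : U y,
        fib (trivializationAt C2 U' x) y (Function.invFun (P.tens y (q y)) u)
          = B y (fib (trivializationAt C2 U x) y u) := by
  set e' := trivializationAt C2 U' x
  set e := trivializationAt C2 U x
  let W₁ := W ∩ e'.baseSet ∩ e.baseSet
  have hW₁ : IsOpen W₁ := (hW.inter e'.open_baseSet).inter e.open_baseSet
  -- Matrix of `s ↦ q ⊗ s`. Division by `q` is its inverse, smooth because inversion is smooth at
  -- the units of the algebra of endomorphisms.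
  let A : M → End2 := fun y ↦ LinearMap.toContinuousLinearMap
    (e.linearMapAt ℂ y ∘ₗ P.tens y (q y) ∘ₗ e'.symmₗ ℂ y)
  have hA : ∀ y ∈ W₁, ∀ z, A y z = fib e y (P.tens y (q y) (e'.symm y z)) := fun y hy z ↦ by
    change e.linearMapAt ℂ y (P.tens y (q y) (e'.symmₗ ℂ y z)) = _
    rw [Trivialization.coe_linearMapAt_of_mem e hy.2]
    exact congrArg (fun t ↦ fib e y (P.tens y (q y) t)) (congrFun (Trivialization.coe_symmₗ (R := ℂ) e' hy.1.2) z)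
  have hA' : ∀ y ∈ W₁, ∀ s : U' y, A y (fib e' y s) = fib e y (P.tens y (q y) s) := fun y hy s ↦ by
    rw [hA y hy]
    congr 2
    exact fib_injective hy.1.2 (fib_symm hy.1.2 _)
  have hAs : ContMDiffOn 𝓘(ℝ, R4) 𝓘(ℝ, End2) ∞ A W₁ := by
    refine contMDiffOn_end fun z ↦ ?_
    have h1 : SmoothOn C2 W₁ (fun y ↦ P.tens y (q y) (e'.symm y z)) :=
      P.tens_smooth W₁ _ _ hW₁ (hq.mono fun y hy ↦ hy.1.1)
        ((smoothOn_symm z).mono fun y hy ↦ hy.1.2)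
    exact ((contMDiffOn_fib h1).mono fun y hy ↦ ⟨hy, hy.2⟩).congr fun y hy ↦ hA y hy z
  have hAu : ∀ y ∈ W₁, IsUnit (A y) := by
    intro y hy
    refine ContinuousLinearMap.isUnit_iff_bijective.2 ⟨fun z z' h ↦ ?_, fun z ↦ ?_⟩
    · rw [hA y hy, hA y hy] at h
      have h2 := P.tens_injective (h0 y hy.1.1) (fib_injective hy.2 h)
      rw [← fib_symm hy.1.2 z, h2, fib_symm hy.1.2]
    · obtain ⟨u, hu⟩ := exists_fib_eq (e := e) hy.2 z
      obtain ⟨s, hs⟩ := P.tens_surjective (h0 y hy.1.1) u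
      exact ⟨fib e' y s, by rw [hA' y hy, hs, hu]⟩
  refine ⟨W₁, fun y ↦ Ring.inverse (A y), hW₁, ⟨⟨hx, mem_baseSet_extend x⟩, mem_baseSet_extend x⟩,
    fun y hy ↦ hy.1.1, fun y hy ↦ hy.1.2, fun y hy ↦ hy.2, fun y hy ↦ ?_, fun y hy u ↦ ?_⟩
  · obtain ⟨a, ha⟩ := hAu y hy
    have h1 : ContDiffAt ℝ ∞ (Ring.inverse : End2 → End2) (A y) := by
      rw [← ha]
      exact contDiffAt_ringInverse ℝ a
    exact h1.contMDiffAt.comp_contMDiffWithinAt y (hAs y hy)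
  · have h1 := hA' y hy (Function.invFun (P.tens y (q y)) u)
    rw [P.tens_invFun (h0 y hy.1.1)] at h1
    rw [← h1]
    change _ = (Ring.inverse (A y) * A y) _
    rw [Ring.inverse_mul_cancel _ (hAu y hy)]
    rfl

lemma smoothOn_division (hW : IsOpen W) (hq : SmoothOn ℂ W q) (h0 : ∀ y ∈ W, q y ≠ 0)
    (hψ : SmoothOn C2 W ψ) : SmoothOn C2 W (fun y ↦ Function.invFun (P.tens y (q y)) (ψ y)) := by
  refine smoothOn_of_forall fun x hx ↦ ?_
  obtain ⟨W₁, B, hW₁, hx₁, hsub, hs', hs, hB, h⟩ := P.exists_division hW hx hq h0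
  refine ⟨W₁, hW₁, hx₁, smoothOn_of_fib hs' ?_⟩
  exact (contMDiffOn_bilin applyR hB ((contMDiffOn_fib hψ).mono fun y hy ↦ ⟨hsub hy, hs hy⟩)).congr
    fun y hy ↦ h y hy (ψ y)

lemma diffAt_division (hW : IsOpen W) (hx : x ∈ W) (hq : SmoothOn ℂ W q) (h0 : ∀ y ∈ W, q y ≠ 0)
    (hψ : DiffAt C2 ψ x) : DiffAt C2 (fun y ↦ Function.invFun (P.tens y (q y)) (ψ y)) x := by
  obtain ⟨W₁, B, hW₁, hx₁, hsub, hs', hs, hB, h⟩ := P.exists_division hW hx hq h0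
  refine diffAt_of_fib (hs' hx₁) ((mdifferentiableAt_bilin applyR (mdiffAt_of_smoothOn hW₁ hB hx₁)
    (mdifferentiableAt_fib (hs hx₁) hψ)).congr_of_eventuallyEq ?_)
  filter_upwards [hW₁.mem_nhds hx₁] with y hy using h y hy (ψ y)

variable (Q) in
/-- The local section of `Q` used near `x` in the definition of the tensor product connection. -/
def frameQ (x : M) : ∀ y, Q y :=
  FiberBundle.extend ℂ (Classical.epsilon fun q₀ : Q x ↦ q₀ ≠ 0)

lemma fib_extend {F : Type*} [NormedAddCommGroup F] [NormedSpace ℝ F] {V : M → Type*}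
    [TopologicalSpace (TotalSpace F V)] [∀ x, AddCommGroup (V x)] [∀ x, Module ℝ (V x)]
    [∀ x, TopologicalSpace (V x)] [FiberBundle F V] [VectorBundle ℝ F V] (w : V x) {y : M}
    (hy : y ∈ (trivializationAt F V x).baseSet) :
    fib (trivializationAt F V x) y (FiberBundle.extend F w y)
      = fib (trivializationAt F V x) x w := by
  simp [fib, FiberBundle.extend, hy]

lemma smoothOn_frameQ (x : M) : SmoothOn ℂ (trivializationAt ℂ Q x).baseSet (frameQ Q x) :=
  smoothOn_extend _

lemma frameQ_ne_zero (x : M) {y : M} (hy : y ∈ (trivializationAt ℂ Q x).baseSet) :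
    frameQ Q x y ≠ 0 := by
  obtain ⟨h1, h2⟩ := finrank_fibre ℂ Q x
  haveI : Nontrivial (Q x) := Module.nontrivial_of_finrank_pos (R := ℂ)
    (by rw [h2, Module.finrank_self]; exact one_pos)
  have h3 : (Classical.epsilon fun q₀ : Q x ↦ q₀ ≠ 0) ≠ 0 :=
    Classical.epsilon_spec (p := fun q₀ : Q x ↦ q₀ ≠ 0) (exists_ne 0)
  intro h
  have h4 := fib_extend (F := ℂ) (Classical.epsilon fun q₀ : Q x ↦ q₀ ≠ 0) hy
  rw [show FiberBundle.extend ℂ _ y = frameQ Q x y from rfl, h, fib_zero hy, eq_comm] at h4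
  exact h3 (fib_injective (mem_baseSet_extend (F := ℂ) x) (h4.trans (fib_zero (mem_baseSet_extend x)).symm))

lemma exists_smul_eq {q : Q x} (hq : q ≠ 0) (q' : Q x) : ∃ c : ℂ, q' = c • q := by
  obtain ⟨h1, h2⟩ := finrank_fibre ℂ Q x
  obtain ⟨c, hc⟩ := (finrank_eq_one_iff_of_nonzero' q hq).1 (h2.trans (Module.finrank_self ℂ)) q'
  exact ⟨c, hc.symm⟩

/-- The factor of a section of `U` relatively to `frameQ`. -/
def factor (x : M) (ψ : ∀ x, U x) (y : M) : U' y :=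
  Function.invFun (P.tens y (frameQ Q x y)) (ψ y)

lemma tens_factor (x : M) (ψ : ∀ x, U x) {y : M} (hy : y ∈ (trivializationAt ℂ Q x).baseSet) :
    P.tens y (frameQ Q x y) (P.factor x ψ y) = ψ y :=
  P.tens_invFun (frameQ_ne_zero x hy) _

lemma diffAt_frameQ (x : M) : DiffAt ℂ (frameQ Q x) x :=
  (smoothOn_frameQ x).diffAt (Trivialization.open_baseSet _) (mem_baseSet_extend x)

lemma diffAt_factor (hψ : DiffAt C2 ψ x) : DiffAt C2 (P.factor x ψ) x :=
  P.diffAt_division (Trivialization.open_baseSet _) (mem_baseSet_extend x) (smoothOn_frameQ x)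
    (fun _ hy ↦ frameQ_ne_zero x hy) hψ

lemma smoothOn_factor (hW : IsOpen W) (hψ : SmoothOn C2 W ψ) :
    SmoothOn C2 (W ∩ (trivializationAt ℂ Q x).baseSet) (P.factor x ψ) :=
  P.smoothOn_division (hW.inter (Trivialization.open_baseSet _))
    ((smoothOn_frameQ x).mono inter_subset_right) (fun _ hy ↦ frameQ_ne_zero x hy.2)
    (hψ.mono inter_subset_left)

lemma isConnAt_C (x : M) : IsConnAt C2 (fun s y X ↦ P.C s y X) x :=
  isConnAt_of_isCovariantDerivativeOn P.C.isCovariantDerivativeOn x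

/-- The connection `Ch[o] ⊗ C` in terms of an arbitrary factorization. -/
lemma tensorConn_eq (o : ∀ x, S.J1 x) (hq : DiffAt ℂ q x) (hs : DiffAt C2 s x)
    (h : ∀ᶠ y in 𝓝 x, ψ y = P.tens y (q y) (s y)) (X : Tan x) :
    P.tensorConn o ψ x X = P.tens x (P.Ch q x (o x) X) (s x) + P.tens x (q x) (P.C s x X) := by
  set e := trivializationAt ℂ Q x
  have hx : x ∈ e.baseSet := mem_baseSet_extend x
  set q₀ := frameQ Q x
  have hq₀ : DiffAt ℂ q₀ x := diffAt_frameQ x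
  let k : ℂ := fib e x (q₀ x)
  have hk : k ≠ 0 := fun h ↦ frameQ_ne_zero (Q := Q) x hx (fib_injective hx (h.trans (fib_zero hx).symm))
  -- The frame `q₀` has constant coordinate `k`, so `q = c q₀` near `x`. The function `c` moves
  -- across the tensor product, and its differential enters both expressions as `dc q₀ ⊗ s`.
  let c : M → ℂ := fun y ↦ fib e y (q y) * k⁻¹
  have hc : MDifferentiableAt 𝓘(ℝ, R4) 𝓘(ℝ, ℂ) c x :=
    mdifferentiableAt_bilin (ContinuousLinearMap.mul ℝ ℂ) (mdifferentiableAt_fib hx hq)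
      mdifferentiableAt_const
  have hcq : ∀ y ∈ e.baseSet, q y = c y • q₀ y := by
    intro y hy
    refine fib_injective hy ?_
    have h1 : fib e y (q₀ y) = k :=
      (fib_extend _ hy).trans (fib_extend _ hx).symm
    rw [fib_csmul hy, h1, smul_eq_mul, mul_assoc, inv_mul_cancel₀ hk, mul_one]
  have h1 : ∀ᶠ y in 𝓝 x, P.factor x ψ y = c y • s y := by
    filter_upwards [h, e.open_baseSet.mem_nhds hx] with y h hy
    rw [factor, h, hcq y hy, map_smul, LinearMap.smul_apply, ← map_smul]
    exact P.invFun_tens (frameQ_ne_zero x hy) _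
  have h2 : P.C (P.factor x ψ) x X = c x • P.C s x X + (show ℂ from mvfderiv 𝓘(ℝ, R4) c x X) • s x :=
    ((P.isConnAt_C x).congr (DiffAt.csmul hc hs) h1 X).trans
      ((P.isConnAt_C x).leibniz_complex (fun s X ↦ P.C_hermitian.smul_I s x X) hc hs X)
  have h3 : P.Ch q x (o x) X = c x • P.Ch q₀ x (o x) X
      + (show ℂ from mvfderiv 𝓘(ℝ, R4) c x X) • q₀ x :=
    ((P.isConnAt o x).congr (DiffAt.csmul hc hq₀)
      (by filter_upwards [e.open_baseSet.mem_nhds hx] with y hy using hcq y hy) X).trans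
      ((P.isConnAt o x).leibniz_complex (fun s X ↦ (P.hermitian o).smul_I s x X) hc hq₀ X)
  change P.tens x (P.Ch q₀ x (o x) X) (P.factor x ψ x)
    + P.tens x (q₀ x) (P.C (P.factor x ψ) x X) = _
  rw [h1.self_of_nhds, h2, h3, hcq x hx]
  simp only [map_add, map_smul, LinearMap.add_apply, LinearMap.smul_apply]
  abel

lemma eventually_tens_factor (x : M) (ψ : ∀ x, U x) :
    ∀ᶠ y in 𝓝 x, ψ y = P.tens y (frameQ Q x y) (P.factor x ψ y) := by
  filter_upwards [(Trivialization.open_baseSet _).mem_nhds (mem_baseSet_extend (F := ℂ) (V := Q) x)]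
    with y hy using (P.tens_factor x ψ hy).symm

lemma isConnAt_tensorConn (o : ∀ x, S.J1 x) (x : M) : IsConnAt C2 (P.tensorConn o) x where
  add ψ ψ' X hψ hψ' := by
    have hq := diffAt_frameQ (Q := Q) x
    have hs := P.diffAt_factor hψ
    have hs' := P.diffAt_factor hψ'
    have h1 := (P.isConnAt_C x).add _ _ X hs hs'
    rw [P.tensorConn_eq o hq hs (P.eventually_tens_factor x ψ),
      P.tensorConn_eq o hq hs' (P.eventually_tens_factor x ψ'),
      P.tensorConn_eq o hq (mdifferentiableAt_add_section hs hs') (s := P.factor x ψ + P.factor x ψ'), h1]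
    · simp only [map_add, Pi.add_apply]
      abel
    · filter_upwards [P.eventually_tens_factor x ψ, P.eventually_tens_factor x ψ'] with y h h'
      rw [Pi.add_apply, h, h', ← map_add]
      rfl
  leibniz f ψ X hf hψ := by
    have hq := diffAt_frameQ (Q := Q) x
    have hs := P.diffAt_factor hψ
    have h1 := (P.isConnAt_C x).leibniz _ _ X hf hs
    rw [P.tensorConn_eq o hq hs (P.eventually_tens_factor x ψ),
      P.tensorConn_eq o hq (hf.smul_section hs) (s := f • P.factor x ψ), h1]
    · simp only [map_add, Pi.smul_apply', LinearMap.map_smul_of_tower,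
        (P.eventually_tens_factor x ψ).self_of_nhds]
      rw [smul_add, add_assoc]
    · filter_upwards [P.eventually_tens_factor x ψ] with y h
      rw [Pi.smul_apply', h, ← LinearMap.map_smul_of_tower]
      rfl

end SpinQuantum

/-! ### Metric, Pauli map and curvature for `Ch[o] ⊗ C` -/

namespace SpinQuantum

open Spacetime

variable {M : Type*} [TopologicalSpace M] [T2Space M] [ChartedSpace R4 M]
  [IsManifold 𝓘(ℝ, R4) ∞ M] {S : Spacetime M} {Q U' U : M → Type*}
  [TopologicalSpace (TotalSpace ℂ Q)] [∀ x, NormedAddCommGroup (Q x)]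
  [∀ x, InnerProductSpace ℂ (Q x)] [FiberBundle ℂ Q] [VectorBundle ℂ ℂ Q]
  [VectorBundle ℝ ℂ Q] [ContMDiffVectorBundle ∞ ℂ Q 𝓘(ℝ, R4)]
  [TopologicalSpace (TotalSpace C2 U')] [∀ x, NormedAddCommGroup (U' x)]
  [∀ x, InnerProductSpace ℂ (U' x)] [FiberBundle C2 U'] [VectorBundle ℂ C2 U']
  [VectorBundle ℝ C2 U'] [ContMDiffVectorBundle ∞ C2 U' 𝓘(ℝ, R4)]
  [TopologicalSpace (TotalSpace C2 U)] [∀ x, NormedAddCommGroup (U x)]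
  [∀ x, InnerProductSpace ℂ (U x)] [FiberBundle C2 U] [VectorBundle ℂ C2 U]
  [VectorBundle ℝ C2 U] [ContMDiffVectorBundle ∞ C2 U 𝓘(ℝ, R4)]
  (P : SpinQuantum S Q U' U) {W : Set M} {x : M} {o : ∀ x, S.J1 x} {q : ∀ x, Q x}
  {s : ∀ x, U' x} {ψ : ∀ x, U x} {X Y : ∀ x : M, Tan x}

lemma tensorConn_map_add (o : ∀ x, S.J1 x) (ψ : ∀ x, U x) (x : M) (X Y : Tan x) :
    P.tensorConn o ψ x (X + Y) = P.tensorConn o ψ x X + P.tensorConn o ψ x Y := by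
  simp only [tensorConn, map_add, LinearMap.add_apply]
  abel

lemma tensorConn_map_smul (o : ∀ x, S.J1 x) (ψ : ∀ x, U x) (x : M) (c : ℝ) (X : Tan x) :
    P.tensorConn o ψ x (c • X) = c • P.tensorConn o ψ x X := by
  simp only [tensorConn, map_smul, LinearMap.map_smul_of_tower, LinearMap.smul_apply, smul_add]

lemma tensorConn_smul_I (o : ∀ x, S.J1 x) (ψ : ∀ x, U x) (x : M) (X : Tan x)
    (hψ : DiffAt C2 ψ x) : P.tensorConn o (fun y ↦ Complex.I • ψ y) x X
      = Complex.I • P.tensorConn o ψ x X := by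
  have hq := diffAt_frameQ (Q := Q) x
  have hs := P.diffAt_factor hψ
  have h1 := P.C_hermitian.smul_I _ x X hs
  rw [P.tensorConn_eq o hq hs (P.eventually_tens_factor x ψ),
    P.tensorConn_eq o hq (DiffAt.csmul mdifferentiableAt_const hs)
      (s := fun y ↦ Complex.I • P.factor x ψ y), h1]
  · simp only [map_smul, smul_add]
  · filter_upwards [P.eventually_tens_factor x ψ] with y h
    rw [h, ← map_smul]

/-- The dependence of the connection `Ch[o] ⊗ C` on the observer. -/
lemma tensorConn_sub (hψ : DiffAt C2 ψ x) (o o' : ∀ x, S.J1 x) (X : Tan x) :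
    P.tensorConn o' ψ x X - P.tensorConn o ψ x X
      = (-Complex.I * ((S.coef * (S.g x ((o' x).sub (o x)) (S.spacePart x (o x) X)
          - S.dt x X / 2 * S.g x ((o' x).sub (o x)) ((o' x).sub (o x))) : ℝ) : ℂ)) • ψ x := by
  have hq := diffAt_frameQ (Q := Q) x
  have hs := P.diffAt_factor hψ
  rw [P.tensorConn_eq o hq hs (P.eventually_tens_factor x ψ),
    P.tensorConn_eq o' hq hs (P.eventually_tens_factor x ψ), add_sub_add_right_eq_sub,
    ← LinearMap.sub_apply, ← map_sub, P.Ch_sub hq, map_smul, LinearMap.smul_apply,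
    ← (P.eventually_tens_factor x ψ).self_of_nhds]

/-- Local factorizations of a smooth section of `U`. -/
lemma exists_factorization (hW : IsOpen W) (hx : x ∈ W) (hψ : SmoothOn C2 W ψ) :
    ∃ W' ⊆ W, IsOpen W' ∧ x ∈ W' ∧ ∃ (q : ∀ x, Q x) (s : ∀ x, U' x), SmoothOn ℂ W' q ∧
      SmoothOn C2 W' s ∧ (∀ y ∈ W', q y ≠ 0) ∧ ∀ y ∈ W', ψ y = P.tens y (q y) (s y) :=
  ⟨W ∩ (trivializationAt ℂ Q x).baseSet, inter_subset_left,
    hW.inter (Trivialization.open_baseSet _), ⟨hx, mem_baseSet_extend x⟩, frameQ Q x,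
    P.factor x ψ, (smoothOn_frameQ x).mono inter_subset_right, P.smoothOn_factor hW hψ,
    fun _ hy ↦ frameQ_ne_zero x hy.2, fun _ hy ↦ (P.tens_factor x ψ hy.2).symm⟩

lemma tensorConn_tens (o : ∀ x, S.J1 x) (hW : IsOpen W) (hx : x ∈ W) (hq : SmoothOn ℂ W q)
    (hs : SmoothOn C2 W s) (h : ∀ y ∈ W, ψ y = P.tens y (q y) (s y)) (X : Tan x) :
    P.tensorConn o ψ x X = P.tens x (P.Ch q x (o x) X) (s x) + P.tens x (q x) (P.C s x X) :=
  P.tensorConn_eq o (hq.diffAt hW hx) (hs.diffAt hW hx)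
    (Filter.mem_of_superset (hW.mem_nhds hx) h) X

lemma isSmoothConnOn_C : IsSmoothConnOn C2 univ (fun s x X ↦ P.C s x X) :=
  isSmoothConnOn_of_contMDiff P.C P.C_smooth

lemma isSmoothConnOn_tensorConn (ho : S.IsObserverOn W o) :
    IsSmoothConnOn C2 W (P.tensorConn o) where
  conn x _ := P.isConnAt_tensorConn o x
  map_add s x X Y := P.tensorConn_map_add o s x X Y
  map_smul s x c X := P.tensorConn_map_smul o s x c X
  smooth W' h hW' ψ X hψ hX := by
    refine smoothOn_of_forall fun x hx ↦ ?_
    obtain ⟨W₁, h₁, hW₁, hx₁, q, s, hq, hs, -, hf⟩ := P.exists_factorization hW' hx hψ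
    refine ⟨W₁, hW₁, hx₁, ?_⟩
    have hX₁ := hX.mono h₁
    have h2 := (P.isSmoothConnOn_Ch ho).smooth W₁ (h₁.trans h) hW₁ q X hq hX₁
    have h3 := P.isSmoothConnOn_C.smooth W₁ (subset_univ _) hW₁ s X hs hX₁
    refine ((P.tens_smooth W₁ _ _ hW₁ h2 hs).add (P.tens_smooth W₁ _ _ hW₁ hq h3)).congr
      fun y hy ↦ ?_
    exact P.tensorConn_tens o hW₁ hy hq hs hf (X y)

/-- Dividing both sections by the same `q` gives `h(ψ, ψ') = h(q, q) h(s, s')`, and the two factors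
are differentiated with the metric properties of `Ch[o]` and `C`. -/
lemma tensorConn_metric (o : ∀ x, S.J1 x) (hW : IsOpen W) (hx : x ∈ W) {ψ' : ∀ x, U x}
    (hψ : SmoothOn C2 W ψ) (hψ' : SmoothOn C2 W ψ') (X : Tan x) :
    mvfderiv 𝓘(ℝ, R4) (fun y ↦ inner ℂ (ψ y) (ψ' y)) x X
      = inner ℂ (P.tensorConn o ψ x X) (ψ' x) + inner ℂ (ψ x) (P.tensorConn o ψ' x X) := by
  obtain ⟨W₁, h₁, hW₁, hx₁, q, s, hq, hs, h0, hf⟩ := P.exists_factorization hW hx hψ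
  have hs' := P.smoothOn_division hW₁ hq h0 (hψ'.mono h₁)
  set s' : ∀ y, U' y := fun y ↦ Function.invFun (P.tens y (q y)) (ψ' y)
  have hf' : ∀ y ∈ W₁, ψ' y = P.tens y (q y) (s' y) := fun y hy ↦ (P.tens_invFun (h0 y hy) _).symm
  have e1 : (fun y ↦ inner ℂ (ψ y) (ψ' y)) =ᶠ[𝓝 x]
      fun y ↦ ContinuousLinearMap.mul ℝ ℂ (inner ℂ (q y) (q y)) (inner ℂ (s y) (s' y)) := by
    filter_upwards [hW₁.mem_nhds hx₁] with y hy
    rw [hf y hy, hf' y hy, P.tens_inner]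
    rfl
  rw [mvfderiv_congr_apply e1, mvfderiv_bilin _ (mdiffAt_of_smoothOn hW₁ (P.metric_Q _ _ _ hW₁ hq hq) hx₁)
    (mdiffAt_of_smoothOn hW₁ (P.metric_U' _ _ _ hW₁ hs hs') hx₁),
    (P.hermitian o).metric q q x X (hq.diffAt hW₁ hx₁) (hq.diffAt hW₁ hx₁),
    P.C_hermitian.metric s s' x X (hs.diffAt hW₁ hx₁) (hs'.diffAt hW₁ hx₁),
    P.tensorConn_tens o hW₁ hx₁ hq hs hf, P.tensorConn_tens o hW₁ hx₁ hq hs' hf', hf x hx₁, hf' x hx₁]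
  simp only [inner_add_left, inner_add_right, P.tens_inner, ContinuousLinearMap.mul_apply']
  ring

/-- The Pauli map is parallel. -/
lemma tensorConn_pauli (o : ∀ x, S.J1 x) (hW : IsOpen W) (hx : x ∈ W) {Z : ∀ x, S.VE x}
    (hZ : VerSmoothOn S.t W Z) (hψ : SmoothOn C2 W ψ) (X : Tan x) :
    P.tensorConn o (fun y ↦ P.pauli y (Z y) (ψ y)) x X
      = P.pauli x (S.covVer Z x X) (ψ x) + P.pauli x (Z x) (P.tensorConn o ψ x X) := by
  obtain ⟨W₁, h₁, hW₁, hx₁, q, s, hq, hs, h0, hf⟩ := P.exists_factorization hW hx hψ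
  have hZ₁ : VerSmoothOn S.t W₁ Z := SmoothOn.mono hZ h₁
  have hs' := P.smoothOn_division hW₁ hq h0 (P.pauli_smooth W₁ Z ψ hW₁ hZ₁ (hψ.mono h₁))
  set s' : ∀ y, U' y := fun y ↦ Function.invFun (P.tens y (q y)) (P.pauli y (Z y) (ψ y))
  have hf' : ∀ y ∈ W₁, P.pauli y (Z y) (ψ y) = P.tens y (q y) (s' y) :=
    fun y hy ↦ (P.tens_invFun (h0 y hy) _).symm
  -- Division gives this relation for the chosen `q` only; as `Q` has rank one it extends to every
  -- `q'`.
  have hq' : ∀ y ∈ W₁, ∀ q' : Q y, P.tens y q' (s' y) = P.pauli y (Z y) (P.tens y q' (s y)) := by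
    intro y hy q'
    obtain ⟨c, rfl⟩ := exists_smul_eq (h0 y hy) q'
    simp only [map_smul, LinearMap.smul_apply]
    rw [← hf' y hy, hf y hy]
  rw [P.tensorConn_tens o hW₁ hx₁ hq hs' hf', P.tensorConn_tens o hW₁ hx₁ hq hs hf,
    P.C_pauli W₁ Z s s' hW₁ hZ₁ hs hs' hq' x hx₁, hq' x hx₁, map_add, hf x hx₁]
  abel

/-- `K` preserves spacelike fields, so the curvature of the restriction is the restriction of the
curvature. -/
lemma coe_curvOp_covVer (hW : IsOpen W) (hx : x ∈ W) (hX : SmoothOn R4 W X) (hY : SmoothOn R4 W Y)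
    {Z : ∀ x, S.VE x} (hZ : VerSmoothOn S.t W Z) :
    curvOp S.covVer X Y Z x = S.curvVer x (X x) (Y x) (Z x) := by
  have hK := (isSmoothConnOn_K S).mono (subset_univ W)
  have h1 := curv_eq_curvOp hK hW hx hX hY hZ
  have h2 : ∀ {T : ∀ x : M, Tan x}, SmoothOn R4 W T → ∀ v : Tan x,
      (S.covVer (fun y ↦ S.covVer Z y (T y)) x v : Tan x)
        = S.K (fun y ↦ S.K (fun y ↦ (Z y : Tan y)) y (T y)) x v := by
    intro T hT v
    rw [coe_covVer (SmoothOn.diffAt hW (verSmoothOn_covVer hW hZ hT) hx)]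
    refine (S.isConnAt_K x).congr ((hK.smooth W subset_rfl hW _ T hZ hT).diffAt hW hx) ?_ v
    filter_upwards [hW.mem_nhds hx] with y hy using coe_covVer (SmoothOn.diffAt hW hZ hy) (T y)
  have h3 : (curvOp S.covVer X Y Z x : Tan x)
      = curv R4 (fun s y Z ↦ S.K s y Z) x (X x) (Y x) (Z x : Tan x) := by
    rw [h1]
    simp only [curvOp, Submodule.coe_sub]
    rw [h2 hX, h2 hY, coe_covVer (SmoothOn.diffAt hW hZ hx)]
  refine Subtype.ext ?_
  rw [h3, curvVer, coe_toVer]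
  rw [← h3]
  exact (curvOp S.covVer X Y Z x).2

lemma exists_ver_extension (w : S.VE x) : ∃ (Z : ∀ x, S.VE x) (W : Set M), IsOpen W ∧ x ∈ W ∧
    VerSmoothOn S.t W Z ∧ Z x = w := by
  obtain ⟨o, W, hW, hx, ho, -, -⟩ := S.exists_parallel_observer (S.someObserver x)
  refine ⟨fun y ↦ S.spacePart y (o y) (FiberBundle.extend R4 (w : Tan x) y), W ∩ _,
    hW.inter (Trivialization.open_baseSet _), ⟨hx, mem_baseSet_extend x⟩,
    verSmoothOn_spacePart (hW.inter (Trivialization.open_baseSet _))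
      (SmoothOn.mono ho inter_subset_left)
      ((smoothOn_extend (w : Tan x)).mono inter_subset_right), Subtype.ext ?_⟩
  rw [coe_spacePart, FiberBundle.extend_apply_self, show S.dt x (w : Tan x) = 0 from w.2,
    zero_smul, sub_zero]

/-- On the determinant form of a basis the derivation induced by `R` is multiplication by the trace.
-/
lemma trace_eq_zero_of_det {H : Type*} [AddCommGroup H] [Module ℂ H] [FiniteDimensional ℂ H]
    (h2 : Module.finrank ℂ H = 2) (R : H →ₗ[ℂ] H)
    (hR : ∀ (s₁ s₂ : H) (α : H [⋀^Fin 2]→ₗ[ℂ] ℂ), α ![R s₁, s₂] + α ![s₁, R s₂] = 0) :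
    LinearMap.trace ℂ H R = 0 := by
  let b := Module.finBasisOfFinrankEq ℂ H h2
  have h := hR (b 0) (b 1) b.det
  rw [Module.Basis.det_apply, Module.Basis.det_apply, Matrix.det_fin_two, Matrix.det_fin_two] at h
  rw [LinearMap.trace_eq_matrix_trace ℂ b, Matrix.trace_fin_two, LinearMap.toMatrix_apply,
    LinearMap.toMatrix_apply]
  simpa [Module.Basis.toMatrix_apply] using h

/-- The curvature of `Ch[o] ⊗ C` where the observer `o` is parallel. -/
lemma exists_curvature (ho : S.IsObserverOn W o) (hW : IsOpen W) (hx : x ∈ W)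
    (hp : ∀ X, S.K (fun y ↦ (o y).1) x X = 0) (hX : SmoothOn R4 W X) (hY : SmoothOn R4 W Y) :
    ∃ r : S.VE x, (∀ w, S.rho x (X x) (Y x) w = S.g x r w) ∧
      ∀ ψ, SmoothOn C2 W ψ → curvOp (P.tensorConn o) X Y ψ x = P.pauli x r (ψ x) := by
  have hc := P.isSmoothConnOn_tensorConn ho
  obtain ⟨D, hD⟩ := exists_curv_linear hc hW hx (fun s y X ↦ P.tensorConn_smul_I o s y X) (X x) (Y x)
  obtain ⟨R, hR⟩ := exists_curv_linear P.isSmoothConnOn_C isOpen_univ (mem_univ x)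
    (fun s y X ↦ P.C_hermitian.smul_I s y X) (X x) (Y x)
  have hD' : ∀ (W' : Set M), IsOpen W' → x ∈ W' → W' ⊆ W → ∀ ψ, SmoothOn C2 W' ψ →
      curvOp (P.tensorConn o) X Y ψ x = D (ψ x) := fun W' hW' hx' h ψ hψ ↦ by
    rw [hD, curv_eq_curvOp (hc.mono h) hW' hx' (hX.mono h) (hY.mono h) hψ]
  have hanti : IsAntiHerm D := by
    intro u u'
    let W' := W ∩ (trivializationAt C2 U x).baseSet
    have hW' : IsOpen W' := hW.inter (Trivialization.open_baseSet _)
    have hx' : x ∈ W' := ⟨hx, mem_baseSet_extend x⟩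
    have hs : ∀ u : U x, SmoothOn C2 W' (FiberBundle.extend C2 u : ∀ y, U y) := fun u ↦
      (smoothOn_extend u).mono inter_subset_right
    have h := curvOp_antiHerm (hc.mono inter_subset_left) hW' hx' P.metric_U
      (fun s s' hs hs' y hy v ↦ P.tensorConn_metric o hW' hy hs hs' v)
      (hX.mono inter_subset_left) (hY.mono inter_subset_left) (hs u) (hs u')
    rw [hD' W' hW' hx' inter_subset_left _ (hs u), hD' W' hW' hx' inter_subset_left _ (hs u'),
      FiberBundle.extend_apply_self, FiberBundle.extend_apply_self] at h
    exact eq_neg_of_add_eq_zero_left h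
  -- The curvature is a derivation of the tensor product, and the one of `Ch[o]` is `-i o^*Ω`, which
  -- vanishes at `x` since `o` is parallel there.
  have htens : ∀ s : U' x, D (P.tens x (frameQ Q x x) s) = P.tens x (frameQ Q x x) (R s) := by
    intro s
    let W' := W ∩ ((trivializationAt ℂ Q x).baseSet ∩ (trivializationAt C2 U' x).baseSet)
    have hW' : IsOpen W' := hW.inter ((Trivialization.open_baseSet _).inter
      (Trivialization.open_baseSet _))
    have hx' : x ∈ W' := ⟨hx, mem_baseSet_extend x, mem_baseSet_extend x⟩
    have hW'W : W' ⊆ W := inter_subset_left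
    have hq : SmoothOn ℂ W' (frameQ Q x) := (smoothOn_frameQ x).mono fun y hy ↦ hy.2.1
    have hs : SmoothOn C2 W' (FiberBundle.extend C2 s : ∀ y, U' y) :=
      (smoothOn_extend s).mono fun y hy ↦ hy.2.2
    have hcQ := (P.isSmoothConnOn_Ch ho).mono hW'W
    have hcC := P.isSmoothConnOn_C.mono (subset_univ W')
    have h := curvOp_bilin (F := C2) (V := U) (p₁ := SmoothOn ℂ W') (p₂ := SmoothOn C2 W')
      (cov₁ := fun s y X ↦ P.Ch s y (o y) X) (cov₂ := fun s y X ↦ P.C s y X)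
      (B := fun y a b ↦ P.tens y a b) (cov := P.tensorConn o) (x := x)
      (by intro a a' b; simp) (by intro a b b'; simp)
      (fun a b ha hb ↦ P.tens_smooth W' a b hW' ha hb)
      (fun a Z ha hZ ↦ hcQ.smooth W' subset_rfl hW' a Z ha hZ)
      (fun b Z hb hZ ↦ hcC.smooth W' subset_rfl hW' b Z hb hZ) (hc.mono hW'W)
      (fun a b ha hb y hy v ↦ P.tensorConn_tens o hW' hy ha hb (fun _ _ ↦ rfl) v) hW' hx'
      (hX.mono hW'W) (hY.mono hW'W) hq hs
    have h1 := P.curvature W o hW ho x hx (X x) (Y x) (frameQ Q x x)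
    rw [curv_eq_curvOp hcQ hW' hx' (hX.mono hW'W) (hY.mono hW'W) hq, pullOmega_of_parallel hp] at h1
    have h2 := curv_eq_curvOp hcC hW' hx' (hX.mono hW'W) (hY.mono hW'W) hs
    rw [← hR] at h2
    rw [hD' W' hW' hx' hW'W _ (P.tens_smooth W' _ _ hW' hq hs), h1, ← h2] at h
    simpa using h
  -- `D` is conjugate to the curvature of `C`, which is traceless by flatness on `⋀² U'`.
  have htr : LinearMap.trace ℂ (U x) D = 0 := by
    have hq := frameQ_ne_zero (Q := Q) x (mem_baseSet_extend x)
    let T : U' x ≃ₗ[ℂ] U x := LinearEquiv.ofBijective (P.tens x (frameQ Q x x))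
      ⟨P.tens_injective hq, P.tens_surjective hq⟩
    have h1 : D = T.conj R := by
      refine LinearMap.ext fun u ↦ ?_
      obtain ⟨s, rfl⟩ := T.surjective u
      rw [LinearEquiv.conj_apply_apply, LinearEquiv.symm_apply_apply]
      exact htens s
    rw [h1, LinearMap.trace_conj']
    obtain ⟨h2, h3⟩ := finrank_fibre C2 U' x
    refine trace_eq_zero_of_det (h3.trans finrank_euclideanSpace_fin) R fun s₁ s₂ α ↦ ?_
    rw [hR, hR]
    exact P.C_flat x (X x) (Y x) s₁ s₂ α
  obtain ⟨r, hr⟩ := P.exists_pauli_eq hanti htr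
  -- Since `Σ` is parallel, `[D, Σ(w)] = Σ(Ř w)`. With `D = Σ(r)` the commutator is also `Σ(r × w)`,
  -- whence `Ř w = r × w` and `r` is dual to `ρ`.
  refine ⟨r, rho_eq fun w ↦ P.pauli_injective x (LinearMap.ext fun u ↦ ?_), fun ψ hψ ↦ ?_⟩
  · obtain ⟨Z, W₀, hW₀, hx₀, hZ, hZx⟩ := exists_ver_extension w
    let W' := W ∩ (W₀ ∩ (trivializationAt C2 U x).baseSet)
    have hW' : IsOpen W' := hW.inter (hW₀.inter (Trivialization.open_baseSet _))
    have hx' : x ∈ W' := ⟨hx, hx₀, mem_baseSet_extend x⟩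
    have hW'W : W' ⊆ W := inter_subset_left
    have hZ' : VerSmoothOn S.t W' Z := SmoothOn.mono hZ fun y hy ↦ hy.2.1
    have hs : SmoothOn C2 W' (FiberBundle.extend C2 u : ∀ y, U y) :=
      (smoothOn_extend u).mono fun y hy ↦ hy.2.2
    have hc' := hc.mono hW'W
    have h := curvOp_bilin (F := C2) (V := U) (p₁ := VerSmoothOn S.t W') (p₂ := SmoothOn C2 W')
      (cov₁ := S.covVer) (cov₂ := P.tensorConn o)
      (B := fun y a b ↦ P.pauli y a b) (cov := P.tensorConn o) (x := x)
      (by intro a a' b; simp) (by intro a b b'; simp)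
      (fun a b ha hb ↦ P.pauli_smooth W' a b hW' ha hb)
      (fun a Z ha hZ ↦ verSmoothOn_covVer hW' ha hZ)
      (fun b Z hb hZ ↦ hc'.smooth W' subset_rfl hW' b Z hb hZ) hc'
      (fun a b ha hb y hy v ↦ P.tensorConn_pauli o hW' hy ha hb v) hW' hx'
      (hX.mono hW'W) (hY.mono hW'W) hZ' hs
    rw [hD' W' hW' hx' hW'W _ (P.pauli_smooth W' _ _ hW' hZ' hs), hD' W' hW' hx' hW'W _ hs,
      coe_curvOp_covVer hW' hx' (hX.mono hW'W) (hY.mono hW'W) hZ', hZx,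
      FiberBundle.extend_apply_self, ← hr] at h
    rw [← P.pauli_commutator x r w]
    exact (sub_eq_of_eq_add h).symm
  · rw [hD' W hW hx subset_rfl ψ hψ, hr]

end SpinQuantum

/-! ### Special phase functions -/

section Lifts

variable {M : Type*} [TopologicalSpace M] [ChartedSpace R4 M] [IsManifold 𝓘(ℝ, R4) ∞ M]
  {F : Type*} [NormedAddCommGroup F] [NormedSpace ℝ F]
  {V : M → Type*} [TopologicalSpace (TotalSpace F V)]
  [∀ x, AddCommGroup (V x)] [∀ x, Module ℝ (V x)] [∀ x, TopologicalSpace (V x)]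
  [FiberBundle F V] [VectorBundle ℝ F V] [ContMDiffVectorBundle ∞ F V 𝓘(ℝ, R4)]
  {cov : (∀ x, V x) → ∀ x : M, Tan x → V x} {u : TotalSpace F V}

lemma hlift_add (h : ∀ s x X Y, cov s x (X + Y) = cov s x X + cov s x Y) (X Y : Tan u.proj) :
    hlift cov u (X + Y) = hlift cov u X + hlift cov u Y := by
  simp only [hlift, map_add, h, vlift_add]
  exact add_sub_add_comm _ _ _ _

lemma hlift_smul (h : ∀ s x (c : ℝ) X, cov s x (c • X) = c • cov s x X) (c : ℝ) (X : Tan u.proj) :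
    hlift cov u (c • X) = c • hlift cov u X := by
  simp only [hlift, map_smul, h, vlift_smul]
  exact (smul_sub _ _ _).symm

end Lifts

/-! ### Quadratic functions of the velocity and the scalar bracket -/

namespace Spacetime

variable {M : Type*} [TopologicalSpace M] [ChartedSpace R4 M] [IsManifold 𝓘(ℝ, R4) ∞ M]
  {S : Spacetime M} {x : M} {W W' : Set M}

variable (S) in
lemma coef_pos : 0 < S.coef := div_pos S.mass_pos S.hbar_pos

variable (S) in
/-- A function of the velocities at `x` is quadratic, in the way of a special phase function with
associated tangent vector `X`. -/
def QuadAt (x : M) (f : S.J1 x → ℝ) (X : Tan x) : Prop :=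
  ∀ v v', f v' = f v + S.coef * (S.dt x X / 2 * S.g x (v'.sub v) (v'.sub v)
    - S.g x (S.spacePart x v X) (v'.sub v))

/-- Taylor expansion of a quadratic function at an arbitrary velocity instead of `v₀`. In this form
the role of the reference velocity disappears, and `X[f]` is seen not to depend on it. -/
lemma quadAt_quad (v₀ : S.J1 x) (a : ℝ) (b : S.VE x) (c : ℝ) :
    S.QuadAt x (S.quad x v₀ a b c) (a • v₀.1 - (b : Tan x)) := by
  intro v v'
  have h1 : v'.sub v = v'.sub v₀ - v.sub v₀ := Subtype.ext (by
    change v'.1 - v.1 = (v'.1 - v₀.1) - (v.1 - v₀.1)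
    abel)
  have h2 : S.dt x (a • v₀.1 - (b : Tan x)) = a := by
    rw [map_sub, map_smul, show S.dt x v₀.1 = 1 from v₀.2, show S.dt x (b : Tan x) = 0 from b.2]
    simp
  have h3 : S.spacePart x v (a • v₀.1 - (b : Tan x)) = -(a • v.sub v₀) - b := by
    refine Subtype.ext ?_
    rw [coe_spacePart, h2]
    change a • v₀.1 - (b : Tan x) - a • v.1 = -(a • (v.1 - v₀.1)) - (b : Tan x)
    module
  rw [h1, h2, h3]
  simp only [quad, map_sub, map_neg, map_smul, LinearMap.sub_apply, LinearMap.neg_apply,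
    LinearMap.smul_apply, smul_eq_mul, S.g_symm x (v'.sub v₀) (v.sub v₀)]
  ring

lemma QuadAt.eq_quad {f : S.J1 x → ℝ} {X : Tan x} (h : S.QuadAt x f X) (v₀ v : S.J1 x) :
    f v = S.quad x v₀ (S.dt x X) (-S.spacePart x v₀ X) (f v₀) v := by
  rw [h v₀ v, quad]
  simp only [map_neg, LinearMap.neg_apply]
  ring

lemma eq_add_spacePart (v : S.J1 x) (X : Tan x) :
    X = S.dt x X • v.1 + (S.spacePart x v X : Tan x) := by
  rw [coe_spacePart]
  exact (add_sub_cancel _ _).symm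

/-- The increments along a unit vector and its opposite give `dt X`; what remains is linear and
gives the spacelike part. -/
lemma QuadAt.unique {f : S.J1 x → ℝ} {X X' : Tan x} (h : S.QuadAt x f X) (h' : S.QuadAt x f X') :
    X = X' := by
  let v := S.someObserver x
  have hk := S.coef_pos.ne'
  have key : ∀ w : S.VE x, S.dt x X / 2 * S.g x w w - S.g x (S.spacePart x v X) w
      = S.dt x X' / 2 * S.g x w w - S.g x (S.spacePart x v X') w := by
    intro w
    have h1 := (h v (v.add w)).symm.trans (h' v (v.add w))
    rw [J1.sub_add] at h1
    exact mul_left_cancel₀ hk (add_left_cancel h1)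
  have hdt : S.dt x X = S.dt x X' := by
    obtain ⟨e⟩ := S.exists_orientedFrame x
    have h1 := key (e.b 0)
    have h2 := key (-e.b 0)
    have h3 : S.g x (e.b 0) (e.b 0) = 1 := by simp [e.ortho]
    simp only [map_neg, LinearMap.neg_apply, neg_neg, h3] at h1 h2
    linarith
  have hsp : S.spacePart x v X = S.spacePart x v X' := g_ext fun w ↦ by
    have := key w
    rw [hdt] at this
    linarith
  rw [eq_add_spacePart v X, eq_add_spacePart v X', hdt, hsp]

lemma vec_eq {f : ∀ x, S.J1 x → ℝ} {X : Tan x} (h : S.QuadAt x (f x) X) : S.vec f x = X := by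
  have h1 : ∃ X : Tan x, ∃ (v₀ : S.J1 x) (a : ℝ) (b : S.VE x) (c : ℝ),
      (∀ v, f x v = S.quad x v₀ a b c v) ∧ X = a • v₀.1 - (b : Tan x) := by
    refine ⟨_, S.someObserver x, _, _, _, h.eq_quad _, rfl⟩
  rw [vec, dif_pos h1]
  obtain ⟨v₀, a, b, c, h2, h3⟩ := h1.choose_spec
  refine QuadAt.unique ?_ h
  rw [h3, show f x = S.quad x v₀ a b c from funext h2]
  exact quadAt_quad v₀ a b c

lemma QuadAt.add {f f' : S.J1 x → ℝ} {X X' : Tan x} (h : S.QuadAt x f X) (h' : S.QuadAt x f' X') :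
    S.QuadAt x (f + f') (X + X') := by
  intro v v'
  have h1 : S.spacePart x v (X + X') = S.spacePart x v X + S.spacePart x v X' := Subtype.ext (by
    rw [Submodule.coe_add]
    simp only [coe_spacePart, map_add]
    module)
  rw [Pi.add_apply, Pi.add_apply, h v v', h' v v', h1]
  simp only [map_add, LinearMap.add_apply]
  ring

lemma QuadAt.smul {f : S.J1 x → ℝ} {X : Tan x} (c : ℝ) (h : S.QuadAt x f X) :
    S.QuadAt x (c • f) (c • X) := by
  intro v v'
  have h1 : S.spacePart x v (c • X) = c • S.spacePart x v X := Subtype.ext (by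
    rw [Submodule.coe_smul]
    simp only [coe_spacePart, map_smul, smul_eq_mul]
    module)
  rw [Pi.smul_apply, Pi.smul_apply, h v v', h1]
  simp only [map_smul, LinearMap.smul_apply, smul_eq_mul]
  ring

variable (S) in
/-- The special phase functions with a given associated vector field, in terms of arbitrary
observers. -/
structure IsSpecialWith (W : Set M) (f : ∀ x, S.J1 x → ℝ) (X : ∀ x : M, Tan x) : Prop where
  smooth_vec : SmoothOn R4 W X
  quad : ∀ x ∈ W, S.QuadAt x (f x) (X x)
  smooth : ∀ W' ⊆ W, IsOpen W' → ∀ o, S.IsObserverOn W' o →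
    ContMDiffOn 𝓘(ℝ, R4) 𝓘(ℝ, ℝ) ∞ (fun y ↦ f y (o y)) W'

variable {f f' : ∀ x, S.J1 x → ℝ} {X X' : ∀ x : M, Tan x}

lemma verSmoothOn_sub {o o' : ∀ x, S.J1 x} (ho : S.IsObserverOn W o) (ho' : S.IsObserverOn W o') :
    VerSmoothOn S.t W (fun y ↦ (o y).sub (o' y)) := SmoothOn.sub ho ho'

lemma IsSpecialWith.mono (h : S.IsSpecialWith W f X) (hW : W' ⊆ W) : S.IsSpecialWith W' f X where
  smooth_vec := h.smooth_vec.mono hW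
  quad x hx := h.quad x (hW hx)
  smooth W'' h' := h.smooth W'' (h'.trans hW)

lemma IsSpecialWith.congr (h : S.IsSpecialWith W f X) (hf : ∀ x ∈ W, f' x = f x)
    (hX : ∀ x ∈ W, X' x = X x) : S.IsSpecialWith W f' X' where
  smooth_vec := h.smooth_vec.congr hX
  quad x hx := by
    rw [hf x hx, hX x hx]
    exact h.quad x hx
  smooth W' h' hW' o ho := (h.smooth W' h' hW' o ho).congr fun y hy ↦ by rw [hf y (h' hy)]

lemma isSpecialWith_of_local
    (h : ∀ x ∈ W, ∃ W', IsOpen W' ∧ x ∈ W' ∧ S.IsSpecialWith W' f X) : S.IsSpecialWith W f X where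
  smooth_vec := smoothOn_of_forall fun x hx ↦ by
    obtain ⟨W', h1, h2, h3⟩ := h x hx
    exact ⟨W', h1, h2, h3.smooth_vec⟩
  quad x hx := by
    obtain ⟨W', h1, h2, h3⟩ := h x hx
    exact h3.quad x h2
  smooth W₁ h₁ hW₁ o ho := by
    refine contMDiffOn_of_locally_contMDiffOn fun x hx ↦ ?_
    obtain ⟨W', h1, h2, h3⟩ := h x (h₁ hx)
    exact ⟨W', h1, h2, h3.smooth _ inter_subset_right (hW₁.inter h1) o
      (SmoothOn.mono ho inter_subset_left)⟩

/-- Passes from one local observer to all of them. Conversely any observer `o` recovers the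
coefficients as `f⁰ = dt X`, `f⃗ = -(X - dt(X) o)` and `f̆ = f[o]`. -/
lemma isSpecialOn_iff (hW : IsOpen W) : S.IsSpecialOn W f ↔ S.IsSpecialWith W f (S.vec f) := by
  constructor
  · intro h
    refine isSpecialWith_of_local fun x hx ↦ ?_
    obtain ⟨W', hW', hx', hsub, o, a, b, c, ho, ha, hb, hc, hf⟩ := h x hx
    have hq : ∀ y ∈ W', S.QuadAt y (f y) (a y • (o y).1 - (b y : Tan y)) := fun y hy ↦ by
      rw [show f y = _ from funext (hf y hy)]
      exact quadAt_quad _ _ _ _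
    refine ⟨W', hW', hx', ?_, fun y hy ↦ ?_, fun W₁ h₁ hW₁ o' ho' ↦ ?_⟩
    · exact ((SmoothOn.smul ha ho).sub hb).congr fun y hy ↦ vec_eq (hq y hy)
    · rw [vec_eq (hq y hy)]
      exact hq y hy
    · have hd := verSmoothOn_sub ho' (SmoothOn.mono ho h₁)
      have h2 := S.g_smooth W₁ _ _ hW₁ hd hd
      have h3 := S.g_smooth W₁ _ _ hW₁ (SmoothOn.mono hb h₁) hd
      refine ContMDiffOn.congr ((((ha.mono h₁).mul (contMDiffOn_const (c := S.coef / 2))).mul h2).add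
        ((contMDiffOn_const (c := S.coef)).mul h3) |>.add (hc.mono h₁)) fun y hy ↦ ?_
      rw [hf y (h₁ hy)]
      rfl
  · intro h x hx
    obtain ⟨o, W₁, hW₁, hx₁, ho, -, -⟩ := S.exists_parallel_observer (S.someObserver x)
    have hW₂ := hW.inter hW₁
    have ho₂ : S.IsObserverOn (W ∩ W₁) o := SmoothOn.mono ho inter_subset_right
    have hX := h.smooth_vec.mono (inter_subset_left (t := W₁))
    exact ⟨W ∩ W₁, hW₂, ⟨hx, hx₁⟩, inter_subset_left, o, fun y ↦ S.dt y (S.vec f y),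
      fun y ↦ -S.spacePart y (o y) (S.vec f y), fun y ↦ f y (o y), ho₂, contMDiffOn_dt hW₂ hX,
      by
        have := (VerSmoothOn.smul (contMDiffOn_const (c := (-1 : ℝ)))
          (verSmoothOn_spacePart hW₂ ho₂ hX))
        exact SmoothOn.congr this fun y _ ↦ congrArg Subtype.val
          (neg_one_smul ℝ (S.spacePart y (o y) (S.vec f y))).symm,
      h.smooth _ inter_subset_left hW₂ o ho₂, fun y hy v ↦ (h.quad y hy.1).eq_quad (o y) v⟩

/-! #### Derivatives of special phase functions -/

lemma extJ1_coe (v : S.J1 x) : S.extJ1 f (TotalSpace.mk' R4 x v.1) = f x v := by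
  rw [extJ1, dif_pos (dt_ne_zero v)]
  exact congrArg (f x) (ofTan_coe v _)

variable (S) in
lemma contMDiff_dt : ContMDiff (𝓘(ℝ, R4).prod 𝓘(ℝ, R4)) 𝓘(ℝ, ℝ) ∞
    (fun w : TangentBundle 𝓘(ℝ, R4) M ↦ S.dt w.proj w.snd) :=
  (contMDiff_snd_tangentBundle_modelSpace (n := ∞) ℝ 𝓘(ℝ, ℝ)).comp
    (S.t_smooth.contMDiff_tangentMap (by simp))

lemma spacePart_sum {ι : Type*} (t : Finset ι) (v : S.J1 x) (c : ι → ℝ) (X : ι → Tan x) :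
    S.spacePart x v (∑ i ∈ t, c i • X i) = ∑ i ∈ t, c i • S.spacePart x v (X i) := by
  refine Subtype.ext ?_
  simp only [Submodule.coe_sum, Submodule.coe_smul, coe_spacePart, map_sum, map_smul, smul_eq_mul,
    smul_sub, Finset.sum_sub_distrib, Finset.sum_smul, mul_smul]

lemma ofTan_sub (v : S.J1 x) {w : Tan x} (h : S.dt x w ≠ 0) :
    (J1.ofTan S w h).sub v = (S.dt x w)⁻¹ • S.spacePart x v w := by
  refine Subtype.ext ?_
  rw [Submodule.coe_smul, coe_spacePart, smul_sub, inv_smul_smul₀ h]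
  rfl

/-- Special phase functions are differentiable functions of the velocity. -/
lemma IsSpecialWith.mdifferentiableAt (h : S.IsSpecialWith W f X) (hW : IsOpen W) (hx : x ∈ W)
    (v : S.J1 x) : MDifferentiableAt (𝓘(ℝ, R4).prod 𝓘(ℝ, R4)) 𝓘(ℝ, ℝ) (S.extJ1 f)
      (TotalSpace.mk' R4 x v.1) := by
  obtain ⟨o, W₁, hW₁, hx₁, ho, -, -⟩ := S.exists_parallel_observer v
  set e := trivializationAt R4 (TangentSpace 𝓘(ℝ, R4) : M → Type) x
  let W₂ := W ∩ W₁ ∩ e.baseSet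
  have hW₂ : IsOpen W₂ := (hW.inter hW₁).inter e.open_baseSet
  have hx₂ : x ∈ W₂ := ⟨⟨hx, hx₁⟩, mem_baseSet_extend x⟩
  have ho₂ : S.IsObserverOn W₂ o := SmoothOn.mono ho fun y hy ↦ hy.1.2
  let b := EuclideanSpace.basisFun (Fin 4) ℝ
  let ε : Fin 4 → ∀ y : M, Tan y := fun i y ↦ e.symm y (b i)
  have hε : ∀ i, SmoothOn R4 W₂ (ε i) := fun i ↦ by
    refine smoothOn_of_fib (e := e) (fun y hy ↦ hy.2) ?_
    exact (contMDiffOn_const (c := b i)).congr fun y hy ↦ fib_symm hy.2 _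
  -- Four fields that span the three-dimensional spacelike spaces. Independence is not needed: the
  -- spacelike part of `w` only has to be a combination of them with the coordinates of `w` as
  -- coefficients.
  let E : Fin 4 → ∀ y, S.VE y := fun i y ↦ S.spacePart y (o y) (ε i y)
  have hE : ∀ i, VerSmoothOn S.t W₂ (E i) := fun i ↦ verSmoothOn_spacePart hW₂ ho₂ (hε i)
  let z : Fin 4 → TangentBundle 𝓘(ℝ, R4) M → ℝ := fun i w ↦ fib e w.proj w.snd i
  let O : Set (TangentBundle 𝓘(ℝ, R4) M) := {w | w.proj ∈ W₂}
  have hO : IsOpen O := isOpen_over R4 (TangentSpace 𝓘(ℝ, R4) : M → Type) hW₂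
  have hz : ∀ i, ContMDiffOn (𝓘(ℝ, R4).prod 𝓘(ℝ, R4)) 𝓘(ℝ, ℝ) ∞ (z i) O := fun i ↦
    (EuclideanSpace.proj (𝕜 := ℝ) i).contMDiff.comp_contMDiffOn
      ((contMDiffOn_fib_snd (e := e)).mono fun w hw ↦ e.mem_source.2 hw.2)
  have hw : ∀ w ∈ O, S.spacePart w.proj (o w.proj) w.snd = ∑ i, z i w • E i w.proj := by
    intro w hw
    have h1 : w.snd = ∑ i, z i w • ε i w.proj := by
      refine fib_injective (e := e) hw.2 ?_
      rw [fib_sum _ hw.2]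
      simp only [fib_smul hw.2, ε, fib_symm hw.2]
      exact (b.sum_repr (fib e w.proj w.snd)).symm
    rw [← spacePart_sum, ← h1]
  let τ : TangentBundle 𝓘(ℝ, R4) M → ℝ := fun w ↦ S.dt w.proj w.snd
  let O' := O ∩ τ ⁻¹' {0}ᶜ
  have hO' : IsOpen O' := hO.inter (isOpen_compl_singleton.preimage S.contMDiff_dt.continuous)
  have hxO : (TotalSpace.mk' R4 x v.1 : TangentBundle 𝓘(ℝ, R4) M) ∈ O' := ⟨hx₂, dt_ne_zero v⟩
  have hτ : ContMDiffOn (𝓘(ℝ, R4).prod 𝓘(ℝ, R4)) 𝓘(ℝ, ℝ) ∞ (fun w ↦ (τ w)⁻¹) O' := fun w hw ↦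
    (contDiffAt_inv ℝ hw.2).contMDiffAt.comp_contMDiffWithinAt w
      (S.contMDiff_dt.contMDiffOn (s := O') w hw)
  have hX₂ : SmoothOn R4 W₂ X := h.smooth_vec.mono fun y hy ↦ hy.1.1
  have hc : ∀ {k : M → ℝ}, ContMDiffOn 𝓘(ℝ, R4) 𝓘(ℝ, ℝ) ∞ k W₂ → ContMDiffOn
      (𝓘(ℝ, R4).prod 𝓘(ℝ, R4)) 𝓘(ℝ, ℝ) ∞ (fun w : TangentBundle 𝓘(ℝ, R4) M ↦ k w.proj) O' :=
    fun hk ↦ (contMDiffOn_comp_proj (V := (TangentSpace 𝓘(ℝ, R4) : M → Type)) hk).mono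
      inter_subset_left
  have c1 := hc (h.smooth W₂ (fun y hy ↦ hy.1.1) hW₂ o ho₂)
  have c2 := hc (contMDiffOn_dt (S := S) hW₂ hX₂)
  have c3 : ContMDiffOn (𝓘(ℝ, R4).prod 𝓘(ℝ, R4)) 𝓘(ℝ, ℝ) ∞
      (fun w ↦ ∑ i, ∑ j, z i w * z j w * S.g w.proj (E i w.proj) (E j w.proj)) O' :=
    contMDiffOn_finsetSum fun i _ ↦ contMDiffOn_finsetSum fun j _ ↦
      (((hz i).mono inter_subset_left).mul ((hz j).mono inter_subset_left)).mul
        (hc (S.g_smooth W₂ _ _ hW₂ (hE i) (hE j)))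
  have c4 : ContMDiffOn (𝓘(ℝ, R4).prod 𝓘(ℝ, R4)) 𝓘(ℝ, ℝ) ∞
      (fun w ↦ ∑ i, z i w * S.g w.proj (S.spacePart w.proj (o w.proj) (X w.proj)) (E i w.proj)) O' :=
    contMDiffOn_finsetSum fun i _ ↦ ((hz i).mono inter_subset_left).mul
        (hc (S.g_smooth W₂ _ _ hW₂ (verSmoothOn_spacePart hW₂ ho₂ hX₂) (hE i)))
  -- The quadratic expansion of `f` around `o`, evaluated at the velocity `w / dt(w)`.
  have c5 := c1.add ((contMDiffOn_const (c := S.coef)).mul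
    (((c2.mul (contMDiffOn_const (c := (2 : ℝ)⁻¹))).mul ((hτ.mul hτ).mul c3)).sub (hτ.mul c4)))
  refine ((c5.contMDiffAt (hO'.mem_nhds hxO)).mdifferentiableAt (by simp)).congr_of_eventuallyEq ?_
  filter_upwards [hO'.mem_nhds hxO] with w hwO
  have h0 : S.dt w.proj w.snd ≠ 0 := hwO.2
  rw [extJ1, dif_pos h0, (h.quad _ hwO.1.1.1) (o w.proj), ofTan_sub, hw w hwO.1]
  simp only [map_smul, map_sum, LinearMap.smul_apply, LinearMap.sum_apply, smul_eq_mul,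
    Finset.mul_sum]
  change _ = f w.proj (o w.proj) + S.coef * (S.dt w.proj (X w.proj) * 2⁻¹ * ((τ w)⁻¹ * (τ w)⁻¹ * _)
    - (τ w)⁻¹ * _)
  simp only [Finset.mul_sum, τ]
  congr 3
  refine Finset.sum_congr rfl fun i _ ↦ Finset.sum_congr rfl fun j _ ↦ ?_
  rw [S.g_symm _ (E j _)]
  ring

/-- The linear term of the expansion of `f` along the line `v + r w`. -/
lemma IsSpecialWith.dVer_eq (h : S.IsSpecialWith W f X) (hW : IsOpen W) (hx : x ∈ W)
    (v : S.J1 x) (w : S.VE x) :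
    S.dVer f x v w = -S.coef * S.g x (S.spacePart x v (X x)) w := by
  have h1 := hasDerivAt_vlift (h.mdifferentiableAt hW hx v) (w : Tan x)
  have h2 : ∀ r : ℝ, S.extJ1 f (TotalSpace.mk' R4 x (v.1 + r • (w : Tan x)))
      = f x v + S.coef * (S.dt x (X x) / 2 * (r ^ 2 * S.g x w w)
        - r * S.g x (S.spacePart x v (X x)) w) := by
    intro r
    refine (extJ1_coe (v.add (r • w))).trans ?_
    rw [h.quad x hx v, J1.sub_add]
    simp only [map_smul, LinearMap.smul_apply, smul_eq_mul]
    ring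
  have h3 : HasDerivAt (fun r : ℝ ↦ f x v + S.coef * (S.dt x (X x) / 2 * (r ^ 2 * S.g x w w)
      - r * S.g x (S.spacePart x v (X x)) w)) (-S.coef * S.g x (S.spacePart x v (X x)) w) 0 := by
    have h4 := ((((hasDerivAt_pow 2 (0 : ℝ)).mul_const (S.g x w w)).const_mul
      (S.dt x (X x) / 2)).sub ((hasDerivAt_id (0 : ℝ)).mul_const
        (S.g x (S.spacePart x v (X x)) w))).const_mul S.coef |>.const_add (f x v)
    refine h4.congr_deriv ?_
    simp
  exact h1.unique (h3.congr_of_eventuallyEq (Filter.Eventually.of_forall h2))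

lemma IsSpecialWith.gradVer_eq (h : S.IsSpecialWith W f X) (hW : IsOpen W) (hx : x ∈ W)
    (v : S.J1 x) : S.gradVer f x v = -S.coef • S.spacePart x v (X x) := by
  have h1 : ∃ u : S.VE x, ∀ w : S.VE x, S.g x u w = S.dVer f x v w :=
    ⟨-S.coef • S.spacePart x v (X x), fun w ↦ by
      rw [h.dVer_eq hW hx, map_smul, LinearMap.smul_apply, smul_eq_mul]⟩
  rw [gradVer, dif_pos h1]
  refine g_ext fun w ↦ ?_
  rw [h1.choose_spec, h.dVer_eq hW hx, map_smul, LinearMap.smul_apply, smul_eq_mul]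

/-- Where `o` is parallel its tangent map is the horizontal lift, so the horizontal derivative of
`f` is the derivative of `f[o]`. -/
lemma IsSpecialWith.dHor_eq (h : S.IsSpecialWith W f X) (hW : IsOpen W) (hx : x ∈ W)
    {o : ∀ x, S.J1 x} (ho : DiffAt R4 (fun y ↦ (o y).1) x)
    (hp : ∀ X, S.K (fun y ↦ (o y).1) x X = 0) (Z : Tan x) :
    S.dHor f x (o x) Z = mvfderiv 𝓘(ℝ, R4) (fun y ↦ f y (o y)) x Z := by
  have h1 := mvfderiv_comp_observer (h.mdifferentiableAt hW hx (o x)) ho rfl Z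
  have h2 : vlift (F := R4) (V := (TangentSpace 𝓘(ℝ, R4) : M → Type))
      (TotalSpace.mk' R4 x (o x).1) 0 = 0 := by
    have := vlift_smul (F := R4) (V := (TangentSpace 𝓘(ℝ, R4) : M → Type))
      (u := TotalSpace.mk' R4 x (o x).1) 0 0
    simpa using this
  rw [hp Z, h2, map_zero, add_zero] at h1
  refine h1.symm.trans ?_
  exact congrArg (fun k ↦ mvfderiv 𝓘(ℝ, R4) k x Z) (funext fun y ↦ extJ1_coe (o y))

lemma gradHor_spec (f : ∀ x, S.J1 x → ℝ) (v : S.J1 x) (w : S.VE x) :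
    S.g x (S.gradHor f x v) w = S.dHor f x v w := by
  have h1 : ∃ u : S.VE x, ∀ w : S.VE x, S.g x u w = S.dHor f x v w := by
    let α : Module.Dual ℝ (S.VE x) :=
      { toFun := fun w ↦ S.dHor f x v w
        map_add' := fun w w' ↦ by
          simp only [dHor, Submodule.coe_add]
          rw [hlift_add (fun s x X Y ↦ map_add _ _ _), map_add]
        map_smul' := fun c w ↦ by
          simp only [dHor, Submodule.coe_smul]
          rw [hlift_smul (fun s x c X ↦ map_smul _ _ _), map_smul]
          rfl }
    exact ⟨S.sharp x α, fun w ↦ sharp_spec α w⟩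
  rw [gradHor, dif_pos h1]
  exact h1.choose_spec w

/-- The special bracket of scalar functions along an observer that is parallel at `x`. -/
lemma scalarBracket_eq (h : S.IsSpecialWith W f X) (h' : S.IsSpecialWith W f' X') (hW : IsOpen W)
    (hx : x ∈ W) {o : ∀ x, S.J1 x} (ho : DiffAt R4 (fun y ↦ (o y).1) x)
    (hp : ∀ X, S.K (fun y ↦ (o y).1) x X = 0) :
    S.scalarBracket f f' x (o x) = mvfderiv 𝓘(ℝ, R4) (fun y ↦ f' y (o y)) x (X x)
      - mvfderiv 𝓘(ℝ, R4) (fun y ↦ f y (o y)) x (X' x) := by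
  -- Each field is split into its component along `o` and its spacelike part. The `γ` terms account
  -- for the first. The Poisson bracket accounts for the second, because `gradVer` is a multiple of
  -- the spacelike part of `X[f]`.
  have e1 : ∀ (k : M → ℝ) (Z : Tan x), mvfderiv 𝓘(ℝ, R4) k x Z
      = S.dt x Z * mvfderiv 𝓘(ℝ, R4) k x (o x).1
        + mvfderiv 𝓘(ℝ, R4) k x (S.spacePart x (o x) Z : Tan x) := by
    intro k Z
    conv_lhs => rw [eq_add_spacePart (o x) Z, map_add, map_smul]
    rfl
  rw [scalarBracket, poisson, gammaDeriv, gammaDeriv, vec_eq (h.quad x hx), vec_eq (h'.quad x hx),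
    h.gradVer_eq hW hx, h'.gradVer_eq hW hx]
  simp only [map_smul, LinearMap.smul_apply, smul_eq_mul]
  rw [S.g_symm x (S.spacePart x (o x) (X x)), gradHor_spec, gradHor_spec, h.dHor_eq hW hx ho hp,
    h'.dHor_eq hW hx ho hp, h.dHor_eq hW hx ho hp, h'.dHor_eq hW hx ho hp, e1 _ (X x), e1 _ (X' x)]
  have hk := S.coef_pos.ne'
  field_simp
  ring

end Spacetime

/-! ### Special phase functions with spin -/

namespace Spacetime

variable {M : Type*} [TopologicalSpace M] [ChartedSpace R4 M] [IsManifold 𝓘(ℝ, R4) ∞ M]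
  {S : Spacetime M} {x : M} {V W : TopologicalSpace.Opens M} {G G' : S.PhaseFun V}
  {X X' : ∀ x : M, Tan x} {Z Z' : ∀ x, S.VE x}

lemma scalarPart_apply (G : S.PhaseFun V) (hx : x ∈ V) (v : S.J1 x) :
    scalarPart G x v = G ⟨x, hx⟩ v 0 := dif_pos hx

lemma scalarPart_add (G G' : S.PhaseFun V) :
    scalarPart (G + G') = scalarPart G + scalarPart G' := by
  funext x v
  by_cases hx : x ∈ V
  · simp [scalarPart, hx]
  · simp [scalarPart, hx]

lemma scalarPart_smul (c : ℝ) (G : S.PhaseFun V) : scalarPart (c • G) = c • scalarPart G := by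
  funext x v
  by_cases hx : x ∈ V
  · simp [scalarPart, hx]
  · simp [scalarPart, hx]

/-- The special phase functions with spin, in terms of the associated vector fields. -/
structure SpecialRep (G : S.PhaseFun V) (X : ∀ x : M, Tan x) (Z : ∀ x, S.VE x) : Prop where
  scalar : S.IsSpecialWith (V : Set M) (scalarPart G) X
  spin : VerSmoothOn S.t (V : Set M) Z
  eq : ∀ x (hx : x ∈ V) v w, G ⟨x, hx⟩ v w = scalarPart G x v + S.g x (Z x) w

lemma SpecialRep.vecField_eq (h : SpecialRep G X Z) (hx : x ∈ V) : vecField G x = X x :=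
  vec_eq (h.scalar.quad x hx)

lemma spinVec_eq {z : S.VE x} (hx : x ∈ V)
    (h : ∀ v w, G ⟨x, hx⟩ v w = G ⟨x, hx⟩ v 0 + S.g x z w) : spinVec G x = z := by
  have h1 : ∃ (hx : x ∈ V) (φ : Module.Dual ℝ (S.VE x)),
      ∀ v w, G ⟨x, hx⟩ v w = G ⟨x, hx⟩ v 0 + φ w := ⟨hx, S.g x z, h⟩
  refine g_ext fun w ↦ ?_
  rw [spinVec, spinPart, dif_pos h1, sharp_spec]
  have h2 := h1.choose_spec.choose_spec (S.someObserver x) w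
  rw [h] at h2
  exact (add_left_cancel h2).symm

lemma SpecialRep.spinVec_eq (h : SpecialRep G X Z) (hx : x ∈ V) : spinVec G x = Z x :=
  Spacetime.spinVec_eq hx fun v w ↦ by rw [h.eq x hx, scalarPart_apply G hx]

lemma SpecialRep.congr (h : SpecialRep G X Z) (hX : ∀ x ∈ V, X' x = X x)
    (hZ : ∀ x ∈ V, Z' x = Z x) : SpecialRep G X' Z' where
  scalar := h.scalar.congr (fun _ _ ↦ rfl) hX
  spin := SmoothOn.congr h.spin fun y hy ↦ by rw [hZ y hy]
  eq x hx v w := by rw [h.eq x hx, hZ x hx]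

lemma SpecialRep.canonical (h : SpecialRep G X Z) : SpecialRep G (vecField G) (spinVec G) :=
  h.congr (fun _ hx ↦ h.vecField_eq hx) (fun _ hx ↦ h.spinVec_eq hx)

lemma SpecialRep.mem (h : SpecialRep G X Z) : G ∈ S.special V :=
  ⟨scalarPart G, fun x ↦ S.g x (Z x), (isSpecialOn_iff V.isOpen).2 h.canonical.scalar,
    fun _ Y hW' hsub hY ↦ S.g_smooth _ Z Y hW' (SmoothOn.mono h.spin hsub) hY,
    fun x v w ↦ h.eq x x.2 v w⟩

/-- Special phase functions are handled from here on through their smooth fields `X[f]` and `φ^♯`;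
smoothness of the second is that of raising an index. -/
lemma mem_special_iff : G ∈ S.special V ↔ SpecialRep G (vecField G) (spinVec G) := by
  refine ⟨?_, SpecialRep.mem⟩
  rintro ⟨f, φ, hf, hφ, h⟩
  have h1 : ∀ x (hx : x ∈ V) v, scalarPart G x v = f x v := fun x hx v ↦ by
    rw [scalarPart_apply G hx, h ⟨x, hx⟩, map_zero, add_zero]
  have h2 : SpecialRep G (S.vec f) (fun x ↦ S.sharp x (φ x)) :=
    ⟨((isSpecialOn_iff V.isOpen).1 hf).congr (fun x hx ↦ funext (h1 x hx)) fun _ _ ↦ rfl,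
      verSmoothOn_sharp V.isOpen hφ, fun x hx v w ↦ by rw [h1 x hx, sharp_spec, h ⟨x, hx⟩]⟩
  exact h2.canonical

lemma SpecialRep.add (h : SpecialRep G X Z) (h' : SpecialRep G' X' Z') :
    SpecialRep (G + G') (X + X') (fun x ↦ Z x + Z' x) where
  scalar := by
    rw [scalarPart_add]
    exact ⟨h.scalar.smooth_vec.add h'.scalar.smooth_vec,
      fun x hx ↦ (h.scalar.quad x hx).add (h'.scalar.quad x hx),
      fun W h1 h2 o ho ↦ (h.scalar.smooth W h1 h2 o ho).add (h'.scalar.smooth W h1 h2 o ho)⟩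
  spin := VerSmoothOn.add h.spin h'.spin
  eq x hx v w := by
    simp only [Pi.add_apply, h.eq x hx, h'.eq x hx, scalarPart_add, map_add, LinearMap.add_apply]
    ring

lemma SpecialRep.smul (c : ℝ) (h : SpecialRep G X Z) :
    SpecialRep (c • G) (c • X) (fun x ↦ c • Z x) where
  scalar := by
    rw [scalarPart_smul]
    exact ⟨h.scalar.smooth_vec.smul (f := fun _ ↦ c) contMDiffOn_const,
      fun x hx ↦ (h.scalar.quad x hx).smul c,
      fun W h1 h2 o ho ↦ contMDiffOn_const.mul (h.scalar.smooth W h1 h2 o ho)⟩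
  spin := VerSmoothOn.smul contMDiffOn_const h.spin
  eq x hx v w := by
    simp only [Pi.smul_apply, h.eq x hx, scalarPart_smul, map_smul, LinearMap.smul_apply,
      smul_eq_mul]
    ring

lemma scalarPart_resFun (h : W ≤ V) (G : S.PhaseFun V) (hx : x ∈ W) :
    scalarPart (resFun h G) x = scalarPart G x := by
  funext v
  rw [scalarPart_apply _ hx, scalarPart_apply G (h hx)]
  rfl

lemma SpecialRep.res (hW : W ≤ V) (h : SpecialRep G X Z) : SpecialRep (resFun hW G) X Z where
  scalar := (h.scalar.mono hW).congr (fun _ hx ↦ scalarPart_resFun hW G hx) fun _ _ ↦ rfl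
  spin := SmoothOn.mono h.spin hW
  eq x hx v w := by
    rw [scalarPart_resFun hW G hx]
    exact h.eq x (hW hx) v w

/-- The fields `vecField G` and `spinVec G` are defined event by event from `G`, so there is nothing
to glue, and the conditions on them are local. -/
lemma mem_special_of_local
    (h : ∀ x ∈ V, ∃ (W : TopologicalSpace.Opens M) (h : W ≤ V), x ∈ W ∧ resFun h G ∈ S.special W) :
    G ∈ S.special V := by
  have hloc : ∀ x ∈ V, ∃ W : TopologicalSpace.Opens M, x ∈ W ∧
      S.IsSpecialWith (W : Set M) (scalarPart G) (vecField G) ∧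
      VerSmoothOn S.t (W : Set M) (spinVec G) ∧
      ∀ (hx : x ∈ V) v w, G ⟨x, hx⟩ v w = scalarPart G x v + S.g x (spinVec G x) w := by
    intro x hx
    obtain ⟨W, hW, hxW, hG⟩ := h x hx
    have hr := mem_special_iff.1 hG
    have hs : ∀ y ∈ W, spinVec G y = spinVec (resFun hW G) y := fun y hy ↦
      Spacetime.spinVec_eq (hW hy) fun v w ↦ by
        have := hr.eq y hy v w
        rwa [scalarPart_apply _ hy] at this
    refine ⟨W, hxW, hr.scalar.congr (fun y hy ↦ (scalarPart_resFun hW G hy).symm) fun y hy ↦ ?_,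
      SmoothOn.congr hr.spin fun y hy ↦ by rw [hs y hy], fun hx' v w ↦ ?_⟩
    · have := hr.scalar.quad y hy
      rw [scalarPart_resFun hW G hy] at this
      exact vec_eq this
    · rw [hs x hxW, ← scalarPart_resFun hW G hxW]
      exact hr.eq x hxW v w
  refine SpecialRep.mem (X := vecField G) (Z := spinVec G) ⟨?_, ?_, fun x hx v w ↦ ?_⟩
  · refine isSpecialWith_of_local fun x hx ↦ ?_
    obtain ⟨W, h1, h2, -⟩ := hloc x hx
    exact ⟨W, W.isOpen, h1, h2⟩
  · refine smoothOn_of_forall fun x hx ↦ ?_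
    obtain ⟨W, h1, -, h2, -⟩ := hloc x hx
    exact ⟨W, W.isOpen, h1, h2⟩
  · obtain ⟨W, -, -, -, h2⟩ := hloc x hx
    exact h2 hx v w

/-- A special phase function is determined by its two vector fields and one of its values at each
event. -/
lemma special_ext (hG : G ∈ S.special V) (hG' : G' ∈ S.special V) (o : ∀ x, S.J1 x)
    (hX : ∀ x ∈ V, vecField G x = vecField G' x) (hZ : ∀ x ∈ V, spinVec G x = spinVec G' x)
    (hf : ∀ x ∈ V, scalarPart G x (o x) = scalarPart G' x (o x)) : G = G' := by
  have h := mem_special_iff.1 hG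
  have h' := mem_special_iff.1 hG'
  funext ⟨x, hx⟩ v w
  rw [h.eq x hx, h'.eq x hx, hZ x hx, h.scalar.quad x hx (o x) v, h'.scalar.quad x hx (o x) v,
    hX x hx, hf x hx]

end Spacetime

/-! ### Hermitian fields and pairs -/

namespace SpinQuantum

open Spacetime

variable {M : Type*} [TopologicalSpace M] [T2Space M] [ChartedSpace R4 M]
  [IsManifold 𝓘(ℝ, R4) ∞ M] {S : Spacetime M} {Q U' U : M → Type*}
  [TopologicalSpace (TotalSpace ℂ Q)] [∀ x, NormedAddCommGroup (Q x)]
  [∀ x, InnerProductSpace ℂ (Q x)] [FiberBundle ℂ Q] [VectorBundle ℂ ℂ Q]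
  [VectorBundle ℝ ℂ Q] [ContMDiffVectorBundle ∞ ℂ Q 𝓘(ℝ, R4)]
  [TopologicalSpace (TotalSpace C2 U')] [∀ x, NormedAddCommGroup (U' x)]
  [∀ x, InnerProductSpace ℂ (U' x)] [FiberBundle C2 U'] [VectorBundle ℂ C2 U']
  [VectorBundle ℝ C2 U'] [ContMDiffVectorBundle ∞ C2 U' 𝓘(ℝ, R4)]
  [TopologicalSpace (TotalSpace C2 U)] [∀ x, NormedAddCommGroup (U x)]
  [∀ x, InnerProductSpace ℂ (U x)] [FiberBundle C2 U] [VectorBundle ℂ C2 U]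
  [VectorBundle ℝ C2 U] [ContMDiffVectorBundle ∞ C2 U 𝓘(ℝ, R4)]
  (P : SpinQuantum S Q U' U) {W W' : Set M} {x : M} {o : ∀ x, S.J1 x}
  {ψ ψ' : ∀ x, U x} {X X' : ∀ x : M, Tan x} {N : ∀ x, U x →ₗ[ℂ] U x}
  {Y : ∀ u : TotalSpace C2 U, TotTan u}

/-- Smooth families of endomorphisms of the fibres. -/
def EndSmoothOn (W : Set M) (N : ∀ x, U x →ₗ[ℂ] U x) : Prop :=
  ∀ W' ⊆ W, IsOpen W' → ∀ ψ : ∀ x, U x, SmoothOn C2 W' ψ → SmoothOn C2 W' (fun y ↦ N y (ψ y))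

/-- The trace is computed in the basis transported from a trivialization. It is the tool that
extracts smooth scalars from smooth endomorphisms. -/
lemma EndSmoothOn.contMDiffOn_trace (h : EndSmoothOn W N) (hW : IsOpen W) :
    ContMDiffOn 𝓘(ℝ, R4) 𝓘(ℝ, ℂ) ∞ (fun x ↦ LinearMap.trace ℂ (U x) (N x)) W := by
  refine contMDiffOn_of_locally_contMDiffOn fun x hx ↦ ?_
  set e := trivializationAt C2 U x
  have hO : IsOpen (W ∩ e.baseSet) := hW.inter e.open_baseSet
  refine ⟨e.baseSet, e.open_baseSet, mem_baseSet_extend x, ?_⟩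
  let b := EuclideanSpace.basisFun (Fin 2) ℂ
  have h1 : ∀ i, ContMDiffOn 𝓘(ℝ, R4) 𝓘(ℝ, ℂ) ∞
      (fun y ↦ fib e y (N y (e.symm y (b i))) i) (W ∩ e.baseSet) := fun i ↦
    ((EuclideanSpace.proj (𝕜 := ℂ) i).restrictScalars ℝ).contMDiff.comp_contMDiffOn
      ((contMDiffOn_fib (e := e) (h _ inter_subset_left hO _
        ((smoothOn_symm (e := e) (b i)).mono inter_subset_right))).mono
          (subset_inter subset_rfl inter_subset_right))
  refine ContMDiffOn.congr (contMDiffOn_finsetSum (t := Finset.univ) fun i _ ↦ h1 i)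
    fun y hy ↦ ?_
  rw [LinearMap.trace_eq_matrix_trace ℂ (b.toBasis.map (e.linearEquivAt ℂ y hy.2).symm),
    Matrix.trace]
  refine Finset.sum_congr rfl fun i _ ↦ ?_
  rw [Matrix.diag_apply, LinearMap.toMatrix_apply]
  simp only [Module.Basis.map_repr, Module.Basis.map_apply, LinearEquiv.symm_symm,
    LinearEquiv.trans_apply, Trivialization.linearEquivAt_apply,
    Trivialization.linearEquivAt_symm_apply, OrthonormalBasis.coe_toBasis]
  rfl

/-- The horizontal lift subtracts the covariant derivative, so it changes by the opposite of
`tensorConn_sub`. -/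
lemma hlift_observer (o o' : ∀ x, S.J1 x) (u : U x) (X : Tan x) :
    hlift (P.tensorConn o') (TotalSpace.mk' C2 x u) X
      = hlift (P.tensorConn o) (TotalSpace.mk' C2 x u) X
        + vlift (TotalSpace.mk' C2 x u) ((Complex.I * ((S.coef
          * (S.g x ((o' x).sub (o x)) (S.spacePart x (o x) X)
            - S.dt x X / 2 * S.g x ((o' x).sub (o x)) ((o' x).sub (o x))) : ℝ) : ℂ)) • u) := by
  have h1 := P.tensorConn_sub (diffAt_extend C2 u) o o' X
  rw [FiberBundle.extend_apply_self, neg_mul, neg_smul, sub_eq_iff_eq_add] at h1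
  have h2 : P.tensorConn o (FiberBundle.extend C2 u) x X
      = P.tensorConn o' (FiberBundle.extend C2 u) x X + (Complex.I * ((S.coef
          * (S.g x ((o' x).sub (o x)) (S.spacePart x (o x) X)
            - S.dt x X / 2 * S.g x ((o' x).sub (o x)) ((o' x).sub (o x))) : ℝ) : ℂ)) • u := by
    rw [h1]
    abel
  simp only [hlift]
  rw [h2, vlift_add]
  have key : ∀ {A : Type} [AddCommGroup A] (a b c : A), a - b = a - (b + c) + c :=
    fun a b c ↦ by abel
  exact key _ _ _

/-- The vertical part of a linear field is the difference of the covariant derivative and the Lie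
derivative. -/
lemma vproj_sub_hlift {e : Trivialization C2 (π C2 U)} [MemTrivializationAtlas e] {A : M → End2}
    (h : AffRep e W Y X A 0) (hW : IsOpen W) (hWe : W ⊆ e.baseSet) (hx : x ∈ W)
    (o : ∀ x, S.J1 x) (hψ : SmoothOn C2 W ψ) :
    vproj (TotalSpace.mk' C2 x (ψ x)) (Y (TotalSpace.mk' C2 x (ψ x))
      - hlift (P.tensorConn o) (TotalSpace.mk' C2 x (ψ x)) (X x))
      = P.tensorConn o ψ x (X x) - lieSec Y ψ x := by
  have hp : dproj (Y (TotalSpace.mk' C2 x (ψ x))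
      - hlift (P.tensorConn o) (TotalSpace.mk' C2 x (ψ x)) (X x)) = 0 := by
    rw [dproj_sub, dproj_hlift, h.proj _ hx, sub_self]
  refine fib_injective (e := e) (hWe hx) ?_
  have h1 := fib_vproj (e := e) (u := TotalSpace.mk' C2 x (ψ x)) (hWe hx) hp
  rw [dfib_sub, dfib_hlift (hWe hx) (P.isConnAt_tensorConn o x) (hψ.diffAt hW hx) rfl,
    h.comp _ hx] at h1
  refine h1.trans ?_
  rw [fib_sub (hWe hx), fib_lieSec h hW hWe hψ hx]
  simp only [Pi.zero_apply, add_zero]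
  change A x (fib e x (ψ x)) - _ = _
  abel

/-- The vertical part of a Hermitian field. -/
lemma exists_vertical_part (h : HermField W Y X) (hW : IsOpen W) (hx : x ∈ W) (o : ∀ x, S.J1 x) :
    ∃ N : U x →ₗ[ℂ] U x, IsAntiHerm N ∧
      (∀ u, N u = vproj (TotalSpace.mk' C2 x u) (Y (TotalSpace.mk' C2 x u)
        - hlift (P.tensorConn o) (TotalSpace.mk' C2 x u) (X x))) ∧
      ∀ W' ⊆ W, IsOpen W' → x ∈ W' → ∀ ψ, SmoothOn C2 W' ψ →
        N (ψ x) = P.tensorConn o ψ x (X x) - lieSec Y ψ x := by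
  obtain ⟨e, _, W₁, hW₁, hx₁, hsub, hWe, hr⟩ := h.exists_rep hW hx
  set A := fieldMat e Y
  let ν : U x → U x := fun u ↦ vproj (TotalSpace.mk' C2 x u) (Y (TotalSpace.mk' C2 x u)
        - hlift (P.tensorConn o) (TotalSpace.mk' C2 x u) (X x))
  -- Evaluated on sections through arbitrary vectors, this identity yields complex linearity from
  -- that of `∇_X` and of `Y.`, and anti-Hermiticity because both satisfy the Leibniz rule for the
  -- metric over the same `X`.
  have key : ∀ W' ⊆ W, IsOpen W' → x ∈ W' → ∀ ψ, SmoothOn C2 W' ψ →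
      ν (ψ x) = P.tensorConn o ψ x (X x) - lieSec Y ψ x := fun W' _ hW' hx' ψ hψ ↦
    P.vproj_sub_hlift (hr.mono (inter_subset_left (t := W'))) (hW₁.inter hW')
      (inter_subset_left.trans hWe) ⟨hx₁, hx'⟩ o (hψ.mono inter_subset_right)
  have hex : ∀ u : U x, ∃ ψ : ∀ y, U y, SmoothOn C2 W₁ ψ ∧ ψ x = u := fun u ↦
    ⟨fun y ↦ e.symm y (fib e x u), (smoothOn_symm _).mono hWe,
      fib_injective (hWe hx₁) (fib_symm (hWe hx₁) _)⟩
  have hlie : ∀ ψ, SmoothOn C2 W₁ ψ →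
      fib e x (lieSec Y ψ x) = dcoord e ψ x (X x) - A x (fib e x (ψ x)) := fun ψ hψ ↦
    fib_lieSec hr hW₁ hWe hψ hx₁
  have hadd : ∀ u u', ν (u + u') = ν u + ν u' := by
    intro u u'
    obtain ⟨ψ, hψ, rfl⟩ := hex u
    obtain ⟨ψ', hψ', rfl⟩ := hex u'
    have d := hψ.diffAt hW₁ hx₁
    have d' := hψ'.diffAt hW₁ hx₁
    have h1 := key W₁ hsub hW₁ hx₁ _ (hψ.add hψ')
    rw [key W₁ hsub hW₁ hx₁ ψ hψ, key W₁ hsub hW₁ hx₁ ψ' hψ', ← Pi.add_apply, h1,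
      (P.isConnAt_tensorConn o x).add _ _ _ d d']
    have h2 : lieSec Y (ψ + ψ') x = lieSec Y ψ x + lieSec Y ψ' x := by
      refine fib_injective (e := e) (hWe hx₁) ?_
      rw [fib_add (hWe hx₁), hlie _ hψ, hlie _ hψ', hlie _ (hψ.add hψ'),
        dcoord_add (hWe hx₁) d d', Pi.add_apply, fib_add (hWe hx₁), map_add]
      abel
    rw [h2]
    abel
  have hsmul : ∀ (c : ℂ) u, ν (c • u) = c • ν u := by
    intro c u
    obtain ⟨ψ, hψ, rfl⟩ := hex u
    have d := hψ.diffAt hW₁ hx₁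
    have hcψ : SmoothOn C2 W₁ (fun y ↦ c • ψ y) := SmoothOn.csmul contMDiffOn_const hψ
    have h1 := key W₁ hsub hW₁ hx₁ _ hcψ
    have h3 : P.tensorConn o (fun y ↦ c • ψ y) x (X x) = c • P.tensorConn o ψ x (X x) := by
      have := (P.isConnAt_tensorConn o x).leibniz_complex
        (fun s Z hs ↦ P.tensorConn_smul_I o s x Z hs) (f := fun _ ↦ c) mdifferentiableAt_const d
        (X x)
      rw [this, mvfderiv_const]
      simp
    have h2 : lieSec Y (fun y ↦ c • ψ y) x = c • lieSec Y ψ x := by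
      refine fib_injective (e := e) (hWe hx₁) ?_
      have h4 : dcoord e (fun y ↦ c • ψ y) x (X x) = c • dcoord e ψ x (X x) := by
        have h5 := mvfderiv_clm ((c • ContinuousLinearMap.id ℂ C2).restrictScalars ℝ)
          (mdifferentiableAt_fib (hWe hx₁) d) (X x)
        refine Eq.trans (mvfderiv_congr_apply ?_ _) h5
        filter_upwards [hW₁.mem_nhds hx₁] with y hy
        exact fib_csmul (hWe hy) _ _
      rw [fib_csmul (hWe hx₁), hlie _ hψ, hlie _ hcψ, h4, fib_csmul (hWe hx₁), map_smul, smul_sub]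
    rw [key W₁ hsub hW₁ hx₁ ψ hψ, h1, h2, h3, smul_sub]
  refine ⟨{ toFun := ν, map_add' := hadd, map_smul' := hsmul }, ?_, fun _ ↦ rfl, key⟩
  intro u u'
  obtain ⟨ψ, hψ, rfl⟩ := hex u
  obtain ⟨ψ', hψ', rfl⟩ := hex u'
  change inner ℂ (ν (ψ x)) (ψ' x) = -inner ℂ (ψ x) (ν (ψ' x))
  rw [key W₁ hsub hW₁ hx₁ ψ hψ, key W₁ hsub hW₁ hx₁ ψ' hψ', inner_sub_left, inner_sub_right]
  have h1 := P.tensorConn_metric o hW₁ hx₁ hψ hψ' (X x)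
  rw [h.herm W₁ ψ ψ' hW₁ hsub hψ hψ' x hx₁] at h1
  linear_combination -h1

/-- The field associated with a pair by an observer. -/
lemma hermField_of_pair (hW : IsOpen W) (ho : S.IsObserverOn W o) (hX : SmoothOn R4 W X)
    (hN : EndSmoothOn W N) (hN' : ∀ y ∈ W, IsAntiHerm (N y))
    (hY : ∀ u : TotalSpace C2 U, u.proj ∈ W → Y u
      = hlift (P.tensorConn o) u (X u.proj) + vlift u (N u.proj u.snd)) :
    HermField W Y X := by
  classical
  have hc := P.isSmoothConnOn_tensorConn ho
  have hrep : ∀ (e : Trivialization C2 (π C2 U)) [MemTrivializationAtlas e],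
      ∃ A, AffRep e (W ∩ e.baseSet) Y X A 0 := by
    intro e _
    let s : C2 → ∀ y, U y := fun z y ↦ e.symmₗ ℂ y z
    have hse : ∀ z, ∀ y ∈ e.baseSet, s z y = e.symm y z := fun z y hy ↦
      congrFun (e.coe_symmₗ hy) z
    have hWe : IsOpen (W ∩ e.baseSet) := hW.inter e.open_baseSet
    have hs : ∀ z, SmoothOn C2 (W ∩ e.baseSet) (s z) := fun z ↦
      ((smoothOn_symm z).mono inter_subset_right).congr fun y hy ↦ hse z y hy.2
    -- The section `s z` has constant coordinate `z`, so its horizontal lift has fibre component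
    -- `-∇_X (s z)`, to which the vertical part `N` is added. Outside the domain the value is a
    -- default.
    let a : M → C2 → C2 := fun y z ↦
      if y ∈ W ∩ e.baseSet then fib e y (N y (s z y) - P.tensorConn o (s z) y (X y)) else 0
    have hs_add : ∀ z z', s (z + z') = s z + s z' := fun z z' ↦ funext fun y ↦
      (e.symmₗ ℂ y).map_add z z'
    have hs_smul : ∀ (c : ℂ) z, s (c • z) = fun y ↦ c • s z y := fun c z ↦ funext fun y ↦
      (e.symmₗ ℂ y).map_smul c z
    let A : M → End2 := fun y ↦ LinearMap.toContinuousLinearMap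
      { toFun := a y
        map_add' := fun z z' ↦ by
          by_cases hy : y ∈ W ∩ e.baseSet
          · simp only [a, if_pos hy]
            rw [hs_add, (hc.conn y hy.1).add _ _ _ ((hs z).diffAt hWe hy) ((hs z').diffAt hWe hy),
              Pi.add_apply, map_add, ← fib_add hy.2]
            congr 1
            abel
          · simp only [a, if_neg hy, add_zero]
        map_smul' := fun c z ↦ by
          by_cases hy : y ∈ W ∩ e.baseSet
          · simp only [a, if_pos hy, RingHom.id_apply]
            have := (hc.conn y hy.1).leibniz_complex
              (fun s Z hs ↦ P.tensorConn_smul_I o s y Z hs) (f := fun _ ↦ c)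
              mdifferentiableAt_const ((hs z).diffAt hWe hy) (X y)
            rw [hs_smul, this, mvfderiv_const, map_smul, ← fib_csmul hy.2]
            simp [smul_sub]
          · simp only [a, if_neg hy, smul_zero] }
    have hA : ∀ y ∈ W ∩ e.baseSet, ∀ z,
        A y z = fib e y (N y (s z y) - P.tensorConn o (s z) y (X y)) := fun y hy z ↦ by
      change a y z = _
      simp only [a, if_pos hy]
    refine ⟨A, hX.mono inter_subset_left, contMDiffOn_end fun z ↦ ?_, contMDiffOn_const,
      fun u hu ↦ ?_, fun u hu ↦ ?_⟩
    · have h1 : SmoothOn C2 (W ∩ e.baseSet)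
          ((fun y ↦ N y (s z y)) - fun y ↦ P.tensorConn o (s z) y (X y)) :=
        (hN _ inter_subset_left hWe _ (hs z)).sub
          (hc.smooth _ inter_subset_left hWe _ _ (hs z) (hX.mono inter_subset_left))
      exact ((contMDiffOn_fib (e := e) h1).mono
        (subset_inter subset_rfl inter_subset_right)).congr fun y hy ↦ hA y hy z
    · rw [hY u hu.1, dproj_add, dproj_hlift, dproj_vlift, add_zero]
    · have hu' : s (e u).2 u.proj = u.snd :=
        (hse _ _ hu.2).trans (fib_injective (e := e) hu.2 (fib_symm hu.2 _))
      have h1 : dcoord e (s (e u).2) u.proj (X u.proj) = 0 := by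
        have h2 : (fun y ↦ fib e y (s (e u).2 y)) =ᶠ[𝓝 u.proj] fun _ ↦ (e u).2 := by
          filter_upwards [e.open_baseSet.mem_nhds hu.2] with y hy
          rw [hse _ y hy, fib_symm hy]
        refine (mvfderiv_congr_apply h2 _).trans ?_
        rw [mvfderiv_const]
        rfl
      rw [hY u hu.1, dfib_add, dfib_vlift hu.2,
        dfib_hlift hu.2 (hc.conn _ hu.1) ((hs (e u).2).diffAt hWe hu) hu', h1, hA _ hu, hu',
        fib_sub hu.2]
      simp only [Pi.zero_apply, add_zero, zero_sub]
      abel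
  have hrep' : ∀ (e : Trivialization C2 (π C2 U)) [MemTrivializationAtlas e],
      AffRep e (W ∩ e.baseSet) Y X (fieldMat e Y) 0 := fun e _ ↦ by
    obtain ⟨A, hA⟩ := hrep e
    exact hA.toFieldMat inter_subset_right
  refine ⟨hrep', fun W' φ ψ hW' hsub hφ hψ x hx ↦ ?_⟩
  have hlie : ∀ ψ, SmoothOn C2 W' ψ →
      lieSec Y ψ x = P.tensorConn o ψ x (X x) - N x (ψ x) := by
    intro ψ hψ
    have hxe := mem_baseSet_extend (F := C2) (V := U) x
    set e := trivializationAt C2 U x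
    have h1 := P.vproj_sub_hlift (((hrep' e).mono (inter_subset_inter_left e.baseSet hsub)))
      (hW'.inter e.open_baseSet) inter_subset_right ⟨hx, hxe⟩ o (hψ.mono inter_subset_left)
    rw [hY _ (hsub hx), add_sub_cancel_left, vproj_vlift] at h1
    rw [show N x (ψ x) = _ from h1]
    abel
  rw [P.tensorConn_metric o hW' hx hφ hψ, hlie φ hφ, hlie ψ hψ, inner_sub_left, inner_sub_right]
  have := hN' x (hsub hx) (φ x) (ψ x)
  linear_combination this

end SpinQuantum

/-! ### The correspondence -/

namespace SpinQuantum

open Spacetime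

variable {M : Type*} [TopologicalSpace M] [T2Space M] [ChartedSpace R4 M]
  [IsManifold 𝓘(ℝ, R4) ∞ M] {S : Spacetime M} {Q U' U : M → Type*}
  [TopologicalSpace (TotalSpace ℂ Q)] [∀ x, NormedAddCommGroup (Q x)]
  [∀ x, InnerProductSpace ℂ (Q x)] [FiberBundle ℂ Q] [VectorBundle ℂ ℂ Q]
  [VectorBundle ℝ ℂ Q] [ContMDiffVectorBundle ∞ ℂ Q 𝓘(ℝ, R4)]
  [TopologicalSpace (TotalSpace C2 U')] [∀ x, NormedAddCommGroup (U' x)]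
  [∀ x, InnerProductSpace ℂ (U' x)] [FiberBundle C2 U'] [VectorBundle ℂ C2 U']
  [VectorBundle ℝ C2 U'] [ContMDiffVectorBundle ∞ C2 U' 𝓘(ℝ, R4)]
  [TopologicalSpace (TotalSpace C2 U)] [∀ x, NormedAddCommGroup (U x)]
  [∀ x, InnerProductSpace ℂ (U x)] [FiberBundle C2 U] [VectorBundle ℂ C2 U]
  [VectorBundle ℝ C2 U] [ContMDiffVectorBundle ∞ C2 U 𝓘(ℝ, R4)]
  (P : SpinQuantum S Q U' U) {V W : TopologicalSpace.Opens M} {x : M} {o : ∀ x, S.J1 x}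
  {G G' : S.PhaseFun V} {Y : FieldOver U V} {X X' : ∀ x : M, Tan x}

/-- The endomorphism `i f[o] + Σ (φ^♯)` of a special phase function. -/
def pairEnd (o : ∀ x, S.J1 x) (G : S.PhaseFun V) (x : M) : U x →ₗ[ℂ] U x :=
  (Complex.I * (scalarPart G x (o x) : ℂ)) • LinearMap.id + P.pauli x (spinVec G x)

lemma isAntiHerm_I_smul_add_pauli (c : ℝ) (w : S.VE x) :
    IsAntiHerm ((Complex.I * (c : ℂ)) • LinearMap.id + P.pauli x w) := by
  intro u u'
  simp only [LinearMap.add_apply, LinearMap.smul_apply, LinearMap.id_apply, inner_add_left,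
    inner_add_right, P.pauli_antiherm x w u u', inner_smul_left, inner_smul_right, map_mul,
    Complex.conj_I, Complex.conj_ofReal]
  ring

variable (V) in
/-- The field of a special phase function. -/
def toField (G : S.PhaseFun V) : FieldOver U V :=
  P.fieldOfPair S.someObserver (P.pairOfFun S.someObserver G)

/-- The field of a special phase function does not depend on the observer. -/
lemma fieldOfPair_eq (hG : G ∈ S.special V) (o o' : ∀ x, S.J1 x) :
    P.fieldOfPair o' (P.pairOfFun o' G) = P.fieldOfPair o (P.pairOfFun o G) := by
  have h := mem_special_iff.1 hG
  funext ⟨⟨x, u⟩, hx⟩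
  -- The change of `i f[o]` given by this quadratic law is opposite to the change of the horizontal
  -- lift.
  have hq := h.scalar.quad x hx (o x) (o' x)
  simp only [fieldOfPair, pairOfFun]
  rw [P.hlift_observer o o', hq, add_assoc, ← vlift_add, S.g_symm x ((o' x).sub (o x))
    (S.spacePart x (o x) _), ← add_assoc, ← add_smul]
  congr 5
  push_cast
  ring

lemma fieldOfPair_eq_toField (hG : G ∈ S.special V) (o : ∀ x, S.J1 x) :
    P.fieldOfPair o (P.pairOfFun o G) = P.toField V G := P.fieldOfPair_eq hG _ _

/-- The definition of `toField` uses an observer that may fail to be smooth; independence of the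
observer allows a smooth one to be used near each event. -/
lemma hermField_toField (hG : G ∈ S.special V) :
    HermField (V : Set M) (extField (P.toField V G)) (vecField G) := by
  have h := mem_special_iff.1 hG
  refine hermField_of_local fun x hx ↦ ?_
  obtain ⟨o, W₁, hW₁, hx₁, ho, -, -⟩ := S.exists_parallel_observer (S.someObserver x)
  have hW := V.isOpen.inter hW₁
  have ho' : S.IsObserverOn ((V : Set M) ∩ W₁) o := SmoothOn.mono ho inter_subset_right
  refine ⟨_, hW, ⟨hx, hx₁⟩, inter_subset_left, P.hermField_of_pair (N := P.pairEnd o G) hW ho'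
    (h.scalar.smooth_vec.mono inter_subset_left) (fun W' hsub hW' ψ hψ ↦ ?_)
    (fun y _ ↦ P.isAntiHerm_I_smul_add_pauli _ _) fun u hu ↦ ?_⟩
  · have h1 := h.scalar.smooth W' (hsub.trans inter_subset_left) hW' o (SmoothOn.mono ho' hsub)
    have h2 : ContMDiffOn 𝓘(ℝ, R4) 𝓘(ℝ, ℂ) ∞
        (fun y ↦ Complex.I * (scalarPart G y (o y) : ℂ)) W' :=
      ((ContinuousLinearMap.mul ℝ ℂ Complex.I).comp
        Complex.ofRealCLM).contMDiff.comp_contMDiffOn h1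
    exact (SmoothOn.csmul h2 hψ).add (P.pauli_smooth W' _ ψ hW'
      (SmoothOn.mono h.spin (hsub.trans inter_subset_left)) hψ)
  · rw [extField_apply _ hu.1, ← P.fieldOfPair_eq_toField hG o]
    rfl

lemma toField_mem (hG : G ∈ S.special V) : P.toField V G ∈ hermFields U V :=
  mem_hermFields_iff.2 ⟨_, P.hermField_toField hG⟩

lemma _root_.GalileiSpin.HermField.smooth_base {W : Set M} {Y : ∀ u : TotalSpace C2 U, TotTan u}
    (h : HermField W Y X) : SmoothOn R4 W X := fun x hx ↦
  ((h.rep (trivializationAt C2 U x)).smoothX x ⟨hx, mem_baseSet_extend x⟩).mono_of_mem_nhdsWithin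
    (Filter.inter_mem self_mem_nhdsWithin (mem_nhdsWithin_of_mem_nhds
      ((Trivialization.open_baseSet _).mem_nhds (mem_baseSet_extend x))))

lemma projField_eq (h : HermField (V : Set M) (extField Y) X) (hx : x ∈ V) :
    projField Y ⟨x, hx⟩ = X x := by
  have h1 := h.proj (u := TotalSpace.mk' C2 x (0 : U x)) hx
  rw [extField_apply _ hx] at h1
  exact h1

/-- A Hermitian field is recovered from its pair. -/
lemma fieldOfPair_pairOfField (hY : Y ∈ hermFields U V) (o : ∀ x, S.J1 x) :
    P.fieldOfPair o (P.pairOfField o Y) = Y := by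
  obtain ⟨X, hX⟩ := mem_hermFields_iff.1 hY
  funext ⟨⟨x, u⟩, hx⟩
  simp only [fieldOfPair, pairOfField]
  rw [vlift_vproj, add_sub_cancel]
  have h1 := hX.proj (u := TotalSpace.mk' C2 x u) hx
  rw [extField_apply _ hx] at h1
  rw [dproj_sub, dproj_hlift, projField_eq hX hx, h1, sub_self]

lemma pairOfField_toField (hG : G ∈ S.special V) (o : ∀ x, S.J1 x) :
    P.pairOfField o (P.toField V G) = P.pairOfFun o G := by
  have h1 : ∀ x : V, projField (P.toField V G) x = vecField G x := fun x ↦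
    projField_eq (P.hermField_toField hG) x.2
  refine Prod.ext (funext h1) (funext fun x ↦ funext fun u ↦ ?_)
  simp only [pairOfField]
  rw [h1, ← P.fieldOfPair_eq_toField hG o]
  simp only [fieldOfPair]
  exact (congrArg (vproj _) (add_sub_cancel_left _ _)).trans (vproj_vlift _)

/-- A special phase function is determined by its pair. -/
lemma pairOfFun_injOn (hG : G ∈ S.special V) (hG' : G' ∈ S.special V)
    (h : P.pairOfFun o G = P.pairOfFun o G') : G = G' := by
  have h1 : ∀ x (hx : x ∈ V), scalarPart G x (o x) = scalarPart G' x (o x)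
      ∧ spinVec G x = spinVec G' x := fun x hx ↦
    P.decomposition_unique fun u ↦ congrFun (congrFun (congrArg Prod.snd h) ⟨x, hx⟩) u
  exact special_ext hG hG' o (fun x hx ↦ congrFun (congrArg Prod.fst h) ⟨x, hx⟩)
    (fun x hx ↦ (h1 x hx).2) fun x hx ↦ (h1 x hx).1

lemma toField_injOn : InjOn (P.toField V) (S.special V) := fun G hG G' hG' h ↦
  P.pairOfFun_injOn (o := S.someObserver) hG hG' (by
    rw [← P.pairOfField_toField hG, h, P.pairOfField_toField hG'])

lemma toField_add (hG : G ∈ S.special V) (hG' : G' ∈ S.special V) :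
    P.toField V (G + G') = P.toField V G + P.toField V G' := by
  have h := (mem_special_iff.1 hG).add (mem_special_iff.1 hG')
  funext ⟨⟨x, u⟩, hx⟩
  simp only [toField, fieldOfPair, pairOfFun, Pi.add_apply]
  rw [h.vecField_eq hx, h.spinVec_eq hx, scalarPart_add, Pi.add_apply,
    hlift_add (P.tensorConn_map_add _), map_add, Pi.add_apply, Pi.add_apply, Complex.ofReal_add,
    mul_add, add_smul, LinearMap.add_apply, add_add_add_comm, vlift_add, add_add_add_comm]

lemma toField_smul (c : ℝ) (hG : G ∈ S.special V) :
    P.toField V (c • G) = c • P.toField V G := by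
  have h := (mem_special_iff.1 hG).smul c
  funext ⟨⟨x, u⟩, hx⟩
  simp only [toField, fieldOfPair, pairOfFun, Pi.smul_apply]
  rw [h.vecField_eq hx, h.spinVec_eq hx, scalarPart_smul, Pi.smul_apply, Pi.smul_apply,
    hlift_smul (P.tensorConn_map_smul _), map_smul, Pi.smul_apply, smul_eq_mul,
    Complex.ofReal_mul, LinearMap.smul_apply, smul_add, ← vlift_smul, smul_add]
  congr 3
  rw [mul_left_comm, mul_smul]
  rfl

lemma toField_res (h : W ≤ V) (hG : G ∈ S.special V) :
    P.toField W (resFun h G) = resField h (P.toField V G) := by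
  have hr := (mem_special_iff.1 hG).res h
  funext ⟨⟨x, u⟩, hx⟩
  simp only [toField, fieldOfPair, pairOfFun, resField]
  rw [hr.vecField_eq hx, hr.spinVec_eq hx, scalarPart_resFun h G hx]

/-- Every Hermitian field comes from a special phase function, with respect to all observers. -/
lemma exists_special (hY : Y ∈ hermFields U V) :
    ∃ G ∈ S.special V, ∀ o, P.pairOfFun o G = P.pairOfField o Y := by
  obtain ⟨X, hX⟩ := mem_hermFields_iff.1 hY
  let o₀ := S.someObserver
  let ν : (∀ x, S.J1 x) → ∀ x, U x → U x := fun o x u ↦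
    vproj (TotalSpace.mk' C2 x u) (extField Y (TotalSpace.mk' C2 x u)
      - hlift (P.tensorConn o) (TotalSpace.mk' C2 x u) (X x))
  -- The decomposition is made event by event with one observer, possibly not smooth; smoothness is
  -- recovered below from traces.
  have h0 : ∀ x, ∃ (c : ℝ) (w : S.VE x), x ∈ V → ∀ u,
      ν o₀ x u = (Complex.I * (c : ℂ)) • u + P.pauli x w u := by
    intro x
    by_cases hx : x ∈ V
    · obtain ⟨N, h1, h2, -⟩ := P.exists_vertical_part hX V.isOpen hx o₀
      obtain ⟨w, hw⟩ := P.exists_decomposition h1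
      exact ⟨_, w, fun _ u ↦ (h2 u).symm.trans (hw u)⟩
    · exact ⟨0, 0, fun h ↦ absurd h hx⟩
  choose c Z hcZ using h0
  -- The only candidate: quadratic in the velocity, with associated vector `X` and value `c` at
  -- `o₀`.
  let f : ∀ x, S.J1 x → ℝ := fun x ↦
    S.quad x (o₀ x) (S.dt x (X x)) (-S.spacePart x (o₀ x) (X x)) (c x)
  let N : (∀ x, S.J1 x) → ∀ x, U x →ₗ[ℂ] U x := fun o x ↦
    (Complex.I * (f x (o x) : ℂ)) • LinearMap.id + P.pauli x (Z x)
  -- The change of the vertical part with the observer is the increment of `i f` prescribed by `X`,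
  -- so the same `f` and `Z` serve every observer.
  have hν : ∀ o, ∀ x ∈ V, ∀ u, ν o x u = N o x u := by
    intro o x hx u
    have hp : dproj (extField Y (TotalSpace.mk' C2 x u)
        - hlift (P.tensorConn o₀) (TotalSpace.mk' C2 x u) (X x)) = 0 := by
      rw [dproj_sub, dproj_hlift, hX.proj hx, sub_self]
    have h1 := vlift_vproj hp
    rw [show vproj (TotalSpace.mk' C2 x u) _ = _ from hcZ x hx u] at h1
    have h2 : extField Y (TotalSpace.mk' C2 x u)
        - hlift (P.tensorConn o) (TotalSpace.mk' C2 x u) (X x)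
        = vlift (TotalSpace.mk' C2 x u) (N o x u) := by
      rw [P.hlift_observer o₀ o, ← sub_sub, ← h1, sub_eq_iff_eq_add, ← vlift_add]
      congr 1
      simp only [N, LinearMap.add_apply, LinearMap.smul_apply, LinearMap.id_apply]
      rw [add_right_comm, ← add_smul]
      congr 2
      simp only [f, quad, map_neg, LinearMap.neg_apply,
        S.g_symm x ((o x).sub (o₀ x)) (S.spacePart x (o₀ x) (X x))]
      push_cast
      ring
    exact (congrArg (vproj _) h2).trans (vproj_vlift _)
  have hN : ∀ (W : Set M), W ⊆ V → IsOpen W → ∀ o, S.IsObserverOn W o →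
      EndSmoothOn W (N o) := by
    intro W hsub hW o ho W' hsub' hW' ψ hψ
    have h1 := (P.isSmoothConnOn_tensorConn ho).smooth W' hsub' hW' ψ X hψ
      (hX.smooth_base.mono (hsub'.trans hsub))
    have h2 := hX.smoothOn_lieSec hW' (hsub'.trans hsub) hψ
    refine (h1.sub h2).congr fun y hy ↦ ?_
    obtain ⟨N', -, h3, h4⟩ := P.exists_vertical_part hX V.isOpen (hsub (hsub' hy)) o
    rw [← hν o y (hsub (hsub' hy))]
    exact (h3 _).symm.trans (h4 W' (hsub'.trans hsub) hW' hy ψ hψ)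
  -- `Tr N = 2 i f[o]`, as `Σ` is traceless, so `f[o]` is half the imaginary part of a smooth trace.
  have hf : ∀ (W : Set M), W ⊆ V → IsOpen W → ∀ o, S.IsObserverOn W o →
      ContMDiffOn 𝓘(ℝ, R4) 𝓘(ℝ, ℝ) ∞ (fun y ↦ f y (o y)) W := by
    intro W hsub hW o ho
    have h1 := (hN W hsub hW o ho).contMDiffOn_trace hW
    refine (((2⁻¹ : ℝ) • Complex.imCLM).contMDiff.comp_contMDiffOn h1).congr fun y hy ↦ ?_
    have h2 : LinearMap.trace ℂ (U y) LinearMap.id = 2 := by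
      obtain ⟨_, -⟩ := finrank_fibre C2 U y
      rw [LinearMap.trace_id, finrank_U, Nat.cast_ofNat]
    simp only [N, Function.comp_apply, map_add, map_smul, h2, P.pauli_trace]
    simp
    ring
  have hZ : VerSmoothOn S.t (V : Set M) Z := by
    refine smoothOn_of_forall fun x hx ↦ ?_
    obtain ⟨o, W₁, hW₁, hx₁, ho, -, -⟩ := S.exists_parallel_observer (S.someObserver x)
    have hW := V.isOpen.inter hW₁
    have hV : (V : Set M) ∩ W₁ ⊆ V := inter_subset_left
    have ho' : S.IsObserverOn ((V : Set M) ∩ W₁) o := SmoothOn.mono ho inter_subset_right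
    refine ⟨(V : Set M) ∩ W₁, hW, ⟨hx, hx₁⟩, ?_⟩
    -- `Σ(Z) = N - i f[o] 1` acts smoothly on smooth sections, and `g(Z, Z') = -2 Tr(Σ(Z) Σ(Z'))`
    -- for every smooth spacelike `Z'`.
    have h1 : S.CovecSmoothOn ((V : Set M) ∩ W₁) (fun y ↦ S.g y (Z y)) := by
      intro W' Z' hW' hsub hZ'
      have h2 : EndSmoothOn W' (fun y ↦ P.pauli y (Z y) ∘ₗ P.pauli y (Z' y)) := by
        intro W'' hsub'' hW'' ψ hψ
        have h3 := P.pauli_smooth W'' Z' ψ hW'' (SmoothOn.mono hZ' hsub'') hψ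
        have hs := hsub''.trans hsub
        have h4 := hN _ hV hW o ho' W'' hs hW'' _ h3
        have h5 : ContMDiffOn 𝓘(ℝ, R4) 𝓘(ℝ, ℂ) ∞ (fun y ↦ Complex.I * (f y (o y) : ℂ)) W'' :=
          ((ContinuousLinearMap.mul ℝ ℂ Complex.I).comp
            Complex.ofRealCLM).contMDiff.comp_contMDiffOn
              (hf W'' (hs.trans hV) hW'' o (SmoothOn.mono ho' hs))
        refine (h4.sub (SmoothOn.csmul h5 h3)).congr fun y _ ↦ ?_
        simp [N]
      have h3 := h2.contMDiffOn_trace hW'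
      refine (((-2 : ℝ) • Complex.reCLM).contMDiff.comp_contMDiffOn h3).congr fun y hy ↦ ?_
      have h4 := congrArg Complex.re (P.pauli_isometry y (Z y) (Z' y))
      rw [Complex.ofReal_re] at h4
      rw [← h4]
      simp
    exact SmoothOn.congr (verSmoothOn_sharp hW h1) fun y _ ↦ congrArg Subtype.val
      (eq_sharp fun w ↦ rfl)
  let G : S.PhaseFun V := fun x v w ↦ f x v + S.g x (Z x) w
  have hG : ∀ x ∈ V, scalarPart G x = f x := fun x hx ↦ funext fun v ↦ by
    rw [scalarPart_apply G hx]
    simp only [G, map_zero, add_zero]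
  have hr : SpecialRep G X Z := by
    refine ⟨⟨hX.smooth_base, fun x hx ↦ ?_, fun W hsub hW o ho ↦ ?_⟩, hZ, fun x hx v w ↦ ?_⟩
    · rw [hG x hx]
      have := quadAt_quad (o₀ x) (S.dt x (X x)) (-S.spacePart x (o₀ x) (X x)) (c x)
      rwa [Submodule.coe_neg, sub_neg_eq_add, ← eq_add_spacePart] at this
    · exact (hf W hsub hW o ho).congr fun y hy ↦ by rw [hG y (hsub hy)]
    · rw [hG x hx]
  refine ⟨G, hr.mem, fun o ↦ Prod.ext (funext fun x ↦ ?_) (funext fun x ↦ funext fun u ↦ ?_)⟩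
  · exact (hr.vecField_eq x.2).trans (projField_eq hX x.2).symm
  · have h1 := hν o x x.2 u
    simp only [pairOfField, pairOfFun]
    rw [projField_eq hX x.2, ← extField_apply Y (u := TotalSpace.mk' C2 (x : M) u) x.2,
      hr.spinVec_eq x.2, hG x x.2]
    exact h1.symm

end SpinQuantum

/-! ### The special bracket and the transport of the Lie algebra structure -/

namespace SpinQuantum

open Spacetime

variable {M : Type*} [TopologicalSpace M] [T2Space M] [ChartedSpace R4 M]
  [IsManifold 𝓘(ℝ, R4) ∞ M] {S : Spacetime M} {Q U' U : M → Type*}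
  [TopologicalSpace (TotalSpace ℂ Q)] [∀ x, NormedAddCommGroup (Q x)]
  [∀ x, InnerProductSpace ℂ (Q x)] [FiberBundle ℂ Q] [VectorBundle ℂ ℂ Q]
  [VectorBundle ℝ ℂ Q] [ContMDiffVectorBundle ∞ ℂ Q 𝓘(ℝ, R4)]
  [TopologicalSpace (TotalSpace C2 U')] [∀ x, NormedAddCommGroup (U' x)]
  [∀ x, InnerProductSpace ℂ (U' x)] [FiberBundle C2 U'] [VectorBundle ℂ C2 U']
  [VectorBundle ℝ C2 U'] [ContMDiffVectorBundle ∞ C2 U' 𝓘(ℝ, R4)]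
  [TopologicalSpace (TotalSpace C2 U)] [∀ x, NormedAddCommGroup (U x)]
  [∀ x, InnerProductSpace ℂ (U x)] [FiberBundle C2 U] [VectorBundle ℂ C2 U]
  [VectorBundle ℝ C2 U] [ContMDiffVectorBundle ∞ C2 U 𝓘(ℝ, R4)]
  (P : SpinQuantum S Q U' U) {V W : TopologicalSpace.Opens M} {x : M} {o : ∀ x, S.J1 x}
  {G G' : S.PhaseFun V} {Y : FieldOver U V} {X X' : ∀ x : M, Tan x}

lemma pairOfField_eq (h : HermField (V : Set M) (extField Y) X) (hx : x ∈ V) (o : ∀ x, S.J1 x)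
    {W' : Set M} (hsub : W' ⊆ V) (hW' : IsOpen W') (hx' : x ∈ W') {ψ : ∀ x, U x}
    (hψ : SmoothOn C2 W' ψ) :
    (P.pairOfField o Y).2 ⟨x, hx⟩ (ψ x)
      = P.tensorConn o ψ x (X x) - lieSec (extField Y) ψ x := by
  obtain ⟨N, -, h1, h2⟩ := P.exists_vertical_part h V.isOpen hx o
  rw [← h2 W' hsub hW' hx' ψ hψ, h1, extField_apply Y (u := TotalSpace.mk' C2 x (ψ x)) hx]
  simp only [pairOfField]
  rw [projField_eq h hx]

lemma lieSec_toField (hG : G ∈ S.special V) (hx : x ∈ V) (o : ∀ x, S.J1 x)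
    {W' : Set M} (hsub : W' ⊆ V) (hW' : IsOpen W') (hx' : x ∈ W') {ψ : ∀ x, U x}
    (hψ : SmoothOn C2 W' ψ) :
    lieSec (extField (P.toField V G)) ψ x
      = P.tensorConn o ψ x (vecField G x) - P.pairEnd o G x (ψ x) := by
  have h1 := P.pairOfField_eq (P.hermField_toField hG) hx o hsub hW' hx' hψ
  rw [P.pairOfField_toField hG] at h1
  rw [show P.pairEnd o G x (ψ x) = _ from h1]
  abel

/-- The covariant derivative of the Lie derivative of a section along a special field. -/
lemma tensorConn_lieSec (hG : G ∈ S.special V) {W' : Set M} (hsub : W' ⊆ V) (hW' : IsOpen W')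
    (hx : x ∈ W') (ho : S.IsObserverOn W' o) {ψ : ∀ x, U x} (hψ : SmoothOn C2 W' ψ) (v : Tan x) :
    P.tensorConn o (lieSec (extField (P.toField V G)) ψ) x v
      = P.tensorConn o (fun y ↦ P.tensorConn o ψ y (vecField G y)) x v
        - ((Complex.I * (mvfderiv 𝓘(ℝ, R4) (fun y ↦ scalarPart G y (o y)) x v : ℝ)) • ψ x
          + P.pauli x (S.covVer (spinVec G) x v) (ψ x)
          + P.pairEnd o G x (P.tensorConn o ψ x v)) := by
  have h := mem_special_iff.1 hG
  have hc := P.isSmoothConnOn_tensorConn ho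
  have hf := h.scalar.smooth W' hsub hW' o ho
  let k : M → ℂ := fun y ↦ Complex.I * (scalarPart G y (o y) : ℂ)
  let L : ℝ →L[ℝ] ℂ := (ContinuousLinearMap.mul ℝ ℂ Complex.I).comp Complex.ofRealCLM
  have hk : ContMDiffOn 𝓘(ℝ, R4) 𝓘(ℝ, ℂ) ∞ k W' := L.contMDiff.comp_contMDiffOn hf
  have hZ : VerSmoothOn S.t W' (spinVec G) := SmoothOn.mono h.spin hsub
  have s1 : SmoothOn C2 W' (lieSec (extField (P.toField V G)) ψ) :=
    (P.hermField_toField hG).smoothOn_lieSec hW' hsub hψ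
  have s2 : SmoothOn C2 W' (fun y ↦ k y • ψ y) := SmoothOn.csmul hk hψ
  have s3 : SmoothOn C2 W' (fun y ↦ P.pauli y (spinVec G y) (ψ y)) :=
    P.pauli_smooth W' _ ψ hW' hZ hψ
  have e1 : ∀ᶠ y in 𝓝 x, P.tensorConn o ψ y (vecField G y)
      = (lieSec (extField (P.toField V G)) ψ
        + ((fun y ↦ k y • ψ y) + fun y ↦ P.pauli y (spinVec G y) (ψ y))) y := by
    filter_upwards [hW'.mem_nhds hx] with y hy
    simp only [Pi.add_apply]
    rw [P.lieSec_toField hG (hsub hy) o hsub hW' hy hψ]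
    simp only [pairEnd, LinearMap.add_apply, LinearMap.smul_apply, LinearMap.id_apply, k]
    abel
  have hcx := hc.conn x hx
  have e2 := hcx.congr ((s1.add (s2.add s3)).diffAt hW' hx) e1 v
  rw [hcx.add _ _ _ (s1.diffAt hW' hx) ((s2.add s3).diffAt hW' hx),
    hcx.add _ _ _ (s2.diffAt hW' hx) (s3.diffAt hW' hx),
    hcx.leibniz_complex (fun s Z hs ↦ P.tensorConn_smul_I o s x Z hs)
      (mdiffAt_of_smoothOn hW' hk hx) (hψ.diffAt hW' hx),
    P.tensorConn_pauli o hW' hx hZ hψ] at e2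
  have e3 : (show ℂ from mvfderiv 𝓘(ℝ, R4) k x v)
      = Complex.I * (mvfderiv 𝓘(ℝ, R4) (fun y ↦ scalarPart G y (o y)) x v : ℝ) :=
    mvfderiv_clm L (mdiffAt_of_smoothOn hW' hf hx) v
  rw [e3] at e2
  rw [e2]
  simp only [pairEnd, LinearMap.add_apply, LinearMap.smul_apply, LinearMap.id_apply, k]
  abel

/-- The special bracket corresponds to the Lie bracket. -/
lemma bracket_eq {H : S.PhaseFun V} (hG : G ∈ S.special V) (hG' : G' ∈ S.special V)
    (hH : H ∈ S.special V)
    (h : ∀ o, P.pairOfFun o H = P.pairOfField o (lieField (P.toField V G) (P.toField V G'))) :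
    bracket G G' = H := by
  have r := mem_special_iff.1 hG
  have r' := mem_special_iff.1 hG'
  have hY := P.hermField_toField hG
  have hY' := P.hermField_toField hG'
  have hL := (hY.bracket P.metric_U hY' V.isOpen).congr V.isOpen
    (Y' := extField (lieField (P.toField V G) (P.toField V G')))
    fun u hu ↦ extField_lieField _ _ hu
  funext ⟨x, hx⟩ v w
  -- Each velocity `v` gets its own observer, parallel at `x`: there `o^*Ω` vanishes and the scalar
  -- bracket is a difference of two derivatives. As `v` is arbitrary, the vector fields associated
  -- with the two functions need not be compared.
  obtain ⟨o, W₁, hW₁, hx₁, ho, rfl, hp⟩ := S.exists_parallel_observer v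
  let W' := (V : Set M) ∩ W₁
  have hW' : IsOpen W' := V.isOpen.inter hW₁
  have hsub : W' ⊆ V := inter_subset_left
  have hx' : x ∈ W' := ⟨hx, hx₁⟩
  have ho' : S.IsObserverOn W' o := SmoothOn.mono ho inter_subset_right
  have hX := r.scalar.smooth_vec.mono hsub
  have hX' := r'.scalar.smooth_vec.mono hsub
  obtain ⟨ρ, hρ, hR⟩ := P.exists_curvature ho' hW' hx' hp hX hX'
  have hs := scalarBracket_eq r.scalar r'.scalar V.isOpen hx (SmoothOn.diffAt hW₁ ho hx₁) hp
  have key : ∀ u : U x,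
      (Complex.I * (scalarPart H x (o x) : ℂ)) • u + P.pauli x (spinVec H x) u
      = (Complex.I * (S.scalarBracket (scalarPart G) (scalarPart G') x (o x) : ℂ)) • u
        + P.pauli x (S.covVer (spinVec G') x (vecField G x)
          - S.covVer (spinVec G) x (vecField G' x) + S.cross x (spinVec G' x) (spinVec G x)
          - ρ) u := by
    intro u
    obtain ⟨ψ, hψ, rfl⟩ : ∃ ψ : ∀ y, U y, SmoothOn C2 W' ψ ∧ ψ x = u := by
      obtain ⟨ψ, hψ, W'', -, -, hxW, h2⟩ := exists_global_section
        (W := (trivializationAt C2 U x).baseSet) (Trivialization.open_baseSet _)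
        (mem_baseSet_extend x) (smoothOn_extend u)
      exact ⟨ψ, hψ.mono (subset_univ _), (h2 x hxW).trans (FiberBundle.extend_apply_self C2 u)⟩
    have h1 := congrFun (congrFun (congrArg Prod.snd (h o)) ⟨x, hx⟩) (ψ x)
    rw [P.pairOfField_eq hL hx o hsub hW' hx' hψ] at h1
    refine Eq.trans h1 ?_
    have c1 : lieSec (extField (lieField (P.toField V G) (P.toField V G'))) ψ x
        = lieSec (extField (P.toField V G)) (lieSec (extField (P.toField V G')) ψ) x
          - lieSec (extField (P.toField V G')) (lieSec (extField (P.toField V G)) ψ) x :=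
      (lieSec_congr V.isOpen hx fun u hu ↦ extField_lieField _ _ hu).trans
        (hY.lieSec_bracket hY' hW' hsub hψ hx')
    have s1 := hY.smoothOn_lieSec hW' hsub hψ
    have s1' := hY'.smoothOn_lieSec hW' hsub hψ
    have hR' := hR ψ hψ
    have hcomm := LinearMap.congr_fun (P.pauli_commutator x (spinVec G x) (spinVec G' x)) (ψ x)
    -- Expansion of the commutator of `∇_X - N` and `∇_X' - N'`. Subtracted from `∇_[X, X']` it
    -- leaves `∇_X N' - ∇_X' N - [N, N'] - R(X, X')`, with `R(X, X') = Σ(ρ^♯)`.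
    rw [c1, P.lieSec_toField hG hx o hsub hW' hx' s1', P.lieSec_toField hG' hx o hsub hW' hx' s1,
      P.tensorConn_lieSec hG' hsub hW' hx' ho' hψ, P.tensorConn_lieSec hG hsub hW' hx' ho' hψ,
      P.lieSec_toField hG hx o hsub hW' hx' hψ, P.lieSec_toField hG' hx o hsub hW' hx' hψ, hs,
      cross_swap (spinVec G x) (spinVec G' x)]
    simp only [map_sub, map_add, map_neg, LinearMap.add_apply, LinearMap.sub_apply,
      LinearMap.neg_apply, ← hcomm, ← hR', curvOp]
    simp only [pairEnd, LinearMap.add_apply, LinearMap.smul_apply, LinearMap.id_apply, map_add,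
      map_smul, LinearMap.comp_apply]
    push_cast
    module
  obtain ⟨k1, k2⟩ := P.decomposition_unique key
  rw [(mem_special_iff.1 hH).eq x hx, k1, k2]
  simp only [bracket, map_sub, LinearMap.sub_apply, hρ]
  ring

/-- The special phase function of a Hermitian field. -/
lemma exists_toFun (V : TopologicalSpace.Opens M) : ∃ F : FieldOver U V → S.PhaseFun V,
    ∀ Y ∈ hermFields U V, F Y ∈ S.special V ∧ ∀ o, P.pairOfFun o (F Y) = P.pairOfField o Y := by
  classical
  refine ⟨fun Y ↦ if h : Y ∈ hermFields U V then (P.exists_special h).choose else 0,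
    fun Y hY ↦ ?_⟩
  simp only [dif_pos hY]
  exact (P.exists_special hY).choose_spec

/-- The Lie bracket of the two fields comes from some special function, which `bracket_eq`
identifies with the special bracket. Closure therefore needs no separate calculation. -/
lemma bracket_mem_and_toField_bracket (hG : G ∈ S.special V) (hG' : G' ∈ S.special V) :
    bracket G G' ∈ S.special V ∧
      P.toField V (bracket G G') = lieField (P.toField V G) (P.toField V G') := by
  have hL := lieField_mem P.metric_U (P.toField_mem hG) (P.toField_mem hG')
  obtain ⟨H, hH, h⟩ := P.exists_special hL
  rw [P.bracket_eq hG hG' hH h]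
  refine ⟨hH, ?_⟩
  rw [← P.fieldOfPair_eq_toField hH S.someObserver, h, P.fieldOfPair_pairOfField hL]

lemma bracket_mem (P : SpinQuantum S Q U' U) (hG : G ∈ S.special V)
    (hG' : G' ∈ S.special V) :
    bracket G G' ∈ S.special V := (P.bracket_mem_and_toField_bracket hG hG').1

lemma toField_bracket (hG : G ∈ S.special V) (hG' : G' ∈ S.special V) :
    P.toField V (bracket G G') = lieField (P.toField V G) (P.toField V G') :=
  (P.bracket_mem_and_toField_bracket hG hG').2

lemma add_mem_special (hG : G ∈ S.special V) (hG' : G' ∈ S.special V) :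
    G + G' ∈ S.special V := ((mem_special_iff.1 hG).add (mem_special_iff.1 hG')).mem

lemma smul_mem_special (c : ℝ) (hG : G ∈ S.special V) : c • G ∈ S.special V :=
  ((mem_special_iff.1 hG).smul c).mem

lemma resFun_mem_special (h : W ≤ V) (hG : G ∈ S.special V) : resFun h G ∈ S.special W :=
  ((mem_special_iff.1 hG).res h).mem

/-- Every identity is pulled back from the Hermitian fields, `toField` being injective, linear and
compatible with the brackets on special functions. -/
lemma isLieAlgebraOn_special (P : SpinQuantum S Q U' U)
    (V : TopologicalSpace.Opens M) :
    IsLieAlgebraOn (S.special V) (fun G G' ↦ bracket G G') := by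
  have hA := isLieAlgebraOn_hermFields P.metric_U V
  have h0 : (0 : S.PhaseFun V) ∈ S.special V := by
    obtain ⟨G, hG, -⟩ := P.exists_special hA.zero_mem
    have := smul_mem_special 0 hG
    rwa [zero_smul] at this
  have hz : P.toField V 0 = 0 := by
    have := P.toField_smul 0 h0
    rwa [zero_smul, zero_smul] at this
  have hb : ∀ {a b}, a ∈ S.special V → b ∈ S.special V → bracket a b ∈ S.special V :=
    fun ha hb ↦ P.bracket_mem ha hb
  refine ⟨h0, fun a ha b hb ↦ add_mem_special ha hb, fun c a ha ↦ smul_mem_special c ha,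
    fun a ha b h ↦ hb ha h, fun a ha b h c hc ↦ ?_, fun r a ha b h ↦ ?_, fun a ha ↦ ?_,
    fun a ha b h c hc ↦ ?_⟩
  · refine P.toField_injOn (hb (add_mem_special ha h) hc)
      (add_mem_special (hb ha hc) (hb h hc)) ?_
    rw [P.toField_bracket (add_mem_special ha h) hc, P.toField_add (hb ha hc) (hb h hc),
      P.toField_add ha h, P.toField_bracket ha hc, P.toField_bracket h hc]
    exact hA.add_br _ (P.toField_mem ha) _ (P.toField_mem h) _ (P.toField_mem hc)
  · refine P.toField_injOn (hb (smul_mem_special r ha) h) (smul_mem_special r (hb ha h)) ?_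
    rw [P.toField_bracket (smul_mem_special r ha) h, P.toField_smul r (hb ha h),
      P.toField_smul r ha, P.toField_bracket ha h]
    exact hA.smul_br _ _ (P.toField_mem ha) _ (P.toField_mem h)
  · refine P.toField_injOn (hb ha ha) h0 ?_
    rw [P.toField_bracket ha ha, hz]
    exact hA.br_self _ (P.toField_mem ha)
  · have h1 := hb ha (hb h hc)
    have h2 := hb h (hb hc ha)
    have h3 := hb hc (hb ha h)
    refine P.toField_injOn (add_mem_special (add_mem_special h1 h2) h3) h0 ?_
    rw [P.toField_add (add_mem_special h1 h2) h3, P.toField_add h1 h2,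
      P.toField_bracket ha (hb h hc), P.toField_bracket h (hb hc ha),
      P.toField_bracket hc (hb ha h), P.toField_bracket h hc, P.toField_bracket hc ha,
      P.toField_bracket ha h, hz]
    exact hA.jacobi _ (P.toField_mem ha) _ (P.toField_mem h) _ (P.toField_mem hc)

lemma isLieSheaf_special (P : SpinQuantum S Q U' U) :
    IsLieSheaf (A := fun V : TopologicalSpace.Opens M ↦ S.PhaseFun V) resFun
      (fun V ↦ S.special V) (fun _ G G' ↦ bracket G G') where
  lie := P.isLieAlgebraOn_special
  res_br h a ha b hb := by
    have ha' := resFun_mem_special h ha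
    have hb' := resFun_mem_special h hb
    refine P.toField_injOn (resFun_mem_special h (P.bracket_mem ha hb)) (P.bracket_mem ha' hb') ?_
    rw [P.toField_res h (P.bracket_mem ha hb), P.toField_bracket ha hb, P.toField_bracket ha' hb',
      P.toField_res h ha, P.toField_res h hb, resField_lieField]
  mem_iff V a := ⟨fun ha x hx ↦ ⟨V, le_rfl, hx, ha⟩, mem_special_of_local⟩

end SpinQuantum

end GalileiSpin

end

/-! ### The theorem -/

open GalileiSpin TopologicalSpace in
theorem mainTheorem1 {M : Type*} [TopologicalSpace M] [T2Space M] [SecondCountableTopology M]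
    [ChartedSpace R4 M] [IsManifold 𝓘(ℝ, R4) ∞ M]
    {Q U' U : M → Type*}
    [TopologicalSpace (TotalSpace ℂ Q)] [∀ x, NormedAddCommGroup (Q x)]
    [∀ x, InnerProductSpace ℂ (Q x)] [FiberBundle ℂ Q] [VectorBundle ℂ ℂ Q]
    [VectorBundle ℝ ℂ Q] [ContMDiffVectorBundle ∞ ℂ Q 𝓘(ℝ, R4)]
    [TopologicalSpace (TotalSpace C2 U')] [∀ x, NormedAddCommGroup (U' x)]
    [∀ x, InnerProductSpace ℂ (U' x)] [FiberBundle C2 U'] [VectorBundle ℂ C2 U']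
    [VectorBundle ℝ C2 U'] [ContMDiffVectorBundle ∞ C2 U' 𝓘(ℝ, R4)]
    [TopologicalSpace (TotalSpace C2 U)] [∀ x, NormedAddCommGroup (U x)]
    [∀ x, InnerProductSpace ℂ (U x)] [FiberBundle C2 U] [VectorBundle ℂ C2 U]
    [VectorBundle ℝ C2 U] [ContMDiffVectorBundle ∞ C2 U 𝓘(ℝ, R4)]
    (S : Spacetime M) (P : SpinQuantum S Q U' U) :
    -- the special phase functions and the Hermitian fields are sheaves of Lie algebras
    IsLieSheaf (A := fun V : Opens M ↦ S.PhaseFun V) Spacetime.resFun (fun V ↦ S.special V)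
      (fun _ G G' ↦ Spacetime.bracket G G') ∧
    IsLieSheaf (A := fun V : Opens M ↦ FieldOver U V) resField (fun V ↦ hermFields U V)
      (fun _ Y Y' ↦ lieField Y Y') ∧
    -- `toField` is `f + φ ↦ Y[f + φ]` and `toFun` is the converse correspondence
    ∃ (toField : ∀ V : Opens M, S.PhaseFun V → FieldOver U V)
      (toFun : ∀ V : Opens M, FieldOver U V → S.PhaseFun V), ∀ V : Opens M,
      -- each observer yields the field `toField V G`
      (∀ o : ∀ x, S.J1 x, S.IsObserverOn (V : Set M) o → ∀ G ∈ S.special V,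
        P.fieldOfPair o (P.pairOfFun o G) = toField V G) ∧
      -- for each observer `toFun V Y` is the special function corresponding to the pair of `Y`
      (∀ o : ∀ x, S.J1 x, S.IsObserverOn (V : Set M) o → ∀ Y ∈ hermFields U V,
        P.pairOfFun o (toFun V Y) = P.pairOfField o Y ∧
        ∀ G ∈ S.special V, P.pairOfFun o G = P.pairOfField o Y → G = toFun V Y) ∧
      -- the two maps are mutually inverse bijections
      MapsTo (toField V) (S.special V) (hermFields U V) ∧
      MapsTo (toFun V) (hermFields U V) (S.special V) ∧
      InvOn (toFun V) (toField V) (S.special V) (hermFields U V) ∧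
      -- and morphisms of Lie algebras
      (∀ G ∈ S.special V, ∀ G' ∈ S.special V,
        toField V (G + G') = toField V G + toField V G') ∧
      (∀ r : ℝ, ∀ G ∈ S.special V, toField V (r • G) = r • toField V G) ∧
      (∀ G ∈ S.special V, ∀ G' ∈ S.special V,
        toField V (Spacetime.bracket G G') = lieField (toField V G) (toField V G')) ∧
      -- compatible with restrictions
      (∀ (W : Opens M) (h : W ≤ V),
        (∀ G ∈ S.special V, toField W (Spacetime.resFun h G) = resField h (toField V G)) ∧
        (∀ Y ∈ hermFields U V, toFun W (resField h Y) = Spacetime.resFun h (toFun V Y))) := by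
  have hF : ∀ V : Opens M, ∀ Y ∈ hermFields U V, (P.exists_toFun V).choose Y ∈ S.special V :=
    fun V Y hY ↦ ((P.exists_toFun V).choose_spec Y hY).1
  have hF' : ∀ V : Opens M, ∀ Y ∈ hermFields U V, ∀ o,
      P.pairOfFun o ((P.exists_toFun V).choose Y) = P.pairOfField o Y :=
    fun V Y hY ↦ ((P.exists_toFun V).choose_spec Y hY).2
  have hinv : ∀ V : Opens M, ∀ G ∈ S.special V, (P.exists_toFun V).choose (P.toField V G) = G :=
    fun V G hG ↦ P.pairOfFun_injOn (o := S.someObserver) (hF V _ (P.toField_mem hG)) hG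
      ((hF' V _ (P.toField_mem hG) _).trans (P.pairOfField_toField hG _))
  have hinv' : ∀ V : Opens M, ∀ Y ∈ hermFields U V,
      P.toField V ((P.exists_toFun V).choose Y) = Y := fun V Y hY ↦ by
    rw [← P.fieldOfPair_eq_toField (hF V Y hY) S.someObserver, hF' V Y hY,
      P.fieldOfPair_pairOfField hY]
  refine ⟨P.isLieSheaf_special, isLieSheaf_hermFields P.metric_U, fun V ↦ P.toField V,
    fun V ↦ (P.exists_toFun V).choose, fun V ↦ ⟨fun o _ G hG ↦ P.fieldOfPair_eq_toField hG o,
      fun o _ Y hY ↦ ⟨hF' V Y hY o, fun G hG h ↦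
        P.pairOfFun_injOn hG (hF V Y hY) (h.trans (hF' V Y hY o).symm)⟩,
      fun G hG ↦ P.toField_mem hG, fun Y hY ↦ hF V Y hY, ⟨hinv V, hinv' V⟩,
      fun G hG G' hG' ↦ P.toField_add hG hG', fun r G hG ↦ P.toField_smul r hG,
      fun G hG G' hG' ↦ P.toField_bracket hG hG',
      fun W h ↦ ⟨fun G hG ↦ P.toField_res h hG, fun Y hY ↦ ?_⟩⟩⟩
  -- The converse map commutes with restrictions because its inverse does.
  have h1 := SpinQuantum.resFun_mem_special h (hF V Y hY)
  have h2 := P.toField_res h (hF V Y hY)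
  rw [hinv' V Y hY] at h2
  exact (congrArg (P.exists_toFun W).choose h2.symm).trans (hinv W _ h1)
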